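/- Let $A$ be a finite dimensional Hopf algebra over a field $k$, with comultiplication $\Delta(a)=\sum a^{(1)}\otimes a^{(2)}$, counit $\varepsilon$ and antipode $S$; $S$ is bijective. A \emph{Hopf bimodule} over $A$ is an $A$-bimodule and $A$-bicomodule $M$ whose coactions $\delta_L(m)=\sum m_{(-1)}\otimes m_{(0)}$ and $\delta_R(m)=\sum m_{(0)}\otimes m_{(1)}$ are morphisms of bimodules ($A\otimes M$ and $M\otimes A$ carrying the diagonal actions). Morphisms of Hopf bimodules are the linear maps that commute with both actions and both coactions. \emph{The algebra $X$.} Let $X$ be the associative algebra of Cibils and Rosso, with underlying vector space $(A^{*op}\otimes A^*)\otimes(A\otimes A^{op})$, in which $A^{*op}\otimes A^*$ and $A\otimes A^{op}$ are subalgebras with their natural multiplications, and in which the products in the other order are determined, for $a\in A$, $b\in A^{op}$, $l\in A^{*op}$, $l'\in A^{*}$, by $$a\,l=\sum l(S(a^{(1)})\,\cdot\,)\,a^{(2)},\quad a\,l'=\sum l'(S^{-1}(a^{(2)})\,\cdot\,)\,a^{(1)},\quad b\,l=\sum l(\,\cdot\,S^{-1}(b^{(1)}))\,b^{(2)},\quad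 b\,l'=\sum l'(\,\cdot\,S(b^{(2)}))\,b^{(1)}.$$ A Hopf bimodule is a left $X$-module via $[(l\otimes l')\otimes(a\otimes b)]m=\sum l(y_{(-1)})\,l'(y_{(1)})\,y_{(0)}$ with $y=amb$. Write $\mathrm{Ext}_X^*$ for $\mathrm{Ext}$ of left $X$-modules, and $G\circ F\in \mathrm{Ext}_X^{p+q}(M,N)$ for the Yoneda product of $F\in \mathrm{Ext}_X^p(M,L)$ and $G\in\mathrm{Ext}_X^q(L,N)$. \emph{Hopf bimodule cohomology.} For Hopf bimodules $M,N$, endow $M\otimes A^{\otimes q}$ with the left action on $M$ and the codiagonal coactions (e.g. $\delta_L(m\otimes a_1\otimes\cdots\otimes a_q)=\sum m_{(-1)}a_1^{(1)}\cdots a_q^{(1)}\otimes m_{(0)}\otimes a_1^{(2)}\otimes\cdots\otimes a_q^{(2)}$), and $A^{\otimes p}\otimes N$ with the diagonal left and right actions and the right coaction of $N$. Let $\mathrm{Hom}_{A-}^{-A}(M\otimes A^{\otimes q},A^{\otimes p}\otimes N)$ be the space of left $A$-linear, right $A$-colinear maps; for $\alpha$ in it put $$(d_h\alpha)(m\otimes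 a_1\otimes\cdots\otimes a_{q+1})=\alpha(ma_1\otimes a_2\otimes\cdots)+\sum_{i=1}^{q}(-1)^i\alpha(m\otimes\cdots\otimes a_ia_{i+1}\otimes\cdots)+(-1)^{q+1}\alpha(m\otimes a_1\otimes\cdots\otimes a_q)\,a_{q+1},$$ $$d_c\alpha=(-1)^q\Big[(1\otimes\alpha)\delta_L+\sum_{i=1}^{p}(-1)^i\Delta_i\alpha+(-1)^{p+1}(1^{\otimes p}\otimes\delta_L^N)\alpha\Big],$$ where $\Delta_i$ is $\Delta$ applied to the $i$-th factor $A$. Let $H_{A4}^*(M,N)$ be the cohomology of the total complex, with $n$-cochains $\bigoplus_{p+q=n}\mathrm{Hom}_{A-}^{-A}(M\otimes A^{\otimes q},A^{\otimes p}\otimes N)$ and differential $D=d_h+d_c$. A $0$-cocycle is the same as a morphism of Hopf bimodules $M\to N$. \emph{Cup product.} For $f\in\mathrm{Hom}_{A-}^{-A}(M\otimes A^{\otimes a},A^{\otimes s}\otimes L)$ and $g\in\mathrm{Hom}_{A-}^{-A}(L\otimes A^{\otimes b},A^{\otimes r}\otimes N)$ put $$(f\smile g)(m\otimes a_1\otimes\cdots\otimes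 a_{a+b})=(-1)^{sb}\sum(1^{\otimes s}\otimes g)\big[f(m\otimes a_1\otimes\cdots\otimes a_a)\cdot(\Delta^{(s-1)}(a_{a+1}^{(1)}\cdots a_{a+b}^{(1)})\otimes1)\otimes a_{a+1}^{(2)}\otimes\cdots\otimes a_{a+b}^{(2)}\big],$$ where $\Delta^{(s-1)}:A\to A^{\otimes s}$ is the iterated comultiplication ($\Delta^{(-1)}=\varepsilon$); extend biadditively to cochains. \emph{Maps of $\delta$-functors.} For fixed $M$, both $H_{A4}^*(M,-)$ and $\mathrm{Ext}_X^*(M,-)$ are $\delta$-functors on Hopf bimodules. For a short exact sequence $E:0\to N'\to N\to N''\to0$, the connecting homomorphism of $H_{A4}^*(M,-)$ is the usual one: it sends the class of a cocycle $f''$ to the class of $f'$ if there is a cochain $c$ with values in $N$ that maps to $f''$ and for which $Dc$ is the image of $f'$. That of $\mathrm{Ext}_X^*(M,-)$ is the Yoneda product $\mathrm{Ext}_X^n(M,N'')\to\mathrm{Ext}_X^{n+1}(M,N')$, $x\mapsto[E]\circ x$, with the class $[E]\in\mathrm{Ext}_X^1(N'',N')$. \textbf{Theorem.} There are $k$-linear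 isomorphisms $\varphi_{MN}^n:H_{A4}^n(M,N)\to\mathrm{Ext}_X^n(M,N)$, for all Hopf bimodules $M,N$ and all $n\ge0$, such that for every $M$ the family $\varphi_{M-}^*$ is a map of $\delta$-functors in the second variable that extends the identity of $\mathrm{Hom}(M,-)$ in degree $0$; for every $M$ this family is the only family of $k$-linear maps that is such a map of $\delta$-functors. Moreover, for all Hopf bimodules $M,L,N$, all $p,q\ge0$, every $p$-cocycle $f$ for $(M,L)$ and every $q$-cocycle $g$ for $(L,N)$, the cochain $f\smile g$ is a $(p+q)$-cocycle for $(M,N)$, and $$\varphi_{MN}^{p+q}(f\smile g)=(-1)^{pq}\,\varphi_{LN}^q(g)\circ\varphi_{ML}^p(f).$$ -/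

import Mathlib

open TensorProduct Coalgebra HopfAlgebra
set_option linter.unusedSectionVars false
universe u
namespace HopfBimodCoh
variable {k A : Type u} [Field k] [Ring A] [HopfAlgebra k A]

open WithConv in
theorem comul_antipode (a : A) :
    comul (R := k) (antipode k a) =
      TensorProduct.comm k A A (TensorProduct.map (antipode k) (antipode k) (comul a)) := by
  let i₁ : A →ₐ[k] A ⊗[k] A := Algebra.TensorProduct.includeLeft
  let i₂ : A →ₐ[k] A ⊗[k] A := Algebra.TensorProduct.includeRight
  let S : A →ₗ[k] A := antipode k
  have key : ∀ i : A →ₐ[k] A ⊗[k] A,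
      toConv (i.toLinearMap ∘ₗ S) * toConv i.toLinearMap = 1 := by
    intro i
    have h := LinearMap.algHom_comp_convMul_distrib (R := k) i (toConv S) (toConv LinearMap.id)
    rw [show toConv S * toConv (LinearMap.id : A →ₗ[k] A) = 1 from LinearMap.antipode_mul_id] at h
    apply WithConv.ext
    refine Eq.trans h.symm ?_
    ext x
    simp [LinearMap.convOne_def]
  have hΔ : toConv (comul (R := k) (A := A)) = toConv i₁.toLinearMap * toConv i₂.toLinearMap := by
    ext x
    rw [(ℛ k x).convMul_apply]
    simp [i₁, i₂, (ℛ k x).eq]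
  have hL : (toConv (i₂.toLinearMap ∘ₗ S) * toConv (i₁.toLinearMap ∘ₗ S)) *
      toConv (comul (R := k) (A := A)) = 1 := by
    rw [hΔ, mul_assoc, ← mul_assoc (toConv (i₁.toLinearMap ∘ₗ S)), key, one_mul, key]
  have h := left_inv_eq_right_inv hL LinearMap.comul_right_inv
  have h2 := congr(WithConv.ofConv $h a)
  refine Eq.trans h2.symm ?_
  change (toConv (i₂.toLinearMap ∘ₗ S) * toConv (i₁.toLinearMap ∘ₗ S)) a = _
  rw [(ℛ k a).convMul_apply]
  conv_rhs => rw [← (ℛ k a).eq]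
  simp [i₁, i₂, S]


theorem tri_coassoc {B : Type*} [AddCommMonoid B] [Module k B] (F : A ⊗[k] (A ⊗[k] A) →ₗ[k] B)
    (a : A) :
    ∑ i ∈ (ℛ k a).index, ∑ j ∈ (ℛ k ((ℛ k a).left i)).index,
        F ((ℛ k ((ℛ k a).left i)).left j ⊗ₜ ((ℛ k ((ℛ k a).left i)).right j ⊗ₜ (ℛ k a).right i)) =
      ∑ i ∈ (ℛ k a).index, ∑ j ∈ (ℛ k ((ℛ k a).right i)).index,
        F ((ℛ k a).left i ⊗ₜ ((ℛ k ((ℛ k a).right i)).left j ⊗ₜ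
          (ℛ k ((ℛ k a).right i)).right j)) := by
  have h := congrArg F (sum_tmul_tmul_eq (R := k) (ℛ k a) (fun i => ℛ k ((ℛ k a).left i))
    (fun i => ℛ k ((ℛ k a).right i)))
  simpa only [map_sum] using h

theorem sq_antipode_mul (a : A) :
    ∑ i ∈ (ℛ k a).index, antipode k (antipode k ((ℛ k a).right i)) * antipode k ((ℛ k a).left i) =
      algebraMap k A (counit a) := by
  simp only [← antipode_mul_antidistrib, ← map_sum, sum_mul_antipode_eq_algebraMap_counit]
  rw [Algebra.algebraMap_eq_smul_one, map_smul, antipode_one]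

theorem antipode_mul_sq (a : A) :
    ∑ i ∈ (ℛ k a).index, antipode k ((ℛ k a).right i) * antipode k (antipode k ((ℛ k a).left i)) =
      algebraMap k A (counit a) := by
  simp only [← antipode_mul_antidistrib, ← map_sum, sum_antipode_mul_eq_algebraMap_counit]
  rw [Algebra.algebraMap_eq_smul_one, map_smul, antipode_one]

theorem comul_sq_antipode (a : A) :
    comul (R := k) (antipode k (antipode k a)) =
      TensorProduct.map (antipode k ∘ₗ antipode k) (antipode k ∘ₗ antipode k) (comul a) := by
  rw [comul_antipode, comul_antipode, ← (ℛ k a).eq]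
  simp

theorem comul_sq_mul (a : A) :
    ∑ i ∈ (ℛ k a).index, comul (R := k) (antipode k (antipode k ((ℛ k a).right i))) *
        (antipode k ((ℛ k a).left i) ⊗ₜ[k] (1 : A)) =
      (1 : A) ⊗ₜ[k] antipode k (antipode k a) := by
  let S : A →ₗ[k] A := antipode k
  let F : A ⊗[k] (A ⊗[k] A) →ₗ[k] A ⊗[k] A :=
    TensorProduct.map (LinearMap.mul' k A ∘ₗ (TensorProduct.comm k A A).toLinearMap ∘ₗ
      TensorProduct.map S (S ∘ₗ S)) (S ∘ₗ S) ∘ₗ (TensorProduct.assoc k A A A).symm.toLinearMap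
  have h := tri_coassoc F a
  simp only [F, S, LinearMap.comp_apply, LinearEquiv.coe_coe, TensorProduct.assoc_symm_tmul,
    TensorProduct.map_tmul, TensorProduct.comm_tmul, LinearMap.mul'_apply,
    ← TensorProduct.sum_tmul, sq_antipode_mul] at h
  calc _ = _ := ?_
    _ = _ := h.symm
    _ = _ := ?_
  · refine Finset.sum_congr rfl fun i _ => ?_
    rw [comul_sq_antipode, ← (ℛ k ((ℛ k a).right i)).eq]
    simp [Finset.sum_mul]
  · simp only [Algebra.algebraMap_eq_smul_one, TensorProduct.smul_tmul, ← TensorProduct.tmul_sum,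
      ← map_smul, ← map_sum, sum_counit_smul]

theorem sum_counit_smul' (a : A) :
    ∑ i ∈ (ℛ k a).index, counit (R := k) ((ℛ k a).right i) • (ℛ k a).left i = a := by
  have h := congrArg (TensorProduct.rid k A) (lTensor_counit_comul (R := k) a)
  rw [← (ℛ k a).eq] at h
  simpa only [map_sum, LinearMap.lTensor_tmul, TensorProduct.rid_tmul, one_smul] using h

/-- `p ⊗ q ↦ ∑ g(q₁ S(p)) q₂` -/
noncomputable def kerG (g : Module.Dual k A) : A →ₗ[k] A →ₗ[k] A :=
  LinearMap.mk₂ k (fun p q => TensorProduct.lid k A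
      (LinearMap.rTensor A (g ∘ₗ LinearMap.mulRight k (antipode k p)) (comul q)))
    (fun p p' q => by
      rw [← (ℛ k q).eq]; simp [mul_add, TensorProduct.add_tmul, Finset.sum_add_distrib])
    (fun c p q => by
      rw [← (ℛ k q).eq]; simp [Finset.smul_sum, smul_smul])
    (fun p q q' => by simp)
    (fun c p q => by simp)

theorem trace_kerG [FiniteDimensional k A] (g : Module.Dual k A) (N : A →ₗ[k] A) :
    LinearMap.trace k A (TensorProduct.lift (kerG g) ∘ₗ N.lTensor A ∘ₗ comul) =
      g 1 * LinearMap.trace k A N := by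
  obtain ⟨t, rfl⟩ : ∃ t, dualTensorHom k A A t = N := by
    obtain ⟨t, ht⟩ := (dualTensorHomEquiv k A A).surjective N
    exact ⟨t, by rw [← ht]; simp [dualTensorHomEquiv]⟩
  induction t with
  | zero => simp
  | add x y hx hy =>
    rw [map_add, LinearMap.lTensor_add, LinearMap.add_comp, LinearMap.comp_add, map_add, hx, hy,
      map_add, mul_add]
  | tmul φ v =>
    let ψ : A → Module.Dual k A := fun w =>
      TensorProduct.lid k k ∘ₗ
        TensorProduct.map (g ∘ₗ LinearMap.mulLeft k w ∘ₗ antipode k) φ ∘ₗ comul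
    have h1 : TensorProduct.lift (kerG g) ∘ₗ
        (dualTensorHom k A A (φ ⊗ₜ v)).lTensor A ∘ₗ comul =
        ∑ i ∈ (ℛ k v).index, dualTensorHom k A A (ψ ((ℛ k v).left i) ⊗ₜ (ℛ k v).right i) := by
      ext h
      simp only [LinearMap.comp_apply, LinearMap.sum_apply, dualTensorHom_apply, ψ,
        LinearEquiv.coe_coe]
      conv_lhs => rw [← (ℛ k h).eq]
      conv_rhs => rw [← (ℛ k h).eq]
      simp only [map_sum, LinearMap.lTensor_tmul, TensorProduct.lift.tmul,
        TensorProduct.map_tmul, TensorProduct.lid_tmul, 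
        dualTensorHom_apply, map_smul, kerG, LinearMap.mk₂_apply, LinearMap.comp_apply,
        LinearMap.mulLeft_apply, Finset.sum_smul]
      rw [Finset.sum_comm]
      refine Finset.sum_congr rfl fun i _ => ?_
      rw [← (ℛ k v).eq]
      simp [Finset.smul_sum, smul_smul, mul_comm]
    rw [h1, map_sum]
    simp only [LinearMap.trace_eq_contract_apply, contractLeft_apply]
    let F : A ⊗[k] (A ⊗[k] A) →ₗ[k] k := TensorProduct.lid k k ∘ₗ
      TensorProduct.map (g ∘ₗ LinearMap.mul' k A ∘ₗ (antipode k).lTensor A) φ ∘ₗ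
      (TensorProduct.assoc k A A A).symm.toLinearMap
    have h2 := tri_coassoc F v
    simp only [F, LinearMap.comp_apply, LinearEquiv.coe_coe, TensorProduct.assoc_symm_tmul,
      TensorProduct.map_tmul, LinearMap.lTensor_tmul, LinearMap.mul'_apply,
      TensorProduct.lid_tmul] at h2
    calc _ = _ := ?_
      _ = _ := h2.symm
      _ = _ := ?_
    · refine Finset.sum_congr rfl fun i _ => ?_
      simp only [ψ, LinearMap.comp_apply, LinearEquiv.coe_coe]
      rw [← (ℛ k ((ℛ k v).right i)).eq]
      simp
    · simp only [← Finset.sum_smul, ← map_sum, sum_mul_antipode_eq_algebraMap_counit]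
      simp only [Algebra.algebraMap_eq_smul_one, map_smul, smul_eq_mul, mul_assoc, mul_left_comm _ (g 1),
        ← Finset.mul_sum]
      congr 1
      conv_rhs => rw [← sum_counit_smul (ℛ k v)]
      simp

/-- `z ↦ ∑ z₁ f(z₂)` -/
noncomputable def rHit (f : Module.Dual k A) : A →ₗ[k] A :=
  TensorProduct.rid k A ∘ₗ f.lTensor A ∘ₗ comul

/-- the functional `x ↦ tr(z ↦ ∑ x₁ S²(z₁) f(x₂ S²(z₂)))` -/
noncomputable def intFun (f : Module.Dual k A) : Module.Dual k A where
  toFun x := LinearMap.trace k A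
    (rHit f ∘ₗ LinearMap.mulLeft k x ∘ₗ antipode k ∘ₗ antipode k)
  map_add' x y := by
    rw [← map_add, ← LinearMap.comp_add, ← LinearMap.add_comp]; congr 3
    ext; simp [add_mul]
  map_smul' c x := by
    rw [RingHom.id_apply, ← map_smul, ← LinearMap.comp_smul, ← LinearMap.smul_comp]; congr 3
    ext; simp

theorem comul_rHit (f : Module.Dual k A) (z : A) :
    comul (R := k) (rHit f z) = (rHit f).lTensor A (comul z) := by
  let F : A ⊗[k] (A ⊗[k] A) →ₗ[k] A ⊗[k] A :=
    LinearMap.lTensor A ((TensorProduct.rid k A).toLinearMap ∘ₗ f.lTensor A)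
  have h := tri_coassoc F z
  simp only [F, LinearMap.lTensor_tmul, LinearMap.comp_apply, LinearEquiv.coe_coe,
    TensorProduct.rid_tmul] at h
  calc _ = _ := ?_
    _ = _ := h
    _ = _ := ?_
  · simp only [rHit, LinearMap.comp_apply, LinearEquiv.coe_coe]
    rw [← (ℛ k z).eq]
    simp only [map_sum, LinearMap.lTensor_tmul, TensorProduct.rid_tmul, map_smul]
    refine Finset.sum_congr rfl fun i _ => ?_
    rw [← (ℛ k ((ℛ k z).left i)).eq]
    simp [Finset.smul_sum]
  · conv_rhs => rw [← (ℛ k z).eq]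
    simp only [map_sum, LinearMap.lTensor_tmul]
    refine Finset.sum_congr rfl fun i _ => ?_
    simp only [rHit, LinearMap.comp_apply, LinearEquiv.coe_coe]
    rw [← (ℛ k ((ℛ k z).right i)).eq]
    simp [TensorProduct.tmul_sum]

theorem intFun_spec [FiniteDimensional k A] (f g : Module.Dual k A) (x : A) :
    ∑ i ∈ (ℛ k x).index, g ((ℛ k x).left i) * intFun f ((ℛ k x).right i) =
      g 1 * intFun f x := by
  change _ = g 1 * LinearMap.trace k A _
  rw [← trace_kerG]
  simp only [intFun, LinearMap.coe_mk, AddHom.coe_mk, ← smul_eq_mul, ← map_smul, ← map_sum]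
  congr 1
  ext h
  simp only [LinearMap.comp_apply]
  have h0 : ∀ p q : A, kerG g p (rHit f q) = TensorProduct.lid k A
      (TensorProduct.map g (rHit f) (comul q * (antipode k p ⊗ₜ[k] (1 : A)))) := by
    intro p q
    simp only [kerG, LinearMap.mk₂_apply, comul_rHit]
    rw [← (ℛ k q).eq]
    simp [Finset.sum_mul]
  conv_rhs => rw [← (ℛ k h).eq]
  simp only [map_sum, LinearMap.lTensor_tmul, TensorProduct.lift.tmul, LinearMap.comp_apply, h0,
    LinearMap.mulLeft_apply, Bialgebra.comul_mul, mul_assoc]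
  simp only [← map_sum, ← Finset.mul_sum, comul_sq_mul]
  rw [← (ℛ k x).eq]
  simp [Finset.sum_mul]

theorem exists_integral [FiniteDimensional k A] :
    ∃ l : Module.Dual k A, l ≠ 0 ∧ ∀ x : A,
      ∑ i ∈ (ℛ k x).index, l ((ℛ k x).right i) • (ℛ k x).left i = l x • 1 := by
  let b := Module.finBasis k A
  have hsum : ∑ i, intFun (b.coord i ∘ₗ antipode k) (b i) = 1 := by
    have : ∑ i, (LinearMap.mulLeft k (b i) ∘ₗ antipode k ∘ₗ antipode k) ∘ₗ
        rHit (b.coord i ∘ₗ antipode k) = dualTensorHom k A A (counit ⊗ₜ 1) := by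
      ext h
      simp only [LinearMap.sum_apply, LinearMap.comp_apply, rHit, LinearEquiv.coe_coe,
        dualTensorHom_apply]
      have h1 := antipode_mul_sq (k := k) h
      rw [Algebra.algebraMap_eq_smul_one] at h1
      rw [← h1]
      conv_lhs => 
        enter [2, i]
        rw [← (ℛ k h).eq]
      simp only [map_sum, LinearMap.lTensor_tmul, TensorProduct.rid_tmul, LinearMap.comp_apply,
        map_smul, LinearMap.mulLeft_apply]
      rw [Finset.sum_comm]
      refine Finset.sum_congr rfl fun j _ => ?_
      simp only [← smul_mul_assoc, ← Finset.sum_mul, Module.Basis.coord_apply, b.sum_repr]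
    calc _ = LinearMap.trace k A _ := ?_
      _ = LinearMap.trace k A _ := congrArg _ this
      _ = _ := by simp [LinearMap.trace_eq_contract_apply]
    rw [map_sum]
    refine Finset.sum_congr rfl fun i _ => ?_
    exact LinearMap.trace_comp_comm' _ _
  have : ∃ i, intFun (b.coord i ∘ₗ antipode k) ≠ 0 := by
    by_contra! hcon
    simp [hcon] at hsum
  obtain ⟨i, hi⟩ := this
  refine ⟨_, hi, fun x => ?_⟩
  rw [← sub_eq_zero, ← Module.forall_dual_apply_eq_zero_iff k]
  intro g
  rw [map_sub, sub_eq_zero, map_sum, map_smul, smul_eq_mul, mul_comm, ← intFun_spec]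
  simp [mul_comm]

theorem antipode_injective [FiniteDimensional k A] : Function.Injective (antipode k (A := A)) := by
  obtain ⟨l, hl, hint⟩ := exists_integral (k := k) (A := A)
  refine (injective_iff_map_eq_zero (antipode k (A := A))).2 fun h hh => ?_
  obtain ⟨y, hy⟩ : ∃ y, l y ≠ 0 := by
    by_contra! hcon
    exact hl (LinearMap.ext hcon)
  let Φ : A →ₗ[k] Module.Dual k A :=
    LinearMap.compRight k l ∘ₗ (LinearMap.mul k A).flip ∘ₗ antipode k
  have hΦ : ∀ p x, Φ p x = l (x * antipode k p) := fun p x => rfl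
  -- `∑ l(x S(h₁)) h₂ = ∑ x₁ l(x₂ S(h))`
  have h0 : ∀ p x : A, TensorProduct.rid k A (l.lTensor A (comul (R := k) (x * antipode k p))) =
      l (x * antipode k p) • 1 := by
    intro p x
    rw [← hint, ← (ℛ k (x * antipode k p)).eq]
    simp
  have h1 : Φ.rTensor A (comul h) = 0 := by
    apply (dualTensorHomEquiv k A A).injective
    rw [map_zero, ← (ℛ k h).eq]
    ext x
    change dualTensorHom k A A _ x = _
    simp only [map_sum, LinearMap.rTensor_tmul, LinearMap.sum_apply,
      dualTensorHom_apply, hΦ, LinearMap.zero_apply]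
    have hF : ∀ z w : A, ∑ i ∈ (ℛ k h).index, ∑ j ∈ (ℛ k ((ℛ k h).left i)).index,
        l (w * antipode k ((ℛ k ((ℛ k h).left i)).left j)) •
          (z * (antipode k ((ℛ k ((ℛ k h).left i)).right j) * (ℛ k h).right i)) = 0 := by
      intro z w
      let F : A ⊗[k] (A ⊗[k] A) →ₗ[k] A := TensorProduct.lid k A ∘ₗ
        TensorProduct.map (l ∘ₗ LinearMap.mulLeft k w ∘ₗ antipode k)
          (LinearMap.mulLeft k z ∘ₗ LinearMap.mul' k A ∘ₗ (antipode k).rTensor A)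
      have h2 := tri_coassoc F h
      simp only [F, LinearMap.comp_apply, LinearEquiv.coe_coe, TensorProduct.map_tmul,
        LinearMap.rTensor_tmul, LinearMap.mul'_apply, TensorProduct.lid_tmul,
        LinearMap.mulLeft_apply] at h2
      rw [h2]
      simp only [← Finset.smul_sum, ← Finset.mul_sum, sum_antipode_mul_eq_algebraMap_counit]
      simp only [Algebra.algebraMap_eq_smul_one, mul_smul_comm, mul_one, smul_smul,
        ← Finset.sum_smul]
      have : ∑ i ∈ (ℛ k h).index, l (w * antipode k ((ℛ k h).left i)) *
          counit (R := k) ((ℛ k h).right i) = l (w * antipode k h) := by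
        conv_rhs => rw [← sum_counit_smul' (k := k) h]
        simp [Finset.mul_sum, mul_comm]
      rw [this, hh]
      simp
    calc _ = ∑ i ∈ (ℛ k h).index, TensorProduct.rid k A (l.lTensor A
            (comul (R := k) (x * antipode k ((ℛ k h).left i)))) * (ℛ k h).right i := by
          simp only [h0, smul_mul_assoc, one_mul]
      _ = ∑ m ∈ (ℛ k x).index, ∑ i ∈ (ℛ k h).index, ∑ j ∈ (ℛ k ((ℛ k h).left i)).index,
        l ((ℛ k x).right m * antipode k ((ℛ k ((ℛ k h).left i)).left j)) •
          ((ℛ k x).left m * (antipode k ((ℛ k ((ℛ k h).left i)).right j) * (ℛ k h).right i)) := by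
          rw [Finset.sum_comm]
          refine Finset.sum_congr rfl fun i _ => ?_
          rw [Bialgebra.comul_mul, comul_antipode, ← (ℛ k x).eq, ← (ℛ k ((ℛ k h).left i)).eq]
          simp only [map_sum, Finset.sum_mul, Finset.mul_sum, TensorProduct.map_tmul,
            TensorProduct.comm_tmul, Algebra.TensorProduct.tmul_mul_tmul, LinearMap.lTensor_tmul,
            TensorProduct.rid_tmul, smul_mul_assoc, mul_assoc]
          try rw [Finset.sum_comm]
      _ = 0 := by simp [hF]
  let G : A ⊗[k] A →ₗ[k] k := l ∘ₗ LinearMap.mulLeft k y ∘ₗ LinearMap.mul' k A ∘ₗ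
    (TensorProduct.comm k A A).toLinearMap ∘ₗ TensorProduct.map (antipode k) (antipode k ∘ₗ antipode k)
  let F : A ⊗[k] (A ⊗[k] A) →ₗ[k] A := (TensorProduct.lid k A).toLinearMap ∘ₗ
    G.rTensor A ∘ₗ (TensorProduct.assoc k A A A).symm.toLinearMap
  let G' : Module.Dual k A ⊗[k] (A ⊗[k] A) →ₗ[k] A :=
    TensorProduct.lid k A ∘ₗ
    TensorProduct.map (contractLeft k A ∘ₗ LinearMap.lTensor _ (LinearMap.mulLeft k y ∘ₗ antipode k ∘ₗ antipode k))
      LinearMap.id ∘ₗ (TensorProduct.assoc k _ A A).symm.toLinearMap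
  have hFG : ∀ t, F t = G' (Φ.rTensor _ t) := by
    intro t
    have : F = G' ∘ₗ Φ.rTensor _ := by
      ext a b c
      simp [F, G', G, hΦ, mul_assoc]
    rw [this]; rfl
  have h2 : F (comul.lTensor A (comul h)) = 0 := by
    have h4 : Φ.rTensor _ (comul.lTensor A (comul h)) =
        LinearMap.lTensor _ comul (Φ.rTensor A (comul h)) := by
      rw [← LinearMap.comp_apply, LinearMap.rTensor_comp_lTensor,
        ← LinearMap.lTensor_comp_rTensor, LinearMap.comp_apply]
    rw [hFG, h4, h1, map_zero, map_zero]
  have h3 : F (comul.lTensor A (comul h)) = l y • h := by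
    rw [← coassoc_apply]
    conv_lhs => rw [← (ℛ k h).eq]
    simp only [map_sum, LinearMap.rTensor_tmul, F, LinearMap.comp_apply, LinearEquiv.coe_coe,
      LinearEquiv.symm_apply_apply, TensorProduct.lid_tmul]
    conv_rhs => rw [← sum_counit_smul (ℛ k h)]
    rw [Finset.smul_sum]
    refine Finset.sum_congr rfl fun i _ => ?_
    rw [smul_smul]
    congr 1
    have := sq_antipode_mul (k := k) ((ℛ k h).left i)
    calc _ = l (y * ∑ j ∈ (ℛ k ((ℛ k h).left i)).index,
          antipode k (antipode k ((ℛ k ((ℛ k h).left i)).right j)) *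
            antipode k ((ℛ k ((ℛ k h).left i)).left j)) := by
          rw [← (ℛ k ((ℛ k h).left i)).eq]
          simp [G, Finset.mul_sum]
      _ = _ := by
        rw [this, Algebra.algebraMap_eq_smul_one]
        simp [mul_comm]
  rw [h2] at h3
  exact (smul_eq_zero.1 h3.symm).resolve_left hy


section Inverse

variable (k A) in
/-- The inverse `S⁻¹` of the antipode of a finite dimensional Hopf algebra. -/
noncomputable def antipodeInv [FiniteDimensional k A] : A →ₗ[k] A :=
  (LinearEquiv.ofInjectiveEndo (antipode k (A := A)) antipode_injective).symm.toLinearMap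

variable [FiniteDimensional k A]

@[simp] theorem antipodeInv_antipode (a : A) : antipodeInv k A (antipode k a) = a :=
  (LinearEquiv.ofInjectiveEndo (antipode k (A := A)) antipode_injective).symm_apply_apply a

@[simp] theorem antipode_antipodeInv (a : A) : antipode k (antipodeInv k A a) = a :=
  (LinearEquiv.ofInjectiveEndo (antipode k (A := A)) antipode_injective).apply_symm_apply a

theorem antipodeInv_one : antipodeInv k A 1 = 1 := by
  conv_lhs => rw [← antipode_one (R := k) (A := A)]
  exact antipodeInv_antipode 1

theorem antipodeInv_mul (a b : A) :
    antipodeInv k A (a * b) = antipodeInv k A b * antipodeInv k A a := by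
  apply antipode_injective (k := k)
  simp [antipode_mul_antidistrib]

theorem comul_antipodeInv (a : A) :
    comul (R := k) (antipodeInv k A a) = TensorProduct.comm k A A
      (TensorProduct.map (antipodeInv k A) (antipodeInv k A) (comul a)) := by
  obtain ⟨b, rfl⟩ : ∃ b, antipode k b = a := ⟨antipodeInv k A a, by simp⟩
  rw [comul_antipode, antipodeInv_antipode, ← (ℛ k b).eq]
  simp

theorem sum_antipodeInv_mul (a : A) :
    ∑ i ∈ (ℛ k a).index, antipodeInv k A ((ℛ k a).right i) * (ℛ k a).left i =
      algebraMap k A (counit a) := by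
  apply antipode_injective (k := k)
  rw [map_sum]
  simp only [antipode_mul_antidistrib, antipode_antipodeInv, sum_antipode_mul_eq_algebraMap_counit]
  rw [Algebra.algebraMap_eq_smul_one, map_smul, antipode_one]

theorem sum_mul_antipodeInv (a : A) :
    ∑ i ∈ (ℛ k a).index, (ℛ k a).right i * antipodeInv k A ((ℛ k a).left i) =
      algebraMap k A (counit a) := by
  apply antipode_injective (k := k)
  rw [map_sum]
  simp only [antipode_mul_antidistrib, antipode_antipodeInv, sum_mul_antipode_eq_algebraMap_counit]
  rw [Algebra.algebraMap_eq_smul_one, map_smul, antipode_one]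

end Inverse

section AlgebraX

variable (k A) in
/-- The product of the dual algebra `A^*`: `(l * l')(x) = ∑ l(x⁽¹⁾) l'(x⁽²⁾)`. -/
noncomputable def dualMul : Module.Dual k A →ₗ[k] Module.Dual k A →ₗ[k] Module.Dual k A :=
  LinearMap.mk₂ k (fun l l' => LinearMap.mul' k k ∘ₗ TensorProduct.map l l' ∘ₗ comul)
    (fun _ _ _ => by rw [TensorProduct.map_add_left, LinearMap.add_comp, LinearMap.comp_add])
    (fun _ _ _ => by rw [TensorProduct.map_smul_left, LinearMap.smul_comp, LinearMap.comp_smul])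
    (fun _ _ _ => by rw [TensorProduct.map_add_right, LinearMap.add_comp, LinearMap.comp_add])
    (fun _ _ _ => by rw [TensorProduct.map_smul_right, LinearMap.smul_comp, LinearMap.comp_smul])

theorem dualMul_apply (l l' : Module.Dual k A) (x : A) :
    dualMul k A l l' x = ∑ i ∈ (ℛ k x).index, l ((ℛ k x).left i) * l' ((ℛ k x).right i) := by
  simp only [dualMul, LinearMap.mk₂_apply, LinearMap.comp_apply]
  rw [← (ℛ k x).eq]
  simp

variable (k A) in
/-- `x ↦ (l ↦ l(x ·))` -/
noncomputable def transL : A →ₗ[k] Module.End k (Module.Dual k A) where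
  toFun x := (LinearMap.mulLeft k x).dualMap
  map_add' x y := by ext; simp [add_mul]
  map_smul' c x := by ext; simp

variable (k A) in
/-- `x ↦ (l ↦ l(· x))` -/
noncomputable def transR : A →ₗ[k] Module.End k (Module.Dual k A) where
  toFun x := (LinearMap.mulRight k x).dualMap
  map_add' x y := by ext; simp [mul_add]
  map_smul' c x := by ext; simp

@[simp] theorem transL_apply (x y : A) (l : Module.Dual k A) : transL k A x l y = l (x * y) := rfl
@[simp] theorem transR_apply (x y : A) (l : Module.Dual k A) : transR k A x l y = l (y * x) := rfl

variable (k A) in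
/-- The vector space `(A^{*op} ⊗ A^*) ⊗ (A ⊗ A^{op})` underlying the algebra `X`. -/
def XAlg : Type u :=
  (Module.Dual k A ⊗[k] Module.Dual k A) ⊗[k] (A ⊗[k] A)

noncomputable instance : AddCommMonoid (XAlg k A) :=
  inferInstanceAs (AddCommMonoid ((Module.Dual k A ⊗[k] Module.Dual k A) ⊗[k] (A ⊗[k] A)))

noncomputable instance : Module k (XAlg k A) :=
  inferInstanceAs (Module k ((Module.Dual k A ⊗[k] Module.Dual k A) ⊗[k] (A ⊗[k] A)))

noncomputable instance : AddCommGroup (XAlg k A) :=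
  Module.addCommMonoidToAddCommGroup k

variable [FiniteDimensional k A]

variable (k A) in
/-- Linear families of elements of an algebra `R`, indexed by `A^{*op}`, `A^*`, `A` and `A^{op}`,
which satisfy the relations between these four subalgebras of `X`. -/
structure ExchangeRep (R : Type u) [Ring R] [Algebra k R] where
  lam : Module.Dual k A →ₗ[k] R
  kap : Module.Dual k A →ₗ[k] R
  al : A →ₗ[k] R
  be : A →ₗ[k] R
  lam_one : lam counit = 1
  kap_one : kap counit = 1
  al_one : al 1 = 1
  be_one : be 1 = 1
  lam_mul : ∀ l l', lam l * lam l' = lam (dualMul k A l' l)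
  kap_mul : ∀ l l', kap l * kap l' = kap (dualMul k A l l')
  al_mul : ∀ a a', al a * al a' = al (a * a')
  be_mul : ∀ b b', be b * be b' = be (b' * b)
  lam_kap : ∀ l l', kap l' * lam l = lam l * kap l'
  al_be : ∀ a b, be b * al a = al a * be b
  al_lam : ∀ a l, al a * lam l = ∑ i ∈ (ℛ k a).index,
    lam (transL k A (antipode k ((ℛ k a).left i)) l) * al ((ℛ k a).right i)
  al_kap : ∀ a l, al a * kap l = ∑ i ∈ (ℛ k a).index,
    kap (transL k A (antipodeInv k A ((ℛ k a).right i)) l) * al ((ℛ k a).left i)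
  be_lam : ∀ b l, be b * lam l = ∑ i ∈ (ℛ k b).index,
    lam (transR k A (antipodeInv k A ((ℛ k b).left i)) l) * be ((ℛ k b).right i)
  be_kap : ∀ b l, be b * kap l = ∑ i ∈ (ℛ k b).index,
    kap (transR k A (antipode k ((ℛ k b).right i)) l) * be ((ℛ k b).left i)

namespace ExchangeRep

variable {R : Type u} [Ring R] [Algebra k R]

/-- `(l ⊗ l') ⊗ (a ⊗ b) ↦ l · l' · a · b` -/
noncomputable def toFun (ρ : ExchangeRep k A R) : XAlg k A →ₗ[k] R :=
  LinearMap.mul' k R ∘ₗ TensorProduct.map (LinearMap.mul' k R ∘ₗ TensorProduct.map ρ.lam ρ.kap)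
    (LinearMap.mul' k R ∘ₗ TensorProduct.map ρ.al ρ.be)

end ExchangeRep

namespace XAlg

/-- the element `(l ⊗ l') ⊗ (a ⊗ b)` of `X` -/
noncomputable abbrev tm (l l' : Module.Dual k A) (a b : A) : XAlg k A := (l ⊗ₜ l') ⊗ₜ[k] (a ⊗ₜ b)

/-- the operator `f₁ ⊗ f₂ ⊗ f₃ ⊗ f₄` on `X` -/
noncomputable def op (f₁ f₂ : Module.End k (Module.Dual k A)) (f₃ f₄ : Module.End k A) :
    Module.End k (XAlg k A) :=
  TensorProduct.map (TensorProduct.map f₁ f₂) (TensorProduct.map f₃ f₄)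

@[simp] theorem op_tm (f₁ f₂ : Module.End k (Module.Dual k A)) (f₃ f₄ : Module.End k A)
    (l l' : Module.Dual k A) (a b : A) :
    op f₁ f₂ f₃ f₄ (tm l l' a b) = tm (f₁ l) (f₂ l') (f₃ a) (f₄ b) := rfl

theorem hom_ext {M : Type*} [AddCommMonoid M] [Module k M] {f g : XAlg k A →ₗ[k] M}
    (h : ∀ l l' a b, f (tm l l' a b) = g (tm l l' a b)) : f = g := by
  refine TensorProduct.ext (LinearMap.ext fun x => LinearMap.ext fun y => ?_)
  induction x with
  | zero => simp
  | add x x' hx hx' => simp only [map_add, LinearMap.add_apply, hx, hx']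
  | tmul l l' =>
    induction y with
    | zero => simp
    | add x x' hx hx' => simp only [map_add, hx, hx']
    | tmul a b => exact h l l' a b

end XAlg


open WithConv in
/-- `a ↦ ∑ f(a⁽¹⁾) g(a⁽²⁾)` -/
noncomputable def conv {R : Type u} [Ring R] [Algebra k R] (f g : A →ₗ[k] R) : A →ₗ[k] R :=
  (toConv f * toConv g).ofConv

theorem conv_apply {R : Type u} [Ring R] [Algebra k R] (f g : A →ₗ[k] R) (a : A) :
    conv f g a = ∑ i ∈ (ℛ k a).index, f ((ℛ k a).left i) * g ((ℛ k a).right i) :=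
  (ℛ k a).convMul_apply (WithConv.toConv f) (WithConv.toConv g)

theorem conv_assoc {R : Type u} [Ring R] [Algebra k R] (f g h : A →ₗ[k] R) :
    conv (conv f g) h = conv f (conv g h) :=
  congrArg WithConv.ofConv
    (mul_assoc (WithConv.toConv f) (WithConv.toConv g) (WithConv.toConv h))

theorem conv_one {R : Type u} [Ring R] [Algebra k R] (f g : A →ₗ[k] R) (hf : f 1 = 1)
    (hg : g 1 = 1) : conv f g 1 = 1 := by
  change LinearMap.mul' k R (TensorProduct.map f g (comul 1)) = 1
  simp [Algebra.TensorProduct.one_def, hf, hg]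

theorem conv_mul {R : Type u} [Ring R] [Algebra k R] (f g : A →ₗ[k] R)
    (hf : ∀ a b, f (a * b) = f a * f b) (hg : ∀ a b, g (a * b) = g a * g b)
    (hfg : ∀ a b, g a * f b = f b * g a) (a b : A) :
    conv f g (a * b) = conv f g a * conv f g b := by
  change LinearMap.mul' k R (TensorProduct.map f g (comul (a * b))) =
    LinearMap.mul' k R (TensorProduct.map f g (comul a)) *
      LinearMap.mul' k R (TensorProduct.map f g (comul b))
  rw [Bialgebra.comul_mul, ← (ℛ k a).eq, ← (ℛ k b).eq]
  simp only [Finset.sum_mul_sum, Algebra.TensorProduct.tmul_mul_tmul, map_sum,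
    TensorProduct.map_tmul, LinearMap.mul'_apply, hf, hg]
  refine Finset.sum_congr rfl fun i _ => Finset.sum_congr rfl fun j _ => ?_
  rw [mul_assoc, ← mul_assoc (f _) (g _), ← hfg, mul_assoc, mul_assoc]

theorem conv_mul_anti {R : Type u} [Ring R] [Algebra k R] (f g : A →ₗ[k] R)
    (hf : ∀ a b, f (a * b) = f b * f a) (hg : ∀ a b, g (a * b) = g b * g a)
    (hfg : ∀ a b, g a * f b = f b * g a) (a b : A) :
    conv f g (a * b) = conv f g b * conv f g a := by
  change LinearMap.mul' k R (TensorProduct.map f g (comul (a * b))) =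
    LinearMap.mul' k R (TensorProduct.map f g (comul b)) *
      LinearMap.mul' k R (TensorProduct.map f g (comul a))
  rw [Bialgebra.comul_mul, ← (ℛ k a).eq, ← (ℛ k b).eq]
  rw [Finset.sum_mul_sum, Finset.sum_comm]
  simp only [Algebra.TensorProduct.tmul_mul_tmul, map_sum, Finset.sum_mul_sum,
    TensorProduct.map_tmul, LinearMap.mul'_apply, hf, hg]
  refine Finset.sum_congr rfl fun i _ => Finset.sum_congr rfl fun j _ => ?_
  rw [mul_assoc, ← mul_assoc (f _) (g _), ← hfg, mul_assoc, mul_assoc]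

theorem commute_conv {R : Type u} [Ring R] [Algebra k R] (f g : A →ₗ[k] R) (r : R)
    (hf : ∀ a, f a * r = r * f a) (hg : ∀ a, g a * r = r * g a) (a : A) :
    conv f g a * r = r * conv f g a := by
  rw [conv_apply, Finset.sum_mul, Finset.mul_sum]
  refine Finset.sum_congr rfl fun i _ => ?_
  rw [mul_assoc, hg, ← mul_assoc, hf, mul_assoc]

namespace XAlg

theorem op_mul (f₁ f₂ g₁ g₂ : Module.End k (Module.Dual k A)) (f₃ f₄ g₃ g₄ : Module.End k A) :
    op f₁ f₂ f₃ f₄ * op g₁ g₂ g₃ g₄ = op (f₁ * g₁) (f₂ * g₂) (f₃ * g₃) (f₄ * g₄) :=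
  hom_ext fun _ _ _ _ => rfl

variable (k A) in
/-- operators on the first tensorand -/
noncomputable def op₁ : Module.End k (Module.Dual k A) →ₗ[k] Module.End k (XAlg k A) where
  toFun f := op f 1 1 1
  map_add' f g := by simp only [op, TensorProduct.map_add_left]; rfl
  map_smul' c f := by simp only [op, TensorProduct.map_smul_left]; rfl

variable (k A) in
/-- operators on the second tensorand -/
noncomputable def op₂ : Module.End k (Module.Dual k A) →ₗ[k] Module.End k (XAlg k A) where
  toFun f := op 1 f 1 1
  map_add' f g := by simp only [op, TensorProduct.map_add_left, TensorProduct.map_add_right]; rfl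
  map_smul' c f := by
    simp only [op, TensorProduct.map_smul_left, TensorProduct.map_smul_right]; rfl

variable (k A) in
/-- operators on the third tensorand -/
noncomputable def op₃ : Module.End k A →ₗ[k] Module.End k (XAlg k A) where
  toFun f := op 1 1 f 1
  map_add' f g := by simp only [op, TensorProduct.map_add_left, TensorProduct.map_add_right]; rfl
  map_smul' c f := by
    simp only [op, TensorProduct.map_smul_left, TensorProduct.map_smul_right]; rfl

variable (k A) in
/-- operators on the fourth tensorand -/
noncomputable def op₄ : Module.End k A →ₗ[k] Module.End k (XAlg k A) where
  toFun f := op 1 1 1 f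
  map_add' f g := by simp only [op, TensorProduct.map_add_right]; rfl
  map_smul' c f := by simp only [op, TensorProduct.map_smul_right]; rfl

theorem op₁_apply (f : Module.End k (Module.Dual k A)) : op₁ k A f = op f 1 1 1 := rfl
theorem op₂_apply (f : Module.End k (Module.Dual k A)) : op₂ k A f = op 1 f 1 1 := rfl
theorem op₃_apply (f : Module.End k A) : op₃ k A f = op 1 1 f 1 := rfl
theorem op₄_apply (f : Module.End k A) : op₄ k A f = op 1 1 1 f := rfl

variable (k A) in
/-- Left multiplication by `1 ⊗ (a ⊗ 1)` in `X`, that is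
`l ⊗ l' ⊗ a' ⊗ b' ↦ ∑ l(S(a⁽¹⁾) ·) ⊗ l'(S⁻¹(a⁽³⁾) ·) ⊗ a⁽²⁾a' ⊗ b'`. -/
noncomputable def leftAl : A →ₗ[k] Module.End k (XAlg k A) :=
  conv (op₁ k A ∘ₗ transL k A ∘ₗ antipode k)
    (conv (op₃ k A ∘ₗ LinearMap.mul k A) (op₂ k A ∘ₗ transL k A ∘ₗ antipodeInv k A))

variable (k A) in
/-- Left multiplication by `1 ⊗ (1 ⊗ b)` in `X`, that is
`l ⊗ l' ⊗ a' ⊗ b' ↦ ∑ l(· S⁻¹(b⁽¹⁾)) ⊗ l'(· S(b⁽³⁾)) ⊗ a' ⊗ b' b⁽²⁾`. -/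
noncomputable def leftBe : A →ₗ[k] Module.End k (XAlg k A) :=
  conv (op₁ k A ∘ₗ transR k A ∘ₗ antipodeInv k A)
    (conv (op₄ k A ∘ₗ (LinearMap.mul k A).flip) (op₂ k A ∘ₗ transR k A ∘ₗ antipode k))

theorem leftAl_tm (a : A) (l l' : Module.Dual k A) (a' b' : A) :
    leftAl k A a (tm l l' a' b') = ∑ i ∈ (ℛ k a).index, ∑ j ∈ (ℛ k ((ℛ k a).right i)).index,
      tm (transL k A (antipode k ((ℛ k a).left i)) l)
        (transL k A (antipodeInv k A ((ℛ k ((ℛ k a).right i)).right j)) l')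
        ((ℛ k ((ℛ k a).right i)).left j * a') b' := by
  simp only [leftAl, conv_apply, LinearMap.comp_apply, Finset.mul_sum, LinearMap.sum_apply,
    op₁_apply, op₂_apply, op₃_apply, op_mul, op_tm]
  rfl

theorem leftBe_tm (b : A) (l l' : Module.Dual k A) (a' b' : A) :
    leftBe k A b (tm l l' a' b') = ∑ i ∈ (ℛ k b).index, ∑ j ∈ (ℛ k ((ℛ k b).right i)).index,
      tm (transR k A (antipodeInv k A ((ℛ k b).left i)) l)
        (transR k A (antipode k ((ℛ k ((ℛ k b).right i)).right j)) l')
        a' (b' * (ℛ k ((ℛ k b).right i)).left j) := by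
  simp only [leftBe, conv_apply, LinearMap.comp_apply, Finset.mul_sum, LinearMap.sum_apply,
    op₁_apply, op₂_apply, op₄_apply, op_mul, op_tm]
  rfl

end XAlg

namespace ExchangeRep

variable {R : Type u} [Ring R] [Algebra k R] (ρ : ExchangeRep k A R)

theorem toFun_tm (l l' : Module.Dual k A) (a b : A) :
    ρ.toFun (XAlg.tm l l' a b) = ρ.lam l * ρ.kap l' * (ρ.al a * ρ.be b) := rfl

theorem toFun_lam (m : Module.Dual k A) (x : XAlg k A) :
    ρ.toFun (XAlg.op₁ k A ((dualMul k A).flip m) x) = ρ.lam m * ρ.toFun x := by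
  suffices h : ρ.toFun ∘ₗ XAlg.op₁ k A ((dualMul k A).flip m) =
      LinearMap.mulLeft k (ρ.lam m) ∘ₗ ρ.toFun from LinearMap.congr_fun h x
  refine XAlg.hom_ext fun l l' a b => ?_
  simp only [LinearMap.comp_apply, XAlg.op₁_apply, XAlg.op_tm, toFun_tm, LinearMap.mulLeft_apply,
    LinearMap.flip_apply, ← ρ.lam_mul, Module.End.one_apply, mul_assoc]

theorem toFun_kap (m : Module.Dual k A) (x : XAlg k A) :
    ρ.toFun (XAlg.op₂ k A (dualMul k A m) x) = ρ.kap m * ρ.toFun x := by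
  suffices h : ρ.toFun ∘ₗ XAlg.op₂ k A (dualMul k A m) =
      LinearMap.mulLeft k (ρ.kap m) ∘ₗ ρ.toFun from LinearMap.congr_fun h x
  refine XAlg.hom_ext fun l l' a b => ?_
  simp only [LinearMap.comp_apply, XAlg.op₂_apply, XAlg.op_tm, toFun_tm, LinearMap.mulLeft_apply,
    ← ρ.kap_mul, Module.End.one_apply]
  simp only [← mul_assoc]
  rw [ρ.lam_kap]

theorem toFun_al (c : A) (x : XAlg k A) :
    ρ.toFun (XAlg.leftAl k A c x) = ρ.al c * ρ.toFun x := by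
  suffices h : ρ.toFun ∘ₗ XAlg.leftAl k A c =
      LinearMap.mulLeft k (ρ.al c) ∘ₗ ρ.toFun from LinearMap.congr_fun h x
  refine XAlg.hom_ext fun l l' a b => ?_
  simp only [LinearMap.comp_apply, XAlg.leftAl_tm, toFun_tm, LinearMap.mulLeft_apply, map_sum]
  simp only [← mul_assoc, ρ.al_lam, Finset.sum_mul]
  refine Finset.sum_congr rfl fun i _ => ?_
  simp only [mul_assoc (ρ.lam _) (ρ.al _) (ρ.kap _), ρ.al_kap, Finset.sum_mul, Finset.mul_sum]
  refine Finset.sum_congr rfl fun j _ => ?_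
  simp only [← ρ.al_mul, mul_assoc]

theorem toFun_be (c : A) (x : XAlg k A) :
    ρ.toFun (XAlg.leftBe k A c x) = ρ.be c * ρ.toFun x := by
  suffices h : ρ.toFun ∘ₗ XAlg.leftBe k A c =
      LinearMap.mulLeft k (ρ.be c) ∘ₗ ρ.toFun from LinearMap.congr_fun h x
  refine XAlg.hom_ext fun l l' a b => ?_
  simp only [LinearMap.comp_apply, XAlg.leftBe_tm, toFun_tm, LinearMap.mulLeft_apply, map_sum]
  simp only [← mul_assoc, ρ.be_lam, Finset.sum_mul]
  refine Finset.sum_congr rfl fun i _ => ?_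
  simp only [mul_assoc (ρ.lam _) (ρ.be _) (ρ.kap _), ρ.be_kap, Finset.sum_mul, Finset.mul_sum]
  refine Finset.sum_congr rfl fun j _ => ?_
  simp only [← ρ.be_mul, mul_assoc, ρ.al_be]

end ExchangeRep

namespace XAlg

theorem tm_sum₁ {ι : Type*} (s : Finset ι) (f : ι → Module.Dual k A) (l' : Module.Dual k A)
    (a b : A) : tm (∑ i ∈ s, f i) l' a b = ∑ i ∈ s, tm (f i) l' a b := by
  simp only [tm, TensorProduct.sum_tmul]; rfl

theorem tm_sum₂ {ι : Type*} (s : Finset ι) (l : Module.Dual k A) (f : ι → Module.Dual k A)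
    (a b : A) : tm l (∑ i ∈ s, f i) a b = ∑ i ∈ s, tm l (f i) a b := by
  simp only [tm, TensorProduct.sum_tmul, TensorProduct.tmul_sum]; rfl

theorem transL_mul (x y : A) : transL k A x * transL k A y = transL k A (y * x) := by
  ext; simp [mul_assoc]

theorem transR_mul (x y : A) : transR k A x * transR k A y = transR k A (x * y) := by
  ext; simp [mul_assoc]

theorem transL_one : transL k A 1 = 1 := by ext; simp
theorem transR_one : transR k A 1 = 1 := by ext; simp

theorem dualMul_assoc (l m n : Module.Dual k A) :
    dualMul k A (dualMul k A l m) n = dualMul k A l (dualMul k A m n) :=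
  congrArg WithConv.ofConv
    (mul_assoc (WithConv.toConv l) (WithConv.toConv m) (WithConv.toConv n))

theorem counit_dualMul (l : Module.Dual k A) : dualMul k A counit l = l :=
  congrArg WithConv.ofConv (one_mul (WithConv.toConv l))

theorem dualMul_counit (l : Module.Dual k A) : dualMul k A l counit = l :=
  congrArg WithConv.ofConv (mul_one (WithConv.toConv l))

theorem transL_dualMul {ι : Type*} {x : A} (r : Repr k x ι) (l m : Module.Dual k A) :
    transL k A x (dualMul k A l m) =
      ∑ i ∈ r.index, dualMul k A (transL k A (r.left i) l) (transL k A (r.right i) m) := by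
  ext z
  change LinearMap.mul' k k (TensorProduct.map l m (comul (x * z))) = _
  rw [Bialgebra.comul_mul, ← r.eq, ← (ℛ k z).eq, LinearMap.sum_apply, Finset.sum_mul_sum]
  simp [dualMul_apply]

theorem transR_dualMul {ι : Type*} {x : A} (r : Repr k x ι) (l m : Module.Dual k A) :
    transR k A x (dualMul k A l m) =
      ∑ i ∈ r.index, dualMul k A (transR k A (r.left i) l) (transR k A (r.right i) m) := by
  ext z
  change LinearMap.mul' k k (TensorProduct.map l m (comul (z * x))) = _
  rw [Bialgebra.comul_mul, ← r.eq, ← (ℛ k z).eq, LinearMap.sum_apply, Finset.sum_mul_sum,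
    Finset.sum_comm]
  simp [dualMul_apply]

/-- `Δ(S(a)) = ∑ S(a⁽²⁾) ⊗ S(a⁽¹⁾)` -/
noncomputable def reprAntipode (a : A) : Repr k (antipode k a) (A × A) where
  index := (ℛ k a).index
  left i := antipode k ((ℛ k a).right i)
  right i := antipode k ((ℛ k a).left i)
  eq := by rw [comul_antipode, ← (ℛ k a).eq]; simp

/-- `Δ(S⁻¹(a)) = ∑ S⁻¹(a⁽²⁾) ⊗ S⁻¹(a⁽¹⁾)` -/
noncomputable def reprAntipodeInv (a : A) : Repr k (antipodeInv k A a) (A × A) where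
  index := (ℛ k a).index
  left i := antipodeInv k A ((ℛ k a).right i)
  right i := antipodeInv k A ((ℛ k a).left i)
  eq := by rw [comul_antipodeInv, ← (ℛ k a).eq]; simp

theorem conv_fwd {R : Type u} [Ring R] [Algebra k R] (P N θ : A →ₗ[k] R) (K : R)
    (hP : ∀ a, P a * K = ∑ i ∈ (ℛ k a).index, θ ((ℛ k a).left i) * P ((ℛ k a).right i))
    (hN : ∀ a, N a * K = K * N a) (a : A) :
    conv P N a * K = ∑ i ∈ (ℛ k a).index, θ ((ℛ k a).left i) * conv P N ((ℛ k a).right i) := by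
  have hP' : ∀ a, P a * K = conv θ P a := fun a => by rw [hP, conv_apply]
  rw [← conv_apply, ← conv_assoc, conv_apply, conv_apply, Finset.sum_mul]
  refine Finset.sum_congr rfl fun i _ => ?_
  rw [mul_assoc, hN, ← mul_assoc, hP']

theorem conv_rev {R : Type u} [Ring R] [Algebra k R] (N Q θ : A →ₗ[k] R) (K : R)
    (hQ : ∀ a, Q a * K = ∑ i ∈ (ℛ k a).index, θ ((ℛ k a).right i) * Q ((ℛ k a).left i))
    (hN : ∀ a b, N a * θ b = θ b * N a) (a : A) :
    conv N Q a * K = ∑ i ∈ (ℛ k a).index, θ ((ℛ k a).right i) * conv N Q ((ℛ k a).left i) := by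
  let F : A ⊗[k] (A ⊗[k] A) →ₗ[k] R := LinearMap.mul' k R ∘ₗ
    (TensorProduct.comm k R R).toLinearMap ∘ₗ
    TensorProduct.map (LinearMap.mul' k R ∘ₗ TensorProduct.map N Q) θ ∘ₗ
      (TensorProduct.assoc k A A A).symm.toLinearMap
  have h := tri_coassoc F a
  simp only [F, LinearMap.comp_apply, LinearEquiv.coe_coe, TensorProduct.assoc_symm_tmul,
    TensorProduct.map_tmul, TensorProduct.comm_tmul, LinearMap.mul'_apply] at h
  simp only [conv_apply, Finset.mul_sum, Finset.sum_mul]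
  rw [h]
  refine Finset.sum_congr rfl fun i _ => ?_
  rw [mul_assoc, hQ, Finset.mul_sum]
  refine Finset.sum_congr rfl fun j _ => ?_
  rw [← mul_assoc, hN, mul_assoc]

variable (k A) in
/-- the operators of left multiplication in `X` -/
noncomputable def regular : ExchangeRep k A (Module.End k (XAlg k A)) where
  lam := op₁ k A ∘ₗ (dualMul k A).flip
  kap := op₂ k A ∘ₗ dualMul k A
  al := leftAl k A
  be := leftBe k A
  lam_one := hom_ext fun l l' a b => by
    simp [op₁_apply, dualMul_counit]
  kap_one := hom_ext fun l l' a b => by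
    simp [op₂_apply, counit_dualMul]
  al_one := by
    refine conv_one _ _ ?_ (conv_one _ _ ?_ ?_) <;> refine hom_ext fun l l' a b => ?_ <;>
      simp [op₁_apply, op₂_apply, op₃_apply, antipodeInv_one, transL_one]
  be_one := by
    refine conv_one _ _ ?_ (conv_one _ _ ?_ ?_) <;> refine hom_ext fun l l' a b => ?_ <;>
      simp [op₁_apply, op₂_apply, op₄_apply, antipodeInv_one, transR_one]
  lam_mul l l' := hom_ext fun m m' a b => by
    simp [op₁_apply, dualMul_assoc]
  kap_mul l l' := hom_ext fun m m' a b => by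
    simp [op₂_apply, dualMul_assoc]
  al_mul a a' := by
    symm
    refine conv_mul _ _ ?_ (conv_mul _ _ ?_ ?_ ?_) ?_ _ _
    · intro a b
      simp [op₁_apply, op_mul, transL_mul, antipode_mul_antidistrib]
    · intro a b
      simp only [LinearMap.comp_apply, op₃_apply, op_mul, mul_one]
      congr 1
      ext; simp [mul_assoc]
    · intro a b
      simp [op₂_apply, op_mul, transL_mul, antipodeInv_mul]
    · intro a b
      simp [op₃_apply, op₂_apply, op_mul]
    · intro a b
      refine commute_conv _ _ _ ?_ ?_ _ <;> intro c <;>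
        simp [op₁_apply, op₂_apply, op₃_apply, op_mul]
  be_mul b b' := by
    symm
    refine conv_mul_anti _ _ ?_ (conv_mul_anti _ _ ?_ ?_ ?_) ?_ _ _
    · intro a b
      simp [op₁_apply, op_mul, transR_mul, antipodeInv_mul]
    · intro a b
      simp only [LinearMap.comp_apply, op₄_apply, op_mul, mul_one]
      congr 1
      ext; simp [mul_assoc]
    · intro a b
      simp [op₂_apply, op_mul, transR_mul, antipode_mul_antidistrib]
    · intro a b
      simp [op₄_apply, op₂_apply, op_mul]
    · intro a b
      refine commute_conv _ _ _ ?_ ?_ _ <;> intro c <;>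
        simp [op₁_apply, op₂_apply, op₄_apply, op_mul]
  lam_kap l l' := by simp [op₁_apply, op₂_apply, op_mul]
  al_be a b := by
    have hc : ∀ x y : A, transR k A x * transL k A y = transL k A y * transR k A x := by
      intro x y; ext; simp [mul_assoc]
    have hc' : ∀ x y : A, (LinearMap.mul k A).flip x * LinearMap.mul k A y =
        LinearMap.mul k A y * (LinearMap.mul k A).flip x := by
      intro x y; ext; simp [mul_assoc]
    refine commute_conv _ _ _ (fun b => ?_) (fun b => commute_conv _ _ _ (fun b => ?_)
      (fun b => ?_) _) _ <;> symm <;>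
    refine commute_conv _ _ _ (fun a => ?_) (fun a => commute_conv _ _ _ (fun a => ?_)
      (fun a => ?_) _) _ <;> simp [op₁_apply, op₂_apply, op₃_apply, op₄_apply, op_mul, hc]
  al_lam a l := by
    refine conv_fwd _ _ (op₁ k A ∘ₗ (dualMul k A).flip ∘ₗ
      LinearMap.applyₗ (R := k) l ∘ₗ transL k A ∘ₗ antipode k) _ (fun a => ?_) (fun a => ?_) a
    · refine hom_ext fun m m' a' b' => ?_
      simp [op₁_apply, transL_dualMul (reprAntipode a), reprAntipode, tm_sum₁]
    · refine commute_conv _ _ _ ?_ ?_ _ <;> intro c <;>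
        simp [op₁_apply, op₂_apply, op₃_apply, op_mul]
  al_kap a l := by
    rw [leftAl, ← conv_assoc]
    refine conv_rev _ _ (op₂ k A ∘ₗ dualMul k A ∘ₗ
      LinearMap.applyₗ (R := k) l ∘ₗ transL k A ∘ₗ antipodeInv k A) _ (fun a => ?_) (fun a b => ?_) a
    · refine hom_ext fun m m' a' b' => ?_
      simp [op₂_apply, transL_dualMul (reprAntipodeInv a), reprAntipodeInv, tm_sum₂]
    · refine commute_conv _ _ _ ?_ ?_ _ <;> intro c <;>
        simp [op₁_apply, op₂_apply, op₃_apply, op_mul]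
  be_lam b l := by
    refine conv_fwd _ _ (op₁ k A ∘ₗ (dualMul k A).flip ∘ₗ
      LinearMap.applyₗ (R := k) l ∘ₗ transR k A ∘ₗ antipodeInv k A) _ (fun a => ?_) (fun a => ?_) b
    · refine hom_ext fun m m' a' b' => ?_
      simp [op₁_apply, transR_dualMul (reprAntipodeInv a), reprAntipodeInv, tm_sum₁]
    · refine commute_conv _ _ _ ?_ ?_ _ <;> intro c <;>
        simp [op₁_apply, op₂_apply, op₄_apply, op_mul]
  be_kap b l := by
    rw [leftBe, ← conv_assoc]
    refine conv_rev _ _ (op₂ k A ∘ₗ dualMul k A ∘ₗ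
      LinearMap.applyₗ (R := k) l ∘ₗ transR k A ∘ₗ antipode k) _ (fun a => ?_) (fun a b => ?_) b
    · refine hom_ext fun m m' a' b' => ?_
      simp [op₂_apply, transR_dualMul (reprAntipode a), reprAntipode, tm_sum₂]
    · refine commute_conv _ _ _ ?_ ?_ _ <;> intro c <;>
        simp [op₁_apply, op₂_apply, op₄_apply, op_mul]

end XAlg

namespace XAlg

/-- The multiplication of `X`; `tm_mul_tm` below gives it on elementary tensors. -/
noncomputable instance : Mul (XAlg k A) := ⟨fun x y => (regular k A).toFun x y⟩

noncomputable instance : One (XAlg k A) := ⟨tm counit counit 1 1⟩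

theorem mul_def (x y : XAlg k A) : x * y = (regular k A).toFun x y := rfl

theorem one_def : (1 : XAlg k A) = tm counit counit 1 1 := rfl

/-- The multiplication of `X`:
`[(l ⊗ l') ⊗ (a ⊗ b)] [(m ⊗ m') ⊗ (c ⊗ d)]` is the sum of the elements
`(m(S(a⁽¹⁾) · S⁻¹(b⁽¹⁾)) * l) ⊗ (l' * m'(S⁻¹(a⁽³⁾) · S(b⁽³⁾))) ⊗ (a⁽²⁾ c ⊗ d b⁽²⁾)`. In particular
the tensorands `A^{*op}`, `A^*`, `A` and `A^{op}` keep their natural multiplications, and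
`[(ε ⊗ ε) ⊗ (a ⊗ b)] [(m ⊗ m') ⊗ (1 ⊗ 1)]` is
`∑ (m(S(a⁽¹⁾) · S⁻¹(b⁽¹⁾)) ⊗ m'(S⁻¹(a⁽³⁾) · S(b⁽³⁾))) ⊗ (a⁽²⁾ ⊗ b⁽²⁾)`. -/
theorem tm_mul_tm (l l' m m' : Module.Dual k A) (a b c d : A) :
    tm l l' a b * tm m m' c d =
      ∑ i ∈ (ℛ k a).index, ∑ i' ∈ (ℛ k ((ℛ k a).right i)).index,
      ∑ j ∈ (ℛ k b).index, ∑ j' ∈ (ℛ k ((ℛ k b).right j)).index,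
        tm (dualMul k A (transL k A (antipode k ((ℛ k a).left i))
              (transR k A (antipodeInv k A ((ℛ k b).left j)) m)) l)
          (dualMul k A l' (transL k A (antipodeInv k A ((ℛ k ((ℛ k a).right i)).right i'))
            (transR k A (antipode k ((ℛ k ((ℛ k b).right j)).right j')) m')))
          ((ℛ k ((ℛ k a).right i)).left i' * c)
          (d * (ℛ k ((ℛ k b).right j)).left j') := by
  rw [mul_def, ExchangeRep.toFun_tm]
  simp only [regular, Module.End.mul_apply, leftBe_tm, map_sum, leftAl_tm, LinearMap.comp_apply,
    op₂_apply, op₁_apply, op_tm, LinearMap.flip_apply, Module.End.one_apply]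
  conv_lhs =>
    enter [2, j]
    rw [Finset.sum_comm]
    enter [2, i]
    rw [Finset.sum_comm]
  rw [Finset.sum_comm]
  refine Finset.sum_congr rfl fun i _ => ?_
  conv_rhs => rw [Finset.sum_comm]

theorem counit_antipodeInv (a : A) : counit (R := k) (antipodeInv k A a) = counit a := by
  conv_rhs => rw [← antipode_antipodeInv (k := k) a, counit_antipode]

theorem transL_counit (x : A) : transL k A x counit = counit (R := k) x • counit := by
  ext; simp

theorem transR_counit (x : A) : transR k A x counit = counit (R := k) x • counit := by
  ext; simp [mul_comm]

theorem sum_counit_counit (f : A →ₗ[k] XAlg k A) (a : A) :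
    ∑ i ∈ (ℛ k a).index, ∑ j ∈ (ℛ k ((ℛ k a).right i)).index,
      counit (R := k) ((ℛ k a).left i) • counit (R := k) ((ℛ k ((ℛ k a).right i)).right j) •
        f ((ℛ k ((ℛ k a).right i)).left j) = f a := by
  simp only [← map_smul, ← Finset.smul_sum, ← map_sum, sum_counit_smul', sum_counit_smul]

theorem tm_smul (c d : k) (l l' : Module.Dual k A) (a b : A) :
    tm (c • l) (d • l') a b = c • d • tm l l' a b := by
  have h : ((c • l) ⊗ₜ[k] (d • l')) ⊗ₜ[k] (a ⊗ₜ[k] b) =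
      c • d • ((l ⊗ₜ[k] l') ⊗ₜ[k] (a ⊗ₜ[k] b)) := by
    rw [TensorProduct.smul_tmul_smul, ← TensorProduct.smul_tmul', mul_smul]
  exact h

theorem leftAl_one (a b : A) : leftAl k A a (tm counit counit 1 b) = tm counit counit a b := by
  rw [leftAl_tm]
  simp only [transL_counit, counit_antipode, counit_antipodeInv, mul_one, tm_smul]
  exact sum_counit_counit
    (TensorProduct.mk k _ _ (counit ⊗ₜ counit) ∘ₗ (TensorProduct.mk k A A).flip b) a

theorem leftBe_one (b : A) : leftBe k A b (tm counit counit 1 1) = tm counit counit 1 b := by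
  rw [leftBe_tm]
  simp only [transR_counit, counit_antipode, counit_antipodeInv, one_mul, tm_smul]
  exact sum_counit_counit
    (TensorProduct.mk k _ _ (counit ⊗ₜ counit) ∘ₗ (TensorProduct.mk k A A) 1) b

end XAlg

theorem ExchangeRep.toFun_mul {R : Type u} [Ring R] [Algebra k R] (ρ : ExchangeRep k A R)
    (x y : XAlg k A) : ρ.toFun (x * y) = ρ.toFun x * ρ.toFun y := by
  rw [XAlg.mul_def]
  suffices h : ρ.toFun ∘ₗ LinearMap.applyₗ (R := k) y ∘ₗ (XAlg.regular k A).toFun =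
      LinearMap.mulRight k (ρ.toFun y) ∘ₗ ρ.toFun from LinearMap.congr_fun h x
  refine XAlg.hom_ext fun l l' a b => ?_
  change ρ.toFun ((XAlg.regular k A).toFun (XAlg.tm l l' a b) y) =
    ρ.toFun (XAlg.tm l l' a b) * ρ.toFun y
  rw [toFun_tm, toFun_tm]
  change ρ.toFun (XAlg.op₁ k A _ (XAlg.op₂ k A _ (XAlg.leftAl k A _ (XAlg.leftBe k A _ y)))) = _
  rw [toFun_lam, toFun_kap, toFun_al, toFun_be]
  simp only [mul_assoc]

theorem ExchangeRep.toFun_one {R : Type u} [Ring R] [Algebra k R] (ρ : ExchangeRep k A R) :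
    ρ.toFun 1 = 1 := by
  rw [XAlg.one_def, toFun_tm, ρ.lam_one, ρ.kap_one, ρ.al_one, ρ.be_one]
  simp

noncomputable instance : Ring (XAlg k A) where
  __ := (inferInstance : AddCommGroup (XAlg k A))
  __ := (inferInstance : Mul (XAlg k A))
  __ := (inferInstance : One (XAlg k A))
  mul_assoc x y z := by
    change (XAlg.regular k A).toFun (x * y) z = _
    rw [ExchangeRep.toFun_mul]; rfl
  one_mul x := by
    change (XAlg.regular k A).toFun 1 x = x
    rw [ExchangeRep.toFun_one]; rfl
  mul_one x := by
    suffices h : LinearMap.applyₗ (R := k) (1 : XAlg k A) ∘ₗ (XAlg.regular k A).toFun =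
      LinearMap.id from LinearMap.congr_fun h x
    refine XAlg.hom_ext fun l l' a b => ?_
    change XAlg.op₁ k A _ (XAlg.op₂ k A _ (XAlg.leftAl k A _ (XAlg.leftBe k A _ _))) = _
    rw [XAlg.one_def, XAlg.leftBe_one, XAlg.leftAl_one]
    simp [XAlg.op₁_apply, XAlg.op₂_apply, XAlg.counit_dualMul, XAlg.dualMul_counit]
  left_distrib x y z := map_add ((XAlg.regular k A).toFun x) y z
  right_distrib x y z := by
    change (XAlg.regular k A).toFun (x + y) z = _
    rw [map_add]; rfl
  zero_mul x := by
    change (XAlg.regular k A).toFun 0 x = _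
    rw [map_zero]; rfl
  mul_zero x := map_zero ((XAlg.regular k A).toFun x)

noncomputable instance : Algebra k (XAlg k A) :=
  Algebra.ofModule
    (fun c x y => by
      change (XAlg.regular k A).toFun (c • x) y = _
      rw [map_smul]; rfl)
    (fun c x y => map_smul ((XAlg.regular k A).toFun x) c y)

/-- the morphism of algebras from `X` given by an exchange representation -/
noncomputable def ExchangeRep.toAlgHom {R : Type u} [Ring R] [Algebra k R]
    (ρ : ExchangeRep k A R) : XAlg k A →ₐ[k] R :=
  AlgHom.ofLinearMap ρ.toFun ρ.toFun_one ρ.toFun_mul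

end AlgebraX


section HopfBimodules

/-- The diagonal action `a ↦ (v ⊗ w ↦ ∑ a⁽¹⁾v ⊗ a⁽²⁾w)`. -/
noncomputable def diag {V W : Type u} [AddCommGroup V] [Module k V] [AddCommGroup W] [Module k W]
    (ρ : A →ₗ[k] Module.End k V) (σ : A →ₗ[k] Module.End k W) : A →ₗ[k] Module.End k (V ⊗[k] W) :=
  TensorProduct.homTensorHomMap (RingHom.id k) V W V W ∘ₗ TensorProduct.map ρ σ ∘ₗ comul

theorem diag_apply {V W : Type u} [AddCommGroup V] [Module k V] [AddCommGroup W] [Module k W]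
    (ρ : A →ₗ[k] Module.End k V) (σ : A →ₗ[k] Module.End k W) (a : A) :
    diag ρ σ a = ∑ i ∈ (ℛ k a).index,
      TensorProduct.map (ρ ((ℛ k a).left i)) (σ ((ℛ k a).right i)) := by
  simp only [diag, LinearMap.comp_apply]
  conv_lhs => rw [← (ℛ k a).eq]
  simp

variable (k A) in
/-- A Hopf bimodule over `A`: an `A`-bimodule and `A`-bicomodule such that both coactions are
morphisms of bimodules, `A ⊗ M` and `M ⊗ A` carrying the diagonal actions. -/
structure HopfBimod where
  carrier : Type u
  [addCommGroup : AddCommGroup carrier]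
  [module : Module k carrier]
  /-- the left action `a ↦ (m ↦ a m)` -/
  lact : A →ₗ[k] Module.End k carrier
  /-- the right action `a ↦ (m ↦ m a)` -/
  ract : A →ₗ[k] Module.End k carrier
  /-- the left coaction -/
  lco : carrier →ₗ[k] A ⊗[k] carrier
  /-- the right coaction -/
  rco : carrier →ₗ[k] carrier ⊗[k] A
  one_lact : lact 1 = 1
  mul_lact : ∀ a b, lact (a * b) = lact a * lact b
  one_ract : ract 1 = 1
  mul_ract : ∀ a b, ract (a * b) = ract b * ract a
  lact_ract : ∀ a b, lact a * ract b = ract b * lact a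
  lco_coassoc : (TensorProduct.assoc k A A carrier).toLinearMap ∘ₗ comul.rTensor carrier ∘ₗ lco =
    lco.lTensor A ∘ₗ lco
  lco_counit : (TensorProduct.lid k carrier).toLinearMap ∘ₗ counit.rTensor carrier ∘ₗ lco =
    LinearMap.id
  rco_coassoc : (TensorProduct.assoc k carrier A A).toLinearMap ∘ₗ rco.rTensor A ∘ₗ rco =
    comul.lTensor carrier ∘ₗ rco
  rco_counit : (TensorProduct.rid k carrier).toLinearMap ∘ₗ counit.lTensor carrier ∘ₗ rco =
    LinearMap.id
  lco_rco : (TensorProduct.assoc k A carrier A).toLinearMap ∘ₗ lco.rTensor A ∘ₗ rco =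
    rco.lTensor A ∘ₗ lco
  lco_lact : ∀ a, lco ∘ₗ lact a = diag (LinearMap.mul k A) lact a ∘ₗ lco
  lco_ract : ∀ a, lco ∘ₗ ract a = diag (LinearMap.mul k A).flip ract a ∘ₗ lco
  rco_lact : ∀ a, rco ∘ₗ lact a = diag lact (LinearMap.mul k A) a ∘ₗ rco
  rco_ract : ∀ a, rco ∘ₗ ract a = diag ract (LinearMap.mul k A).flip a ∘ₗ rco

attribute [instance] HopfBimod.addCommGroup HopfBimod.module

variable [FiniteDimensional k A]

theorem al_lam_of {R : Type u} [Ring R] [Algebra k R] (lam : Module.Dual k A →ₗ[k] R)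
    (al : A →ₗ[k] R)
    (h : ∀ a l, lam l * al a = ∑ i ∈ (ℛ k a).index,
      al ((ℛ k a).right i) * lam (transL k A ((ℛ k a).left i) l)) (a : A) (l : Module.Dual k A) :
    al a * lam l = ∑ i ∈ (ℛ k a).index,
      lam (transL k A (antipode k ((ℛ k a).left i)) l) * al ((ℛ k a).right i) := by
  let F : A ⊗[k] (A ⊗[k] A) →ₗ[k] R := LinearMap.mul' k R ∘ₗ
    (TensorProduct.comm k R R).toLinearMap ∘ₗ
    TensorProduct.map (lam ∘ₗ LinearMap.applyₗ (R := k) l ∘ₗ transL k A ∘ₗ LinearMap.mul' k A ∘ₗ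
      (antipode k).rTensor A) al ∘ₗ
      (TensorProduct.assoc k A A A).symm.toLinearMap
  have hF := tri_coassoc F a
  simp only [F, LinearMap.comp_apply, LinearEquiv.coe_coe, TensorProduct.assoc_symm_tmul,
    TensorProduct.map_tmul, TensorProduct.comm_tmul, LinearMap.mul'_apply,
    LinearMap.rTensor_tmul, LinearMap.applyₗ_apply_apply] at hF
  simp only [h, ← Module.End.mul_apply, XAlg.transL_mul]
  rw [← hF]
  simp only [← Finset.mul_sum, ← map_sum, ← LinearMap.sum_apply,
    sum_antipode_mul_eq_algebraMap_counit]
  simp only [Algebra.algebraMap_eq_smul_one, map_smul, XAlg.transL_one, LinearMap.smul_apply,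
    Module.End.one_apply, mul_smul_comm, ← smul_mul_assoc, ← Finset.sum_mul]
  simp only [← map_smul, ← map_sum, sum_counit_smul]

theorem al_kap_of {R : Type u} [Ring R] [Algebra k R] (kap : Module.Dual k A →ₗ[k] R)
    (al : A →ₗ[k] R)
    (h : ∀ a l, kap l * al a = ∑ i ∈ (ℛ k a).index,
      al ((ℛ k a).left i) * kap (transL k A ((ℛ k a).right i) l)) (a : A) (l : Module.Dual k A) :
    al a * kap l = ∑ i ∈ (ℛ k a).index,
      kap (transL k A (antipodeInv k A ((ℛ k a).right i)) l) * al ((ℛ k a).left i) := by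
  let F : A ⊗[k] (A ⊗[k] A) →ₗ[k] R := LinearMap.mul' k R ∘ₗ
    TensorProduct.map al (kap ∘ₗ LinearMap.applyₗ (R := k) l ∘ₗ transL k A ∘ₗ LinearMap.mul' k A ∘ₗ
      (TensorProduct.comm k A A).toLinearMap ∘ₗ (antipodeInv k A).lTensor A)
  have hF := tri_coassoc F a
  simp only [F, LinearMap.comp_apply, LinearEquiv.coe_coe,
    TensorProduct.map_tmul, TensorProduct.comm_tmul, LinearMap.mul'_apply,
    LinearMap.lTensor_tmul, LinearMap.applyₗ_apply_apply] at hF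
  simp only [h, ← Module.End.mul_apply, XAlg.transL_mul]
  rw [hF]
  simp only [← Finset.mul_sum, ← map_sum, ← LinearMap.sum_apply,
    sum_antipodeInv_mul]
  simp only [Algebra.algebraMap_eq_smul_one, map_smul, XAlg.transL_one, LinearMap.smul_apply,
    Module.End.one_apply, mul_smul_comm, ← smul_mul_assoc, ← Finset.sum_mul]
  simp only [← map_smul, ← map_sum, sum_counit_smul']

theorem be_lam_of {R : Type u} [Ring R] [Algebra k R] (lam : Module.Dual k A →ₗ[k] R)
    (be : A →ₗ[k] R)
    (h : ∀ a l, lam l * be a = ∑ i ∈ (ℛ k a).index,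
      be ((ℛ k a).right i) * lam (transR k A ((ℛ k a).left i) l)) (a : A) (l : Module.Dual k A) :
    be a * lam l = ∑ i ∈ (ℛ k a).index,
      lam (transR k A (antipodeInv k A ((ℛ k a).left i)) l) * be ((ℛ k a).right i) := by
  let F : A ⊗[k] (A ⊗[k] A) →ₗ[k] R := LinearMap.mul' k R ∘ₗ
    (TensorProduct.comm k R R).toLinearMap ∘ₗ
    TensorProduct.map (lam ∘ₗ LinearMap.applyₗ (R := k) l ∘ₗ transR k A ∘ₗ LinearMap.mul' k A ∘ₗ
      (TensorProduct.comm k A A).toLinearMap ∘ₗ (antipodeInv k A).rTensor A) be ∘ₗ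
      (TensorProduct.assoc k A A A).symm.toLinearMap
  have hF := tri_coassoc F a
  simp only [F, LinearMap.comp_apply, LinearEquiv.coe_coe, TensorProduct.assoc_symm_tmul,
    TensorProduct.map_tmul, TensorProduct.comm_tmul, LinearMap.mul'_apply,
    LinearMap.rTensor_tmul, LinearMap.applyₗ_apply_apply] at hF
  simp only [h, ← Module.End.mul_apply, XAlg.transR_mul]
  rw [← hF]
  simp only [← Finset.mul_sum, ← map_sum, ← LinearMap.sum_apply,
    sum_mul_antipodeInv]
  simp only [Algebra.algebraMap_eq_smul_one, map_smul, XAlg.transR_one, LinearMap.smul_apply,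
    Module.End.one_apply, mul_smul_comm, ← smul_mul_assoc, ← Finset.sum_mul]
  simp only [← map_smul, ← map_sum, sum_counit_smul]

theorem be_kap_of {R : Type u} [Ring R] [Algebra k R] (kap : Module.Dual k A →ₗ[k] R)
    (be : A →ₗ[k] R)
    (h : ∀ a l, kap l * be a = ∑ i ∈ (ℛ k a).index,
      be ((ℛ k a).left i) * kap (transR k A ((ℛ k a).right i) l)) (a : A) (l : Module.Dual k A) :
    be a * kap l = ∑ i ∈ (ℛ k a).index,
      kap (transR k A (antipode k ((ℛ k a).right i)) l) * be ((ℛ k a).left i) := by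
  let F : A ⊗[k] (A ⊗[k] A) →ₗ[k] R := LinearMap.mul' k R ∘ₗ
    TensorProduct.map be (kap ∘ₗ LinearMap.applyₗ (R := k) l ∘ₗ transR k A ∘ₗ LinearMap.mul' k A ∘ₗ
      (antipode k).lTensor A)
  have hF := tri_coassoc F a
  simp only [F, LinearMap.comp_apply,
    TensorProduct.map_tmul, LinearMap.mul'_apply,
    LinearMap.lTensor_tmul, LinearMap.applyₗ_apply_apply] at hF
  simp only [h, ← Module.End.mul_apply, XAlg.transR_mul]
  rw [hF]
  simp only [← Finset.mul_sum, ← map_sum, ← LinearMap.sum_apply,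
    sum_mul_antipode_eq_algebraMap_counit]
  simp only [Algebra.algebraMap_eq_smul_one, map_smul, XAlg.transR_one, LinearMap.smul_apply,
    Module.End.one_apply, mul_smul_comm, ← smul_mul_assoc, ← Finset.sum_mul]
  simp only [← map_smul, ← map_sum, sum_counit_smul']

namespace HopfBimod

variable (M : HopfBimod k A)

/-- `l ↦ (m ↦ ∑ l(m₍₋₁₎) m₍₀₎)` -/
noncomputable def lhit : Module.Dual k A →ₗ[k] Module.End k M.carrier where
  toFun l := TensorProduct.lid k M.carrier ∘ₗ l.rTensor M.carrier ∘ₗ M.lco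
  map_add' l l' := by simp only [LinearMap.rTensor_add, LinearMap.add_comp, LinearMap.comp_add]
  map_smul' c l := by
    simp only [LinearMap.rTensor_smul, LinearMap.smul_comp, LinearMap.comp_smul, RingHom.id_apply]

/-- `l ↦ (m ↦ ∑ l(m₍₁₎) m₍₀₎)` -/
noncomputable def rhit : Module.Dual k A →ₗ[k] Module.End k M.carrier where
  toFun l := TensorProduct.rid k M.carrier ∘ₗ l.lTensor M.carrier ∘ₗ M.rco
  map_add' l l' := by simp only [LinearMap.lTensor_add, LinearMap.add_comp, LinearMap.comp_add]
  map_smul' c l := by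
    simp only [LinearMap.lTensor_smul, LinearMap.smul_comp, LinearMap.comp_smul, RingHom.id_apply]

theorem lhit_apply (l : Module.Dual k A) (m : M.carrier) :
    M.lhit l m = TensorProduct.lid k M.carrier (l.rTensor M.carrier (M.lco m)) := rfl

theorem rhit_apply (l : Module.Dual k A) (m : M.carrier) :
    M.rhit l m = TensorProduct.rid k M.carrier (l.lTensor M.carrier (M.rco m)) := rfl

theorem lhit_mul (l l' : Module.Dual k A) :
    M.lhit l * M.lhit l' = M.lhit (dualMul k A l' l) := by
  have h1 : ∀ t : A ⊗[k] M.carrier, M.lhit l (TensorProduct.lid k _ (l'.rTensor _ t)) =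
      TensorProduct.lid k _ (l'.rTensor _ (LinearMap.lTensor A
        (TensorProduct.lid k M.carrier ∘ₗ l.rTensor M.carrier) (M.lco.lTensor A t))) := by
    intro t
    induction t with
    | zero => simp
    | add x y hx hy => simp only [map_add, hx, hy]
    | tmul a m => simp [lhit_apply]
  have h2 : ∀ t : A ⊗[k] M.carrier, TensorProduct.lid k _ (l'.rTensor _ (LinearMap.lTensor A
        (TensorProduct.lid k M.carrier ∘ₗ l.rTensor M.carrier)
        (TensorProduct.assoc k A A M.carrier (comul.rTensor M.carrier t)))) =
      TensorProduct.lid k _ ((dualMul k A l' l).rTensor _ t) := by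
    intro t
    induction t with
    | zero => simp
    | add x y hx hy => simp only [map_add, hx, hy]
    | tmul a m =>
      rw [LinearMap.rTensor_tmul, ← (ℛ k a).eq]
      simp [TensorProduct.sum_tmul, dualMul_apply, smul_smul, mul_comm]
  ext m
  rw [Module.End.mul_apply, lhit_apply M l', h1, lhit_apply, ← h2]
  congr 3
  exact (LinearMap.congr_fun M.lco_coassoc m).symm

theorem rhit_mul (l l' : Module.Dual k A) :
    M.rhit l * M.rhit l' = M.rhit (dualMul k A l l') := by
  have h1 : ∀ t : M.carrier ⊗[k] A, M.rhit l (TensorProduct.rid k _ (l'.lTensor _ t)) =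
      TensorProduct.rid k _ (l.lTensor _ (LinearMap.lTensor M.carrier
        (TensorProduct.rid k A ∘ₗ l'.lTensor A)
          (TensorProduct.assoc k _ _ _ (M.rco.rTensor A t)))) := by
    intro t
    induction t with
    | zero => simp
    | add x y hx hy => simp only [map_add, hx, hy]
    | tmul m a =>
      rw [LinearMap.lTensor_tmul, LinearMap.rTensor_tmul, TensorProduct.rid_tmul, map_smul,
        rhit_apply]
      induction M.rco m with
      | zero => simp
      | add x y hx hy => simp only [map_add, smul_add, TensorProduct.add_tmul, hx, hy]
      | tmul m a' => simp [smul_smul, mul_comm]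
  have h2 : ∀ t : M.carrier ⊗[k] A, TensorProduct.rid k _ (l.lTensor _
        (LinearMap.lTensor M.carrier (TensorProduct.rid k A ∘ₗ l'.lTensor A)
          (comul.lTensor M.carrier t))) =
      TensorProduct.rid k _ ((dualMul k A l l').lTensor _ t) := by
    intro t
    induction t with
    | zero => simp
    | add x y hx hy => simp only [map_add, hx, hy]
    | tmul m a =>
      rw [LinearMap.lTensor_tmul, ← (ℛ k a).eq]
      simp [TensorProduct.tmul_sum, dualMul_apply, smul_smul, mul_comm]
  ext m
  rw [Module.End.mul_apply, rhit_apply M l', h1, rhit_apply, ← h2]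
  congr 3
  exact LinearMap.congr_fun M.rco_coassoc m

theorem lhit_rhit (l l' : Module.Dual k A) :
    M.rhit l' * M.lhit l = M.lhit l * M.rhit l' := by
  have h1 : ∀ t : A ⊗[k] M.carrier, M.rhit l' (TensorProduct.lid k _ (l.rTensor _ t)) =
      TensorProduct.lid k _ (l.rTensor _ (LinearMap.lTensor A
        (TensorProduct.rid k M.carrier ∘ₗ l'.lTensor M.carrier) (M.rco.lTensor A t))) := by
    intro t
    induction t with
    | zero => simp
    | add x y hx hy => simp only [map_add, hx, hy]
    | tmul a m => simp [rhit_apply]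
  have h2 : ∀ t : M.carrier ⊗[k] A, M.lhit l (TensorProduct.rid k _ (l'.lTensor _ t)) =
      TensorProduct.lid k _ (l.rTensor _ (LinearMap.lTensor A
        (TensorProduct.rid k M.carrier ∘ₗ l'.lTensor M.carrier)
          (TensorProduct.assoc k _ _ _ (M.lco.rTensor A t)))) := by
    intro t
    induction t with
    | zero => simp
    | add x y hx hy => simp only [map_add, hx, hy]
    | tmul m a =>
      rw [LinearMap.lTensor_tmul, LinearMap.rTensor_tmul, TensorProduct.rid_tmul, map_smul,
        lhit_apply]
      induction M.lco m with
      | zero => simp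
      | add x y hx hy => simp only [map_add, smul_add, TensorProduct.add_tmul, hx, hy]
      | tmul m a' => simp [smul_smul, mul_comm]
  ext m
  rw [Module.End.mul_apply, Module.End.mul_apply, lhit_apply M l, h1, rhit_apply M l', h2]
  congr 3
  exact (LinearMap.congr_fun M.lco_rco m).symm

theorem lhit_lact (a : A) (l : Module.Dual k A) : M.lhit l * M.lact a =
    ∑ i ∈ (ℛ k a).index, M.lact ((ℛ k a).right i) * M.lhit (transL k A ((ℛ k a).left i) l) := by
  ext m
  rw [Module.End.mul_apply, lhit_apply, ← LinearMap.comp_apply M.lco, M.lco_lact, diag_apply,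
    LinearMap.comp_apply, LinearMap.sum_apply, LinearMap.sum_apply, map_sum, map_sum]
  refine Finset.sum_congr rfl fun i _ => ?_
  rw [Module.End.mul_apply, lhit_apply]
  induction M.lco m with
  | zero => simp
  | add x y hx hy => simp only [map_add, hx, hy]
  | tmul m a' => simp

theorem lhit_ract (a : A) (l : Module.Dual k A) : M.lhit l * M.ract a =
    ∑ i ∈ (ℛ k a).index, M.ract ((ℛ k a).right i) * M.lhit (transR k A ((ℛ k a).left i) l) := by
  ext m
  rw [Module.End.mul_apply, lhit_apply, ← LinearMap.comp_apply M.lco, M.lco_ract, diag_apply,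
    LinearMap.comp_apply, LinearMap.sum_apply, LinearMap.sum_apply, map_sum, map_sum]
  refine Finset.sum_congr rfl fun i _ => ?_
  rw [Module.End.mul_apply, lhit_apply]
  induction M.lco m with
  | zero => simp
  | add x y hx hy => simp only [map_add, hx, hy]
  | tmul m a' => simp

theorem rhit_lact (a : A) (l : Module.Dual k A) : M.rhit l * M.lact a =
    ∑ i ∈ (ℛ k a).index, M.lact ((ℛ k a).left i) * M.rhit (transL k A ((ℛ k a).right i) l) := by
  ext m
  rw [Module.End.mul_apply, rhit_apply, ← LinearMap.comp_apply M.rco, M.rco_lact, diag_apply,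
    LinearMap.comp_apply, LinearMap.sum_apply, LinearMap.sum_apply, map_sum, map_sum]
  refine Finset.sum_congr rfl fun i _ => ?_
  rw [Module.End.mul_apply, rhit_apply]
  induction M.rco m with
  | zero => simp
  | add x y hx hy => simp only [map_add, hx, hy]
  | tmul m a' => simp

theorem rhit_ract (a : A) (l : Module.Dual k A) : M.rhit l * M.ract a =
    ∑ i ∈ (ℛ k a).index, M.ract ((ℛ k a).left i) * M.rhit (transR k A ((ℛ k a).right i) l) := by
  ext m
  rw [Module.End.mul_apply, rhit_apply, ← LinearMap.comp_apply M.rco, M.rco_ract, diag_apply,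
    LinearMap.comp_apply, LinearMap.sum_apply, LinearMap.sum_apply, map_sum, map_sum]
  refine Finset.sum_congr rfl fun i _ => ?_
  rw [Module.End.mul_apply, rhit_apply]
  induction M.rco m with
  | zero => simp
  | add x y hx hy => simp only [map_add, hx, hy]
  | tmul m a' => simp

/-- The operators on `M` given by the elements of `A^{*op}`, `A^*`, `A` and `A^{op}`. -/
noncomputable def rep : ExchangeRep k A (Module.End k M.carrier) where
  lam := M.lhit
  kap := M.rhit
  al := M.lact
  be := M.ract
  lam_one := M.lco_counit
  kap_one := M.rco_counit
  al_one := M.one_lact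
  be_one := M.one_ract
  lam_mul := M.lhit_mul
  kap_mul := M.rhit_mul
  al_mul a b := (M.mul_lact a b).symm
  be_mul a b := (M.mul_ract b a).symm
  lam_kap := M.lhit_rhit
  al_be a b := (M.lact_ract a b).symm
  al_lam := al_lam_of _ _ M.lhit_lact
  al_kap := al_kap_of _ _ M.rhit_lact
  be_lam := be_lam_of _ _ M.lhit_ract
  be_kap := be_kap_of _ _ M.rhit_ract

/-- A Hopf bimodule is a left `X`-module, via
`[(l ⊗ l') ⊗ (a ⊗ b)] m = ∑ l(y₍₋₁₎) l'(y₍₁₎) y₍₀₎` with `y = a m b`. -/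
noncomputable instance : Module (XAlg k A) M.carrier :=
  Module.compHom M.carrier M.rep.toAlgHom.toRingHom

theorem tm_smul (l l' : Module.Dual k A) (a b : A) (m : M.carrier) :
    XAlg.tm l l' a b • m = M.lhit l (M.rhit l' (M.lact a (M.ract b m))) := rfl

theorem smul_def (x : XAlg k A) (m : M.carrier) : x • m = M.rep.toFun x m := rfl

end HopfBimod
end HopfBimodules

section Spaces

variable (A) in
/-- The space `V ⊗ A^{⊗ q}`, as `(⋯ (V ⊗ A) ⊗ ⋯) ⊗ A`. -/
noncomputable def barV (V : ModuleCat.{u} k) : ℕ → ModuleCat.{u} k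
  | 0 => V
  | q + 1 => ModuleCat.of k (barV V q ⊗[k] A)

variable (A) in
/-- The space `A^{⊗ p} ⊗ V`, as `A ⊗ (⋯ ⊗ (A ⊗ V) ⋯)`. -/
noncomputable def cobV (V : ModuleCat.{u} k) : ℕ → ModuleCat.{u} k
  | 0 => V
  | p + 1 => ModuleCat.of k (A ⊗[k] cobV V p)

/-- `1^{⊗ p} ⊗ φ : A^{⊗ p} ⊗ V → A^{⊗ p} ⊗ W` -/
noncomputable def cobMap {V W : ModuleCat.{u} k} (φ : V →ₗ[k] W) :
    ∀ p, cobV A V p →ₗ[k] cobV A W p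
  | 0 => φ
  | p + 1 => (cobMap φ p).lTensor A

/-- The identification of `A^{⊗ s} ⊗ (A^{⊗ r} ⊗ V)` with `A^{⊗ (r + s)} ⊗ V`. -/
noncomputable def cobAdd (V : ModuleCat.{u} k) (r : ℕ) :
    ∀ s, cobV A (cobV A V r) s →ₗ[k] cobV A V (r + s)
  | 0 => LinearMap.id
  | s + 1 => (cobAdd V r s).lTensor A

/-- The map `(A^{⊗ s} ⊗ V) ⊗ A → A^{⊗ s} ⊗ (V ⊗ A)`,
`(x ⊗ v) ⊗ a ↦ ∑ x Δ^{(s-1)}(a⁽¹⁾) ⊗ (v ⊗ a⁽²⁾)`; here `x Δ^{(s-1)}(b)` is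
`∑ x₁ b⁽¹⁾ ⊗ ⋯ ⊗ x_s b⁽ˢ⁾`, and the map is the identity for `s = 0`. -/
noncomputable def codiag (V : ModuleCat.{u} k) :
    ∀ s, cobV A V s ⊗[k] A →ₗ[k] cobV A (barV A V 1) s
  | 0 => LinearMap.id
  | s + 1 => TensorProduct.map (LinearMap.mul' k A) (codiag V s) ∘ₗ
      (TensorProduct.tensorTensorTensorComm k A (cobV A V s) A A).toLinearMap ∘ₗ
      (comul (R := k) (A := A)).lTensor (A ⊗[k] cobV A V s)

variable {V W : Type u} [AddCommGroup V] [Module k V] [AddCommGroup W] [Module k W]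

/-- `v ⊗ a ⊗ b ↦ d(v ⊗ a) ⊗ b + (-1)^(q+1) v ⊗ ab` -/
noncomputable def barStep (d : V ⊗[k] A →ₗ[k] V) (q : ℕ) : (V ⊗[k] A) ⊗[k] A →ₗ[k] V ⊗[k] A :=
  d.rTensor A + (-1 : k) ^ (q + 1) •
    ((LinearMap.mul' k A).lTensor V ∘ₗ (TensorProduct.assoc k V A A).toLinearMap)

/-- `a ⊗ w ↦ -∑ a⁽¹⁾ ⊗ a⁽²⁾ ⊗ w - a ⊗ e(w)` -/
noncomputable def cobarStep (e : W →ₗ[k] A ⊗[k] W) : A ⊗[k] W →ₗ[k] A ⊗[k] (A ⊗[k] W) :=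
  -((TensorProduct.assoc k A A W).toLinearMap ∘ₗ (comul (R := k) (A := A)).rTensor W) - e.lTensor A

/-- `α ↦ (v ⊗ a ↦ α(d(v ⊗ a)) + c α(v) a)`, where `w a = ρ a w` -/
noncomputable def homBar (d : V ⊗[k] A →ₗ[k] V) (ρ : A →ₗ[k] Module.End k W) (c : k) :
    (V →ₗ[k] W) →ₗ[k] (V ⊗[k] A →ₗ[k] W) where
  toFun α := α ∘ₗ d + c • TensorProduct.lift (ρ.flip ∘ₗ α)
  map_add' α β := by
    ext
    simp only [TensorProduct.AlgebraTensorModule.curry_apply, LinearMap.restrictScalars_self,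
      TensorProduct.curry_apply, LinearMap.add_apply, LinearMap.comp_apply, LinearMap.smul_apply,
      TensorProduct.lift.tmul, map_add, smul_add]
    abel
  map_smul' x α := by
    ext
    simp [smul_comm x c]

/-- `α ↦ (1 ⊗ α) ∘ δ + e ∘ α` -/
noncomputable def homCobar (δ : V →ₗ[k] A ⊗[k] V) (e : W →ₗ[k] A ⊗[k] W) :
    (V →ₗ[k] W) →ₗ[k] (V →ₗ[k] A ⊗[k] W) where
  toFun α := α.lTensor A ∘ₗ δ + e ∘ₗ α
  map_add' α β := by
    rw [LinearMap.lTensor_add, LinearMap.add_comp, LinearMap.comp_add]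
    abel
  map_smul' x α := by
    rw [LinearMap.lTensor_smul, LinearMap.smul_comp, LinearMap.comp_smul, smul_add, RingHom.id_apply]

end Spaces

namespace HopfBimod

variable (M N : HopfBimod k A)

/-- The space `M ⊗ A^{⊗ q}`. -/
noncomputable abbrev bar (q : ℕ) : ModuleCat.{u} k := barV A (ModuleCat.of k M.carrier) q

/-- The space `A^{⊗ p} ⊗ N`. -/
noncomputable abbrev cobar (p : ℕ) : ModuleCat.{u} k := cobV A (ModuleCat.of k N.carrier) p

/-- The left action on `M ⊗ A^{⊗ q}`: `b (m ⊗ a₁ ⊗ ⋯) = bm ⊗ a₁ ⊗ ⋯`. -/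
noncomputable def barLact : ∀ q, A →ₗ[k] Module.End k (M.bar q)
  | 0 => M.lact
  | q + 1 => LinearMap.rTensorHom A ∘ₗ barLact q

/-- The codiagonal left coaction on `M ⊗ A^{⊗ q}`:
`m ⊗ a₁ ⊗ ⋯ ↦ ∑ m₍₋₁₎ a₁⁽¹⁾ ⋯ a_q⁽¹⁾ ⊗ (m₍₀₎ ⊗ a₁⁽²⁾ ⊗ ⋯ ⊗ a_q⁽²⁾)`. -/
noncomputable def barLco : ∀ q, M.bar q →ₗ[k] A ⊗[k] M.bar q
  | 0 => M.lco
  | q + 1 => (LinearMap.mul' k A).rTensor (M.bar q ⊗[k] A) ∘ₗ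
      (TensorProduct.tensorTensorTensorComm k A (M.bar q) A A).toLinearMap ∘ₗ
      TensorProduct.map (barLco q) comul

/-- The codiagonal right coaction on `M ⊗ A^{⊗ q}`:
`m ⊗ a₁ ⊗ ⋯ ↦ ∑ (m₍₀₎ ⊗ a₁⁽¹⁾ ⊗ ⋯ ⊗ a_q⁽¹⁾) ⊗ m₍₁₎ a₁⁽²⁾ ⋯ a_q⁽²⁾`. -/
noncomputable def barRco : ∀ q, M.bar q →ₗ[k] M.bar q ⊗[k] A
  | 0 => M.rco
  | q + 1 => (LinearMap.mul' k A).lTensor (M.bar q ⊗[k] A) ∘ₗ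
      (TensorProduct.tensorTensorTensorComm k (M.bar q) A A A).toLinearMap ∘ₗ
      TensorProduct.map (barRco q) comul

/-- The map `M ⊗ A^{⊗ (q+1)} → M ⊗ A^{⊗ q}`,
`m ⊗ a₁ ⊗ ⋯ ↦ m a₁ ⊗ a₂ ⊗ ⋯ + ∑_{1 ≤ i ≤ q} (-1)^i m ⊗ ⋯ ⊗ aᵢ aᵢ₊₁ ⊗ ⋯`. -/
noncomputable def barD : ∀ q, M.bar q ⊗[k] A →ₗ[k] M.bar q
  | 0 => TensorProduct.lift M.ract.flip
  | q + 1 => barStep (barD q) q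

/-- The diagonal left action on `A^{⊗ p} ⊗ N`. -/
noncomputable def cobarLact : ∀ p, A →ₗ[k] Module.End k (N.cobar p)
  | 0 => N.lact
  | p + 1 => diag (LinearMap.mul k A) (cobarLact p)

/-- The diagonal right action on `A^{⊗ p} ⊗ N`. -/
noncomputable def cobarRact : ∀ p, A →ₗ[k] Module.End k (N.cobar p)
  | 0 => N.ract
  | p + 1 => diag (LinearMap.mul k A).flip (cobarRact p)

/-- The right coaction on `A^{⊗ p} ⊗ N`:
`a₁ ⊗ ⋯ ⊗ n ↦ ∑ (a₁ ⊗ ⋯ ⊗ n₍₀₎) ⊗ n₍₁₎`. -/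
noncomputable def cobarRco : ∀ p, N.cobar p →ₗ[k] N.cobar p ⊗[k] A
  | 0 => N.rco
  | p + 1 => (TensorProduct.assoc k A (N.cobar p) A).symm.toLinearMap ∘ₗ
      (cobarRco p).lTensor A

/-- The map `A^{⊗ p} ⊗ N → A^{⊗ (p+1)} ⊗ N`,
`∑_{1 ≤ i ≤ p} (-1)^i Δᵢ + (-1)^{p+1} 1^{⊗ p} ⊗ δ_L`, where `Δᵢ` is `Δ` applied to the `i`-th
factor `A`. -/
noncomputable def cobarD : ∀ p, N.cobar p →ₗ[k] A ⊗[k] N.cobar p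
  | 0 => -N.lco
  | p + 1 => cobarStep (cobarD p)

/-- `Hom_{A-}^{-A}(M ⊗ A^{⊗ q}, A^{⊗ p} ⊗ N)`: the linear maps that are left `A`-linear and right
`A`-colinear. -/
noncomputable def K (M N : HopfBimod k A) (q p : ℕ) : Submodule k (M.bar q →ₗ[k] N.cobar p) where
  carrier := {α | (∀ a, α ∘ₗ M.barLact q a = N.cobarLact p a ∘ₗ α) ∧
    N.cobarRco p ∘ₗ α = α.rTensor A ∘ₗ M.barRco q}
  zero_mem' := by simp
  add_mem' {α β} hα hβ := by
    refine ⟨fun a => ?_, ?_⟩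
    · rw [LinearMap.add_comp, LinearMap.comp_add, hα.1, hβ.1]
    · rw [LinearMap.rTensor_add, LinearMap.add_comp, LinearMap.comp_add, hα.2, hβ.2]
  smul_mem' c α hα := by
    refine ⟨fun a => ?_, ?_⟩
    · rw [LinearMap.smul_comp, LinearMap.comp_smul, hα.1]
    · rw [LinearMap.rTensor_smul, LinearMap.smul_comp, LinearMap.comp_smul, hα.2]

/-- The differential
`(d_h α)(m ⊗ a₁ ⊗ ⋯ ⊗ a_{q+1}) = α(m a₁ ⊗ ⋯) + ∑_{1 ≤ i ≤ q} (-1)^i α(m ⊗ ⋯ ⊗ aᵢ aᵢ₊₁ ⊗ ⋯)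
  + (-1)^{q+1} α(m ⊗ a₁ ⊗ ⋯ ⊗ a_q) a_{q+1}`. -/
noncomputable def dh (q p : ℕ) :
    (M.bar q →ₗ[k] N.cobar p) →ₗ[k] (M.bar (q + 1) →ₗ[k] N.cobar p) :=
  homBar (M.barD q) (N.cobarRact p) ((-1) ^ (q + 1))

/-- The differential
`d_c α = (-1)^q [(1 ⊗ α) δ_L + ∑_{1 ≤ i ≤ p} (-1)^i Δᵢ α + (-1)^{p+1} (1^{⊗ p} ⊗ δ_L) α]`. -/
noncomputable def dc (q p : ℕ) :
    (M.bar q →ₗ[k] N.cobar p) →ₗ[k] (M.bar q →ₗ[k] N.cobar (p + 1)) :=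
  (-1 : k) ^ q • homCobar (M.barLco q) (N.cobarD p)

variable {M N} in
/-- The map `M ⊗ A^{⊗ (a + b)} → A^{⊗ s} ⊗ (L ⊗ A^{⊗ b})`,
`(m ⊗ a₁ ⊗ ⋯ ⊗ a_a) ⊗ b₁ ⊗ ⋯ ⊗ b_b ↦
  ∑ f(m ⊗ a₁ ⊗ ⋯ ⊗ a_a) (Δ^{(s-1)}(b₁⁽¹⁾ ⋯ b_b⁽¹⁾) ⊗ 1) ⊗ b₁⁽²⁾ ⊗ ⋯ ⊗ b_b⁽²⁾`. -/
noncomputable def cupLeft {L : HopfBimod k A} {a s : ℕ} (f : M.bar a →ₗ[k] L.cobar s) :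
    ∀ b, M.bar (a + b) →ₗ[k] cobV A (L.bar b) s
  | 0 => f
  | b + 1 => codiag (L.bar b) s ∘ₗ (cupLeft f b).rTensor A

variable {M N} in
/-- The map `1^{⊗ s} ⊗ g : A^{⊗ s} ⊗ (L ⊗ A^{⊗ b}) → A^{⊗ (r + s)} ⊗ N`. -/
noncomputable def cupRight {L : HopfBimod k A} {b r : ℕ} (g : L.bar b →ₗ[k] N.cobar r) (s : ℕ) :
    cobV A (L.bar b) s →ₗ[k] N.cobar (r + s) :=
  cobAdd (ModuleCat.of k N.carrier) r s ∘ₗ cobMap g s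

/-- The space of all families of linear maps `M ⊗ A^{⊗ q} → A^{⊗ p} ⊗ N`. -/
abbrev Tot : Type u := ∀ x : ℕ × ℕ, M.bar x.1 →ₗ[k] N.cobar x.2

variable {M N} in
/-- The family with a single non-zero member, `α : M ⊗ A^{⊗ q} → A^{⊗ p} ⊗ N`. -/
noncomputable def single (q p : ℕ) : (M.bar q →ₗ[k] N.cobar p) →ₗ[k] Tot M N :=
  LinearMap.single k (fun x : ℕ × ℕ => M.bar x.1 →ₗ[k] N.cobar x.2) (q, p)

/-- The component of `d_h f` in `Hom(M ⊗ A^{⊗ q}, A^{⊗ p} ⊗ N)`. -/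
noncomputable def dhTot : ∀ q p : ℕ, Tot M N →ₗ[k] (M.bar q →ₗ[k] N.cobar p)
  | 0, _ => 0
  | q + 1, p => dh M N q p ∘ₗ LinearMap.proj (q, p)

/-- The component of `d_c f` in `Hom(M ⊗ A^{⊗ q}, A^{⊗ p} ⊗ N)`. -/
noncomputable def dcTot : ∀ q p : ℕ, Tot M N →ₗ[k] (M.bar q →ₗ[k] N.cobar p)
  | _, 0 => 0
  | q, p + 1 => dc M N q p ∘ₗ LinearMap.proj (q, p)

/-- The total differential `D = d_h + d_c`. -/
noncomputable def D : Tot M N →ₗ[k] Tot M N :=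
  LinearMap.pi fun x => dhTot M N x.1 x.2 + dcTot M N x.1 x.2

/-- The cochains of degree `n`, `⨁_{q + p = n} Hom_{A-}^{-A}(M ⊗ A^{⊗ q}, A^{⊗ p} ⊗ N)`. -/
noncomputable def C (n : ℕ) : Submodule k (Tot M N) where
  carrier := {f | ∀ x : ℕ × ℕ, (f x) ∈ K M N x.1 x.2 ∧ (x.1 + x.2 ≠ n → f x = 0)}
  zero_mem' x := ⟨zero_mem _, fun _ => rfl⟩
  add_mem' {f g} hf hg x := by
    refine ⟨by simpa using add_mem (hf x).1 (hg x).1, fun h => ?_⟩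
    simp [(hf x).2 h, (hg x).2 h]
  smul_mem' c f hf x := by
    refine ⟨Submodule.smul_mem _ c (hf x).1, fun h => ?_⟩
    exact (congrArg (c • ·) ((hf x).2 h)).trans (smul_zero c)

/-- The cocycles of degree `n`. -/
noncomputable def Z (n : ℕ) : Submodule k (Tot M N) := C M N n ⊓ LinearMap.ker (D M N)

/-- The coboundaries of degree `n`. -/
noncomputable def B : ℕ → Submodule k (Tot M N)
  | 0 => ⊥
  | n + 1 => (C M N n).map (D M N)

/-- The Hopf bimodule cohomology `H_{A4}^n(M, N)`. -/
abbrev HA4 (n : ℕ) : Type u := Z M N n ⧸ (B M N n).comap (Z M N n).subtype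

variable {M N} in
/-- The class of a cocycle. -/
noncomputable def cls {n : ℕ} (f : Z M N n) : HA4 M N n := Submodule.Quotient.mk f

variable {M N} in
/-- The cup product: for `f : M ⊗ A^{⊗ a} → A^{⊗ s} ⊗ L` and `g : L ⊗ A^{⊗ b} → A^{⊗ r} ⊗ N`,
`(f ⌣ g)(m ⊗ a₁ ⊗ ⋯ ⊗ b_b) =
  ∑ (-1)^(s b) (1^{⊗ s} ⊗ g)[f(m ⊗ a₁ ⊗ ⋯) (Δ^{(s-1)}(b₁⁽¹⁾ ⋯ b_b⁽¹⁾) ⊗ 1) ⊗ b₁⁽²⁾ ⊗ ⋯ ⊗ b_b⁽²⁾]`,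
extended biadditively to families of degrees `p` and `q`. -/
noncomputable def cup {L : HopfBimod k A} (p q : ℕ) (f : Tot M L) (g : Tot L N) : Tot M N :=
  ∑ x ∈ Finset.HasAntidiagonal.antidiagonal p, ∑ y ∈ Finset.HasAntidiagonal.antidiagonal q, (-1 : k) ^ (x.2 * y.1) •
    single (x.1 + y.1) (y.2 + x.2) (cupRight (g y) x.2 ∘ₗ cupLeft (f x) y.1)

/-- Morphisms of Hopf bimodules: linear maps that are morphisms of bimodules and bicomodules. -/
structure Hom where
  toLin : M.carrier →ₗ[k] N.carrier
  map_lact : ∀ a, toLin ∘ₗ M.lact a = N.lact a ∘ₗ toLin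
  map_ract : ∀ a, toLin ∘ₗ M.ract a = N.ract a ∘ₗ toLin
  map_lco : N.lco ∘ₗ toLin = toLin.lTensor A ∘ₗ M.lco
  map_rco : N.rco ∘ₗ toLin = toLin.rTensor A ∘ₗ M.rco

/-- The action of `u : N → N'` on cochains: `α ↦ (1^{⊗ p} ⊗ u) ∘ α`. -/
noncomputable def push {N N' : HopfBimod k A} (u : Hom N N') : Tot M N →ₗ[k] Tot M N' :=
  LinearMap.pi fun x =>
    LinearMap.compRight k (cobMap (A := A) (V := ModuleCat.of k N.carrier)
      (W := ModuleCat.of k N'.carrier) u.toLin x.2) ∘ₗ LinearMap.proj x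

namespace Hom

variable {M N}
variable [FiniteDimensional k A] (u : Hom M N)

theorem map_lhit (l : Module.Dual k A) (m : M.carrier) :
    u.toLin (M.lhit l m) = N.lhit l (u.toLin m) := by
  rw [lhit_apply, lhit_apply, ← LinearMap.comp_apply N.lco, u.map_lco, LinearMap.comp_apply]
  induction M.lco m with
  | zero => simp
  | add x y hx hy => simp only [map_add, hx, hy]
  | tmul a m => simp

theorem map_rhit (l : Module.Dual k A) (m : M.carrier) :
    u.toLin (M.rhit l m) = N.rhit l (u.toLin m) := by
  rw [rhit_apply, rhit_apply, ← LinearMap.comp_apply N.rco, u.map_rco, LinearMap.comp_apply]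
  induction M.rco m with
  | zero => simp
  | add x y hx hy => simp only [map_add, hx, hy]
  | tmul m a => simp

theorem map_smul (x : XAlg k A) (m : M.carrier) : u.toLin (x • m) = x • u.toLin m := by
  have h : ∀ (l l' : Module.Dual k A) (a b : A), u.toLin (XAlg.tm l l' a b • m) = XAlg.tm l l' a b • u.toLin m := by
    intro l l' a b
    rw [tm_smul, tm_smul, map_lhit, map_rhit]
    congr 2
    exact (LinearMap.congr_fun (u.map_lact a) _).trans
      (congrArg _ (LinearMap.congr_fun (u.map_ract b) m))
  let F : XAlg k A →ₗ[k] N.carrier := u.toLin ∘ₗ LinearMap.applyₗ m ∘ₗ M.rep.toFun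
  let G : XAlg k A →ₗ[k] N.carrier := LinearMap.applyₗ (u.toLin m) ∘ₗ N.rep.toFun
  have hFG : F = G := XAlg.hom_ext h
  exact LinearMap.congr_fun hFG x

/-- A morphism of Hopf bimodules, as a morphism of `X`-modules. -/
noncomputable def toX : ModuleCat.of (XAlg k A) M.carrier ⟶ ModuleCat.of (XAlg k A) N.carrier :=
  ModuleCat.ofHom
    { toFun := u.toLin
      map_add' := map_add u.toLin
      map_smul' := u.map_smul }

end Hom

section Ext

variable [FiniteDimensional k A]

open CategoryTheory

/-- `Ext_X^n(M, N)` -/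
abbrev ExtX (n : ℕ) : Type u :=
  Abelian.Ext (ModuleCat.of (XAlg k A) M.carrier) (ModuleCat.of (XAlg k A) N.carrier) n

/-- A short exact sequence `0 ⟶ N' ⟶ N ⟶ N'' ⟶ 0` of Hopf bimodules. -/
structure SES (N' N N'' : HopfBimod k A) where
  i : Hom N' N
  p : Hom N N''
  inj : Function.Injective i.toLin
  exact : Function.Exact i.toLin p.toLin
  surj : Function.Surjective p.toLin

namespace SES

variable {N' N N'' : HopfBimod k A} (S : SES N' N N'')

/-- The underlying short complex of `X`-modules. -/
noncomputable def complex : ShortComplex (ModuleCat.{u} (XAlg k A)) :=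
  ShortComplex.mk S.i.toX S.p.toX (by
    ext x
    exact S.exact.apply_apply_eq_zero x)

theorem shortExact : S.complex.ShortExact where
  exact := (ShortComplex.ShortExact.moduleCat_exact_iff_function_exact _).2 S.exact
  mono_f := (ModuleCat.mono_iff_injective _).2 S.inj
  epi_g := (ModuleCat.epi_iff_surjective _).2 S.surj

/-- The class of the extension in `Ext_X^1(N'', N')`. -/
noncomputable def extClass : ExtX N'' N' 1 := S.shortExact.extClass

end SES

/-- A family of maps `H_{A4}^n(M, N) → Ext_X^n(M, N)` is a map of `δ`-functors in the variable `N`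
that extends the identity of `Hom(M, N)`. -/
structure IsDeltaMap (φ : ∀ (N : HopfBimod k A) (n : ℕ), HA4 M N n →ₗ[k] ExtX M N n) : Prop where
  /-- `φ` is natural in `N` -/
  natural : ∀ {N N' : HopfBimod k A} (u : Hom N N') (n : ℕ) (f : Z M N n) (f' : Z M N' n),
    (f' : Tot M N') = push M u f →
      φ N' n (cls f') = (φ N n (cls f)).comp (Abelian.Ext.mk₀ u.toX) (add_zero n)
  /-- `φ` commutes with the connecting homomorphisms. That of `H_{A4}^*(M, -)` sends the class of
  `f''` to the class of `f'` if there is a cochain `c` of `N` which maps to `f''`, and whose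
  differential is the image of `f'`. That of `Ext_X^*(M, -)` is the Yoneda product with the class
  of the short exact sequence. -/
  connecting : ∀ {N' N N'' : HopfBimod k A} (S : SES N' N N'') (n : ℕ) (f'' : Z M N'' n)
    (c : C M N n) (f' : Z M N' (n + 1)),
    push M S.p c = f'' → D M N c = push M S.i f' →
      φ N' (n + 1) (cls f') = (φ N'' n (cls f'')).comp S.extClass rfl
  /-- `φ` extends the identity of `Hom(M, N)` -/
  zero : ∀ {N : HopfBimod k A} (u : Hom M N) (f : Z M N 0),
    (f : Tot M N) = single 0 0 u.toLin → φ N 0 (cls f) = Abelian.Ext.mk₀ u.toX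

end Ext

end HopfBimod
end HopfBimodCoh

open HopfBimodCoh

/-! Both sides are δ-functors of N that agree in degree 0 and vanish in positive degrees on enough
objects, so they are compared by dimension shifting. The statement on products follows from the same
induction.

Three facts about H_{A4}^*(M, -) carry the argument.

Exactness. The spaces M ⊗ A^{⊗q} and A^{⊗p} ⊗ N are Hopf modules: left modules and right comodules
whose coaction is linear. By the fundamental theorem of Hopf modules such a V is A ⊗ V^{co}, the
projection onto the coinvariants being v ↦ ∑ S⁻¹(v₍₁₎)v₍₀₎. Every linear map can therefore be
averaged to a Hopf module map, and Hom_{A-}^{-A}(V, -) is exact (`average`, `exists_lift`,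
`exists_factor`). A short exact sequence of coefficients thus gives a short exact sequence of
complexes.

Degree 0. A 0-cocycle is a morphism of Hopf bimodules, and these are the X-linear maps. As A is
finite dimensional, every X-module is a Hopf bimodule (`ExchangeRep.toHopfBimod`, `XAlg.universal`),
which also provides cokernels and enough injectives.

Effacement. N embeds into `N.coh` = A ⊗ Hom(A, N), cofree as a left comodule over a coinduced right
module. The counit contracts the direction of d_c, and evaluation at 1 contracts d_h on what is left
(`exists_D_eq_coh`). An injective object is a retract of its `coh`, hence has no cohomology in
positive degrees (`exists_D_eq_of_injective`).

For 0 → N → I → Q → 0 with I injective, degree n + 1 of either functor at N is then the cokernel of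
degree n at I mapping to degree n at Q (`exists_step`). Naturality and compatibility with connecting
homomorphisms hold because any short exact sequence maps to a chosen one with injective middle term
(`exists_next`). Uniqueness is the same induction (`IsDeltaMap.eq`).

For products, the Leibniz rule D(f ⌣ g) = Df ⌣ g + (-1)^p f ⌣ Dg (`D_cup`) shows that f ⌣ - commutes
with connecting homomorphisms up to (-1)^p. Cupping with a morphism is change of coefficients, and
the Yoneda product is associative, so induction on q gives the sign (-1)^{pq}
(`IsDeltaMap.map_cup`). -/

namespace HopfBimodCoh
variable {k A : Type u} [Field k] [Ring A] [HopfAlgebra k A] [FiniteDimensional k A]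

/-! ### Diagonal actions on tensor products -/

section DiagonalActions

variable {V W U V' W' : Type u} [AddCommGroup V] [Module k V] [AddCommGroup W] [Module k W]
  [AddCommGroup U] [Module k U] [AddCommGroup V'] [Module k V'] [AddCommGroup W'] [Module k W']

theorem comp_sum {ι : Type*} (s : Finset ι) (f : V →ₗ[k] W) (g : ι → U →ₗ[k] V) :
    f ∘ₗ ∑ i ∈ s, g i = ∑ i ∈ s, f ∘ₗ g i :=
  map_sum (LinearMap.compRight k f) g s

theorem sum_comp {ι : Type*} (s : Finset ι) (f : U →ₗ[k] V) (g : ι → V →ₗ[k] W) :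
    (∑ i ∈ s, g i) ∘ₗ f = ∑ i ∈ s, g i ∘ₗ f :=
  map_sum (LinearMap.lcomp k W f) g s

theorem map_sum_left {ι : Type*} (s : Finset ι) (f : ι → V →ₗ[k] V') (g : W →ₗ[k] W') :
    TensorProduct.map (∑ i ∈ s, f i) g = ∑ i ∈ s, TensorProduct.map (f i) g :=
  map_sum ((TensorProduct.mapBilinear (RingHom.id k) V W V' W').flip g) f s

theorem map_sum_right {ι : Type*} (s : Finset ι) (f : V →ₗ[k] V') (g : ι → W →ₗ[k] W') :
    TensorProduct.map f (∑ i ∈ s, g i) = ∑ i ∈ s, TensorProduct.map f (g i) :=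
  map_sum (TensorProduct.mapBilinear (RingHom.id k) V W V' W' f) g s

theorem diag_natural {ρ : A →ₗ[k] Module.End k V} {σ : A →ₗ[k] Module.End k W}
    {ρ' : A →ₗ[k] Module.End k V'} {σ' : A →ₗ[k] Module.End k W'} {f : V →ₗ[k] V'}
    {g : W →ₗ[k] W'} (hf : ∀ a, f ∘ₗ ρ a = ρ' a ∘ₗ f) (hg : ∀ a, g ∘ₗ σ a = σ' a ∘ₗ g) (a : A) :
    TensorProduct.map f g ∘ₗ diag ρ σ a = diag ρ' σ' a ∘ₗ TensorProduct.map f g := by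
  rw [diag_apply, diag_apply, comp_sum, sum_comp]
  refine Finset.sum_congr rfl fun i _ => ?_
  rw [← TensorProduct.map_comp, ← TensorProduct.map_comp, hf, hg]

/-- Coassociativity of Δ: both sides are ∑ ρ(a⁽¹⁾) ⊗ σ(a⁽²⁾) ⊗ τ(a⁽³⁾), and `tri_coassoc` compares
the two ways of indexing the sum. Diagonal actions on A^{⊗p} ⊗ N can therefore be built one factor
at a time. -/
theorem diag_assoc (ρ : A →ₗ[k] Module.End k V) (σ : A →ₗ[k] Module.End k W)
    (τ : A →ₗ[k] Module.End k U) (a : A) :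
    (TensorProduct.assoc k V W U).toLinearMap ∘ₗ diag (diag ρ σ) τ a =
      diag ρ (diag σ τ) a ∘ₗ (TensorProduct.assoc k V W U).toLinearMap := by
  let F : A ⊗[k] (A ⊗[k] A) →ₗ[k] (V ⊗[k] W) ⊗[k] U →ₗ[k] V ⊗[k] (W ⊗[k] U) :=
    LinearMap.lcomp k _ (TensorProduct.assoc k V W U).toLinearMap ∘ₗ
    TensorProduct.homTensorHomMap (RingHom.id k) V (W ⊗[k] U) V (W ⊗[k] U) ∘ₗ
    TensorProduct.map ρ (TensorProduct.homTensorHomMap (RingHom.id k) W U W U ∘ₗ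
      TensorProduct.map σ τ)
  have h := tri_coassoc F a
  have hF : ∀ x y z, F (x ⊗ₜ (y ⊗ₜ z)) = TensorProduct.map (ρ x) (TensorProduct.map (σ y) (τ z)) ∘ₗ
    (TensorProduct.assoc k V W U).toLinearMap := fun x y z => rfl
  simp only [hF] at h
  calc _ = _ := ?_
    _ = _ := h
    _ = _ := ?_
  · simp only [diag_apply, comp_sum, map_sum_left]
    refine Finset.sum_congr rfl fun i _ => Finset.sum_congr rfl fun j _ => ?_
    ext; rfl
  · simp only [diag_apply, sum_comp, map_sum_right]

theorem diag_assoc_symm (ρ : A →ₗ[k] Module.End k V) (σ : A →ₗ[k] Module.End k W)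
    (τ : A →ₗ[k] Module.End k U) (a : A) :
    (TensorProduct.assoc k V W U).symm.toLinearMap ∘ₗ diag ρ (diag σ τ) a =
      diag (diag ρ σ) τ a ∘ₗ (TensorProduct.assoc k V W U).symm.toLinearMap := by
  ext v w u
  have h := LinearMap.congr_fun (diag_assoc ρ σ τ a) ((v ⊗ₜ w) ⊗ₜ u)
  simp only [LinearMap.comp_apply, LinearEquiv.coe_coe, TensorProduct.assoc_tmul] at h
  simp only [TensorProduct.AlgebraTensorModule.curry_apply, LinearMap.restrictScalars_self,
    TensorProduct.curry_apply, LinearMap.comp_apply, LinearEquiv.coe_coe,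
    TensorProduct.assoc_symm_tmul]
  rw [← h, LinearEquiv.symm_apply_apply]

/-- Operators on different tensor factors commute. In this form the unit law and the
(anti)multiplicativity of a diagonal action come from `conv_one`, `conv_mul` and `conv_mul_anti`. -/
theorem diag_eq_conv (ρ : A →ₗ[k] Module.End k V) (σ : A →ₗ[k] Module.End k W) :
    diag ρ σ = conv (LinearMap.rTensorHom W ∘ₗ ρ) (LinearMap.lTensorHom V ∘ₗ σ) := by
  ext a v w
  rw [diag_apply, conv_apply]
  simp

theorem rTensor_comm_lTensor (f : Module.End k V) (g : Module.End k W) :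
    LinearMap.lTensorHom V g * LinearMap.rTensorHom W f =
      LinearMap.rTensorHom W f * LinearMap.lTensorHom V g := by
  ext; simp

theorem diag_one {ρ : A →ₗ[k] Module.End k V} {σ : A →ₗ[k] Module.End k W} (hρ : ρ 1 = 1)
    (hσ : σ 1 = 1) : diag ρ σ 1 = 1 := by
  rw [diag_eq_conv]
  refine conv_one _ _ ?_ ?_ <;> ext <;> simp [hρ, hσ]

theorem diag_mul {ρ : A →ₗ[k] Module.End k V} {σ : A →ₗ[k] Module.End k W}
    (hρ : ∀ a b, ρ (a * b) = ρ a * ρ b) (hσ : ∀ a b, σ (a * b) = σ a * σ b) (a b : A) :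
    diag ρ σ (a * b) = diag ρ σ a * diag ρ σ b := by
  rw [diag_eq_conv]
  refine conv_mul _ _ (fun a b => ?_) (fun a b => ?_) (fun a b => rTensor_comm_lTensor _ _) a b <;>
    ext <;> simp [hρ, hσ]

theorem diag_mul_anti {ρ : A →ₗ[k] Module.End k V} {σ : A →ₗ[k] Module.End k W}
    (hρ : ∀ a b, ρ (a * b) = ρ b * ρ a) (hσ : ∀ a b, σ (a * b) = σ b * σ a) (a b : A) :
    diag ρ σ (a * b) = diag ρ σ b * diag ρ σ a := by
  rw [diag_eq_conv]
  refine conv_mul_anti _ _ (fun a b => ?_) (fun a b => ?_) (fun a b => rTensor_comm_lTensor _ _)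
    a b <;> ext <;> simp [hρ, hσ]

theorem diag_commute {ρ ρ' : A →ₗ[k] Module.End k V} {σ σ' : A →ₗ[k] Module.End k W}
    (hρ : ∀ a b, ρ a * ρ' b = ρ' b * ρ a) (hσ : ∀ a b, σ a * σ' b = σ' b * σ a) (a b : A) :
    diag ρ σ a * diag ρ' σ' b = diag ρ' σ' b * diag ρ σ a := by
  rw [diag_apply, diag_apply, Finset.sum_mul_sum, Finset.sum_mul_sum, Finset.sum_comm]
  refine Finset.sum_congr rfl fun i _ => Finset.sum_congr rfl fun j _ => ?_
  rw [← TensorProduct.map_mul, ← TensorProduct.map_mul, hρ, hσ]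

variable (k A) in
/-- left multiplication -/
noncomputable abbrev mulL : A →ₗ[k] Module.End k A := LinearMap.mul k A

variable (k A) in
/-- right multiplication -/
noncomputable abbrev mulR : A →ₗ[k] Module.End k A := (LinearMap.mul k A).flip

/-- Multiplicativity of Δ, phrased as equivariance so that `diag_natural` applies with f = Δ. -/
theorem comul_mulL (a : A) :
    comul (R := k) ∘ₗ mulL k A a = diag (mulL k A) (mulL k A) a ∘ₗ comul (R := k) := by
  ext b
  rw [diag_apply]
  simp only [LinearMap.comp_apply, LinearMap.mul_apply', Bialgebra.comul_mul, LinearMap.sum_apply]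
  conv_lhs => rw [← (ℛ k a).eq]
  rw [Finset.sum_mul]
  refine Finset.sum_congr rfl fun i _ => ?_
  generalize comul (R := k) b = t
  induction t with
  | zero => simp
  | add x y hx hy => simp only [mul_add, map_add, hx, hy]
  | tmul x y => simp

theorem comul_mulR (a : A) :
    comul (R := k) ∘ₗ mulR k A a = diag (mulR k A) (mulR k A) a ∘ₗ comul (R := k) := by
  ext b
  rw [diag_apply]
  simp only [LinearMap.comp_apply, LinearMap.flip_apply, LinearMap.mul_apply', Bialgebra.comul_mul, LinearMap.sum_apply]
  conv_lhs => rw [← (ℛ k a).eq]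
  rw [Finset.mul_sum]
  refine Finset.sum_congr rfl fun i _ => ?_
  generalize comul (R := k) b = t
  induction t with
  | zero => simp
  | add x y hx hy => simp only [add_mul, map_add, hx, hy]
  | tmul x y => simp

end DiagonalActions

/-! ### Hopf modules -/

section HopfModules

variable {V W : Type u} [AddCommGroup V] [Module k V] [AddCommGroup W] [Module k W]

/-- `V` is a left module and a right comodule, whose coaction is a morphism of modules. -/
structure IsLR (ρ : A →ₗ[k] Module.End k V) (r : V →ₗ[k] V ⊗[k] A) : Prop where
  one : ρ 1 = 1
  mul : ∀ a b, ρ (a * b) = ρ a * ρ b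
  coassoc : (TensorProduct.assoc k V A A).toLinearMap ∘ₗ r.rTensor A ∘ₗ r = comul.lTensor V ∘ₗ r
  counit : (TensorProduct.rid k V).toLinearMap ∘ₗ counit.lTensor V ∘ₗ r = LinearMap.id
  compat : ∀ a, r ∘ₗ ρ a = diag ρ (mulL k A) a ∘ₗ r

/-- `V` is a bimodule and a right comodule, whose coaction is a morphism of bimodules. -/
structure IsTri (ρ σ : A →ₗ[k] Module.End k V) (r : V →ₗ[k] V ⊗[k] A) : Prop extends
    IsLR ρ r where
  one' : σ 1 = 1
  mul' : ∀ a b, σ (a * b) = σ b * σ a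
  comm : ∀ a b, ρ a * σ b = σ b * ρ a
  compat' : ∀ a, r ∘ₗ σ a = diag σ (mulR k A) a ∘ₗ r

/-- `V` is a left module and a bicomodule, whose coactions are morphisms of modules. -/
structure IsBi (ρ : A →ₗ[k] Module.End k V) (l : V →ₗ[k] A ⊗[k] V) (r : V →ₗ[k] V ⊗[k] A) : Prop
    extends IsLR ρ r where
  lcoassoc : (TensorProduct.assoc k A A V).toLinearMap ∘ₗ comul.rTensor V ∘ₗ l = l.lTensor A ∘ₗ l
  lcompat : ∀ a, l ∘ₗ ρ a = diag (mulL k A) ρ a ∘ₗ l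
  lr : (TensorProduct.assoc k A V A).toLinearMap ∘ₗ l.rTensor A ∘ₗ r = r.lTensor A ∘ₗ l

/-- Inductive step for A^{⊗p} ⊗ N. The coaction touches only V, so its coassociativity and counit
law are those of `r` with a spectator factor; its equivariance is `diag_natural` for 1 ⊗ r, followed
by reassociation of the diagonal action. -/
theorem IsTri.cob {ρ σ : A →ₗ[k] Module.End k V} {r : V →ₗ[k] V ⊗[k] A} (h : IsTri ρ σ r) :
    IsTri (diag (mulL k A) ρ) (diag (mulR k A) σ)
      ((TensorProduct.assoc k A V A).symm.toLinearMap ∘ₗ r.lTensor A) where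
  one := diag_one (by ext; simp) h.one
  mul := diag_mul (fun a b => by ext; simp [mul_assoc]) h.mul
  one' := diag_one (by ext; simp) h.one'
  mul' := diag_mul_anti (fun a b => by ext; simp [mul_assoc]) h.mul'
  comm := diag_commute (fun a b => by ext; simp [mul_assoc]) h.comm
  compat a := by
    rw [LinearMap.comp_assoc]
    have := diag_natural (f := LinearMap.id) (g := r) (ρ := mulL k A) (ρ' := mulL k A)
      (fun a => rfl) h.compat a
    erw [this]
    rw [← LinearMap.comp_assoc, diag_assoc_symm]
    rfl
  compat' a := by
    rw [LinearMap.comp_assoc]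
    have := diag_natural (f := LinearMap.id) (g := r) (ρ := mulR k A) (ρ' := mulR k A)
      (fun a => rfl) h.compat' a
    erw [this]
    rw [← LinearMap.comp_assoc, diag_assoc_symm]
    rfl
  counit := by
    ext a v
    have h1 := LinearMap.congr_fun h.counit v
    simp only [LinearMap.comp_apply, LinearEquiv.coe_coe, LinearMap.id_apply] at h1
    simp only [TensorProduct.AlgebraTensorModule.curry_apply, LinearMap.restrictScalars_self,
      TensorProduct.curry_apply, LinearMap.comp_apply, LinearEquiv.coe_coe,
      LinearMap.lTensor_tmul, LinearMap.id_apply]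
    conv_rhs => rw [← h1]
    generalize r v = t
    induction t with
    | zero => simp
    | add x y hx hy => simp only [TensorProduct.tmul_add, map_add, hx, hy]
    | tmul x y => simp
  coassoc := by
    ext a v
    have h1 := LinearMap.congr_fun h.coassoc v
    simp only [LinearMap.comp_apply, LinearEquiv.coe_coe] at h1
    simp only [TensorProduct.AlgebraTensorModule.curry_apply, LinearMap.restrictScalars_self,
      TensorProduct.curry_apply, LinearMap.comp_apply, LinearEquiv.coe_coe,
      LinearMap.lTensor_tmul]
    -- Both sides are a ⊗ v₍₀₎ ⊗ v₍₁₎ ⊗ v₍₂₎; in the middle term the last two legs are written with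
    -- Δ, where the coassociativity of `r` can be applied.
    trans (TensorProduct.assoc k A V (A ⊗[k] A)).symm (a ⊗ₜ (comul.lTensor V (r v)))
    · rw [← h1]
      generalize r v = t
      induction t with
      | zero => simp
      | add x y hx hy => simp only [TensorProduct.tmul_add, map_add, hx, hy]
      | tmul x y =>
        simp only [TensorProduct.assoc_symm_tmul, LinearMap.rTensor_tmul, LinearMap.comp_apply,
          LinearMap.lTensor_tmul, LinearEquiv.coe_coe]
        generalize r x = t
        induction t with
        | zero => simp
        | add x y hx hy => simp only [TensorProduct.tmul_add, TensorProduct.add_tmul, map_add, hx, hy]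
        | tmul x y => simp
    · generalize r v = t
      induction t with
      | zero => simp
      | add x y hx hy => simp only [TensorProduct.tmul_add, map_add, hx, hy]
      | tmul x y => simp

end HopfModules
end HopfBimodCoh

namespace HopfBimodCoh
variable {k A : Type u} [Field k] [Ring A] [HopfAlgebra k A] [FiniteDimensional k A]

/-! ### Codiagonal coactions and the spaces M ⊗ A^{⊗q} -/

section BarStep

variable {V W : Type u} [AddCommGroup V] [Module k V] [AddCommGroup W] [Module k W]

variable (k A V) in
/-- `(x ⊗ v) ⊗ (y ⊗ z) ↦ xy ⊗ (v ⊗ z)` -/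
noncomputable def mixL : (A ⊗[k] V) ⊗[k] (A ⊗[k] A) →ₗ[k] A ⊗[k] (V ⊗[k] A) :=
  (LinearMap.mul' k A).rTensor (V ⊗[k] A) ∘ₗ
    (TensorProduct.tensorTensorTensorComm k A V A A).toLinearMap

variable (k A V) in
/-- `(v ⊗ x) ⊗ (y ⊗ z) ↦ (v ⊗ y) ⊗ xz` -/
noncomputable def mixR : (V ⊗[k] A) ⊗[k] (A ⊗[k] A) →ₗ[k] (V ⊗[k] A) ⊗[k] A :=
  (LinearMap.mul' k A).lTensor (V ⊗[k] A) ∘ₗ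
    (TensorProduct.tensorTensorTensorComm k V A A A).toLinearMap

@[simp] theorem mixL_tmul (x y z : A) (v : V) :
    mixL k A V ((x ⊗ₜ v) ⊗ₜ (y ⊗ₜ z)) = (x * y) ⊗ₜ (v ⊗ₜ z) := rfl

@[simp] theorem mixR_tmul (x y z : A) (v : V) :
    mixR k A V ((v ⊗ₜ x) ⊗ₜ (y ⊗ₜ z)) = (v ⊗ₜ y) ⊗ₜ (x * z) := rfl

/-- The codiagonal left coaction on `V ⊗ A`. -/
noncomputable def lcoStep (l : V →ₗ[k] A ⊗[k] V) : V ⊗[k] A →ₗ[k] A ⊗[k] (V ⊗[k] A) :=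
  mixL k A V ∘ₗ TensorProduct.map l comul

/-- The codiagonal right coaction on `V ⊗ A`. -/
noncomputable def rcoStep (r : V →ₗ[k] V ⊗[k] A) : V ⊗[k] A →ₗ[k] (V ⊗[k] A) ⊗[k] A :=
  mixR k A V ∘ₗ TensorProduct.map r comul

@[simp] theorem lcoStep_tmul (l : V →ₗ[k] A ⊗[k] V) (v : V) (a : A) :
    lcoStep l (v ⊗ₜ a) = mixL k A V (l v ⊗ₜ comul a) := rfl

@[simp] theorem rcoStep_tmul (r : V →ₗ[k] V ⊗[k] A) (v : V) (a : A) :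
    rcoStep r (v ⊗ₜ a) = mixR k A V (r v ⊗ₜ comul a) := rfl

/-- Two linear maps agree on `t ⊗ s` if they agree on `(v ⊗ x) ⊗ (y ⊗ z)`. -/
theorem apply_eq_of_fourfold {V₁ V₂ V₃ V₄ X : Type*} [AddCommGroup V₁] [Module k V₁]
    [AddCommGroup V₂] [Module k V₂] [AddCommGroup V₃] [Module k V₃] [AddCommGroup V₄] [Module k V₄]
    [AddCommGroup X] [Module k X]
    (f g : (V₁ ⊗[k] V₂) ⊗[k] (V₃ ⊗[k] V₄) →ₗ[k] X)
    (h : ∀ v x y z, f ((v ⊗ₜ x) ⊗ₜ (y ⊗ₜ z)) = g ((v ⊗ₜ x) ⊗ₜ (y ⊗ₜ z)))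
    (t : (V₁ ⊗[k] V₂) ⊗[k] (V₃ ⊗[k] V₄)) : f t = g t :=
  LinearMap.congr_fun (TensorProduct.ext_fourfold' h) t

/-- Either side is one regrouping `G` of the iterated coaction of v with the iterated
comultiplication of a, so coassociativity of `l` and of Δ finishes; Δ(xy) = Δ(x)Δ(y) is used to
bring the left side to this form. The next two lemmas follow the same scheme. -/
theorem lcoStep_coassoc {l : V →ₗ[k] A ⊗[k] V}
    (h : (TensorProduct.assoc k A A V).toLinearMap ∘ₗ comul.rTensor V ∘ₗ l = l.lTensor A ∘ₗ l) :
    (TensorProduct.assoc k A A (V ⊗[k] A)).toLinearMap ∘ₗ comul.rTensor (V ⊗[k] A) ∘ₗ lcoStep l =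
      (lcoStep l).lTensor A ∘ₗ lcoStep l := by
  -- `G` sends (x ⊗ y ⊗ v) ⊗ (a ⊗ b ⊗ c) to xa ⊗ yb ⊗ v ⊗ c.
  let G : (A ⊗[k] (A ⊗[k] V)) ⊗[k] (A ⊗[k] (A ⊗[k] A)) →ₗ[k] A ⊗[k] (A ⊗[k] (V ⊗[k] A)) :=
    TensorProduct.map (LinearMap.mul' k A) (mixL k A V) ∘ₗ
      (TensorProduct.tensorTensorTensorComm k A (A ⊗[k] V) A (A ⊗[k] A)).toLinearMap
  have h1 : ∀ t, ((TensorProduct.assoc k A A (V ⊗[k] A)).toLinearMap ∘ₗ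
      comul.rTensor (V ⊗[k] A) ∘ₗ mixL k A V) t =
      (G ∘ₗ TensorProduct.map ((TensorProduct.assoc k A A V).toLinearMap ∘ₗ comul.rTensor V)
        ((TensorProduct.assoc k A A A).toLinearMap ∘ₗ comul.rTensor A)) t := by
    refine apply_eq_of_fourfold _ _ fun x v y z => ?_
    simp only [LinearMap.comp_apply, mixL_tmul, LinearMap.rTensor_tmul, TensorProduct.map_tmul,
      Bialgebra.comul_mul, LinearEquiv.coe_coe]
    generalize comul (R := k) x = t
    generalize comul (R := k) y = s
    induction t with
    | zero => simp
    | add x y hx hy => simp only [add_mul, TensorProduct.add_tmul, map_add, hx, hy]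
    | tmul a b =>
      induction s with
      | zero => simp
      | add x y hx hy =>
        simp only [mul_add, TensorProduct.add_tmul, TensorProduct.tmul_add, map_add, hx, hy]
      | tmul c d => simp [G]
  have h2 : ∀ t, ((lcoStep l).lTensor A ∘ₗ mixL k A V) t =
      (G ∘ₗ TensorProduct.map (l.lTensor A) (comul.lTensor A)) t := by
    refine apply_eq_of_fourfold _ _ fun x v y z => ?_
    simp [G]
  ext v a
  have h3 := LinearMap.congr_fun h v
  have h4 := coassoc_apply (R := k) a
  simp only [LinearMap.comp_apply, LinearEquiv.coe_coe] at h3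
  refine (h1 _).trans (Eq.trans ?_ (h2 _).symm)
  simp [h3, h4]

theorem rcoStep_coassoc {r : V →ₗ[k] V ⊗[k] A}
    (h : (TensorProduct.assoc k V A A).toLinearMap ∘ₗ r.rTensor A ∘ₗ r = comul.lTensor V ∘ₗ r) :
    (TensorProduct.assoc k (V ⊗[k] A) A A).toLinearMap ∘ₗ (rcoStep r).rTensor A ∘ₗ rcoStep r =
      comul.lTensor (V ⊗[k] A) ∘ₗ rcoStep r := by
  let G : (V ⊗[k] (A ⊗[k] A)) ⊗[k] (A ⊗[k] (A ⊗[k] A)) →ₗ[k] (V ⊗[k] A) ⊗[k] (A ⊗[k] A) :=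
    TensorProduct.map LinearMap.id (LinearMap.mul' k (A ⊗[k] A)) ∘ₗ
      (TensorProduct.tensorTensorTensorComm k V (A ⊗[k] A) A (A ⊗[k] A)).toLinearMap
  have h1 : ∀ t, ((TensorProduct.assoc k (V ⊗[k] A) A A).toLinearMap ∘ₗ
      (rcoStep r).rTensor A ∘ₗ mixR k A V) t =
      (G ∘ₗ TensorProduct.map ((TensorProduct.assoc k V A A).toLinearMap ∘ₗ r.rTensor A)
        ((TensorProduct.assoc k A A A).toLinearMap ∘ₗ comul.rTensor A)) t := by
    refine apply_eq_of_fourfold _ _ fun v x y z => ?_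
    simp only [LinearMap.comp_apply, mixR_tmul, LinearMap.rTensor_tmul, TensorProduct.map_tmul,
      rcoStep_tmul, LinearEquiv.coe_coe]
    generalize r v = t
    generalize comul (R := k) y = s
    induction t with
    | zero => simp
    | add x y hx hy => simp only [TensorProduct.add_tmul, map_add, hx, hy]
    | tmul a b =>
      induction s with
      | zero => simp
      | add x y hx hy =>
        simp only [TensorProduct.add_tmul, TensorProduct.tmul_add, map_add, hx, hy]
      | tmul c d => simp [G]
  have h2 : ∀ t, (comul.lTensor (V ⊗[k] A) ∘ₗ mixR k A V) t =
      (G ∘ₗ TensorProduct.map (comul.lTensor V) (comul.lTensor A)) t := by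
    refine apply_eq_of_fourfold _ _ fun v x y z => ?_
    simp [G]
  ext v a
  have h3 := LinearMap.congr_fun h v
  have h4 := coassoc_apply (R := k) a
  simp only [LinearMap.comp_apply, LinearEquiv.coe_coe] at h3
  refine (h1 _).trans (Eq.trans ?_ (h2 _).symm)
  simp [h3, h4]

theorem lcoStep_rcoStep {l : V →ₗ[k] A ⊗[k] V} {r : V →ₗ[k] V ⊗[k] A}
    (h : (TensorProduct.assoc k A V A).toLinearMap ∘ₗ l.rTensor A ∘ₗ r = r.lTensor A ∘ₗ l) :
    (TensorProduct.assoc k A (V ⊗[k] A) A).toLinearMap ∘ₗ (lcoStep l).rTensor A ∘ₗ rcoStep r =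
      (rcoStep r).lTensor A ∘ₗ lcoStep l := by
  let G : (A ⊗[k] (V ⊗[k] A)) ⊗[k] (A ⊗[k] (A ⊗[k] A)) →ₗ[k] A ⊗[k] ((V ⊗[k] A) ⊗[k] A) :=
    TensorProduct.map (LinearMap.mul' k A) (mixR k A V) ∘ₗ
      (TensorProduct.tensorTensorTensorComm k A (V ⊗[k] A) A (A ⊗[k] A)).toLinearMap
  have h1 : ∀ t, ((TensorProduct.assoc k A (V ⊗[k] A) A).toLinearMap ∘ₗ
      (lcoStep l).rTensor A ∘ₗ mixR k A V) t =
      (G ∘ₗ TensorProduct.map ((TensorProduct.assoc k A V A).toLinearMap ∘ₗ l.rTensor A)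
        ((TensorProduct.assoc k A A A).toLinearMap ∘ₗ comul.rTensor A)) t := by
    refine apply_eq_of_fourfold _ _ fun v x y z => ?_
    simp only [LinearMap.comp_apply, mixR_tmul, LinearMap.rTensor_tmul, TensorProduct.map_tmul,
      lcoStep_tmul, LinearEquiv.coe_coe]
    generalize l v = t
    generalize comul (R := k) y = s
    induction t with
    | zero => simp
    | add x y hx hy => simp only [TensorProduct.add_tmul, map_add, hx, hy]
    | tmul a b =>
      induction s with
      | zero => simp
      | add x y hx hy =>
        simp only [TensorProduct.add_tmul, TensorProduct.tmul_add, map_add, hx, hy]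
      | tmul c d => simp [G]
  have h2 : ∀ t, ((rcoStep r).lTensor A ∘ₗ mixL k A V) t =
      (G ∘ₗ TensorProduct.map (r.lTensor A) (comul.lTensor A)) t := by
    refine apply_eq_of_fourfold _ _ fun v x y z => ?_
    simp [G]
  ext v a
  have h3 := LinearMap.congr_fun h v
  have h4 := coassoc_apply (R := k) a
  simp only [LinearMap.comp_apply, LinearEquiv.coe_coe] at h3
  refine (h1 _).trans (Eq.trans ?_ (h2 _).symm)
  simp [h3, h4]

theorem rcoStep_counit {r : V →ₗ[k] V ⊗[k] A}
    (h : (TensorProduct.rid k V).toLinearMap ∘ₗ counit.lTensor V ∘ₗ r = LinearMap.id) :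
    (TensorProduct.rid k (V ⊗[k] A)).toLinearMap ∘ₗ counit.lTensor (V ⊗[k] A) ∘ₗ rcoStep r =
      LinearMap.id := by
  have h1 : ∀ t, ((TensorProduct.rid k (V ⊗[k] A)).toLinearMap ∘ₗ
      counit.lTensor (V ⊗[k] A) ∘ₗ mixR k A V) t =
      (TensorProduct.map ((TensorProduct.rid k V).toLinearMap ∘ₗ counit.lTensor V)
        ((TensorProduct.rid k A).toLinearMap ∘ₗ counit.lTensor A)) t := by
    refine apply_eq_of_fourfold _ _ fun v x y z => ?_
    simp [TensorProduct.smul_tmul, smul_smul, mul_comm]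
  ext v a
  have h3 := LinearMap.congr_fun h v
  simp only [LinearMap.comp_apply, LinearEquiv.coe_coe] at h3
  refine (h1 _).trans ?_
  simp [h3]

theorem lcoStep_compat {ρ : A →ₗ[k] Module.End k V} {l : V →ₗ[k] A ⊗[k] V}
    (h : ∀ a, l ∘ₗ ρ a = diag (mulL k A) ρ a ∘ₗ l) (a : A) :
    lcoStep l ∘ₗ (LinearMap.rTensorHom A ∘ₗ ρ) a =
      diag (mulL k A) (LinearMap.rTensorHom A ∘ₗ ρ) a ∘ₗ lcoStep l := by
  have h1 : ∀ t, (mixL k A V ∘ₗ (diag (mulL k A) ρ a).rTensor (A ⊗[k] A)) t =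
      (diag (mulL k A) (LinearMap.rTensorHom A ∘ₗ ρ) a ∘ₗ mixL k A V) t := by
    refine apply_eq_of_fourfold _ _ fun x v y z => ?_
    simp [diag_apply, TensorProduct.sum_tmul, mul_assoc]
  ext v b
  have h3 := LinearMap.congr_fun (h a) v
  simp only [LinearMap.comp_apply] at h3
  refine Eq.trans ?_ (h1 (l v ⊗ₜ comul b))
  simp [h3]

theorem rcoStep_compat {ρ : A →ₗ[k] Module.End k V} {r : V →ₗ[k] V ⊗[k] A}
    (h : ∀ a, r ∘ₗ ρ a = diag ρ (mulL k A) a ∘ₗ r) (a : A) :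
    rcoStep r ∘ₗ (LinearMap.rTensorHom A ∘ₗ ρ) a =
      diag (LinearMap.rTensorHom A ∘ₗ ρ) (mulL k A) a ∘ₗ rcoStep r := by
  have h1 : ∀ t, (mixR k A V ∘ₗ (diag ρ (mulL k A) a).rTensor (A ⊗[k] A)) t =
      (diag (LinearMap.rTensorHom A ∘ₗ ρ) (mulL k A) a ∘ₗ mixR k A V) t := by
    refine apply_eq_of_fourfold _ _ fun x v y z => ?_
    simp [diag_apply, TensorProduct.sum_tmul, mul_assoc]
  ext v b
  have h3 := LinearMap.congr_fun (h a) v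
  simp only [LinearMap.comp_apply] at h3
  refine Eq.trans ?_ (h1 (r v ⊗ₜ comul b))
  simp [h3]

/-- Inductive step for M ⊗ A^{⊗q}. It is enough that V carries the left action: in the legs
v₍₋₁₎a⁽¹⁾ and v₍₁₎a⁽²⁾ the action multiplies from the left and the new letter from the right. -/
theorem IsBi.bar {ρ : A →ₗ[k] Module.End k V} {l : V →ₗ[k] A ⊗[k] V} {r : V →ₗ[k] V ⊗[k] A}
    (h : IsBi ρ l r) : IsBi (LinearMap.rTensorHom A ∘ₗ ρ) (lcoStep l) (rcoStep r) where
  one := by ext; simp [h.one]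
  mul a b := by ext; simp [h.mul]
  coassoc := rcoStep_coassoc h.coassoc
  counit := rcoStep_counit h.counit
  compat := rcoStep_compat h.compat
  lcoassoc := lcoStep_coassoc h.lcoassoc
  lcompat := lcoStep_compat h.lcompat
  lr := lcoStep_rcoStep h.lr

end BarStep

namespace HopfBimod

variable (M N : HopfBimod k A)

/-- The recursive definitions of the action and of the coactions unfold to the one-step
constructions, so the induction needs no further computation. -/
theorem isBi_bar : ∀ q, IsBi (M.barLact q) (M.barLco q) (M.barRco q)
  | 0 => { one := M.one_lact
           mul := M.mul_lact
           coassoc := M.rco_coassoc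
           counit := M.rco_counit
           compat := M.rco_lact
           lcoassoc := M.lco_coassoc
           lcompat := M.lco_lact
           lr := M.lco_rco }
  | q + 1 => (isBi_bar q).bar

theorem isTri_cobar : ∀ p, IsTri (N.cobarLact p) (N.cobarRact p) (N.cobarRco p)
  | 0 => { one := N.one_lact
           mul := N.mul_lact
           coassoc := N.rco_coassoc
           counit := N.rco_counit
           compat := N.rco_lact
           one' := N.one_ract
           mul' := N.mul_ract
           comm := N.lact_ract
           compat' := N.rco_ract }
  | p + 1 => (isTri_cobar p).cob

end HopfBimod
end HopfBimodCoh

namespace HopfBimodCoh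
variable {k A : Type u} [Field k] [Ring A] [HopfAlgebra k A] [FiniteDimensional k A]

/-! ### Bar and cobar differentials, one factor at a time -/

section Differentials

variable {V W : Type u} [AddCommGroup V] [Module k V] [AddCommGroup W] [Module k W]

/-- A map `d : V ⊗ A → V` which is compatible with the left action and with both coactions. -/
structure IsBarMap (ρ : A →ₗ[k] Module.End k V) (l : V →ₗ[k] A ⊗[k] V) (r : V →ₗ[k] V ⊗[k] A)
    (d : V ⊗[k] A →ₗ[k] V) : Prop where
  lin : ∀ a, d ∘ₗ (ρ a).rTensor A = ρ a ∘ₗ d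
  lcolin : l ∘ₗ d = d.lTensor A ∘ₗ lcoStep l
  rcolin : r ∘ₗ d = d.rTensor A ∘ₗ rcoStep r

/-- The two summands of `barStep` are compatible separately: d ⊗ 1 by the hypotheses on `d`, and the
product of the last two letters by Δ(ab) = Δ(a)Δ(b) and associativity. -/
theorem IsBarMap.step {ρ : A →ₗ[k] Module.End k V} {l : V →ₗ[k] A ⊗[k] V} {r : V →ₗ[k] V ⊗[k] A}
    {d : V ⊗[k] A →ₗ[k] V} (h : IsBarMap ρ l r d) (q : ℕ) :
    IsBarMap (LinearMap.rTensorHom A ∘ₗ ρ) (lcoStep l) (rcoStep r) (barStep d q) where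
  lin a := by
    ext v b c
    have h1 := LinearMap.congr_fun (h.lin a) (v ⊗ₜ b)
    simp only [LinearMap.comp_apply, LinearMap.rTensor_tmul] at h1
    simp [barStep, h1]
  lcolin := by
    have hd : lcoStep l ∘ₗ d.rTensor A = (d.rTensor A).lTensor A ∘ₗ lcoStep (lcoStep l) := by
      have h1 : ∀ t, (mixL k A V ∘ₗ (d.lTensor A).rTensor (A ⊗[k] A)) t =
          ((d.rTensor A).lTensor A ∘ₗ mixL k A (V ⊗[k] A)) t :=
        apply_eq_of_fourfold _ _ fun x v y z => by simp
      ext v a b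
      have h2 := LinearMap.congr_fun h.lcolin (v ⊗ₜ a)
      simp only [LinearMap.comp_apply] at h2
      refine Eq.trans ?_ (h1 (lcoStep l (v ⊗ₜ a) ⊗ₜ comul b))
      simp [h2]
    have hm : lcoStep l ∘ₗ (LinearMap.mul' k A).lTensor V ∘ₗ
        (TensorProduct.assoc k V A A).toLinearMap =
        ((LinearMap.mul' k A).lTensor V ∘ₗ (TensorProduct.assoc k V A A).toLinearMap).lTensor A ∘ₗ
          lcoStep (lcoStep l) := by
      ext v a b
      simp only [TensorProduct.AlgebraTensorModule.curry_apply, LinearMap.restrictScalars_self,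
        TensorProduct.curry_apply, LinearMap.comp_apply, LinearEquiv.coe_coe,
        TensorProduct.assoc_tmul, LinearMap.lTensor_tmul, LinearMap.mul'_apply, lcoStep_tmul,
        Bialgebra.comul_mul]
      generalize l v = t
      generalize comul (R := k) a = s
      generalize comul (R := k) b = s'
      induction t with
      | zero => simp
      | add x y hx hy => simp only [TensorProduct.add_tmul, map_add, hx, hy]
      | tmul x v =>
        induction s with
        | zero => simp
        | add x y hx hy =>
          simp only [add_mul, TensorProduct.tmul_add, TensorProduct.add_tmul, map_add, hx, hy]
        | tmul a a' =>
          induction s' with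
          | zero => simp
          | add x y hx hy => simp only [mul_add, TensorProduct.tmul_add, map_add, hx, hy]
          | tmul b b' => simp [mul_assoc]
    rw [barStep, LinearMap.comp_add, LinearMap.comp_smul, hd, hm, LinearMap.lTensor_add,
      LinearMap.lTensor_smul, LinearMap.add_comp, LinearMap.smul_comp]
  rcolin := by
    have hd : rcoStep r ∘ₗ d.rTensor A = (d.rTensor A).rTensor A ∘ₗ rcoStep (rcoStep r) := by
      have h1 : ∀ t, (mixR k A V ∘ₗ (d.rTensor A).rTensor (A ⊗[k] A)) t =
          ((d.rTensor A).rTensor A ∘ₗ mixR k A (V ⊗[k] A)) t :=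
        apply_eq_of_fourfold _ _ fun x v y z => by simp
      ext v a b
      have h2 := LinearMap.congr_fun h.rcolin (v ⊗ₜ a)
      simp only [LinearMap.comp_apply] at h2
      refine Eq.trans ?_ (h1 (rcoStep r (v ⊗ₜ a) ⊗ₜ comul b))
      simp [h2]
    have hm : rcoStep r ∘ₗ (LinearMap.mul' k A).lTensor V ∘ₗ
        (TensorProduct.assoc k V A A).toLinearMap =
        ((LinearMap.mul' k A).lTensor V ∘ₗ (TensorProduct.assoc k V A A).toLinearMap).rTensor A ∘ₗ
          rcoStep (rcoStep r) := by
      ext v a b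
      simp only [TensorProduct.AlgebraTensorModule.curry_apply, LinearMap.restrictScalars_self,
        TensorProduct.curry_apply, LinearMap.comp_apply, LinearEquiv.coe_coe,
        TensorProduct.assoc_tmul, LinearMap.lTensor_tmul, LinearMap.mul'_apply, rcoStep_tmul,
        Bialgebra.comul_mul]
      generalize r v = t
      generalize comul (R := k) a = s
      generalize comul (R := k) b = s'
      induction t with
      | zero => simp
      | add x y hx hy => simp only [TensorProduct.add_tmul, map_add, hx, hy]
      | tmul x v =>
        induction s with
        | zero => simp
        | add x y hx hy =>
          simp only [add_mul, TensorProduct.tmul_add, TensorProduct.add_tmul, map_add, hx, hy]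
        | tmul a a' =>
          induction s' with
          | zero => simp
          | add x y hx hy => simp only [mul_add, TensorProduct.tmul_add, map_add, hx, hy]
          | tmul b b' => simp [mul_assoc]
    rw [barStep, LinearMap.comp_add, LinearMap.comp_smul, hd, hm, LinearMap.rTensor_add,
      LinearMap.rTensor_smul, LinearMap.add_comp, LinearMap.smul_comp]

/-- A map `e : W → A ⊗ W` which is compatible with both actions and with the right coaction. -/
structure IsCobarMap (ρ σ : A →ₗ[k] Module.End k W) (r : W →ₗ[k] W ⊗[k] A)
    (e : W →ₗ[k] A ⊗[k] W) : Prop where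
  llin : ∀ a, e ∘ₗ ρ a = diag (mulL k A) ρ a ∘ₗ e
  rlin : ∀ a, e ∘ₗ σ a = diag (mulR k A) σ a ∘ₗ e
  colin : ((TensorProduct.assoc k A W A).symm.toLinearMap ∘ₗ r.lTensor A) ∘ₗ e = e.rTensor A ∘ₗ r

variable (k A W) in
/-- `a ⊗ w ↦ ∑ a⁽¹⁾ ⊗ (a⁽²⁾ ⊗ w)` -/
noncomputable def comulT : A ⊗[k] W →ₗ[k] A ⊗[k] (A ⊗[k] W) :=
  (TensorProduct.assoc k A A W).toLinearMap ∘ₗ (comul (R := k) (A := A)).rTensor W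

theorem comulT_lact (ρ : A →ₗ[k] Module.End k W) (a : A) :
    comulT k A W ∘ₗ diag (mulL k A) ρ a =
      diag (mulL k A) (diag (mulL k A) ρ) a ∘ₗ comulT k A W := by
  have h := diag_natural (f := comul (R := k) (A := A)) (g := (LinearMap.id : W →ₗ[k] W))
    (ρ := mulL k A) (σ := ρ) (σ' := ρ) comul_mulL (fun _ => rfl) a
  rw [comulT, LinearMap.comp_assoc]
  erw [h]
  rw [← LinearMap.comp_assoc, diag_assoc]
  rfl

theorem comulT_ract (σ : A →ₗ[k] Module.End k W) (a : A) :
    comulT k A W ∘ₗ diag (mulR k A) σ a =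
      diag (mulR k A) (diag (mulR k A) σ) a ∘ₗ comulT k A W := by
  have h := diag_natural (f := comul (R := k) (A := A)) (g := (LinearMap.id : W →ₗ[k] W))
    (ρ := mulR k A) (σ := σ) (σ' := σ) comul_mulR (fun _ => rfl) a
  rw [comulT, LinearMap.comp_assoc]
  erw [h]
  rw [← LinearMap.comp_assoc, diag_assoc]
  rfl

theorem comulT_colin (r : W →ₗ[k] W ⊗[k] A) :
    ((TensorProduct.assoc k A (A ⊗[k] W) A).symm.toLinearMap ∘ₗ
      ((TensorProduct.assoc k A W A).symm.toLinearMap ∘ₗ r.lTensor A).lTensor A) ∘ₗ comulT k A W =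
      (comulT k A W).rTensor A ∘ₗ
        (TensorProduct.assoc k A W A).symm.toLinearMap ∘ₗ r.lTensor A := by
  ext a w
  simp only [comulT, TensorProduct.AlgebraTensorModule.curry_apply, LinearMap.restrictScalars_self,
    TensorProduct.curry_apply, LinearMap.comp_apply, LinearEquiv.coe_coe, LinearMap.lTensor_tmul,
    LinearMap.rTensor_tmul]
  trans ((TensorProduct.assoc k A A W).toLinearMap.rTensor A) ((TensorProduct.assoc k _ W A).symm
    ((comul (R := k) a) ⊗ₜ r w))
  · generalize comul (R := k) a = s
    induction s with
    | zero => simp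
    | add x y hx hy => simp only [TensorProduct.add_tmul, map_add, hx, hy]
    | tmul x y =>
      simp only [TensorProduct.assoc_tmul, LinearMap.lTensor_tmul, LinearMap.comp_apply,
        LinearEquiv.coe_coe]
      generalize r w = t
      induction t with
      | zero => simp
      | add x y hx hy => simp only [TensorProduct.tmul_add, map_add, hx, hy]
      | tmul x y => simp
  · generalize r w = t
    induction t with
    | zero => simp
    | add x y hx hy => simp only [TensorProduct.tmul_add, map_add, hx, hy]
    | tmul x y => simp

theorem comulT_lTensor {W' : Type u} [AddCommGroup W'] [Module k W'] (f : W →ₗ[k] W') :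
    comulT k A W' ∘ₗ f.lTensor A = (f.lTensor A).lTensor A ∘ₗ comulT k A W := by
  ext a w
  simp only [comulT, TensorProduct.AlgebraTensorModule.curry_apply, LinearMap.restrictScalars_self,
    TensorProduct.curry_apply, LinearMap.comp_apply, LinearEquiv.coe_coe, LinearMap.lTensor_tmul,
    LinearMap.rTensor_tmul]
  generalize comul (R := k) a = s
  induction s with
  | zero => simp
  | add x y hx hy => simp only [TensorProduct.add_tmul, map_add, hx, hy]
  | tmul x y => simp

theorem comulT_coassoc :
    comulT k A (A ⊗[k] W) ∘ₗ comulT k A W = (comulT k A W).lTensor A ∘ₗ comulT k A W := by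
  ext a w
  have h1 := coassoc_apply (R := k) a
  simp only [comulT, TensorProduct.AlgebraTensorModule.curry_apply, LinearMap.restrictScalars_self,
    TensorProduct.curry_apply, LinearMap.comp_apply, LinearEquiv.coe_coe, LinearMap.rTensor_tmul]
  let G : (A ⊗[k] (A ⊗[k] A)) →ₗ[k] A ⊗[k] (A ⊗[k] (A ⊗[k] W)) :=
    ((TensorProduct.assoc k A A W).toLinearMap ∘ₗ
      (TensorProduct.mk k (A ⊗[k] A) W).flip w).lTensor A
  trans G (TensorProduct.assoc k A A A (comul.rTensor A (comul a)))
  · generalize comul (R := k) a = s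
    induction s with
    | zero => simp
    | add x y hx hy => simp only [TensorProduct.add_tmul, map_add, hx, hy]
    | tmul x y =>
      simp only [TensorProduct.assoc_tmul, LinearMap.rTensor_tmul]
      generalize comul (R := k) x = s
      induction s with
      | zero => simp
      | add x y hx hy => simp only [TensorProduct.add_tmul, map_add, hx, hy]
      | tmul x y => simp [G]
  · rw [h1]
    generalize comul (R := k) a = s
    induction s with
    | zero => simp
    | add x y hx hy => simp only [TensorProduct.add_tmul, map_add, hx, hy]
    | tmul x y => simp [G]

theorem cobarStep_eq (e : W →ₗ[k] A ⊗[k] W) : cobarStep e = -comulT k A W - e.lTensor A := rfl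

/-- In the square, the terms with two comultiplications cancel by coassociativity. The mixed terms
cancel because Δ on the new factor commutes with `e` on the rest. What remains is 1 ⊗ (`cobarStep e`
∘ e), zero by hypothesis. -/
theorem cobarStep_comp_self {e : W →ₗ[k] A ⊗[k] W} (h : cobarStep e ∘ₗ e = 0) :
    cobarStep (cobarStep e) ∘ₗ cobarStep e = 0 := by
  have h2 : (cobarStep e).lTensor A ∘ₗ e.lTensor A = 0 := by
    rw [← LinearMap.lTensor_comp, h, LinearMap.lTensor_zero]
  have h3 : (cobarStep e).lTensor A = -(comulT k A W).lTensor A - (e.lTensor A).lTensor A := by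
    rw [cobarStep_eq, LinearMap.lTensor_sub, LinearMap.lTensor_neg]
  rw [cobarStep_eq (cobarStep e)]
  nth_rw 2 [cobarStep_eq e]
  rw [LinearMap.comp_sub, LinearMap.sub_comp, LinearMap.sub_comp, h2, LinearMap.comp_neg,
    LinearMap.comp_neg, LinearMap.neg_comp, LinearMap.neg_comp, comulT_coassoc, comulT_lTensor, h3,
    LinearMap.sub_comp, LinearMap.neg_comp]
  abel

/-- The two terms containing `e` once cancel, the two in which α follows a double coaction cancel by
coassociativity of `l`, and the term with a double differential on W is killed by `he`. -/
theorem homCobar_homCobar {l : V →ₗ[k] A ⊗[k] V} {e : W →ₗ[k] A ⊗[k] W}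
    (hl : (TensorProduct.assoc k A A V).toLinearMap ∘ₗ comul.rTensor V ∘ₗ l = l.lTensor A ∘ₗ l)
    (he : cobarStep e ∘ₗ e = 0) (α : V →ₗ[k] W) :
    homCobar l (cobarStep e) (homCobar l e α) = 0 := by
  have hl' : comulT k A V ∘ₗ l = l.lTensor A ∘ₗ l := hl
  change (α.lTensor A ∘ₗ l + e ∘ₗ α).lTensor A ∘ₗ l + cobarStep e ∘ₗ (α.lTensor A ∘ₗ l + e ∘ₗ α) = 0
  rw [LinearMap.comp_add, ← LinearMap.comp_assoc (f := α), he, LinearMap.zero_comp, add_zero,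
    cobarStep_eq, LinearMap.sub_comp, LinearMap.neg_comp, ← LinearMap.comp_assoc (f := l),
    comulT_lTensor, LinearMap.comp_assoc, hl', LinearMap.lTensor_add, LinearMap.lTensor_comp,
    LinearMap.lTensor_comp, LinearMap.add_comp]
  simp only [LinearMap.comp_assoc]
  abel

/-- `v ⊗ a ↦ α(v) a` -/
noncomputable def actR (σ : A →ₗ[k] Module.End k W) (α : V →ₗ[k] W) : V ⊗[k] A →ₗ[k] W :=
  TensorProduct.lift (σ.flip ∘ₗ α)

@[simp] theorem actR_tmul (σ : A →ₗ[k] Module.End k W) (α : V →ₗ[k] W) (v : V) (a : A) :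
    actR σ α (v ⊗ₜ a) = σ a (α v) := rfl

theorem homBar_eq (d : V ⊗[k] A →ₗ[k] V) (σ : A →ₗ[k] Module.End k W) (c : k) (α : V →ₗ[k] W) :
    homBar d σ c α = α ∘ₗ d + c • actR σ α := rfl

theorem homCobar_eq (l : V →ₗ[k] A ⊗[k] V) (e : W →ₗ[k] A ⊗[k] W) (α : V →ₗ[k] W) :
    homCobar l e α = α.lTensor A ∘ₗ l + e ∘ₗ α := rfl

/-- The double bar differential vanishes by `hd`. The terms α(d(v ⊗ a))b occur with the consecutive
signs (-1)^(q+1) and (-1)^(q+2), and α(v)(ab) cancels (α(v)a)b for the same reason. -/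
theorem homBar_homBar {d : V ⊗[k] A →ₗ[k] V} {σ : A →ₗ[k] Module.End k W} (q : ℕ)
    (hd : d ∘ₗ barStep d q = 0) (hσ : ∀ a b, σ (a * b) = σ b * σ a) (α : V →ₗ[k] W) :
    homBar (barStep d q) σ ((-1) ^ (q + 2)) (homBar d σ ((-1) ^ (q + 1)) α) = 0 := by
  ext v a b
  have h := congrArg α (LinearMap.congr_fun hd ((v ⊗ₜ a) ⊗ₜ b))
  simp only [LinearMap.comp_apply, LinearMap.zero_apply, map_zero] at h
  simp only [homBar_eq, TensorProduct.AlgebraTensorModule.curry_apply,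
    LinearMap.restrictScalars_self, TensorProduct.curry_apply, LinearMap.add_apply,
    LinearMap.comp_apply, LinearMap.smul_apply, h, LinearMap.zero_apply, actR_tmul, map_add]
  simp only [barStep, LinearMap.add_apply, LinearMap.rTensor_tmul, LinearMap.smul_apply,
    LinearMap.comp_apply, LinearEquiv.coe_coe, TensorProduct.assoc_tmul, LinearMap.lTensor_tmul,
    LinearMap.mul'_apply, map_add, map_smul, actR_tmul, hσ, Module.End.mul_apply]
  rcases neg_one_pow_eq_or k q with hq | hq <;> simp [pow_succ, hq]

/-- The diagonal right action on A ⊗ W multiplies v₍₋₁₎ by a⁽¹⁾ exactly as the codiagonal coaction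
of V ⊗ A does. It serves twice: for the anticommutation of d_h and d_c, and to transport a primitive
from W to A ⊗ W in the acyclicity argument. -/
theorem homBar_lTensor_comp {l : V →ₗ[k] A ⊗[k] V} {d : V ⊗[k] A →ₗ[k] V}
    (hd : l ∘ₗ d = d.lTensor A ∘ₗ lcoStep l) (σ : A →ₗ[k] Module.End k W) (c : k) (α : V →ₗ[k] W) :
    homBar d (diag (mulR k A) σ) c (α.lTensor A ∘ₗ l) =
      (homBar d σ c α).lTensor A ∘ₗ lcoStep l := by
  have h : actR (diag (mulR k A) σ) (α.lTensor A ∘ₗ l) = (actR σ α).lTensor A ∘ₗ lcoStep l := by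
    ext v a
    simp only [TensorProduct.AlgebraTensorModule.curry_apply, LinearMap.restrictScalars_self,
      TensorProduct.curry_apply, LinearMap.comp_apply, actR_tmul, lcoStep_tmul, diag_apply]
    conv_rhs => rw [← (ℛ k a).eq]
    generalize l v = t
    induction t with
    | zero => simp
    | add x y hx hy => simp only [TensorProduct.add_tmul, map_add, hx, hy]
    | tmul x y => simp [TensorProduct.tmul_sum]
  rw [homBar_eq, homBar_eq, h, LinearMap.comp_assoc, hd, LinearMap.lTensor_add,
    LinearMap.lTensor_smul, LinearMap.lTensor_comp, LinearMap.add_comp, LinearMap.smul_comp,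
    LinearMap.comp_assoc]

theorem homBar_comp_left {W' : Type u} [AddCommGroup W'] [Module k W'] (d : V ⊗[k] A →ₗ[k] V)
    {σ : A →ₗ[k] Module.End k W} {σ' : A →ₗ[k] Module.End k W'} {e : W →ₗ[k] W'}
    (he : ∀ a, e ∘ₗ σ a = σ' a ∘ₗ e) (c : k) (α : V →ₗ[k] W) :
    homBar d σ' c (e ∘ₗ α) = e ∘ₗ homBar d σ c α := by
  ext v a
  have h := LinearMap.congr_fun (he a) (α v)
  simp only [LinearMap.comp_apply] at h
  simp [homBar_eq, h]

theorem homBar_homCobar {l : V →ₗ[k] A ⊗[k] V} {d : V ⊗[k] A →ₗ[k] V}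
    (hd : l ∘ₗ d = d.lTensor A ∘ₗ lcoStep l) {σ : A →ₗ[k] Module.End k W} {e : W →ₗ[k] A ⊗[k] W}
    (he : ∀ a, e ∘ₗ σ a = diag (mulR k A) σ a ∘ₗ e) (c : k) (α : V →ₗ[k] W) :
    homBar d (diag (mulR k A) σ) c (homCobar l e α) =
      homCobar (lcoStep l) e (homBar d σ c α) := by
  rw [homCobar_eq, map_add, homBar_lTensor_comp hd, homBar_comp_left d he, homCobar_eq]

/-- Maps that are left `A`-linear and right `A`-colinear. -/
structure IsLRMap (ρ : A →ₗ[k] Module.End k V) (r : V →ₗ[k] V ⊗[k] A)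
    (ρ' : A →ₗ[k] Module.End k W) (r' : W →ₗ[k] W ⊗[k] A) (α : V →ₗ[k] W) : Prop where
  lin : ∀ a, α ∘ₗ ρ a = ρ' a ∘ₗ α
  colin : r' ∘ₗ α = α.rTensor A ∘ₗ r

theorem IsLRMap.comp {U : Type u} [AddCommGroup U] [Module k U] {ρ : A →ₗ[k] Module.End k V}
    {r : V →ₗ[k] V ⊗[k] A} {ρ' : A →ₗ[k] Module.End k W} {r' : W →ₗ[k] W ⊗[k] A}
    {ρ'' : A →ₗ[k] Module.End k U} {r'' : U →ₗ[k] U ⊗[k] A} {α : V →ₗ[k] W} {β : W →ₗ[k] U}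
    (hβ : IsLRMap ρ' r' ρ'' r'' β) (hα : IsLRMap ρ r ρ' r' α) : IsLRMap ρ r ρ'' r'' (β ∘ₗ α) where
  lin a := by
    rw [LinearMap.comp_assoc, hα.lin, ← LinearMap.comp_assoc, hβ.lin, LinearMap.comp_assoc]
  colin := by
    rw [← LinearMap.comp_assoc, hβ.colin, LinearMap.comp_assoc, hα.colin, LinearMap.rTensor_comp,
      LinearMap.comp_assoc]

theorem IsLRMap.add {ρ : A →ₗ[k] Module.End k V}
    {r : V →ₗ[k] V ⊗[k] A} {ρ' : A →ₗ[k] Module.End k W} {r' : W →ₗ[k] W ⊗[k] A} {α β : V →ₗ[k] W}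
    (hα : IsLRMap ρ r ρ' r' α) (hβ : IsLRMap ρ r ρ' r' β) : IsLRMap ρ r ρ' r' (α + β) where
  lin a := by rw [LinearMap.add_comp, LinearMap.comp_add, hα.lin, hβ.lin]
  colin := by rw [LinearMap.rTensor_add, LinearMap.add_comp, LinearMap.comp_add, hα.colin, hβ.colin]

theorem IsLRMap.smul {ρ : A →ₗ[k] Module.End k V}
    {r : V →ₗ[k] V ⊗[k] A} {ρ' : A →ₗ[k] Module.End k W} {r' : W →ₗ[k] W ⊗[k] A} {α : V →ₗ[k] W}
    (c : k) (hα : IsLRMap ρ r ρ' r' α) : IsLRMap ρ r ρ' r' (c • α) where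
  lin a := by rw [LinearMap.smul_comp, LinearMap.comp_smul, hα.lin]
  colin := by rw [LinearMap.rTensor_smul, LinearMap.smul_comp, LinearMap.comp_smul, hα.colin]

theorem IsLRMap.lTensor {ρ : A →ₗ[k] Module.End k V}
    {r : V →ₗ[k] V ⊗[k] A} {ρ' : A →ₗ[k] Module.End k W} {r' : W →ₗ[k] W ⊗[k] A} {α : V →ₗ[k] W}
    (hα : IsLRMap ρ r ρ' r' α) : IsLRMap (diag (mulL k A) ρ)
      ((TensorProduct.assoc k A V A).symm.toLinearMap ∘ₗ r.lTensor A) (diag (mulL k A) ρ')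
      ((TensorProduct.assoc k A W A).symm.toLinearMap ∘ₗ r'.lTensor A) (α.lTensor A) where
  lin a := diag_natural (f := LinearMap.id) (ρ := mulL k A) (ρ' := mulL k A) (fun _ => rfl)
      hα.lin a
  colin := by
    rw [LinearMap.comp_assoc, ← LinearMap.lTensor_comp, hα.colin]
    ext a w
    simp only [TensorProduct.AlgebraTensorModule.curry_apply, LinearMap.restrictScalars_self,
      TensorProduct.curry_apply, LinearMap.comp_apply, LinearEquiv.coe_coe,
      LinearMap.lTensor_tmul]
    generalize r w = t
    induction t with
    | zero => simp
    | add x y hx hy => simp only [TensorProduct.tmul_add, map_add, hx, hy]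
    | tmul x y => simp

/-- Right colinearity of the left coaction is the commutation of the two coactions. This keeps (1 ⊗
α)δ_L inside Hom_{A-}^{-A}. -/
theorem IsBi.isLRMap {ρ : A →ₗ[k] Module.End k V} {l : V →ₗ[k] A ⊗[k] V} {r : V →ₗ[k] V ⊗[k] A}
    (h : IsBi ρ l r) : IsLRMap ρ r (diag (mulL k A) ρ)
      ((TensorProduct.assoc k A V A).symm.toLinearMap ∘ₗ r.lTensor A) l where
  lin := h.lcompat
  colin := by
    rw [LinearMap.comp_assoc, ← h.lr, ← LinearMap.comp_assoc]
    ext v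
    simp

theorem IsCobarMap.isLRMap {ρ σ : A →ₗ[k] Module.End k W} {r : W →ₗ[k] W ⊗[k] A}
    {e : W →ₗ[k] A ⊗[k] W} (h : IsCobarMap ρ σ r e) : IsLRMap ρ r (diag (mulL k A) ρ)
      ((TensorProduct.assoc k A W A).symm.toLinearMap ∘ₗ r.lTensor A) e where
  lin := h.llin
  colin := h.colin

theorem isLRMap_comulT (ρ : A →ₗ[k] Module.End k W) (r : W →ₗ[k] W ⊗[k] A) :
    IsLRMap (diag (mulL k A) ρ) ((TensorProduct.assoc k A W A).symm.toLinearMap ∘ₗ r.lTensor A)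
      (diag (mulL k A) (diag (mulL k A) ρ))
      ((TensorProduct.assoc k A (A ⊗[k] W) A).symm.toLinearMap ∘ₗ
        ((TensorProduct.assoc k A W A).symm.toLinearMap ∘ₗ r.lTensor A).lTensor A)
      (comulT k A W) where
  lin := comulT_lact ρ
  colin := comulT_colin r

theorem IsCobarMap.step {ρ σ : A →ₗ[k] Module.End k W} {r : W →ₗ[k] W ⊗[k] A}
    {e : W →ₗ[k] A ⊗[k] W} (h : IsCobarMap ρ σ r e) :
    IsCobarMap (diag (mulL k A) ρ) (diag (mulR k A) σ)
      ((TensorProduct.assoc k A W A).symm.toLinearMap ∘ₗ r.lTensor A) (cobarStep e) := by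
  have he : cobarStep e = (-1 : k) • comulT k A W + (-1 : k) • e.lTensor A := by
    refine LinearMap.ext fun x => ?_
    simp [cobarStep_eq, sub_eq_add_neg]
  have hLR := ((isLRMap_comulT ρ r).smul (-1 : k)).add (h.isLRMap.lTensor.smul (-1 : k))
  rw [← he] at hLR
  refine ⟨hLR.lin, fun a => ?_, hLR.colin⟩
  have h1 := diag_natural (f := LinearMap.id) (ρ := mulR k A) (ρ' := mulR k A) (fun _ => rfl)
    h.rlin a
  rw [he, LinearMap.add_comp, LinearMap.smul_comp, comulT_ract, LinearMap.comp_add,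
    LinearMap.comp_smul, LinearMap.comp_smul, LinearMap.smul_comp]
  congr 2

theorem IsBarMap.isLRMap {ρ : A →ₗ[k] Module.End k V} {l : V →ₗ[k] A ⊗[k] V}
    {r : V →ₗ[k] V ⊗[k] A} {d : V ⊗[k] A →ₗ[k] V} (h : IsBarMap ρ l r d) :
    IsLRMap (LinearMap.rTensorHom A ∘ₗ ρ) (rcoStep r) ρ r d where
  lin := h.lin
  colin := h.rcolin

/-- Left linearity holds because the two actions on W commute, colinearity because the right
coaction of W is right linear and the codiagonal coaction of V ⊗ A imitates the diagonal action. -/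
theorem IsLRMap.actR {ρ : A →ₗ[k] Module.End k V}
    {r : V →ₗ[k] V ⊗[k] A} {ρ' σ' : A →ₗ[k] Module.End k W} {r' : W →ₗ[k] W ⊗[k] A}
    (hW : IsTri ρ' σ' r') {α : V →ₗ[k] W} (hα : IsLRMap ρ r ρ' r' α) :
    IsLRMap (LinearMap.rTensorHom A ∘ₗ ρ) (rcoStep r) ρ' r' (actR σ' α) where
  lin a := by
    ext v b
    have h1 := LinearMap.congr_fun (hα.lin a) v
    have h2 := LinearMap.congr_fun (hW.comm a b) (α v)
    simp only [LinearMap.comp_apply, Module.End.mul_apply] at h1 h2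
    simp [h1, h2]
  colin := by
    ext v a
    have h1 := LinearMap.congr_fun hα.colin v
    have h2 := LinearMap.congr_fun (hW.compat' a) (α v)
    simp only [LinearMap.comp_apply] at h1 h2
    simp only [TensorProduct.AlgebraTensorModule.curry_apply, LinearMap.restrictScalars_self,
      TensorProduct.curry_apply, LinearMap.comp_apply, actR_tmul, rcoStep_tmul, h2, h1]
    generalize r v = t
    rw [diag_apply]
    conv_rhs => rw [← (ℛ k a).eq]
    induction t with
    | zero => simp
    | add x y hx hy => simp only [TensorProduct.add_tmul, map_add, hx, hy]
    | tmul x y => simp [TensorProduct.tmul_sum]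

end Differentials
end HopfBimodCoh

namespace HopfBimodCoh
variable {k A : Type u} [Field k] [Ring A] [HopfAlgebra k A] [FiniteDimensional k A]

section Differentials

variable {V W : Type u} [AddCommGroup V] [Module k V] [AddCommGroup W] [Module k W]

/-- Tensoring the hypothesis with the last letter disposes of the double differential; the remaining
products of adjacent letters cancel because the signs alternate, the last two by associativity. -/
theorem barStep_comp_self {d : V ⊗[k] A →ₗ[k] V} {q : ℕ} (h : d ∘ₗ barStep d q = 0) :
    barStep d q ∘ₗ barStep (barStep d q) (q + 1) = 0 := by
  ext v a b c
  have h1 := congrArg (· ⊗ₜ[k] c) (LinearMap.congr_fun h ((v ⊗ₜ a) ⊗ₜ b))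
  simp only [barStep, LinearMap.comp_apply, LinearMap.add_apply, LinearMap.rTensor_tmul,
    LinearMap.smul_apply, LinearEquiv.coe_coe, TensorProduct.assoc_tmul, LinearMap.lTensor_tmul,
    LinearMap.mul'_apply, map_add, map_smul, LinearMap.zero_apply, TensorProduct.add_tmul,
    TensorProduct.zero_tmul] at h1
  -- The hypothesis becomes a rewriting rule for d(d(v ⊗ a) ⊗ b) ⊗ c.
  rw [add_eq_zero_iff_eq_neg, ← TensorProduct.smul_tmul'] at h1
  simp only [barStep, TensorProduct.AlgebraTensorModule.curry_apply,
    LinearMap.restrictScalars_self, TensorProduct.curry_apply, LinearMap.add_apply,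
    LinearMap.comp_apply, LinearMap.smul_apply, LinearMap.zero_apply, LinearMap.rTensor_tmul,
    LinearEquiv.coe_coe, TensorProduct.assoc_tmul, LinearMap.lTensor_tmul,
    LinearMap.mul'_apply, map_add, map_smul, TensorProduct.add_tmul, h1, ← TensorProduct.smul_tmul',
    smul_add, mul_assoc, smul_smul]
  rcases neg_one_pow_eq_or k q with hq | hq <;> simp [pow_succ, hq] <;> abel

theorem lift_comp_barStep {σ : A →ₗ[k] Module.End k V} (hσ : ∀ a b, σ (a * b) = σ b * σ a) :
    TensorProduct.lift σ.flip ∘ₗ barStep (TensorProduct.lift σ.flip) 0 = 0 := by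
  ext m a b
  simp [barStep, hσ]

theorem isBarMap_lift {ρ σ : A →ₗ[k] Module.End k V} {l : V →ₗ[k] A ⊗[k] V} {r : V →ₗ[k] V ⊗[k] A}
    (hc : ∀ a b, ρ a * σ b = σ b * ρ a) (hl : ∀ a, l ∘ₗ σ a = diag (mulR k A) σ a ∘ₗ l)
    (hr : ∀ a, r ∘ₗ σ a = diag σ (mulR k A) a ∘ₗ r) :
    IsBarMap ρ l r (TensorProduct.lift σ.flip) where
  lin a := by
    ext m b
    exact (LinearMap.congr_fun (hc a b) m).symm
  lcolin := by
    ext m a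
    refine (LinearMap.congr_fun (hl a) m).trans ?_
    change diag (mulR k A) σ a (l m) = (TensorProduct.lift σ.flip).lTensor A
      (mixL k A V (l m ⊗ₜ comul a))
    rw [diag_apply]
    conv_rhs => rw [← (ℛ k a).eq]
    generalize l m = t
    induction t with
    | zero => simp
    | add x y hx hy => simp only [TensorProduct.add_tmul, map_add, hx, hy]
    | tmul x y => simp [TensorProduct.tmul_sum]
  rcolin := by
    ext m a
    refine (LinearMap.congr_fun (hr a) m).trans ?_
    change diag σ (mulR k A) a (r m) = (TensorProduct.lift σ.flip).rTensor A
      (mixR k A V (r m ⊗ₜ comul a))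
    rw [diag_apply]
    conv_rhs => rw [← (ℛ k a).eq]
    generalize r m = t
    induction t with
    | zero => simp
    | add x y hx hy => simp only [TensorProduct.add_tmul, map_add, hx, hy]
    | tmul x y => simp [TensorProduct.tmul_sum]

theorem isCobarMap_neg {ρ σ : A →ₗ[k] Module.End k V} {l : V →ₗ[k] A ⊗[k] V}
    {r : V →ₗ[k] V ⊗[k] A} (h : IsBi ρ l r) (hl : ∀ a, l ∘ₗ σ a = diag (mulR k A) σ a ∘ₗ l) :
    IsCobarMap ρ σ r (-l) where
  llin a := by rw [LinearMap.neg_comp, LinearMap.comp_neg, h.lcompat]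
  rlin a := by rw [LinearMap.neg_comp, LinearMap.comp_neg, hl]
  colin := by
    have h1 := (h.isLRMap.smul (-1 : k)).colin
    rwa [show (-1 : k) • l = -l from LinearMap.ext fun x => by simp] at h1

theorem cobarStep_comp_neg {l : V →ₗ[k] A ⊗[k] V}
    (hl : (TensorProduct.assoc k A A V).toLinearMap ∘ₗ comul.rTensor V ∘ₗ l = l.lTensor A ∘ₗ l) :
    cobarStep (-l) ∘ₗ (-l) = 0 := by
  have hl' : comulT k A V ∘ₗ l = l.lTensor A ∘ₗ l := hl
  refine LinearMap.ext fun x => ?_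
  have h := LinearMap.congr_fun hl' x
  simp only [LinearMap.comp_apply] at h
  simp [cobarStep_eq, LinearMap.lTensor_neg, h]

theorem smul_homCobar_smul_homCobar {l : V →ₗ[k] A ⊗[k] V} {e : W →ₗ[k] A ⊗[k] W}
    (hl : (TensorProduct.assoc k A A V).toLinearMap ∘ₗ comul.rTensor V ∘ₗ l = l.lTensor A ∘ₗ l)
    (he : cobarStep e ∘ₗ e = 0) (b c : k) (α : V →ₗ[k] W) :
    (b • homCobar l (cobarStep e)) ((c • homCobar l e) α) = 0 := by
  simp [homCobar_homCobar hl he]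

/-- Without the factor (-1)^q the two differentials commute; as `homBar` raises q by one, this
factor turns commutation into anticommutation. -/
theorem homBar_smul_homCobar {l : V →ₗ[k] A ⊗[k] V} {d : V ⊗[k] A →ₗ[k] V}
    (hd : l ∘ₗ d = d.lTensor A ∘ₗ lcoStep l) {σ : A →ₗ[k] Module.End k W} {e : W →ₗ[k] A ⊗[k] W}
    (he : ∀ a, e ∘ₗ σ a = diag (mulR k A) σ a ∘ₗ e) (c : k) (q : ℕ) (α : V →ₗ[k] W) :
    homBar d (diag (mulR k A) σ) c (((-1 : k) ^ q • homCobar l e) α) =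
      -((-1 : k) ^ (q + 1) • homCobar (lcoStep l) e) (homBar d σ c α) := by
  rw [LinearMap.smul_apply, map_smul, homBar_homCobar hd he, LinearMap.smul_apply]
  refine LinearMap.ext fun x => ?_
  simp [pow_succ]

end Differentials

/-! ### The total complex -/

namespace HopfBimod

variable (M N : HopfBimod k A)

theorem isBarMap_barD : ∀ q, IsBarMap (M.barLact q) (M.barLco q) (M.barRco q) (M.barD q)
  | 0 => isBarMap_lift M.lact_ract M.lco_ract M.rco_ract
  | q + 1 => (isBarMap_barD q).step q

theorem barD_comp_barD : ∀ q, M.barD q ∘ₗ M.barD (q + 1) = 0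
  | 0 => lift_comp_barStep M.mul_ract
  | q + 1 => barStep_comp_self (barD_comp_barD q)

theorem isCobarMap_cobarD :
    ∀ p, IsCobarMap (N.cobarLact p) (N.cobarRact p) (N.cobarRco p) (N.cobarD p)
  | 0 => isCobarMap_neg (N.isBi_bar 0) N.lco_ract
  | p + 1 => (isCobarMap_cobarD p).step

theorem cobarStep_cobarD : ∀ p, cobarStep (N.cobarD p) ∘ₗ N.cobarD p = 0
  | 0 => cobarStep_comp_neg N.lco_coassoc
  | p + 1 => cobarStep_comp_self (cobarStep_cobarD p)

variable {M N}

theorem mem_K_iff {q p : ℕ} {α : M.bar q →ₗ[k] N.cobar p} :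
    α ∈ K M N q p ↔ IsLRMap (M.barLact q) (M.barRco q) (N.cobarLact p) (N.cobarRco p) α :=
  ⟨fun h => ⟨h.1, h.2⟩, fun h => ⟨h.1, h.2⟩⟩

theorem dh_mem_K {q p : ℕ} {α : M.bar q →ₗ[k] N.cobar p} (h : α ∈ K M N q p) :
    dh M N q p α ∈ K M N (q + 1) p := by
  rw [mem_K_iff] at h ⊢
  exact (h.comp (M.isBarMap_barD q).isLRMap).add ((h.actR (N.isTri_cobar p)).smul _)

theorem dc_mem_K {q p : ℕ} {α : M.bar q →ₗ[k] N.cobar p} (h : α ∈ K M N q p) :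
    dc M N q p α ∈ K M N q (p + 1) := by
  rw [mem_K_iff] at h ⊢
  exact ((h.lTensor.comp (M.isBi_bar q).isLRMap).add
    ((N.isCobarMap_cobarD p).isLRMap.comp h)).smul _

theorem dh_dh (q p : ℕ) (α : M.bar q →ₗ[k] N.cobar p) :
    dh M N (q + 1) p (dh M N q p α) = 0 :=
  homBar_homBar q (M.barD_comp_barD q) (N.isTri_cobar p).mul' α

theorem dc_dc (q p : ℕ) (α : M.bar q →ₗ[k] N.cobar p) :
    dc M N q (p + 1) (dc M N q p α) = 0 :=
  smul_homCobar_smul_homCobar (M.isBi_bar q).lcoassoc (N.cobarStep_cobarD p) _ _ α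

theorem dh_dc (q p : ℕ) (α : M.bar q →ₗ[k] N.cobar p) :
    dh M N q (p + 1) (dc M N q p α) = -dc M N (q + 1) p (dh M N q p α) :=
  homBar_smul_homCobar (M.isBarMap_barD q).lcolin (N.isCobarMap_cobarD p).rlin _ q α

theorem D_apply (f : Tot M N) (x : ℕ × ℕ) :
    D M N f x = dhTot M N x.1 x.2 f + dcTot M N x.1 x.2 f := rfl

theorem dhTot_succ (f : Tot M N) (q p : ℕ) : dhTot M N (q + 1) p f = dh M N q p (f (q, p)) := rfl
theorem dcTot_succ (f : Tot M N) (q p : ℕ) : dcTot M N q (p + 1) f = dc M N q p (f (q, p)) := rfl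
theorem dhTot_zero (f : Tot M N) (p : ℕ) : dhTot M N 0 p f = 0 := rfl
theorem dcTot_zero (f : Tot M N) (q : ℕ) : dcTot M N q 0 f = 0 := by cases q <;> rfl

theorem dh_dhTot (f : Tot M N) (q p : ℕ) : dh M N q p (dhTot M N q p f) = 0 := by
  cases q with
  | zero => rw [dhTot_zero, map_zero]
  | succ q => rw [dhTot_succ, dh_dh]

theorem dc_dcTot (f : Tot M N) (q p : ℕ) : dc M N q p (dcTot M N q p f) = 0 := by
  cases p with
  | zero => rw [dcTot_zero, map_zero]
  | succ p => rw [dcTot_succ, dc_dc]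

/-- Squares vanish and the two differentials anticommute. The four cases separate the edges of the
double complex, where one of the differentials has no source. -/
theorem D_D (f : Tot M N) : D M N (D M N f) = 0 := by
  funext ⟨q, p⟩
  rw [D_apply]
  rcases q with _ | q <;> rcases p with _ | p <;>
    simp only [dhTot_succ, dcTot_succ, dhTot_zero, dcTot_zero, D_apply, map_add, dh_dhTot,
      dc_dcTot, dh_dc, add_zero, zero_add, neg_add_cancel] <;> rfl

theorem D_mem_C {n : ℕ} {f : Tot M N} (hf : f ∈ C M N n) : D M N f ∈ C M N (n + 1) := by
  rintro ⟨q, p⟩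
  rw [D_apply]
  refine ⟨add_mem ?_ ?_, fun h => ?_⟩
  · rcases q with _ | q
    · exact zero_mem _
    · exact dh_mem_K (hf (q, p)).1
  · rcases p with _ | p
    · rw [dcTot_zero]; exact zero_mem _
    · exact dc_mem_K (hf (q, p)).1
  · have h1 : dhTot M N q p f = 0 := by
      rcases q with _ | q
      · rfl
      · rw [dhTot_succ, (hf (q, p)).2 (by dsimp at h ⊢; omega), map_zero]
    have h2 : dcTot M N q p f = 0 := by
      rcases p with _ | p
      · rw [dcTot_zero]
      · rw [dcTot_succ, (hf (q, p)).2 (by dsimp at h ⊢; omega), map_zero]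
    simp [h1, h2]

end HopfBimod
end HopfBimodCoh

namespace HopfBimodCoh
variable {k A : Type u} [Field k] [Ring A] [HopfAlgebra k A] [FiniteDimensional k A]

/-! ### Coinvariants of Hopf modules and exactness of Hom -/

section Averaging

variable {V W U : Type u} [AddCommGroup V] [Module k V] [AddCommGroup W] [Module k W]
  [AddCommGroup U] [Module k U]

/-- `v ↦ ∑ S⁻¹(v₍₁₎) v₍₀₎`, the projection of a Hopf module onto its coinvariants -/
noncomputable def coinvProj (ρ : A →ₗ[k] Module.End k V) (r : V →ₗ[k] V ⊗[k] A) : V →ₗ[k] V :=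
  TensorProduct.lift (ρ ∘ₗ antipodeInv k A).flip ∘ₗ r

theorem coinvProj_apply (ρ : A →ₗ[k] Module.End k V) (r : V →ₗ[k] V ⊗[k] A) (v : V) :
    coinvProj ρ r v = TensorProduct.lift (ρ ∘ₗ antipodeInv k A).flip (r v) := rfl

/-- `v ↦ ∑ v₍₁₎ π(h(π(v₍₀₎)))`, where `π` is the projection onto the coinvariants -/
noncomputable def average (ρ : A →ₗ[k] Module.End k V) (r : V →ₗ[k] V ⊗[k] A)
    (ρ' : A →ₗ[k] Module.End k W) (r' : W →ₗ[k] W ⊗[k] A) (h : V →ₗ[k] W) : V →ₗ[k] W :=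
  TensorProduct.lift ρ'.flip ∘ₗ (coinvProj ρ' r' ∘ₗ h ∘ₗ coinvProj ρ r).rTensor A ∘ₗ r

variable {ρ : A →ₗ[k] Module.End k V} {r : V →ₗ[k] V ⊗[k] A} {ρ' : A →ₗ[k] Module.End k W}
  {r' : W →ₗ[k] W ⊗[k] A} {ρ'' : A →ₗ[k] Module.End k U} {r'' : U →ₗ[k] U ⊗[k] A}

/-- π(av) = ∑ S⁻¹(v₍₁₎) S⁻¹(a⁽²⁾) a⁽¹⁾ v₍₀₎, and ∑ S⁻¹(a⁽²⁾) a⁽¹⁾ = ε(a). Because the action is on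
the left and the coaction on the right, it is S⁻¹ and not S that cancels here. -/
theorem coinvProj_lact (h : IsLR ρ r) (a : A) (v : V) :
    coinvProj ρ r (ρ a v) = counit (R := k) a • coinvProj ρ r v := by
  have h1 := LinearMap.congr_fun (h.compat a) v
  simp only [LinearMap.comp_apply] at h1
  rw [coinvProj_apply, h1, coinvProj_apply]
  generalize r v = t
  induction t with
  | zero => simp
  | add x y hx hy => simp only [map_add, hx, hy, smul_add]
  | tmul v x =>
    simp only [diag_apply, LinearMap.sum_apply, TensorProduct.map_tmul, map_sum,
      TensorProduct.lift.tmul, LinearMap.flip_apply, LinearMap.comp_apply, LinearMap.mul_apply',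
      antipodeInv_mul, h.mul, Module.End.mul_apply]
    simp only [← Module.End.mul_apply, ← h.mul]
    rw [← LinearMap.sum_apply, ← map_sum, ← Finset.mul_sum, sum_antipodeInv_mul]
    simp [Algebra.algebraMap_eq_smul_one]

variable (k A) in
/-- `x ⊗ y ⊗ z ↦ S⁻¹(y) x ⊗ z` -/
noncomputable def invMul : A ⊗[k] (A ⊗[k] A) →ₗ[k] A ⊗[k] A :=
  (LinearMap.mul' k A ∘ₗ (TensorProduct.comm k A A).toLinearMap ∘ₗ
    (antipodeInv k A).lTensor A).rTensor A ∘ₗ (TensorProduct.assoc k A A A).symm.toLinearMap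

theorem invMul_comul (a : A) : invMul k A (comul.lTensor A (comul a)) = 1 ⊗ₜ a := by
  rw [← coassoc_apply]
  rw [← (ℛ k a).eq]
  simp only [map_sum, LinearMap.rTensor_tmul, invMul, LinearMap.comp_apply, LinearEquiv.coe_coe,
    LinearEquiv.symm_apply_apply]
  conv_rhs => rw [← sum_counit_smul (ℛ k a), TensorProduct.tmul_sum]
  refine Finset.sum_congr rfl fun i _ => ?_
  have h := sum_antipodeInv_mul (k := k) ((ℛ k a).left i)
  conv_lhs => rw [← (ℛ k ((ℛ k a).left i)).eq]
  simp only [map_sum, LinearMap.lTensor_tmul, TensorProduct.comm_tmul, LinearMap.mul'_apply, h]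
  rw [Algebra.algebraMap_eq_smul_one, TensorProduct.smul_tmul]

/-- S⁻¹ reverses Δ, so that r(π(v)) = ∑ S⁻¹(v₍₃₎)v₍₀₎ ⊗ S⁻¹(v₍₂₎)v₍₁₎; `invMul_comul` collapses the
second leg to 1. -/
theorem coinvProj_coinv (h : IsLR ρ r) (v : V) :
    r (coinvProj ρ r v) = coinvProj ρ r v ⊗ₜ 1 := by
  let F : V ⊗[k] (A ⊗[k] A) →ₗ[k] V ⊗[k] A :=
    (TensorProduct.lift (ρ ∘ₗ antipodeInv k A).flip).rTensor A ∘ₗ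
      (TensorProduct.assoc k V A A).symm.toLinearMap ∘ₗ
      (TensorProduct.comm k A A).toLinearMap.lTensor V
  have hc := LinearMap.congr_fun h.coassoc v
  simp only [LinearMap.comp_apply, LinearEquiv.coe_coe] at hc
  have h1 : ∀ t : V ⊗[k] A, r (TensorProduct.lift (ρ ∘ₗ antipodeInv k A).flip t) =
      F ((invMul k A).lTensor V ((comul.lTensor A).lTensor V
        (TensorProduct.assoc k V A A (r.rTensor A t)))) := by
    intro t
    induction t with
    | zero => simp
    | add x y hx hy => simp only [map_add, hx, hy]
    | tmul v a =>
      have h2 := LinearMap.congr_fun (h.compat (antipodeInv k A a)) v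
      simp only [LinearMap.comp_apply] at h2
      simp only [TensorProduct.lift.tmul, LinearMap.flip_apply, LinearMap.comp_apply, h2,
        LinearMap.rTensor_tmul]
      generalize r v = s
      induction s with
      | zero => simp
      | add x y hx hy => simp only [TensorProduct.add_tmul, map_add, hx, hy]
      | tmul w x =>
        simp only [diag, LinearMap.comp_apply, comul_antipodeInv, TensorProduct.assoc_tmul,
          LinearMap.lTensor_tmul]
        rw [← (ℛ k a).eq]
        simp [F, invMul, TensorProduct.tmul_sum]
  have h3 : ∀ t : V ⊗[k] A, F ((invMul k A).lTensor V ((comul.lTensor A).lTensor V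
        (comul.lTensor V t))) = TensorProduct.lift (ρ ∘ₗ antipodeInv k A).flip t ⊗ₜ 1 := by
    intro t
    induction t with
    | zero => simp
    | add x y hx hy => simp only [map_add, hx, hy, TensorProduct.add_tmul]
    | tmul v a => simp [F, invMul_comul]
  rw [coinvProj_apply, h1, hc, h3]

theorem coinvProj_coinvProj (h : IsLR ρ r) (v : V) :
    coinvProj ρ r (coinvProj ρ r v) = coinvProj ρ r v := by
  rw [coinvProj_apply, coinvProj_coinv h]
  simp [antipodeInv_one, h.one]

/-- The left side is ∑ v₍₂₎ S⁻¹(v₍₁₎) v₍₀₎, which collapses by ∑ a⁽²⁾ S⁻¹(a⁽¹⁾) = ε(a). It is the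
half of the fundamental theorem of Hopf modules saying that the coinvariants generate V. -/
theorem lift_coinvProj (h : IsLR ρ r) (v : V) :
    TensorProduct.lift ρ.flip ((coinvProj ρ r).rTensor A (r v)) = v := by
  have hc := LinearMap.congr_fun h.coassoc v
  have he := LinearMap.congr_fun h.counit v
  simp only [LinearMap.comp_apply, LinearEquiv.coe_coe, LinearMap.id_apply] at hc he
  let F : V ⊗[k] (A ⊗[k] A) →ₗ[k] V := TensorProduct.lift ρ.flip ∘ₗ
    (LinearMap.mul' k A ∘ₗ (TensorProduct.comm k A A).toLinearMap ∘ₗ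
      (antipodeInv k A).rTensor A).lTensor V
  have h1 : ∀ t : V ⊗[k] A, TensorProduct.lift ρ.flip ((coinvProj ρ r).rTensor A t) =
      F (TensorProduct.assoc k V A A (r.rTensor A t)) := by
    intro t
    induction t with
    | zero => simp
    | add x y hx hy => simp only [map_add, hx, hy]
    | tmul v a =>
      simp only [LinearMap.rTensor_tmul, coinvProj_apply]
      generalize r v = s
      induction s with
      | zero => simp
      | add x y hx hy => simp only [TensorProduct.add_tmul, map_add, hx, hy]
      | tmul w x => simp [F, h.mul]
  have h2 : ∀ t : V ⊗[k] A, F (comul.lTensor V t) =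
      TensorProduct.rid k V (counit.lTensor V t) := by
    intro t
    induction t with
    | zero => simp
    | add x y hx hy => simp only [map_add, hx, hy]
    | tmul v a =>
      have h3 := sum_mul_antipodeInv (k := k) a
      simp only [LinearMap.lTensor_tmul, F, LinearMap.comp_apply]
      conv_lhs => rw [← (ℛ k a).eq]
      simp only [map_sum, LinearMap.rTensor_tmul, LinearEquiv.coe_coe, TensorProduct.comm_tmul,
        LinearMap.mul'_apply, h3]
      simp [Algebra.algebraMap_eq_smul_one, h.one]
  rw [h1, hc, h2, he]

/-- Under V = A ⊗ V^{co} the averaged map is 1 ⊗ πfπ, which is left linear and right colinear for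
any linear `f` whatever. -/
theorem isLRMap_average (h : IsLR ρ r) (h' : IsLR ρ' r') (f : V →ₗ[k] W) :
    IsLRMap ρ r ρ' r' (average ρ r ρ' r' f) where
  lin a := by
    ext v
    have h1 := LinearMap.congr_fun (h.compat a) v
    simp only [LinearMap.comp_apply] at h1
    simp only [average, LinearMap.comp_apply, h1]
    generalize r v = t
    induction t with
    | zero => simp
    | add x y hx hy => simp only [map_add, hx, hy]
    | tmul v x =>
      simp only [diag_apply, LinearMap.sum_apply, TensorProduct.map_tmul, map_sum,
        LinearMap.rTensor_tmul, LinearMap.comp_apply, coinvProj_lact h, map_smul,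
        TensorProduct.lift.tmul, LinearMap.flip_apply, LinearMap.mul_apply']
      conv_rhs => rw [← sum_counit_smul (ℛ k a)]
      simp [h'.mul]
  colin := by
    ext v
    have hc := LinearMap.congr_fun h.coassoc v
    simp only [LinearMap.comp_apply, LinearEquiv.coe_coe] at hc
    simp only [LinearMap.comp_apply]
    let F : V ⊗[k] (A ⊗[k] A) →ₗ[k] W ⊗[k] A :=
      (TensorProduct.lift (ρ'.flip ∘ₗ coinvProj ρ' r' ∘ₗ f ∘ₗ coinvProj ρ r)).rTensor A ∘ₗ
      (TensorProduct.assoc k V A A).symm.toLinearMap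
    have h1 : ∀ t : V ⊗[k] A, (average ρ r ρ' r' f).rTensor A t =
        F (TensorProduct.assoc k V A A (r.rTensor A t)) := by
      intro t
      induction t with
      | zero => simp
      | add x y hx hy => simp only [map_add, hx, hy]
      | tmul v a =>
        simp only [LinearMap.rTensor_tmul, average, LinearMap.comp_apply]
        generalize r v = s
        induction s with
        | zero => simp
        | add x y hx hy => simp only [TensorProduct.add_tmul, map_add, hx, hy]
        | tmul w x => simp [F]
    have h2 : ∀ t : V ⊗[k] A, r' (TensorProduct.lift ρ'.flip
        ((coinvProj ρ' r' ∘ₗ f ∘ₗ coinvProj ρ r).rTensor A t)) = F (comul.lTensor V t) := by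
      intro t
      induction t with
      | zero => simp
      | add x y hx hy => simp only [map_add, hx, hy]
      | tmul v a =>
        have h3 := LinearMap.congr_fun (h'.compat a) (coinvProj ρ' r' (f (coinvProj ρ r v)))
        simp only [LinearMap.comp_apply] at h3
        simp only [LinearMap.rTensor_tmul, LinearMap.comp_apply, TensorProduct.lift.tmul,
          LinearMap.flip_apply, h3, coinvProj_coinv h', diag_apply, LinearMap.lTensor_tmul]
        conv_rhs => rw [← (ℛ k a).eq]
        simp [F, TensorProduct.tmul_sum]
    rw [h1, hc, ← h2]
    rfl

theorem IsLRMap.map_coinvProj {f : V →ₗ[k] W} (hf : IsLRMap ρ r ρ' r' f) (v : V) :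
    f (coinvProj ρ r v) = coinvProj ρ' r' (f v) := by
  have h1 := LinearMap.congr_fun hf.colin v
  simp only [LinearMap.comp_apply] at h1
  rw [coinvProj_apply, coinvProj_apply, h1]
  generalize r v = t
  induction t with
  | zero => simp
  | add x y hx hy => simp only [map_add, hx, hy]
  | tmul v a =>
    have h2 := LinearMap.congr_fun (hf.lin (antipodeInv k A a)) v
    simpa using h2

/-- A Hopf module map commutes with π, hence preserves coinvariants, and it is determined by its
values there. -/
theorem average_eq_self (h : IsLR ρ r) (h' : IsLR ρ' r') {f : V →ₗ[k] W}
    (hf : IsLRMap ρ r ρ' r' f) : average ρ r ρ' r' f = f := by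
  have h1 : coinvProj ρ' r' ∘ₗ f ∘ₗ coinvProj ρ r = f ∘ₗ coinvProj ρ r := by
    ext v
    simp only [LinearMap.comp_apply, hf.map_coinvProj, coinvProj_coinvProj h']
  ext v
  rw [average, h1]
  have h2 : ∀ t : V ⊗[k] A, TensorProduct.lift ρ'.flip ((f ∘ₗ coinvProj ρ r).rTensor A t) =
      f (TensorProduct.lift ρ.flip ((coinvProj ρ r).rTensor A t)) := by
    intro t
    induction t with
    | zero => simp
    | add x y hx hy => simp only [map_add, hx, hy]
    | tmul v a =>
      have h2 := LinearMap.congr_fun (hf.lin a) (coinvProj ρ r v)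
      simpa using h2.symm
  simp only [LinearMap.comp_apply, h2, lift_coinvProj h]

theorem IsLRMap.comp_average {f : V →ₗ[k] W} {g : W →ₗ[k] U} (hg : IsLRMap ρ' r' ρ'' r'' g) :
    g ∘ₗ average ρ r ρ' r' f = average ρ r ρ'' r'' (g ∘ₗ f) := by
  ext v
  simp only [average, LinearMap.comp_apply]
  generalize r v = t
  induction t with
  | zero => simp
  | add x y hx hy => simp only [map_add, hx, hy]
  | tmul v a =>
    have h2 := LinearMap.congr_fun (hg.lin a) (coinvProj ρ' r' (f (coinvProj ρ r v)))
    simp only [LinearMap.comp_apply] at h2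
    simp [h2, hg.map_coinvProj]

/-- Compose `f` with a linear section of `g` and average: averaging commutes with composition by `g`
and fixes `f`. Every Hopf module is thus projective among Hopf modules. -/
theorem exists_lift (h : IsLR ρ r) (h' : IsLR ρ' r') (h'' : IsLR ρ'' r'') {g : W →ₗ[k] U}
    (hg : IsLRMap ρ' r' ρ'' r'' g) (hs : Function.Surjective g) {f : V →ₗ[k] U}
    (hf : IsLRMap ρ r ρ'' r'' f) : ∃ f' : V →ₗ[k] W, IsLRMap ρ r ρ' r' f' ∧ g ∘ₗ f' = f := by
  obtain ⟨s, hs⟩ := g.exists_rightInverse_of_surjective (LinearMap.range_eq_top.2 hs)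
  refine ⟨average ρ r ρ' r' (s ∘ₗ f), isLRMap_average h h' _, ?_⟩
  rw [hg.comp_average, ← LinearMap.comp_assoc, hs, LinearMap.id_comp, average_eq_self h h'' hf]

/-- Over a field, g ⊗ 1 is injective along with `g`, so both conditions on a Hopf module map can be
tested after composing with `g`. -/
theorem exists_factor {g : W →ₗ[k] U} (hg : IsLRMap ρ' r' ρ'' r'' g) (hi : Function.Injective g)
    {f : V →ₗ[k] U} (hf : IsLRMap ρ r ρ'' r'' f) (hr : ∀ v, f v ∈ LinearMap.range g) :
    ∃ f' : V →ₗ[k] W, IsLRMap ρ r ρ' r' f' ∧ g ∘ₗ f' = f := by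
  have he : g ∘ₗ (LinearEquiv.ofInjective g hi).symm.toLinearMap ∘ₗ
      f.codRestrict (LinearMap.range g) hr = f := by
    ext v
    exact congrArg Subtype.val ((LinearEquiv.ofInjective g hi).apply_symm_apply
      (f.codRestrict (LinearMap.range g) hr v))
  generalize (LinearEquiv.ofInjective g hi).symm.toLinearMap ∘ₗ
      f.codRestrict (LinearMap.range g) hr = f' at he
  subst he
  have hi' : Function.Injective (g.rTensor A) := Module.Flat.rTensor_preserves_injective_linearMap g hi
  refine ⟨f', ⟨fun a => ?_, ?_⟩, rfl⟩
  · ext v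
    apply hi
    have h1 := LinearMap.congr_fun (hf.lin a) v
    have h2 := LinearMap.congr_fun (hg.lin a) (f' v)
    exact h1.trans h2.symm
  · ext v
    apply hi'
    have h1 := LinearMap.congr_fun hf.colin v
    have h2 := LinearMap.congr_fun hg.colin (f' v)
    rw [LinearMap.rTensor_comp] at h1
    exact h2.symm.trans h1

end Averaging
end HopfBimodCoh

namespace HopfBimodCoh
variable {k A : Type u} [Field k] [Ring A] [HopfAlgebra k A] [FiniteDimensional k A]

/-! ### Change of coefficients and short exact sequences of complexes -/

section CobMap

variable {V W U : ModuleCat.{u} k}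

theorem cobMap_injective {φ : V →ₗ[k] W} (h : Function.Injective φ) :
    ∀ p, Function.Injective (cobMap (A := A) φ p)
  | 0 => h
  | p + 1 => Module.Flat.lTensor_preserves_injective_linearMap _ (cobMap_injective h p)

theorem cobMap_surjective {φ : V →ₗ[k] W} (h : Function.Surjective φ) :
    ∀ p, Function.Surjective (cobMap (A := A) φ p)
  | 0 => h
  | p + 1 => LinearMap.lTensor_surjective _ (cobMap_surjective h p)

theorem cobMap_exact {φ : V →ₗ[k] W} {ψ : W →ₗ[k] U} (h : Function.Exact φ ψ)
    (hs : Function.Surjective ψ) : ∀ p, Function.Exact (cobMap (A := A) φ p) (cobMap (A := A) ψ p)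
  | 0 => h
  | p + 1 => lTensor_exact A (cobMap_exact h hs p) (cobMap_surjective hs p)

theorem cobMap_comp (ψ : W →ₗ[k] U) (φ : V →ₗ[k] W) :
    ∀ p, cobMap (A := A) (V := V) (W := U) (ψ ∘ₗ φ) p = cobMap (A := A) ψ p ∘ₗ cobMap (A := A) φ p
  | 0 => rfl
  | p + 1 => (congrArg (LinearMap.lTensor A) (cobMap_comp ψ φ p)).trans (LinearMap.lTensor_comp _ _ _)

theorem cobMap_id : ∀ p, cobMap (A := A) (V := V) (W := V) LinearMap.id p = LinearMap.id
  | 0 => rfl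
  | p + 1 => (congrArg (LinearMap.lTensor A) (cobMap_id p)).trans (LinearMap.lTensor_id _ _)

theorem cobMap_add (φ ψ : V →ₗ[k] W) :
    ∀ p, cobMap (A := A) (V := V) (W := W) (φ + ψ) p = cobMap (A := A) φ p + cobMap (A := A) ψ p
  | 0 => rfl
  | p + 1 => (congrArg (LinearMap.lTensor A) (cobMap_add φ ψ p)).trans (LinearMap.lTensor_add _ _ _)

theorem cobMap_smul (c : k) (φ : V →ₗ[k] W) :
    ∀ p, cobMap (A := A) (V := V) (W := W) (c • φ) p = c • cobMap (A := A) φ p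
  | 0 => rfl
  | p + 1 => (congrArg (LinearMap.lTensor A) (cobMap_smul c φ p)).trans (LinearMap.lTensor_smul _ _ _)

end CobMap

section Unbundled

variable {V W W' : Type u} [AddCommGroup V] [Module k V] [AddCommGroup W] [Module k W]
  [AddCommGroup W'] [Module k W']

theorem cobarStep_lTensor {e : W →ₗ[k] A ⊗[k] W} {e' : W' →ₗ[k] A ⊗[k] W'} {φ : W →ₗ[k] W'}
    (h : e' ∘ₗ φ = φ.lTensor A ∘ₗ e) :
    cobarStep e' ∘ₗ φ.lTensor A = (φ.lTensor A).lTensor A ∘ₗ cobarStep e := by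
  rw [cobarStep_eq, cobarStep_eq, LinearMap.sub_comp, LinearMap.neg_comp, comulT_lTensor,
    ← LinearMap.lTensor_comp, h, LinearMap.comp_sub, LinearMap.comp_neg, LinearMap.lTensor_comp]

theorem smul_homCobar_comp (l : V →ₗ[k] A ⊗[k] V) {e : W →ₗ[k] A ⊗[k] W}
    {e' : W' →ₗ[k] A ⊗[k] W'} {φ : W →ₗ[k] W'} (h : e' ∘ₗ φ = φ.lTensor A ∘ₗ e) (c : k)
    (α : V →ₗ[k] W) :
    (c • homCobar l e') (φ ∘ₗ α) = φ.lTensor A ∘ₗ (c • homCobar l e) α := by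
  rw [LinearMap.smul_apply, LinearMap.smul_apply, homCobar_eq, homCobar_eq, LinearMap.comp_smul,
    LinearMap.comp_add, ← LinearMap.comp_assoc, h, LinearMap.lTensor_comp]
  rfl

theorem lTensor_diag {τ : A →ₗ[k] Module.End k A} {σ : A →ₗ[k] Module.End k W}
    {σ' : A →ₗ[k] Module.End k W'} {φ : W →ₗ[k] W'} (h : ∀ a, φ ∘ₗ σ a = σ' a ∘ₗ φ) (a : A) :
    φ.lTensor A ∘ₗ diag τ σ a = diag τ σ' a ∘ₗ φ.lTensor A :=
  diag_natural (f := LinearMap.id) (fun _ => rfl) h a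

end Unbundled

namespace HopfBimod

variable {M N N' N'' : HopfBimod k A}

/-- `1^{⊗ p} ⊗ u` -/
noncomputable abbrev cobarMap (u : Hom N N') (p : ℕ) : N.cobar p →ₗ[k] N'.cobar p :=
  cobMap (A := A) (V := ModuleCat.of k N.carrier) (W := ModuleCat.of k N'.carrier) u.toLin p

theorem isLRMap_cobarMap (u : Hom N N') :
    ∀ p, IsLRMap (N.cobarLact p) (N.cobarRco p) (N'.cobarLact p) (N'.cobarRco p) (cobarMap u p)
  | 0 => ⟨u.map_lact, u.map_rco⟩
  | p + 1 => (isLRMap_cobarMap u p).lTensor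

theorem cobarMap_ract (u : Hom N N') :
    ∀ p a, cobarMap u p ∘ₗ N.cobarRact p a = N'.cobarRact p a ∘ₗ cobarMap u p
  | 0 => u.map_ract
  | p + 1 => lTensor_diag (cobarMap_ract u p)

theorem cobarD_cobarMap (u : Hom N N') :
    ∀ p, N'.cobarD p ∘ₗ cobarMap u p = (cobarMap u p).lTensor A ∘ₗ N.cobarD p
  | 0 => by
    refine LinearMap.ext fun n => ?_
    have h := congrArg Neg.neg (LinearMap.congr_fun u.map_lco n)
    exact h.trans (map_neg (u.toLin.lTensor A) (N.lco n)).symm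
  | p + 1 => cobarStep_lTensor (cobarD_cobarMap u p)

theorem push_apply (u : Hom N N') (f : Tot M N) (x : ℕ × ℕ) :
    push M u f x = cobarMap u x.2 ∘ₗ f x := rfl

theorem dh_push (u : Hom N N') (q p : ℕ) (α : M.bar q →ₗ[k] N.cobar p) :
    dh M N' q p (cobarMap u p ∘ₗ α) = cobarMap u p ∘ₗ dh M N q p α :=
  homBar_comp_left _ (cobarMap_ract u p) _ α

theorem dc_push (u : Hom N N') (q p : ℕ) (α : M.bar q →ₗ[k] N.cobar p) :
    dc M N' q p (cobarMap u p ∘ₗ α) = cobarMap u (p + 1) ∘ₗ dc M N q p α :=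
  smul_homCobar_comp (M.barLco q) (cobarD_cobarMap u p) _ α

theorem D_push (u : Hom N N') (f : Tot M N) : D M N' (push M u f) = push M u (D M N f) := by
  funext ⟨q, p⟩
  rw [push_apply, D_apply, D_apply, LinearMap.comp_add]
  congr 1
  · rcases q with _ | q
    · rw [dhTot_zero, dhTot_zero, LinearMap.comp_zero]
    · exact dh_push u q p _
  · rcases p with _ | p
    · rw [dcTot_zero, dcTot_zero, LinearMap.comp_zero]
    · exact dc_push u q p _

theorem push_mem_C (u : Hom N N') {n : ℕ} {f : Tot M N} (hf : f ∈ C M N n) :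
    push M u f ∈ C M N' n := fun x => by
  refine ⟨?_, fun h => ?_⟩
  · rw [push_apply, mem_K_iff]
    exact (isLRMap_cobarMap u x.2).comp (mem_K_iff.1 (hf x).1)
  · rw [push_apply, (hf x).2 h, LinearMap.comp_zero]

theorem mem_Z_iff {n : ℕ} {f : Tot M N} : f ∈ Z M N n ↔ f ∈ C M N n ∧ D M N f = 0 := Iff.rfl

theorem push_mem_Z (u : Hom N N') {n : ℕ} {f : Tot M N} (hf : f ∈ Z M N n) :
    push M u f ∈ Z M N' n :=
  mem_Z_iff.2 ⟨push_mem_C u hf.1, by rw [D_push, (mem_Z_iff.1 hf).2, map_zero]⟩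

theorem push_injective {u : Hom N N'} (h : Function.Injective u.toLin) :
    Function.Injective (push M u) := fun f g hfg => by
  funext x
  refine LinearMap.ext fun v => cobMap_injective (A := A) (V := ModuleCat.of k N.carrier)
    (W := ModuleCat.of k N'.carrier) h x.2 ?_
  exact LinearMap.congr_fun (congrFun hfg x) v

/-- `exists_lift` in each component. With `exists_of_push_eq_zero` and `push_injective` it makes the
cochains an exact functor of the coefficients, which is what the connecting homomorphism rests on.
-/
theorem exists_push_eq {u : Hom N N'} (h : Function.Surjective u.toLin) {n : ℕ} {f : Tot M N'}
    (hf : f ∈ C M N' n) : ∃ g ∈ C M N n, push M u g = f := by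
  have h1 : ∀ x : ℕ × ℕ, ∃ β : M.bar x.1 →ₗ[k] N.cobar x.2,
      (β ∈ K M N x.1 x.2 ∧ (x.1 + x.2 ≠ n → β = 0)) ∧ cobarMap u x.2 ∘ₗ β = f x := fun x => by
    -- Off the diagonal q + p = n the lift has to be chosen zero, as membership in `C` demands.
    by_cases hx : x.1 + x.2 = n
    · obtain ⟨β, hβ, h2⟩ := exists_lift (M.isBi_bar x.1).toIsLR (N.isTri_cobar x.2).toIsLR
        (N'.isTri_cobar x.2).toIsLR (isLRMap_cobarMap u x.2)
        (cobMap_surjective (A := A) (V := ModuleCat.of k N.carrier)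
          (W := ModuleCat.of k N'.carrier) h x.2) (mem_K_iff.1 (hf x).1)
      exact ⟨β, ⟨mem_K_iff.2 hβ, fun h3 => absurd hx h3⟩, h2⟩
    · exact ⟨0, ⟨zero_mem _, fun _ => rfl⟩, by rw [LinearMap.comp_zero, (hf x).2 hx]⟩
  choose g hg hgf using h1
  exact ⟨g, hg, funext hgf⟩

namespace SES

variable (S : SES N' N N'')

theorem push_push (f : Tot M N') : push M S.p (push M S.i f) = 0 := by
  funext x
  refine LinearMap.ext fun v => ?_
  exact (cobMap_exact (A := A) (V := ModuleCat.of k N'.carrier) (W := ModuleCat.of k N.carrier)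
    (U := ModuleCat.of k N''.carrier) S.exact S.surj x.2).apply_apply_eq_zero (f x v)

/-- Exactness of A^{⊗p} ⊗ - puts the values of `f` into the image of N', and `exists_factor` shows
that the resulting map is again a Hopf module map. -/
theorem exists_of_push_eq_zero {n : ℕ} {f : Tot M N} (hf : f ∈ C M N n) (h : push M S.p f = 0) :
    ∃ g ∈ C M N' n, push M S.i g = f := by
  have h1 : ∀ x : ℕ × ℕ, ∃ β : M.bar x.1 →ₗ[k] N'.cobar x.2,
      (β ∈ K M N' x.1 x.2 ∧ (x.1 + x.2 ≠ n → β = 0)) ∧ cobarMap S.i x.2 ∘ₗ β = f x := fun x => by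
    by_cases hx : x.1 + x.2 = n
    · obtain ⟨β, hβ, h2⟩ := exists_factor (isLRMap_cobarMap S.i x.2)
        (cobMap_injective (A := A) (V := ModuleCat.of k N'.carrier)
          (W := ModuleCat.of k N.carrier) S.inj x.2) (mem_K_iff.1 (hf x).1)
          (fun v => ((cobMap_exact (A := A) (V := ModuleCat.of k N'.carrier)
            (W := ModuleCat.of k N.carrier) (U := ModuleCat.of k N''.carrier)
            S.exact S.surj x.2) (f x v)).1 (LinearMap.congr_fun (congrFun h x) v))
      exact ⟨β, ⟨mem_K_iff.2 hβ, fun h3 => absurd hx h3⟩, h2⟩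
    · exact ⟨0, ⟨zero_mem _, fun _ => rfl⟩, by rw [LinearMap.comp_zero, (hf x).2 hx]⟩
  choose g hg hgf using h1
  exact ⟨g, hg, funext hgf⟩

/-- The differential of a cochain which maps to a cocycle comes from a cocycle. -/
theorem exists_connecting {n : ℕ} {c : Tot M N} (hc : c ∈ C M N n)
    (h : D M N'' (push M S.p c) = 0) : ∃ f ∈ Z M N' (n + 1), D M N c = push M S.i f := by
  obtain ⟨f, hf, hfc⟩ := S.exists_of_push_eq_zero (D_mem_C hc) (by rw [← D_push, h])
  refine ⟨f, ⟨hf, ?_⟩, hfc.symm⟩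
  refine push_injective (M := M) S.inj ?_
  rw [← D_push, hfc, D_D, map_zero]

end SES

theorem B_succ (n : ℕ) : B M N (n + 1) = (C M N n).map (D M N) := rfl

theorem cls_eq_zero_iff {n : ℕ} (f : Z M N n) : cls f = 0 ↔ (f : Tot M N) ∈ B M N n := by
  rw [cls, Submodule.Quotient.mk_eq_zero]
  rfl

theorem cls_eq_iff {n : ℕ} (f g : Z M N n) :
    cls f = cls g ↔ (f : Tot M N) - (g : Tot M N) ∈ B M N n := by
  rw [cls, cls, Submodule.Quotient.eq]
  rfl

theorem cls_surjective {n : ℕ} (x : HA4 M N n) : ∃ f : Z M N n, cls f = x :=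
  Submodule.Quotient.mk_surjective _ x

/-- If the connecting homomorphism sends the class of `p(c)` to zero, then `c` is the sum of a
cocycle and of a cochain of `N'`. -/
theorem SES.exists_cocycle (S : SES N' N N'') {n : ℕ} {c : Tot M N} (hc : c ∈ C M N n)
    {f : Z M N' (n + 1)} (h : D M N c = push M S.i f) (hf : cls f = 0) :
    ∃ g ∈ Z M N n, push M S.p g = push M S.p c := by
  rw [cls_eq_zero_iff, B_succ] at hf
  obtain ⟨b, hb, hbf⟩ := hf
  refine ⟨c - push M S.i b, mem_Z_iff.2 ⟨sub_mem hc (push_mem_C _ hb), ?_⟩, ?_⟩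
  · rw [map_sub, D_push, hbf, h, sub_self]
  · rw [map_sub, S.push_push, sub_zero]

/-- The connecting homomorphism sends the class of `p(c)` to zero, if `p(c)` is cohomologous to
the image of a cocycle of `N`. -/
theorem SES.cls_eq_zero (S : SES N' N N'') {n : ℕ} {c g : Tot M N} (hc : c ∈ C M N n)
    {f : Z M N' (n + 1)} (h : D M N c = push M S.i f) (hg : g ∈ Z M N n)
    (hgc : push M S.p c - push M S.p g ∈ B M N'' n) : cls f = 0 := by
  -- The coboundary p(c) − p(g) lifts to a cocycle b of N: zero in degree 0, and otherwise the
  -- differential of a lift of a primitive. Then c − g − b comes from N' and has the same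
  -- differential as c.
  obtain ⟨b, hb, hbD, hbp⟩ : ∃ b ∈ C M N n, D M N b = 0 ∧
      push M S.p b = push M S.p c - push M S.p g := by
    cases n with
    | zero => exact ⟨0, zero_mem _, map_zero _, (map_zero _).trans ((Submodule.mem_bot k).1 hgc).symm⟩
    | succ n =>
      obtain ⟨b', hb', hbD⟩ := hgc
      obtain ⟨b, hb, rfl⟩ := exists_push_eq S.surj hb'
      exact ⟨D M N b, D_mem_C hb, D_D b, by rw [← D_push, hbD]⟩
  obtain ⟨e, he, hei⟩ := S.exists_of_push_eq_zero (f := c - g - b)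
    (sub_mem (sub_mem hc hg.1) hb) (by rw [map_sub, map_sub, hbp, sub_self])
  rw [cls_eq_zero_iff, B_succ]
  refine ⟨e, he, push_injective (M := M) S.inj ?_⟩
  rw [← D_push, hei, map_sub, map_sub, h, (mem_Z_iff.1 hg).2, hbD, sub_zero, sub_zero]

end HopfBimod
end HopfBimodCoh

namespace HopfBimodCoh
variable {k A : Type u} [Field k] [Ring A] [HopfAlgebra k A] [FiniteDimensional k A]

/-! ### From X-modules back to Hopf bimodules -/

section Contraction

variable {V W : Type u} [AddCommGroup V] [Module k V] [AddCommGroup W] [Module k W]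

/-- `a ⊗ v ↦ l(a) v` -/
noncomputable def contrL (l : Module.Dual k A) : A ⊗[k] V →ₗ[k] V :=
  TensorProduct.lid k V ∘ₗ l.rTensor V

/-- `v ⊗ a ↦ l(a) v` -/
noncomputable def contrR (l : Module.Dual k A) : V ⊗[k] A →ₗ[k] V :=
  TensorProduct.rid k V ∘ₗ l.lTensor V

@[simp] theorem contrL_tmul (l : Module.Dual k A) (a : A) (v : V) :
    contrL l (a ⊗ₜ v) = l a • v := by simp [contrL]

@[simp] theorem contrR_tmul (l : Module.Dual k A) (a : A) (v : V) :
    contrR l (v ⊗ₜ a) = l a • v := by simp [contrR]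

/-- `v ↦ ∑ eᵢ ⊗ λ(eᵢ^*) v` -/
noncomputable def coactL (lam : Module.Dual k A →ₗ[k] Module.End k V) : V →ₗ[k] A ⊗[k] V :=
  ∑ i, TensorProduct.mk k A V (Module.finBasis k A i) ∘ₗ lam ((Module.finBasis k A).coord i)

/-- `v ↦ ∑ κ(eᵢ^*) v ⊗ eᵢ` -/
noncomputable def coactR (kap : Module.Dual k A →ₗ[k] Module.End k V) : V →ₗ[k] V ⊗[k] A :=
  ∑ i, (TensorProduct.mk k V A).flip (Module.finBasis k A i) ∘ₗ kap ((Module.finBasis k A).coord i)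

theorem sum_dual_coord (l : Module.Dual k A) :
    ∑ i, l (Module.finBasis k A i) • (Module.finBasis k A).coord i = l := by
  refine (Module.finBasis k A).ext fun j => ?_
  simp

/-- Expansion of l in the dual basis. In finite dimension an action of the dual thus carries the
same information as a coaction. -/
theorem contrL_coactL (lam : Module.Dual k A →ₗ[k] Module.End k V) (l : Module.Dual k A) (v : V) :
    contrL l (coactL lam v) = lam l v := by
  have h := congrArg (fun l => lam l v) (sum_dual_coord l)
  simp only [map_sum, map_smul, LinearMap.sum_apply, LinearMap.smul_apply] at h
  rw [← h]
  simp [coactL]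

theorem contrR_coactR (kap : Module.Dual k A →ₗ[k] Module.End k V) (l : Module.Dual k A) (v : V) :
    contrR l (coactR kap v) = kap l v := by
  have h := congrArg (fun l => kap l v) (sum_dual_coord l)
  simp only [map_sum, map_smul, LinearMap.sum_apply, LinearMap.smul_apply] at h
  rw [← h]
  simp [coactR]

/-- The dual basis recovers t from its contractions. The comodule axioms below are checked by
contracting, which turns them into operator identities among `lam`, `kap`, `al` and `be`. -/
theorem eq_of_contrL {t t' : A ⊗[k] V} (h : ∀ l, contrL l t = contrL l t') : t = t' := by
  have h1 : ∀ t : A ⊗[k] V, t = ∑ i, Module.finBasis k A i ⊗ₜ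
      contrL ((Module.finBasis k A).coord i) t := by
    intro t
    induction t with
    | zero => simp
    | add x y hx hy =>
      simp only [map_add, TensorProduct.tmul_add, Finset.sum_add_distrib]
      rw [← hx, ← hy]
    | tmul a v =>
      have h := congrArg (· ⊗ₜ[k] v) ((Module.finBasis k A).sum_repr a)
      simp only [TensorProduct.sum_tmul, TensorProduct.smul_tmul] at h
      simp only [contrL_tmul, Module.Basis.coord_apply]
      exact h.symm
  rw [h1 t, h1 t']
  simp only [h]

theorem eq_of_contrR {t t' : V ⊗[k] A} (h : ∀ l, contrR l t = contrR l t') : t = t' := by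
  apply (TensorProduct.comm k V A).injective
  refine eq_of_contrL fun l => ?_
  have h1 : ∀ t : V ⊗[k] A, contrL l (TensorProduct.comm k V A t) = contrR l t := fun t => by
    induction t with
    | zero => simp
    | add x y hx hy => simp only [map_add, hx, hy]
    | tmul a v => simp
  rw [h1, h1, h]

theorem contrL_lTensor (l : Module.Dual k A) (f : V →ₗ[k] W) (t : A ⊗[k] V) :
    contrL l (f.lTensor A t) = f (contrL l t) := by
  induction t with
  | zero => simp
  | add x y hx hy => simp only [map_add, hx, hy]
  | tmul a v => simp

theorem contrR_rTensor (l : Module.Dual k A) (f : V →ₗ[k] W) (t : V ⊗[k] A) :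
    contrR l (f.rTensor A t) = f (contrR l t) := by
  induction t with
  | zero => simp
  | add x y hx hy => simp only [map_add, hx, hy]
  | tmul a v => simp

theorem contrL_comul (l l' : Module.Dual k A) (t : A ⊗[k] V) :
    contrL l' (contrL l (TensorProduct.assoc k A A V (comul.rTensor V t))) =
      contrL (dualMul k A l l') t := by
  induction t with
  | zero => simp
  | add x y hx hy => simp only [map_add, hx, hy]
  | tmul a v =>
    rw [LinearMap.rTensor_tmul, ← (ℛ k a).eq]
    simp [TensorProduct.sum_tmul, dualMul_apply, smul_smul, Finset.sum_smul]

theorem contrR_comul (l l' : Module.Dual k A) (t : V ⊗[k] A) :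
    contrR l (contrR l' ((TensorProduct.assoc k V A A).symm (comul.lTensor V t))) =
      contrR (dualMul k A l l') t := by
  induction t with
  | zero => simp
  | add x y hx hy => simp only [map_add, hx, hy]
  | tmul v a =>
    rw [LinearMap.lTensor_tmul, ← (ℛ k a).eq]
    simp [TensorProduct.tmul_sum, dualMul_apply, smul_smul, mul_comm, Finset.sum_smul]

theorem contrL_diag (σ : A →ₗ[k] Module.End k A) (ρ : A →ₗ[k] Module.End k V)
    (T : A →ₗ[k] Module.End k (Module.Dual k A)) (hT : ∀ a l x, T a l x = l (σ a x))
    (l : Module.Dual k A) (a : A) (t : A ⊗[k] V) : contrL l (diag σ ρ a t) =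
    ∑ i ∈ (ℛ k a).index, ρ ((ℛ k a).right i) (contrL (T ((ℛ k a).left i) l) t) := by
  rw [diag_apply, LinearMap.sum_apply, map_sum]
  refine Finset.sum_congr rfl fun i _ => ?_
  induction t with
  | zero => simp
  | add x y hx hy => simp only [map_add, hx, hy]
  | tmul a v => simp [hT]

theorem contrR_diag (σ : A →ₗ[k] Module.End k A) (ρ : A →ₗ[k] Module.End k V)
    (T : A →ₗ[k] Module.End k (Module.Dual k A)) (hT : ∀ a l x, T a l x = l (σ a x))
    (l : Module.Dual k A) (a : A) (t : V ⊗[k] A) : contrR l (diag ρ σ a t) =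
    ∑ i ∈ (ℛ k a).index, ρ ((ℛ k a).left i) (contrR (T ((ℛ k a).right i) l) t) := by
  rw [diag_apply, LinearMap.sum_apply, map_sum]
  refine Finset.sum_congr rfl fun i _ => ?_
  induction t with
  | zero => simp
  | add x y hx hy => simp only [map_add, hx, hy]
  | tmul a v => simp [hT]

end Contraction

section Exchange

variable {R : Type u} [Ring R] [Algebra k R]

/-- Converse of `al_lam_of` and `be_lam_of`: after substitution of the given rule, coassociativity
brings S(a⁽²⁾) next to a⁽¹⁾ and `hT` cancels the pair. The maps `T` and `S` stay abstract because,
for `lam`, left translation goes with the antipode and right translation with its inverse. -/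
theorem exchange_fwd (lam : Module.Dual k A →ₗ[k] R) (al : A →ₗ[k] R)
    (T : A →ₗ[k] Module.End k (Module.Dual k A)) (S : A →ₗ[k] A)
    (hT : ∀ a, ∑ i ∈ (ℛ k a).index, T (S ((ℛ k a).right i)) * T ((ℛ k a).left i) =
      counit (R := k) a • 1)
    (h : ∀ a l, al a * lam l = ∑ i ∈ (ℛ k a).index,
      lam (T (S ((ℛ k a).left i)) l) * al ((ℛ k a).right i)) (a : A) (l : Module.Dual k A) :
    lam l * al a = ∑ i ∈ (ℛ k a).index, al ((ℛ k a).right i) * lam (T ((ℛ k a).left i) l) := by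
  let F : A ⊗[k] (A ⊗[k] A) →ₗ[k] R := LinearMap.mul' k R ∘ₗ
    TensorProduct.map (lam ∘ₗ LinearMap.applyₗ (R := k) l ∘ₗ LinearMap.mul' k _ ∘ₗ
      (TensorProduct.comm k _ _).toLinearMap ∘ₗ TensorProduct.map T (T ∘ₗ S)) al ∘ₗ
      (TensorProduct.assoc k A A A).symm.toLinearMap
  have hF := tri_coassoc F a
  simp only [F, LinearMap.comp_apply, LinearEquiv.coe_coe, TensorProduct.assoc_symm_tmul,
    TensorProduct.map_tmul, TensorProduct.comm_tmul, LinearMap.mul'_apply,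
    LinearMap.applyₗ_apply_apply] at hF
  simp only [h]
  simp only [← Module.End.mul_apply]
  rw [← hF]
  simp only [← Finset.sum_mul, ← map_sum, ← LinearMap.sum_apply, hT]
  simp only [LinearMap.smul_apply, map_smul, Module.End.one_apply, smul_mul_assoc,
    ← mul_smul_comm, ← Finset.mul_sum]
  simp only [← map_smul, ← map_sum, sum_counit_smul]

theorem exchange_rev (kap : Module.Dual k A →ₗ[k] R) (al : A →ₗ[k] R)
    (T : A →ₗ[k] Module.End k (Module.Dual k A)) (S : A →ₗ[k] A)
    (hT : ∀ a, ∑ i ∈ (ℛ k a).index, T (S ((ℛ k a).left i)) * T ((ℛ k a).right i) =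
      counit (R := k) a • 1)
    (h : ∀ a l, al a * kap l = ∑ i ∈ (ℛ k a).index,
      kap (T (S ((ℛ k a).right i)) l) * al ((ℛ k a).left i)) (a : A) (l : Module.Dual k A) :
    kap l * al a = ∑ i ∈ (ℛ k a).index, al ((ℛ k a).left i) * kap (T ((ℛ k a).right i) l) := by
  let F : A ⊗[k] (A ⊗[k] A) →ₗ[k] R := LinearMap.mul' k R ∘ₗ
    (TensorProduct.comm k R R).toLinearMap ∘ₗ
    TensorProduct.map al (kap ∘ₗ LinearMap.applyₗ (R := k) l ∘ₗ LinearMap.mul' k _ ∘ₗ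
      TensorProduct.map (T ∘ₗ S) T)
  have hF := tri_coassoc F a
  simp only [F, LinearMap.comp_apply, LinearEquiv.coe_coe,
    TensorProduct.map_tmul, TensorProduct.comm_tmul, LinearMap.mul'_apply,
    LinearMap.applyₗ_apply_apply] at hF
  simp only [h]
  simp only [← Module.End.mul_apply]
  rw [hF]
  simp only [← Finset.sum_mul, ← map_sum, ← LinearMap.sum_apply, hT]
  simp only [LinearMap.smul_apply, map_smul, Module.End.one_apply, smul_mul_assoc,
    ← mul_smul_comm, ← Finset.mul_sum]
  simp only [← map_smul, ← map_sum, sum_counit_smul']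

theorem transL_cancel (a : A) : ∑ i ∈ (ℛ k a).index,
    (transL k A) (antipode k ((ℛ k a).right i)) * (transL k A) ((ℛ k a).left i) =
      counit (R := k) a • 1 := by
  simp only [XAlg.transL_mul, ← map_sum, sum_mul_antipode_eq_algebraMap_counit]
  simp [Algebra.algebraMap_eq_smul_one, XAlg.transL_one]

theorem transL_cancel' (a : A) : ∑ i ∈ (ℛ k a).index,
    (transL k A) (antipodeInv k A ((ℛ k a).left i)) * (transL k A) ((ℛ k a).right i) =
      counit (R := k) a • 1 := by
  simp only [XAlg.transL_mul, ← map_sum, sum_mul_antipodeInv]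
  simp [Algebra.algebraMap_eq_smul_one, XAlg.transL_one]

theorem transR_cancel (a : A) : ∑ i ∈ (ℛ k a).index,
    (transR k A) (antipodeInv k A ((ℛ k a).right i)) * (transR k A) ((ℛ k a).left i) =
      counit (R := k) a • 1 := by
  simp only [XAlg.transR_mul, ← map_sum, sum_antipodeInv_mul]
  simp [Algebra.algebraMap_eq_smul_one, XAlg.transR_one]

theorem transR_cancel' (a : A) : ∑ i ∈ (ℛ k a).index,
    (transR k A) (antipode k ((ℛ k a).left i)) * (transR k A) ((ℛ k a).right i) =
      counit (R := k) a • 1 := by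
  simp only [XAlg.transR_mul, ← map_sum, sum_antipode_mul_eq_algebraMap_counit]
  simp [Algebra.algebraMap_eq_smul_one, XAlg.transR_one]

variable {V : Type u} [AddCommGroup V] [Module k V]

/-- The Hopf bimodule given by an exchange representation. -/
noncomputable def ExchangeRep.toHopfBimod (ρ : ExchangeRep k A (Module.End k V)) :
    HopfBimod k A where
  carrier := V
  lact := ρ.al
  ract := ρ.be
  lco := coactL ρ.lam
  rco := coactR ρ.kap
  one_lact := ρ.al_one
  mul_lact a b := (ρ.al_mul a b).symm
  one_ract := ρ.be_one
  mul_ract a b := (ρ.be_mul b a).symm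
  lact_ract a b := (ρ.al_be a b).symm
  lco_coassoc := by
    refine LinearMap.ext fun v => eq_of_contrL fun l => eq_of_contrL fun l' => ?_
    simp only [LinearMap.comp_apply, LinearEquiv.coe_coe, contrL_comul, contrL_lTensor,
      contrL_coactL, ← ρ.lam_mul, Module.End.mul_apply]
  lco_counit := LinearMap.ext fun v =>
    (contrL_coactL ρ.lam counit v).trans (by rw [ρ.lam_one]; rfl)
  rco_coassoc := by
    -- Reassociated to (V ⊗ A) ⊗ A, so that both legs in A can be contracted from the right.
    refine LinearMap.ext fun v => (TensorProduct.assoc k V A A).symm.injective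
      (eq_of_contrR fun l' => eq_of_contrR fun l => ?_)
    simp only [LinearMap.comp_apply, LinearEquiv.coe_coe, LinearEquiv.symm_apply_apply,
      contrR_comul, contrR_rTensor, contrR_coactR, ← ρ.kap_mul, Module.End.mul_apply]
  rco_counit := LinearMap.ext fun v =>
    (contrR_coactR ρ.kap counit v).trans (by rw [ρ.kap_one]; rfl)
  lco_rco := by
    refine LinearMap.ext fun v => eq_of_contrL fun l => eq_of_contrR fun l' => ?_
    have h1 : ∀ t : V ⊗[k] A, contrL l (TensorProduct.assoc k A V A
        ((coactL ρ.lam).rTensor A t)) = (ρ.lam l).rTensor A t := by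
      intro t
      induction t with
      | zero => simp
      | add x y hx hy => simp only [map_add, hx, hy]
      | tmul v a =>
        simp only [LinearMap.rTensor_tmul, ← contrL_coactL ρ.lam l v]
        generalize coactL ρ.lam v = s
        induction s with
        | zero => simp
        | add x y hx hy => simp only [TensorProduct.add_tmul, map_add, hx, hy]
        | tmul b w => simp [TensorProduct.smul_tmul']
    have h2 := LinearMap.congr_fun (ρ.lam_kap l l') v
    simp only [Module.End.mul_apply] at h2
    simp only [LinearMap.comp_apply, LinearEquiv.coe_coe, h1, contrR_rTensor, contrL_lTensor,
      contrR_coactR, contrL_coactL, h2]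
  lco_lact a := by
    refine LinearMap.ext fun v => eq_of_contrL fun l => ?_
    have h := LinearMap.congr_fun (exchange_fwd ρ.lam ρ.al (transL k A) (antipode k)
      transL_cancel ρ.al_lam a l) v
    simp only [LinearMap.comp_apply, contrL_diag (mulL k A) ρ.al (transL k A) (fun _ _ _ => rfl),
      contrL_coactL]
    simpa using h
  lco_ract a := by
    refine LinearMap.ext fun v => eq_of_contrL fun l => ?_
    have h := LinearMap.congr_fun (exchange_fwd ρ.lam ρ.be (transR k A) (antipodeInv k A)
      transR_cancel ρ.be_lam a l) v
    simp only [LinearMap.comp_apply, contrL_diag (mulR k A) ρ.be (transR k A) (fun _ _ _ => rfl),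
      contrL_coactL]
    simpa using h
  rco_lact a := by
    refine LinearMap.ext fun v => eq_of_contrR fun l => ?_
    have h := LinearMap.congr_fun (exchange_rev ρ.kap ρ.al (transL k A) (antipodeInv k A)
      transL_cancel' ρ.al_kap a l) v
    simp only [LinearMap.comp_apply, contrR_diag (mulL k A) ρ.al (transL k A) (fun _ _ _ => rfl),
      contrR_coactR]
    simpa using h
  rco_ract a := by
    refine LinearMap.ext fun v => eq_of_contrR fun l => ?_
    have h := LinearMap.congr_fun (exchange_rev ρ.kap ρ.be (transR k A) (antipode k)
      transR_cancel' ρ.be_kap a l) v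
    simp only [LinearMap.comp_apply, contrR_diag (mulR k A) ρ.be (transR k A) (fun _ _ _ => rfl),
      contrR_coactR]
    simpa using h

/-- Contracting the dual-basis coactions returns `lam` and `kap`, so passing to the Hopf bimodule
and back does not change the X-action. -/
theorem ExchangeRep.toHopfBimod_smul (ρ : ExchangeRep k A (Module.End k V)) (x : XAlg k A)
    (v : ρ.toHopfBimod.carrier) : x • v = ρ.toFun x v := by
  have hl : ρ.toHopfBimod.lhit = ρ.lam :=
    LinearMap.ext fun l => LinearMap.ext fun v => contrL_coactL ρ.lam l v
  have hr : ρ.toHopfBimod.rhit = ρ.kap :=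
    LinearMap.ext fun l => LinearMap.ext fun v => contrR_coactR ρ.kap l v
  rw [HopfBimod.smul_def]
  change LinearMap.mul' k _ (TensorProduct.map (LinearMap.mul' k _ ∘ₗ TensorProduct.map
    ρ.toHopfBimod.lhit ρ.toHopfBimod.rhit) _ x) v = _
  rw [hl, hr]
  rfl

/-- The image of an exchange representation under a morphism of algebras. -/
noncomputable def ExchangeRep.map {R' : Type u} [Ring R'] [Algebra k R']
    (ρ : ExchangeRep k A R) (f : R →ₐ[k] R') : ExchangeRep k A R' where
  lam := f.toLinearMap ∘ₗ ρ.lam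
  kap := f.toLinearMap ∘ₗ ρ.kap
  al := f.toLinearMap ∘ₗ ρ.al
  be := f.toLinearMap ∘ₗ ρ.be
  lam_one := by simp [ρ.lam_one]
  kap_one := by simp [ρ.kap_one]
  al_one := by simp [ρ.al_one]
  be_one := by simp [ρ.be_one]
  lam_mul l l' := by simp [← map_mul, ρ.lam_mul]
  kap_mul l l' := by simp [← map_mul, ρ.kap_mul]
  al_mul a a' := by simp [← map_mul, ρ.al_mul]
  be_mul b b' := by simp [← map_mul, ρ.be_mul]
  lam_kap l l' := by simp [← map_mul, ρ.lam_kap]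
  al_be a b := by simp [← map_mul, ρ.al_be]
  al_lam a l := by simp [← map_mul, ρ.al_lam, ← map_sum]
  al_kap a l := by simp [← map_mul, ρ.al_kap, ← map_sum]
  be_lam b l := by simp [← map_mul, ρ.be_lam, ← map_sum]
  be_kap b l := by simp [← map_mul, ρ.be_kap, ← map_sum]

namespace XAlg

/-- An operator of the regular representation is left multiplication by its value at 1, as
`toFun_lam` shows at the unit. With the next three lemmas, the exchange relations among operators
become relations among elements of X, which gives `universal`. -/
theorem regular_lam_mul (l : Module.Dual k A) (x : XAlg k A) :
    (regular k A).lam l 1 * x = (regular k A).lam l x := by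
  have h := (regular k A).toFun_lam l 1
  rw [ExchangeRep.toFun_one, mul_one] at h
  exact LinearMap.congr_fun h x

theorem regular_kap_mul (l : Module.Dual k A) (x : XAlg k A) :
    (regular k A).kap l 1 * x = (regular k A).kap l x := by
  have h := (regular k A).toFun_kap l 1
  rw [ExchangeRep.toFun_one, mul_one] at h
  exact LinearMap.congr_fun h x

theorem regular_al_mul (a : A) (x : XAlg k A) :
    (regular k A).al a 1 * x = (regular k A).al a x := by
  have h := (regular k A).toFun_al a 1
  rw [ExchangeRep.toFun_one, mul_one] at h
  exact LinearMap.congr_fun h x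

theorem regular_be_mul (a : A) (x : XAlg k A) :
    (regular k A).be a 1 * x = (regular k A).be a x := by
  have h := (regular k A).toFun_be a 1
  rw [ExchangeRep.toFun_one, mul_one] at h
  exact LinearMap.congr_fun h x

variable (k A) in
/-- The four subalgebras of `X`. -/
noncomputable def universal : ExchangeRep k A (XAlg k A) where
  lam := LinearMap.applyₗ (R := k) (1 : XAlg k A) ∘ₗ (regular k A).lam
  kap := LinearMap.applyₗ (R := k) (1 : XAlg k A) ∘ₗ (regular k A).kap
  al := LinearMap.applyₗ (R := k) (1 : XAlg k A) ∘ₗ (regular k A).al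
  be := LinearMap.applyₗ (R := k) (1 : XAlg k A) ∘ₗ (regular k A).be
  lam_one := by simp [(regular k A).lam_one]
  kap_one := by simp [(regular k A).kap_one]
  al_one := by simp [(regular k A).al_one]
  be_one := by simp [(regular k A).be_one]
  lam_mul l l' := by
    simp [regular_lam_mul, ← (regular k A).lam_mul]
  kap_mul l l' := by
    simp [regular_kap_mul, ← (regular k A).kap_mul]
  al_mul a a' := by
    simp [regular_al_mul, ← (regular k A).al_mul]
  be_mul b b' := by
    simp [regular_be_mul, ← (regular k A).be_mul]
  lam_kap l l' := by
    have h := LinearMap.congr_fun ((regular k A).lam_kap l l') 1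
    simpa [regular_lam_mul, regular_kap_mul] using h
  al_be a b := by
    have h := LinearMap.congr_fun ((regular k A).al_be a b) 1
    simpa [regular_be_mul, regular_al_mul] using h
  al_lam a l := by
    have h := LinearMap.congr_fun ((regular k A).al_lam a l) 1
    simpa [regular_lam_mul, regular_al_mul] using h
  al_kap a l := by
    have h := LinearMap.congr_fun ((regular k A).al_kap a l) 1
    simpa [regular_kap_mul, regular_al_mul] using h
  be_lam b l := by
    have h := LinearMap.congr_fun ((regular k A).be_lam b l) 1
    simpa [regular_lam_mul, regular_be_mul] using h
  be_kap b l := by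
    have h := LinearMap.congr_fun ((regular k A).be_kap b l) 1
    simpa [regular_kap_mul, regular_be_mul] using h

/-- (l ⊗ l') ⊗ (a ⊗ b) is the product of its four entries, taken in this order. Hence an X-action is
determined by the operators of the four subalgebras. -/
theorem universal_toFun (x : XAlg k A) : (universal k A).toFun x = x := by
  suffices h : (universal k A).toFun = LinearMap.id from LinearMap.congr_fun h x
  refine hom_ext fun l l' a b => ?_
  rw [ExchangeRep.toFun_tm]
  change (regular k A).lam l 1 * (regular k A).kap l' 1 *
    ((regular k A).al a 1 * (regular k A).be b 1) = tm l l' a b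
  rw [mul_assoc, regular_kap_mul, regular_al_mul, regular_lam_mul]
  change op₁ k A _ (op₂ k A _ (leftAl k A _ (leftBe k A _ _))) = _
  rw [one_def, leftBe_one, leftAl_one]
  simp [op₁_apply, op₂_apply, counit_dualMul, dualMul_counit]

end XAlg

end Exchange
end HopfBimodCoh

namespace HopfBimodCoh
variable {k A : Type u} [Field k] [Ring A] [HopfAlgebra k A] [FiniteDimensional k A]

theorem ExchangeRep.toFun_map {R R' : Type u} [Ring R] [Algebra k R] [Ring R'] [Algebra k R']
    (ρ : ExchangeRep k A R) (f : R →ₐ[k] R') (x : XAlg k A) :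
    (ρ.map f).toFun x = f (ρ.toFun x) := by
  have h : (ρ.map f).toFun = f.toLinearMap ∘ₗ ρ.toFun := XAlg.hom_ext fun l l' a b => by
    rw [LinearMap.comp_apply, ExchangeRep.toFun_tm, ExchangeRep.toFun_tm]
    simp [ExchangeRep.map]
  exact LinearMap.congr_fun h x

namespace HopfBimod

instance (M : HopfBimod k A) : IsScalarTower k (XAlg k A) M.carrier where
  smul_assoc c x m := by
    rw [smul_def, smul_def, map_smul, LinearMap.smul_apply]

section OfX

variable (V : Type u) [AddCommGroup V] [Module k V] [Module (XAlg k A) V]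
  [IsScalarTower k (XAlg k A) V]

/-- An `X`-module, as a Hopf bimodule. -/
noncomputable def ofX : HopfBimod k A :=
  ((XAlg.universal k A).map (Algebra.lsmul k k V)).toHopfBimod

/-- The identity of `V`, as an isomorphism of `X`-modules. -/
noncomputable def ofXEquiv : V ≃ₗ[XAlg k A] (ofX (k := k) (A := A) V).carrier where
  toFun v := v
  invFun v := v
  left_inv _ := rfl
  right_inv _ := rfl
  map_add' _ _ := rfl
  map_smul' x v := by
    refine Eq.trans ?_ (ExchangeRep.toHopfBimod_smul _ x v).symm
    rw [ExchangeRep.toFun_map, XAlg.universal_toFun]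
    rfl

end OfX

variable {M N : HopfBimod k A}

theorem lhit_counit (m : M.carrier) : M.lhit counit m = m := LinearMap.congr_fun M.rep.lam_one m

theorem rhit_counit (m : M.carrier) : M.rhit counit m = m := LinearMap.congr_fun M.rep.kap_one m

theorem contrL_lco (l : Module.Dual k A) (m : M.carrier) : contrL l (M.lco m) = M.lhit l m := rfl

theorem contrR_rco (l : Module.Dual k A) (m : M.carrier) : contrR l (M.rco m) = M.rhit l m := rfl

/-- With the next three lemmas, the actions and the contracted coactions are all given by elements
of X; therefore X-linear maps respect the whole Hopf bimodule structure (`Hom.ofX`). -/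
theorem tm_lact (a : A) (m : M.carrier) : XAlg.tm (k := k) counit counit a 1 • m = M.lact a m := by
  rw [tm_smul, lhit_counit, rhit_counit, M.one_ract]; rfl

theorem tm_ract (a : A) (m : M.carrier) : XAlg.tm (k := k) counit counit 1 a • m = M.ract a m := by
  rw [tm_smul, lhit_counit, rhit_counit, M.one_lact]; rfl

theorem tm_lhit (l : Module.Dual k A) (m : M.carrier) :
    XAlg.tm l counit (1 : A) 1 • m = M.lhit l m := by
  rw [tm_smul, rhit_counit, M.one_lact, M.one_ract]; rfl

theorem tm_rhit (l : Module.Dual k A) (m : M.carrier) :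
    XAlg.tm counit l (1 : A) 1 • m = M.rhit l m := by
  rw [tm_smul, lhit_counit, M.one_lact, M.one_ract]; rfl

/-- An `X`-linear map, as a morphism of Hopf bimodules. -/
noncomputable def Hom.ofX (f : M.carrier →ₗ[XAlg k A] N.carrier) : Hom M N where
  toLin := f.restrictScalars k
  map_lact a := LinearMap.ext fun m => by
    simp only [LinearMap.comp_apply, LinearMap.restrictScalars_apply, ← tm_lact]
    exact f.map_smul _ _
  map_ract a := LinearMap.ext fun m => by
    simp only [LinearMap.comp_apply, LinearMap.restrictScalars_apply, ← tm_ract]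
    exact f.map_smul _ _
  map_lco := LinearMap.ext fun m => eq_of_contrL fun l => by
    simp only [LinearMap.comp_apply, contrL_lTensor, contrL_lco, ← tm_lhit,
      LinearMap.restrictScalars_apply]
    exact (f.map_smul _ _).symm
  map_rco := LinearMap.ext fun m => eq_of_contrR fun l => by
    simp only [LinearMap.comp_apply, contrR_rTensor, contrR_rco, ← tm_rhit,
      LinearMap.restrictScalars_apply]
    exact (f.map_smul _ _).symm

/-- A morphism of Hopf bimodules, as an `X`-linear map. -/
noncomputable def Hom.toXLin (u : Hom M N) : M.carrier →ₗ[XAlg k A] N.carrier where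
  toFun := u.toLin
  map_add' := map_add u.toLin
  map_smul' := u.map_smul

theorem Hom.exists_toX_eq (f : ModuleCat.of (XAlg k A) M.carrier ⟶ ModuleCat.of (XAlg k A) N.carrier) :
    ∃ u : Hom M N, u.toX = f := ⟨Hom.ofX f.hom, rfl⟩

/-- The quotient is formed among X-modules and becomes a Hopf bimodule through `ofX`. -/
theorem exists_cokernel (i : Hom M N) (hi : Function.Injective i.toLin) :
    ∃ (Q : HopfBimod k A) (S : SES M N Q), S.i = i := by
  let R := LinearMap.range i.toXLin
  let e := ofXEquiv (k := k) (A := A) (N.carrier ⧸ R)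
  refine ⟨ofX (N.carrier ⧸ R), ⟨i, Hom.ofX (e.toLinearMap ∘ₗ R.mkQ), hi, ?_, ?_⟩, rfl⟩
  · intro n
    change e (R.mkQ n) = 0 ↔ _
    rw [map_eq_zero_iff _ e.injective, ← LinearMap.mem_ker, Submodule.ker_mkQ]
    rfl
  · exact e.surjective.comp R.mkQ_surjective

open CategoryTheory in
theorem exists_injective (N : HopfBimod k A) : ∃ (I : HopfBimod k A) (i : Hom N I),
    Function.Injective i.toLin ∧ Injective (ModuleCat.of (XAlg k A) I.carrier) := by
  let I₀ := Injective.under (ModuleCat.of (XAlg k A) N.carrier)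
  let ι : ModuleCat.of (XAlg k A) N.carrier ⟶ I₀ := Injective.ι _
  -- Scalars act through k → X, which makes the tower condition required by `ofX` automatic.
  let _ : Module k I₀ := Module.compHom I₀ (algebraMap k (XAlg k A))
  have _ : IsScalarTower k (XAlg k A) I₀ := ⟨fun c x m => by
    rw [Algebra.smul_def, mul_smul]; rfl⟩
  let e := ofXEquiv (k := k) (A := A) I₀
  refine ⟨ofX I₀, Hom.ofX (e.toLinearMap ∘ₗ ι.hom), ?_, ?_⟩
  · exact e.injective.comp ((ModuleCat.mono_iff_injective ι).1 inferInstance)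
  · exact Injective.of_iso e.toModuleIso (inferInstanceAs (Injective I₀))

end HopfBimod
end HopfBimodCoh

namespace HopfBimodCoh
variable {k A : Type u} [Field k] [Ring A] [HopfAlgebra k A] [FiniteDimensional k A]

/-! ### The coinduced Hopf module Hom(A, V) -/

section Coinduced

variable {V V' : Type u} [AddCommGroup V] [Module k V] [AddCommGroup V'] [Module k V']

/-- `φ ⊗ y ↦ φ(x) ⊗ y` -/
noncomputable def evalT (X : Type u) [AddCommGroup X] [Module k X] (x : A) :
    (A →ₗ[k] V) ⊗[k] X →ₗ[k] V ⊗[k] X :=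
  (LinearMap.applyₗ x).rTensor X

@[simp] theorem evalT_tmul (X : Type u) [AddCommGroup X] [Module k X] (x : A) (φ : A →ₗ[k] V)
    (y : X) : evalT X x (φ ⊗ₜ y) = φ x ⊗ₜ y := rfl

/-- As A is finite dimensional, Hom(A, V) ⊗ X is Hom(A, V ⊗ X) for any vector space X. All
identities for the coinduced coaction are checked by evaluating at a point. -/
theorem evalT_ext {X : Type u} [AddCommGroup X] [Module k X] {t t' : (A →ₗ[k] V) ⊗[k] X}
    (h : ∀ x, evalT X x t = evalT X x t') : t = t' := by
  have h1 : ∀ (t : (A →ₗ[k] V) ⊗[k] X) (x : A),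
      rTensorHomEquivHomRTensor k A V X t x = evalT X x t := by
    intro t x
    rw [rTensorHomEquivHomRTensor_apply]
    induction t with
    | zero => simp
    | add x y hx hy => simp only [map_add, LinearMap.add_apply, hx, hy]
    | tmul φ y => simp
  apply (rTensorHomEquivHomRTensor k A V X).injective
  ext x
  rw [h1, h1, h]

/-- `v ⊗ a ↦ v ⊗ ab` -/
noncomputable abbrev mulSnd (V : Type u) [AddCommGroup V] [Module k V] (b : A) :
    V ⊗[k] A →ₗ[k] V ⊗[k] A := (mulR k A b).lTensor V

/-- `φ ↦ (x ↦ ∑ φ(x⁽¹⁾)₍₀₎ ⊗ φ(x⁽¹⁾)₍₁₎ S(x⁽²⁾))` -/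
noncomputable def coindAux (r : V →ₗ[k] V ⊗[k] A) : (A →ₗ[k] V) →ₗ[k] (A →ₗ[k] V ⊗[k] A) where
  toFun φ := (LinearMap.mul' k A).lTensor V ∘ₗ (TensorProduct.assoc k V A A).toLinearMap ∘ₗ
    TensorProduct.map (r ∘ₗ φ) (antipode k) ∘ₗ comul
  map_add' φ ψ := by
    rw [LinearMap.comp_add, TensorProduct.map_add_left, LinearMap.add_comp, LinearMap.comp_add,
      LinearMap.comp_add]
  map_smul' c φ := by
    rw [LinearMap.comp_smul, TensorProduct.map_smul_left, LinearMap.smul_comp, LinearMap.comp_smul,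
      LinearMap.comp_smul]
    rfl

theorem coindAux_apply (r : V →ₗ[k] V ⊗[k] A) (φ : A →ₗ[k] V) (x : A) : coindAux r φ x =
    ∑ i ∈ (ℛ k x).index, mulSnd V (antipode k ((ℛ k x).right i)) (r (φ ((ℛ k x).left i))) := by
  change (LinearMap.mul' k A).lTensor V (TensorProduct.assoc k V A A
    (TensorProduct.map (r ∘ₗ φ) (antipode k) (comul x))) = _
  conv_lhs => rw [← (ℛ k x).eq]
  simp only [map_sum, TensorProduct.map_tmul, LinearMap.comp_apply]
  refine Finset.sum_congr rfl fun i _ => ?_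
  generalize r (φ ((ℛ k x).left i)) = t
  induction t with
  | zero => simp
  | add x y hx hy => simp only [TensorProduct.add_tmul, map_add, hx, hy]
  | tmul v a => simp

/-- The right coaction on `Hom(A, V)`. -/
noncomputable def coindRco (r : V →ₗ[k] V ⊗[k] A) : (A →ₗ[k] V) →ₗ[k] (A →ₗ[k] V) ⊗[k] A :=
  (rTensorHomEquivHomRTensor k A V A).symm.toLinearMap ∘ₗ coindAux r

theorem evalT_coindRco (r : V →ₗ[k] V ⊗[k] A) (φ : A →ₗ[k] V) (x : A) :
    evalT A x (coindRco r φ) =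
    ∑ i ∈ (ℛ k x).index, mulSnd V (antipode k ((ℛ k x).right i)) (r (φ ((ℛ k x).left i))) := by
  have h1 : ∀ (t : (A →ₗ[k] V) ⊗[k] A),
      rTensorHomEquivHomRTensor k A V A t x = evalT A x t := by
    intro t
    rw [rTensorHomEquivHomRTensor_apply]
    induction t with
    | zero => simp
    | add x y hx hy => simp only [map_add, LinearMap.add_apply, hx, hy]
    | tmul φ y => simp
  rw [← h1, ← coindAux_apply, coindRco, LinearMap.comp_apply, LinearEquiv.coe_coe,
    LinearEquiv.apply_symm_apply]

theorem evalT_coindRco_mul (r : V →ₗ[k] V ⊗[k] A) (φ : A →ₗ[k] V) (x y : A) :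
    evalT A (x * y) (coindRco r φ) = ∑ i ∈ (ℛ k x).index, ∑ j ∈ (ℛ k y).index,
      mulSnd V (antipode k ((ℛ k x).right i * (ℛ k y).right j))
        (r (φ ((ℛ k x).left i * (ℛ k y).left j))) := by
  have h : evalT A (x * y) (coindRco r φ) = (LinearMap.mul' k A).lTensor V
      (TensorProduct.assoc k V A A (TensorProduct.map (r ∘ₗ φ) (antipode k) (comul (x * y)))) := by
    rw [evalT_coindRco, ← coindAux_apply]
    rfl
  rw [h, Bialgebra.comul_mul]
  conv_lhs => rw [← (ℛ k x).eq, ← (ℛ k y).eq]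
  simp only [Finset.sum_mul_sum, map_sum, TensorProduct.map_tmul, LinearMap.comp_apply,
    Algebra.TensorProduct.tmul_mul_tmul]
  refine Finset.sum_congr rfl fun i _ => Finset.sum_congr rfl fun j _ => ?_
  generalize r _ = t
  induction t with
  | zero => simp
  | add x y hx hy => simp only [TensorProduct.add_tmul, map_add, hx, hy]
  | tmul v a => simp

/-- `a ⊗ b ⊗ c ↦ ∑ r(φ(ax⁽¹⁾)) (1 ⊗ S(x⁽²⁾) S(b) c)` -/
noncomputable def coindF (r : V →ₗ[k] V ⊗[k] A) (φ : A →ₗ[k] V) (x : A) :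
    A ⊗[k] (A ⊗[k] A) →ₗ[k] V ⊗[k] A :=
  ∑ i ∈ (ℛ k x).index, TensorProduct.lift ((LinearMap.lTensorHom V ∘ₗ mulR k A ∘ₗ
    mulL k A (antipode k ((ℛ k x).right i)) ∘ₗ LinearMap.mul' k A ∘ₗ
    (antipode k).rTensor A).flip ∘ₗ r ∘ₗ φ ∘ₗ mulR k A ((ℛ k x).left i))

theorem coindF_tmul (r : V →ₗ[k] V ⊗[k] A) (φ : A →ₗ[k] V) (x a b c : A) :
    coindF r φ x (a ⊗ₜ (b ⊗ₜ c)) = ∑ i ∈ (ℛ k x).index,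
      mulSnd V (antipode k ((ℛ k x).right i) * (antipode k b * c))
        (r (φ (a * (ℛ k x).left i))) := by
  simp [coindF]

variable (k A) in
/-- `(a φ)(x) = a φ(x)` -/
noncomputable def coindLact (ρ : A →ₗ[k] Module.End k V) : A →ₗ[k] Module.End k (A →ₗ[k] V) where
  toFun a := LinearMap.compRight k (ρ a)
  map_add' a b := by ext; simp
  map_smul' c a := by ext; simp

variable (k A V) in
/-- `(φ a)(x) = φ(ax)` -/
noncomputable def coindRact : A →ₗ[k] Module.End k (A →ₗ[k] V) where
  toFun a := LinearMap.lcomp k V (mulL k A a)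
  map_add' a b := by ext; simp
  map_smul' c a := by ext; simp

@[simp] theorem coindLact_apply (ρ : A →ₗ[k] Module.End k V) (a x : A) (φ : A →ₗ[k] V) :
    coindLact k A ρ a φ x = ρ a (φ x) := rfl

@[simp] theorem coindRact_apply (a x : A) (φ : A →ₗ[k] V) :
    coindRact k A V a φ x = φ (a * x) := rfl

theorem evalT_diag (ρ : A →ₗ[k] Module.End k V) (σ : A →ₗ[k] Module.End k A) (a x : A)
    (t : (A →ₗ[k] V) ⊗[k] A) :
    evalT A x (diag (coindLact k A ρ) σ a t) = diag ρ σ a (evalT A x t) := by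
  have h := diag_natural (f := LinearMap.applyₗ (R := k) (M₂ := V) x) (g := (LinearMap.id : A →ₗ[k] A))
    (ρ := coindLact k A ρ) (ρ' := ρ) (σ := σ) (σ' := σ) (fun _ => rfl) (fun _ => rfl) a
  exact LinearMap.congr_fun h t

theorem mulSnd_diag (ρ : A →ₗ[k] Module.End k V) (a b : A) (t : V ⊗[k] A) :
    mulSnd V b (diag ρ (mulL k A) a t) = diag ρ (mulL k A) a (mulSnd V b t) := by
  have h := diag_natural (f := (LinearMap.id : V →ₗ[k] V)) (g := mulR k A b)
    (ρ := ρ) (ρ' := ρ) (σ := mulL k A) (σ' := mulL k A) (fun _ => rfl)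
    (fun _ => by ext; simp [mul_assoc]) a
  exact LinearMap.congr_fun h t

/-- At x both sides are ∑ φ(x⁽¹⁾)₍₀₎ ⊗ φ(x⁽¹⁾)₍₁₎S(x⁽³⁾) ⊗ φ(x⁽¹⁾)₍₂₎S(x⁽²⁾): S reverses Δ, and
`tri_coassoc` aligns the indices. -/
theorem coindRco_coassoc {r : V →ₗ[k] V ⊗[k] A}
    (h : (TensorProduct.assoc k V A A).toLinearMap ∘ₗ r.rTensor A ∘ₗ r = comul.lTensor V ∘ₗ r) :
    (TensorProduct.assoc k (A →ₗ[k] V) A A).toLinearMap ∘ₗ (coindRco r).rTensor A ∘ₗ coindRco r =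
      comul.lTensor (A →ₗ[k] V) ∘ₗ coindRco r := by
  refine LinearMap.ext fun φ => evalT_ext fun x => ?_
  simp only [LinearMap.comp_apply, LinearEquiv.coe_coe]
  have h1 : ∀ t : (A →ₗ[k] V) ⊗[k] A, evalT (A ⊗[k] A) x (TensorProduct.assoc k _ A A
      ((coindRco r).rTensor A t)) = ∑ i ∈ (ℛ k x).index, TensorProduct.assoc k V A A
        ((mulSnd V (antipode k ((ℛ k x).right i)) ∘ₗ r).rTensor A
          (evalT A ((ℛ k x).left i) t)) := by
    intro t
    induction t with
    | zero => simp
    | add x y hx hy => simp only [map_add, hx, hy, Finset.sum_add_distrib]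
    | tmul φ y =>
      simp only [LinearMap.rTensor_tmul, evalT_tmul, LinearMap.comp_apply]
      rw [← map_sum, ← TensorProduct.sum_tmul, ← evalT_coindRco]
      generalize coindRco r φ = s
      induction s with
      | zero => simp
      | add x y hx hy => simp only [TensorProduct.add_tmul, map_add, hx, hy]
      | tmul ψ z => simp
  have h2 : ∀ (y z : A) (t : V ⊗[k] A), TensorProduct.assoc k V A A
      ((mulSnd V y ∘ₗ r).rTensor A (mulSnd V z t)) =
      (TensorProduct.map (mulR k A y) (mulR k A z)).lTensor V
        (TensorProduct.assoc k V A A (r.rTensor A t)) := by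
    intro y z t
    induction t with
    | zero => simp
    | add x y hx hy => simp only [map_add, hx, hy]
    | tmul v a =>
      simp only [LinearMap.rTensor_tmul, LinearMap.lTensor_tmul, LinearMap.comp_apply]
      generalize r v = s
      induction s with
      | zero => simp
      | add x y hx hy => simp only [TensorProduct.add_tmul, map_add, hx, hy]
      | tmul ψ z => simp
  have h3 : ∀ t : (A →ₗ[k] V) ⊗[k] A, evalT (A ⊗[k] A) x (comul.lTensor _ t) =
      comul.lTensor V (evalT A x t) := by
    intro t
    induction t with
    | zero => simp
    | add x y hx hy => simp only [map_add, hx, hy]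
    | tmul φ y => simp
  have h4 : ∀ (y : A) (t : V ⊗[k] A), comul.lTensor V (mulSnd V (antipode k y) t) =
      ∑ i ∈ (ℛ k y).index, (TensorProduct.map (mulR k A (antipode k ((ℛ k y).right i)))
        (mulR k A (antipode k ((ℛ k y).left i)))).lTensor V (comul.lTensor V t) := by
    intro y t
    induction t with
    | zero => simp
    | add x y hx hy => simp only [map_add, hx, hy, Finset.sum_add_distrib]
    | tmul v a =>
      simp only [LinearMap.lTensor_tmul, LinearMap.flip_apply, LinearMap.mul_apply',
        Bialgebra.comul_mul, comul_antipode]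
      conv_lhs => rw [← (ℛ k y).eq]
      simp only [map_sum, TensorProduct.map_tmul, TensorProduct.comm_tmul, Finset.mul_sum,
        TensorProduct.tmul_sum]
      refine Finset.sum_congr rfl fun i _ => ?_
      congr 1
      generalize comul (R := k) a = s
      induction s with
      | zero => simp
      | add x y hx hy => simp only [add_mul, map_add, hx, hy]
      | tmul ψ z => simp
  rw [h1, h3, evalT_coindRco]
  have h5 : ∀ y, TensorProduct.assoc k V A A (r.rTensor A (r y)) = comul.lTensor V (r y) :=
    LinearMap.congr_fun h
  simp only [evalT_coindRco, map_sum, h2, h4, h5]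
  let F : A ⊗[k] (A ⊗[k] A) →ₗ[k] V ⊗[k] (A ⊗[k] A) :=
    TensorProduct.lift ((LinearMap.lTensorHom V ∘ₗ TensorProduct.homTensorHomMap (RingHom.id k) A A A A ∘ₗ
      TensorProduct.map (mulR k A ∘ₗ antipode k) (mulR k A ∘ₗ antipode k) ∘ₗ
      (TensorProduct.comm k A A).toLinearMap).flip ∘ₗ (comul.lTensor V ∘ₗ r ∘ₗ φ))
  have h6 := tri_coassoc F x
  simpa [F] using h6

/-- The point is `compat'`. Evaluating the coaction of φ at a⁽¹⁾x and multiplying by the remaining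
leg of a yields φ(a⁽¹⁾x⁽¹⁾)₍₁₎ S(x⁽²⁾) S(a⁽²⁾) a⁽³⁾, where S(a⁽²⁾)a⁽³⁾ cancels. The factor S(x⁽²⁾)
in the coaction is there for this purpose. -/
theorem IsTri.coind {ρ σ : A →ₗ[k] Module.End k V} {r : V →ₗ[k] V ⊗[k] A} (h : IsTri ρ σ r) :
    IsTri (coindLact k A ρ) (coindRact k A V) (coindRco r) where
  one := by ext; simp [h.one]
  mul a b := by ext; simp [h.mul]
  one' := by ext; simp
  mul' a b := by ext; simp [mul_assoc]
  comm a b := by ext; simp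
  coassoc := coindRco_coassoc h.coassoc
  counit := by
    refine LinearMap.ext fun φ => LinearMap.ext fun x => ?_
    have h1 : ∀ t : (A →ₗ[k] V) ⊗[k] A, TensorProduct.rid k _ (counit.lTensor _ t) x =
        TensorProduct.rid k V (counit.lTensor V (evalT A x t)) := by
      intro t
      induction t with
      | zero => simp
      | add x y hx hy => simp only [map_add, LinearMap.add_apply, hx, hy]
      | tmul φ y => simp
    have h2 : ∀ (y : A) (t : V ⊗[k] A), TensorProduct.rid k V (counit.lTensor V (mulSnd V y t)) =
        counit (R := k) y • TensorProduct.rid k V (counit.lTensor V t) := by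
      intro y t
      induction t with
      | zero => simp
      | add x y hx hy => simp only [map_add, smul_add, hx, hy]
      | tmul φ y => simp [smul_smul, mul_comm]
    have h3 : ∀ v, TensorProduct.rid k V (counit.lTensor V (r v)) = v := LinearMap.congr_fun h.counit
    simp only [LinearMap.comp_apply, LinearEquiv.coe_coe, h1, evalT_coindRco, map_sum, h2, h3]
    simp only [counit_antipode, ← map_smul, ← map_sum]
    rw [sum_counit_smul', LinearMap.id_apply]
  compat a := by
    refine LinearMap.ext fun φ => evalT_ext fun x => ?_
    simp only [LinearMap.comp_apply, evalT_diag, evalT_coindRco, coindLact_apply, map_sum,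
      ← mulSnd_diag]
    refine Finset.sum_congr rfl fun i _ => ?_
    rw [← LinearMap.comp_apply r, h.compat, LinearMap.comp_apply]
  compat' a := by
    refine LinearMap.ext fun φ => evalT_ext fun x => ?_
    have h1 : ∀ t : (A →ₗ[k] V) ⊗[k] A, evalT A x (diag (coindRact k A V) (mulR k A) a t) =
        ∑ j ∈ (ℛ k a).index,
          mulSnd V ((ℛ k a).right j) (evalT A ((ℛ k a).left j * x) t) := by
      intro t
      rw [diag_apply, LinearMap.sum_apply, map_sum]
      refine Finset.sum_congr rfl fun j _ => ?_
      induction t with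
      | zero => simp
      | add x y hx hy => simp only [map_add, hx, hy]
      | tmul φ y => simp
    have h2 : ∀ (y z : A) (t : V ⊗[k] A), mulSnd V y (mulSnd V z t) = mulSnd V (z * y) t := by
      intro y z t
      induction t with
      | zero => simp
      | add x y hx hy => simp only [map_add, hx, hy]
      | tmul φ y => simp [mul_assoc]
    simp only [LinearMap.comp_apply, h1, evalT_coindRco_mul]
    simp only [map_sum, h2, evalT_coindRco, coindRact_apply, antipode_mul_antidistrib, mul_assoc]
    have h3 : ∀ j ∈ (ℛ k a).index, ∑ i' ∈ (ℛ k ((ℛ k a).left j)).index, ∑ i ∈ (ℛ k x).index,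
        mulSnd V (antipode k ((ℛ k x).right i) * (antipode k ((ℛ k ((ℛ k a).left j)).right i') *
          (ℛ k a).right j)) (r (φ ((ℛ k ((ℛ k a).left j)).left i' * (ℛ k x).left i))) =
        ∑ i' ∈ (ℛ k ((ℛ k a).left j)).index, coindF r φ x ((ℛ k ((ℛ k a).left j)).left i' ⊗ₜ
          ((ℛ k ((ℛ k a).left j)).right i' ⊗ₜ (ℛ k a).right j)) := fun j _ =>
      Finset.sum_congr rfl fun i' _ => (coindF_tmul r φ x _ _ _).symm
    -- Coassociativity regroups the sum so that S(a⁽²⁾)a⁽³⁾ is summed first; `h4` replaces it by the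
    -- counit.
    rw [Finset.sum_congr rfl h3, tri_coassoc]
    simp only [coindF_tmul]
    have h4 : ∀ y z : A, ∑ j ∈ (ℛ k y).index, ∑ i ∈ (ℛ k x).index,
        mulSnd V (antipode k ((ℛ k x).right i) *
          (antipode k ((ℛ k y).left j) * (ℛ k y).right j)) (r (φ (z * (ℛ k x).left i))) =
        ∑ i ∈ (ℛ k x).index, mulSnd V (antipode k ((ℛ k x).right i))
          (r (φ ((counit (R := k) y • z) * (ℛ k x).left i))) := by
      intro y z
      rw [Finset.sum_comm]
      refine Finset.sum_congr rfl fun i _ => ?_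
      let G : A →ₗ[k] V ⊗[k] A := LinearMap.applyₗ (r (φ (z * (ℛ k x).left i))) ∘ₗ
        LinearMap.lTensorHom V ∘ₗ mulR k A ∘ₗ mulL k A (antipode k ((ℛ k x).right i))
      have h5 := congrArg G (sum_antipode_mul_eq_algebraMap_counit (R := k) (ℛ k y))
      rw [map_sum] at h5
      refine h5.trans ?_
      simp [G, Algebra.algebraMap_eq_smul_one]
    simp only [h4]
    rw [Finset.sum_comm]
    refine Finset.sum_congr rfl fun i _ => ?_
    simp only [← map_sum, ← Finset.sum_mul]
    rw [sum_counit_smul']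

/-- The adjunction between restriction and coinduction. -/
theorem isLRMap_curry {ρ : A →ₗ[k] Module.End k V} {r : V →ₗ[k] V ⊗[k] A}
    {ρ' : A →ₗ[k] Module.End k V'} {r' : V' →ₗ[k] V' ⊗[k] A} {g : V ⊗[k] A →ₗ[k] V'}
    (h : IsLRMap (LinearMap.rTensorHom A ∘ₗ ρ) (rcoStep r) ρ' r' g) :
    IsLRMap ρ r (coindLact k A ρ') (coindRco r') (TensorProduct.curry g) where
  lin a := by
    ext v x
    have h1 := LinearMap.congr_fun (h.lin a) (v ⊗ₜ x)
    simpa using h1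
  colin := by
    refine LinearMap.ext fun v => evalT_ext fun x => ?_
    have h1 : ∀ y, r' (g (v ⊗ₜ y)) = g.rTensor A (mixR k A V (r v ⊗ₜ comul y)) :=
      fun y => LinearMap.congr_fun h.colin (v ⊗ₜ y)
    simp only [LinearMap.comp_apply, evalT_coindRco, TensorProduct.curry_apply, h1]
    generalize r v = t
    induction t with
    | zero => simp
    | add x y hx hy =>
      simp only [TensorProduct.add_tmul, map_add, Finset.sum_add_distrib, hx, hy]
    | tmul w y =>
      -- The codiagonal coaction produces g(w ⊗ x⁽¹⁾) ⊗ y x⁽²⁾ and the coinduced one appends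
      -- S(x⁽³⁾), so x⁽²⁾S(x⁽³⁾) cancels after regrouping.
      let F : A ⊗[k] (A ⊗[k] A) →ₗ[k] V' ⊗[k] A :=
        TensorProduct.map (TensorProduct.curry g w)
          (mulL k A y ∘ₗ LinearMap.mul' k A ∘ₗ (antipode k).lTensor A)
      have h2 := tri_coassoc F x
      have h3 : ∀ z z' : A, mulSnd V' (antipode k z) (g.rTensor A
          (mixR k A V ((w ⊗ₜ y) ⊗ₜ comul z'))) = ∑ j ∈ (ℛ k z').index,
            F ((ℛ k z').left j ⊗ₜ ((ℛ k z').right j ⊗ₜ z)) := by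
        intro z z'
        conv_lhs => rw [← (ℛ k z').eq]
        simp [F, TensorProduct.tmul_sum, mul_assoc]
      have h4 : ∀ z z' : A, ∑ j ∈ (ℛ k z').index,
            F (z ⊗ₜ ((ℛ k z').left j ⊗ₜ (ℛ k z').right j)) =
            g (w ⊗ₜ (counit (R := k) z' • z)) ⊗ₜ y := by
        intro z z'
        have h5 := sum_mul_antipode_eq_algebraMap_counit (R := k) (ℛ k z')
        simp only [F, TensorProduct.map_tmul, LinearMap.comp_apply, LinearMap.lTensor_tmul,
          LinearMap.mul'_apply]
        rw [← TensorProduct.tmul_sum, ← map_sum, h5]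
        simp [Algebra.algebraMap_eq_smul_one, TensorProduct.smul_tmul]
      simp only [h3, h2, h4]
      rw [← TensorProduct.sum_tmul, ← map_sum, ← TensorProduct.tmul_sum, sum_counit_smul']
      simp

end Coinduced

end HopfBimodCoh

namespace HopfBimodCoh
variable {k A : Type u} [Field k] [Ring A] [HopfAlgebra k A] [FiniteDimensional k A]

/-! ### Cofree comodules and the embedding of N into A ⊗ Hom(A, N) -/

section Cofree

variable {V W U : Type u} [AddCommGroup V] [Module k V] [AddCommGroup W] [Module k W]
  [AddCommGroup U] [Module k U]

variable (k A W) in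
/-- `a ⊗ w ↦ ε(a) w` -/
noncomputable def counitT : A ⊗[k] W →ₗ[k] W :=
  (TensorProduct.lid k W).toLinearMap ∘ₗ counit.rTensor W

@[simp] theorem counitT_tmul (a : A) (w : W) :
    counitT k A W (a ⊗ₜ w) = counit (R := k) a • w := by simp [counitT]

theorem counitT_diag {τ : A →ₗ[k] Module.End k A} (hτ : ∀ a b, counit (R := k) (τ a b) =
    counit (R := k) a * counit b) (ρ : A →ₗ[k] Module.End k W) (a : A) :
    counitT k A W ∘ₗ diag τ ρ a = ρ a ∘ₗ counitT k A W := by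
  have h : ρ a = ∑ i ∈ (ℛ k a).index, counit (R := k) ((ℛ k a).left i) • ρ ((ℛ k a).right i) := by
    conv_lhs => rw [← sum_counit_smul (ℛ k a)]
    simp
  rw [h]
  ext b w
  simp [diag_apply, hτ, smul_smul, mul_comm]

theorem counitT_lact (ρ : A →ₗ[k] Module.End k W) (a : A) :
    counitT k A W ∘ₗ diag (mulL k A) ρ a = ρ a ∘ₗ counitT k A W :=
  counitT_diag (fun a b => by simp) ρ a

theorem counitT_ract (ρ : A →ₗ[k] Module.End k W) (a : A) :
    counitT k A W ∘ₗ diag (mulR k A) ρ a = ρ a ∘ₗ counitT k A W :=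
  counitT_diag (fun a b => by simp [mul_comm]) ρ a

theorem isLRMap_counitT (ρ : A →ₗ[k] Module.End k W) (r : W →ₗ[k] W ⊗[k] A) :
    IsLRMap (diag (mulL k A) ρ) ((TensorProduct.assoc k A W A).symm.toLinearMap ∘ₗ r.lTensor A)
      ρ r (counitT k A W) where
  lin := counitT_lact ρ
  colin := by
    ext a w
    simp only [TensorProduct.AlgebraTensorModule.curry_apply, LinearMap.restrictScalars_self,
      TensorProduct.curry_apply, LinearMap.comp_apply, LinearMap.lTensor_tmul, counitT_tmul,
      LinearEquiv.coe_coe, map_smul]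
    generalize r w = t
    induction t with
    | zero => simp
    | add x y hx hy => simp only [TensorProduct.tmul_add, map_add, smul_add, hx, hy]
    | tmul x y => simp [TensorProduct.smul_tmul']

theorem counitT_comulT : (counitT k A W).lTensor A ∘ₗ comulT k A W = LinearMap.id := by
  ext a w
  simp only [comulT, TensorProduct.AlgebraTensorModule.curry_apply, LinearMap.restrictScalars_self,
    TensorProduct.curry_apply, LinearMap.comp_apply, LinearEquiv.coe_coe, LinearMap.rTensor_tmul]
  rw [← (ℛ k a).eq]
  simp only [TensorProduct.sum_tmul, map_sum, TensorProduct.assoc_tmul, LinearMap.lTensor_tmul,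
    counitT_tmul, ← TensorProduct.smul_tmul]
  rw [← TensorProduct.sum_tmul, sum_counit_smul', LinearMap.id_apply]

theorem counitT_comulT' : counitT k A (A ⊗[k] W) ∘ₗ comulT k A W = LinearMap.id := by
  ext a w
  simp only [comulT, TensorProduct.AlgebraTensorModule.curry_apply, LinearMap.restrictScalars_self,
    TensorProduct.curry_apply, LinearMap.comp_apply, LinearEquiv.coe_coe, LinearMap.rTensor_tmul]
  rw [← (ℛ k a).eq]
  simp only [TensorProduct.sum_tmul, map_sum, TensorProduct.assoc_tmul,
    counitT_tmul, TensorProduct.smul_tmul']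
  rw [← TensorProduct.sum_tmul, sum_counit_smul, LinearMap.id_apply]

/-- The Hopf bimodule `A ⊗ W`, cofree as a left comodule. -/
noncomputable def IsTri.cofree {ρ σ : A →ₗ[k] Module.End k W} {r : W →ₗ[k] W ⊗[k] A}
    (h : IsTri ρ σ r) : HopfBimod k A where
  carrier := A ⊗[k] W
  lact := diag (mulL k A) ρ
  ract := diag (mulR k A) σ
  lco := comulT k A W
  rco := (TensorProduct.assoc k A W A).symm.toLinearMap ∘ₗ r.lTensor A
  one_lact := h.cob.one
  mul_lact := h.cob.mul
  one_ract := h.cob.one'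
  mul_ract := h.cob.mul'
  lact_ract := h.cob.comm
  lco_coassoc := comulT_coassoc
  lco_counit := counitT_comulT'
  rco_coassoc := h.cob.coassoc
  rco_counit := h.cob.counit
  lco_rco := by
    rw [← comulT_colin, LinearMap.comp_assoc]
    refine LinearMap.ext fun x => ?_
    simp only [LinearMap.comp_apply, LinearEquiv.coe_coe, LinearEquiv.apply_symm_apply]
  lco_lact := comulT_lact ρ
  lco_ract := comulT_ract σ
  rco_lact := h.cob.compat
  rco_ract := h.cob.compat'

/-- The term Δ ⊗ 1 of the cobar differential commutes with `T` by naturality, and the term −1 ⊗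
(differential) is replaced through the hypothesis. Its minus sign turns c into −c. -/
theorem contraction_step {T : A ⊗[k] V →ₗ[k] V} {e : V →ₗ[k] A ⊗[k] V} {c : k}
    (h : T.lTensor A ∘ₗ cobarStep e = e ∘ₗ T + c • LinearMap.id) :
    (T.lTensor A).lTensor A ∘ₗ cobarStep (cobarStep e) =
      cobarStep e ∘ₗ T.lTensor A + (-c) • LinearMap.id := by
  have h1 := congrArg (LinearMap.lTensor A) h
  rw [LinearMap.lTensor_comp, LinearMap.lTensor_add, LinearMap.lTensor_smul, LinearMap.lTensor_id,
    LinearMap.lTensor_comp] at h1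
  refine LinearMap.ext fun x => ?_
  have h2 := LinearMap.congr_fun h1 x
  have h3 := LinearMap.congr_fun (comulT_lTensor (A := A) T) x
  simp only [LinearMap.comp_apply, LinearMap.add_apply] at h2 h3
  rw [cobarStep_eq (cobarStep e)]
  simp only [LinearMap.comp_apply, LinearMap.sub_apply, LinearMap.neg_apply, map_sub, map_neg, h2,
    ← h3, LinearMap.add_apply]
  rw [cobarStep_eq e]
  simp only [LinearMap.sub_apply, LinearMap.neg_apply, LinearMap.smul_apply, neg_smul]
  abel

/-- Base of the contraction, with T = 1 ⊗ ε ⊗ 1: the identity term comes from the counit law (1 ⊗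
ε)Δ = 1, and the other two terms agree by naturality of Δ. -/
theorem contraction_zero : ((counitT k A W).lTensor A).lTensor A ∘ₗ cobarStep (-comulT k A W) =
    (-comulT k A W) ∘ₗ (counitT k A W).lTensor A + (1 : k) • LinearMap.id := by
  refine LinearMap.ext fun x => ?_
  have h1 := congrArg (LinearMap.lTensor A) (counitT_comulT (k := k) (A := A) (W := W))
  rw [LinearMap.lTensor_comp, LinearMap.lTensor_id] at h1
  have h2 := LinearMap.congr_fun h1 x
  have h3 := LinearMap.congr_fun (comulT_lTensor (A := A) (counitT k A W)) x
  simp only [LinearMap.comp_apply] at h2 h3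
  simp [cobarStep_eq, LinearMap.lTensor_neg, h2, h3]

theorem lTensor_comp_natural {l : V →ₗ[k] A ⊗[k] V} {η : V →ₗ[k] W} {ρ : A →ₗ[k] Module.End k V}
    {ρ' : A →ₗ[k] Module.End k W} {τ : A →ₗ[k] Module.End k A}
    (hl : ∀ a, l ∘ₗ ρ a = diag τ ρ a ∘ₗ l) (hη : ∀ a, η ∘ₗ ρ a = ρ' a ∘ₗ η) (a : A) :
    (η.lTensor A ∘ₗ l) ∘ₗ ρ a = diag τ ρ' a ∘ₗ η.lTensor A ∘ₗ l := by
  rw [LinearMap.comp_assoc, hl, ← LinearMap.comp_assoc, lTensor_diag hη, LinearMap.comp_assoc]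

theorem comulT_comp_lTensor {l : V →ₗ[k] A ⊗[k] V} (η : V →ₗ[k] W)
    (hl : (TensorProduct.assoc k A A V).toLinearMap ∘ₗ comul.rTensor V ∘ₗ l = l.lTensor A ∘ₗ l) :
    comulT k A W ∘ₗ η.lTensor A ∘ₗ l = (η.lTensor A ∘ₗ l).lTensor A ∘ₗ l := by
  have h : comulT k A V ∘ₗ l = l.lTensor A ∘ₗ l := hl
  rw [← LinearMap.comp_assoc, comulT_lTensor, LinearMap.comp_assoc, h, LinearMap.lTensor_comp,
    LinearMap.comp_assoc]

end Cofree

namespace HopfBimod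

variable {N : HopfBimod k A}

theorem isTri (N : HopfBimod k A) : IsTri N.lact N.ract N.rco := N.isTri_cobar 0

/-- The Hopf bimodule `A ⊗ Hom(A, N)`. -/
noncomputable def coh (N : HopfBimod k A) : HopfBimod k A := N.isTri.coind.cofree

/-- `n ↦ (x ↦ nx)` -/
noncomputable def unitMap (N : HopfBimod k A) : N.carrier →ₗ[k] (A →ₗ[k] N.carrier) := N.ract.flip

theorem isLRMap_unitMap (N : HopfBimod k A) :
    IsLRMap N.lact N.rco (coindLact k A N.lact) (coindRco N.rco) N.unitMap :=
  isLRMap_curry (N.isBarMap_barD 0).isLRMap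

theorem unitMap_ract (N : HopfBimod k A) (a : A) :
    N.unitMap ∘ₗ N.ract a = coindRact k A N.carrier a ∘ₗ N.unitMap := by
  refine LinearMap.ext fun n => LinearMap.ext fun x => ?_
  exact (LinearMap.congr_fun (N.mul_ract a x) n).symm

/-- The embedding `n ↦ ∑ n₍₋₁₎ ⊗ (x ↦ n₍₀₎ x)`. -/
noncomputable def toCoh (N : HopfBimod k A) : Hom N N.coh where
  toLin := N.unitMap.lTensor A ∘ₗ N.lco
  map_lact := lTensor_comp_natural N.lco_lact N.isLRMap_unitMap.lin
  map_ract := lTensor_comp_natural N.lco_ract N.unitMap_ract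
  map_lco := comulT_comp_lTensor N.unitMap N.lco_coassoc
  map_rco := (N.isLRMap_unitMap.lTensor.comp (N.isBi_bar 0).isLRMap).colin

/-- Evaluation at 1 undoes n ↦ (x ↦ nx), and the counit undoes the coaction. -/
theorem toCoh_injective (N : HopfBimod k A) : Function.Injective N.toCoh.toLin := by
  refine Function.Injective.comp (g := N.unitMap.lTensor A)
    (Module.Flat.lTensor_preserves_injective_linearMap _ fun n n' h => ?_) fun n n' h => ?_
  · have h1 := LinearMap.congr_fun h 1
    change N.ract 1 n = N.ract 1 n' at h1
    rwa [N.one_ract] at h1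
  · rw [← lhit_counit n, ← lhit_counit n', lhit_apply, lhit_apply, h]

end HopfBimod
end HopfBimodCoh

namespace HopfBimodCoh
variable {k A : Type u} [Field k] [Ring A] [HopfAlgebra k A] [FiniteDimensional k A]

/-! ### Vanishing of the cohomology with coefficients A ⊗ Hom(A, N) -/

section Unbundled

variable {V W U : Type u} [AddCommGroup V] [Module k V] [AddCommGroup W] [Module k W]
  [AddCommGroup U] [Module k U]

/-- With s = ±T∘-, this is d_c s + s d_c = −1. The sign (-1)^(q+p) of s makes the two terms in which
α follows the coaction cancel here, and makes s anticommute with d_h in `homBar_contraction`. -/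
theorem homCobar_contraction {l : V →ₗ[k] A ⊗[k] V} {T : A ⊗[k] W →ₗ[k] W} {e : W →ₗ[k] A ⊗[k] W}
    (q p : ℕ) (h : T.lTensor A ∘ₗ cobarStep e = e ∘ₗ T + (-1 : k) ^ p • LinearMap.id)
    (α : V →ₗ[k] A ⊗[k] W) :
    ((-1 : k) ^ q • homCobar l e) ((-1 : k) ^ (q + p) • T ∘ₗ α) +
      (-1 : k) ^ (q + (p + 1)) • T.lTensor A ∘ₗ ((-1 : k) ^ q • homCobar l (cobarStep e)) α = -α := by
  refine LinearMap.ext fun v => ?_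
  have h1 := LinearMap.congr_fun h (α v)
  simp only [LinearMap.comp_apply, LinearMap.add_apply, LinearMap.smul_apply,
    LinearMap.id_apply] at h1
  simp only [LinearMap.add_apply, LinearMap.smul_apply, homCobar_eq, LinearMap.comp_apply, map_add,
    map_smul, LinearMap.lTensor_comp, h1, LinearMap.neg_apply]
  rcases neg_one_pow_eq_or k q with hq | hq <;> rcases neg_one_pow_eq_or k p with hp | hp <;>
    simp [pow_succ, pow_add, hq, hp] <;> abel

theorem homBar_contraction {d : V ⊗[k] A →ₗ[k] V} {T : W →ₗ[k] U} {σ : A →ₗ[k] Module.End k W}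
    {σ' : A →ₗ[k] Module.End k U} (hT : ∀ a, T ∘ₗ σ a = σ' a ∘ₗ T) (q p : ℕ) (c : k)
    (α : V →ₗ[k] W) :
    homBar d σ' c ((-1 : k) ^ (q + p) • T ∘ₗ α) +
      (-1 : k) ^ (q + 1 + p) • T ∘ₗ homBar d σ c α = 0 := by
  rw [map_smul, homBar_comp_left d hT]
  refine LinearMap.ext fun v => ?_
  simp [pow_succ, pow_add]

/-- Bookkeeping for a homotopy s: a and b are the d_h and d_c parts of a component of D s f, while
a' and b' are those of a component of D f. For a cocycle the latter sum to zero, so s D f drops out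
when the two homotopy relations are added. -/
theorem add_eq_of_add_eq_zero {a b r : V →ₗ[k] W} {a' b' : V →ₗ[k] U} {T : U →ₗ[k] W} {c : k}
    (h : a' + b' = 0) (ha : a + c • T ∘ₗ a' = 0) (hb : b + c • T ∘ₗ b' = r) : a + b = r := by
  rw [eq_neg_of_add_eq_zero_left h] at ha
  rw [← add_zero b, ← hb]
  refine LinearMap.ext fun v => ?_
  have h1 := LinearMap.congr_fun ha v
  simp only [LinearMap.add_apply, LinearMap.smul_apply, LinearMap.comp_apply, LinearMap.neg_apply,
    map_neg, smul_neg, LinearMap.zero_apply, add_zero] at h1 ⊢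
  rw [add_neg_eq_zero.1 h1, add_comm]

theorem add_smul_comp_zero (T : U →ₗ[k] W) (c : k) :
    (0 : V →ₗ[k] W) + c • T ∘ₗ (0 : V →ₗ[k] U) = 0 := by
  rw [LinearMap.comp_zero, smul_zero, add_zero]

theorem evalT_one (r : W →ₗ[k] W ⊗[k] A) (φ : A →ₗ[k] W) :
    evalT A 1 (coindRco r φ) = r (φ 1) := by
  rw [evalT_coindRco, ← coindAux_apply]
  change (LinearMap.mul' k A).lTensor W (TensorProduct.assoc k W A A
    (TensorProduct.map (r ∘ₗ φ) (antipode k) (comul 1))) = _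
  rw [Bialgebra.comul_one, Algebra.TensorProduct.one_def, TensorProduct.map_tmul, antipode_one,
    LinearMap.comp_apply]
  generalize r (φ 1) = t
  induction t with
  | zero => simp
  | add x y hx hy => simp only [TensorProduct.add_tmul, map_add, hx, hy]
  | tmul x y => simp

theorem isLRMap_eval_one (ρ : A →ₗ[k] Module.End k W) (r : W →ₗ[k] W ⊗[k] A) :
    IsLRMap (coindLact k A ρ) (coindRco r) ρ r (LinearMap.applyₗ (R := k) (1 : A)) where
  lin _ := rfl
  colin := LinearMap.ext fun φ => (evalT_one r φ).symm

/-- The primitive is v ↦ (x ↦ ±g(v ⊗ x)(1)). Evaluating the cocycle identity for v ⊗ a ⊗ x at 1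
expresses g(v ⊗ a)(x) through values at 1. -/
theorem homBar_curry {d : V ⊗[k] A →ₗ[k] V} (n : ℕ) {g : V ⊗[k] A →ₗ[k] (A →ₗ[k] W)}
    (hg : homBar (barStep d n) (coindRact k A W) ((-1) ^ (n + 2)) g = 0) :
    homBar d (coindRact k A W) ((-1) ^ (n + 1))
      ((-1 : k) ^ (n + 1) • TensorProduct.curry (LinearMap.applyₗ (R := k) (1 : A) ∘ₗ g)) = g := by
  ext v a x
  have h := LinearMap.congr_fun (LinearMap.congr_fun hg ((v ⊗ₜ a) ⊗ₜ x)) 1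
  simp only [homBar_eq, LinearMap.add_apply, LinearMap.comp_apply, LinearMap.smul_apply, actR_tmul,
    barStep, LinearMap.rTensor_tmul, LinearEquiv.coe_coe, TensorProduct.assoc_tmul,
    LinearMap.lTensor_tmul, LinearMap.mul'_apply, map_add, map_smul, LinearMap.zero_apply,
    coindRact_apply, mul_one] at h
  simp only [homBar_eq, TensorProduct.AlgebraTensorModule.curry_apply,
    LinearMap.restrictScalars_self, TensorProduct.curry_apply, LinearMap.add_apply,
    LinearMap.comp_apply, LinearMap.smul_apply, actR_tmul, map_smul, coindRact_apply,
    LinearMap.applyₗ_apply_apply]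
  rcases neg_one_pow_eq_or k n with hn | hn <;> simp [pow_succ, hn] at h ⊢
  · rw [add_comm, eq_comm, ← sub_eq_zero, ← h]; abel
  · rw [add_neg_eq_zero.1 h]

theorem homCobar_lTensor_comp {l : V →ₗ[k] A ⊗[k] V}
    (hl : (TensorProduct.assoc k A A V).toLinearMap ∘ₗ comul.rTensor V ∘ₗ l = l.lTensor A ∘ₗ l)
    (c : k) (h : V →ₗ[k] W) : (c • homCobar l (-comulT k A W)) (h.lTensor A ∘ₗ l) = 0 := by
  have h1 := comulT_comp_lTensor h hl
  refine LinearMap.ext fun v => ?_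
  have h2 := LinearMap.congr_fun h1 v
  simp only [LinearMap.comp_apply] at h2
  simp [homCobar_eq, h2]

/-- The hypothesis says that `f` is a comodule map into a cofree comodule, and such a map is
determined by its composite with the counit. `homCobar_lTensor_comp` is the converse. -/
theorem eq_lTensor_comp {l : V →ₗ[k] A ⊗[k] V} {f : V →ₗ[k] A ⊗[k] W} {c : k} (hc : c ≠ 0)
    (h : (c • homCobar l (-comulT k A W)) f = 0) : (counitT k A W ∘ₗ f).lTensor A ∘ₗ l = f := by
  refine LinearMap.ext fun v => ?_
  have h1 := LinearMap.congr_fun ((smul_eq_zero_iff_right hc).1 h) v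
  have h2 := LinearMap.congr_fun (counitT_comulT (k := k) (A := A) (W := W)) (f v)
  simp only [homCobar_eq, LinearMap.add_apply, LinearMap.comp_apply, LinearMap.neg_apply,
    LinearMap.zero_apply] at h1 h2
  rw [LinearMap.comp_apply, LinearMap.lTensor_comp, LinearMap.comp_apply,
    add_neg_eq_zero.1 h1, h2, LinearMap.id_apply]

end Unbundled

namespace HopfBimod

variable {M N : HopfBimod k A}

variable (N) in
/-- `a ⊗ b ⊗ w ↦ ε(b) a ⊗ w`, applied to the last two factors of `A^{⊗ (p+1)} ⊗ (A ⊗ W)`. -/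
noncomputable def cohT : ∀ p, A ⊗[k] N.coh.cobar p →ₗ[k] N.coh.cobar p
  | 0 => (counitT k A (A →ₗ[k] N.carrier)).lTensor A
  | p + 1 => (cohT p).lTensor A

theorem cohT_cobarStep : ∀ p, (N.cohT p).lTensor A ∘ₗ cobarStep (N.coh.cobarD p) =
    N.coh.cobarD p ∘ₗ N.cohT p + (-1 : k) ^ p • LinearMap.id
  | 0 => by
    rw [pow_zero]
    exact contraction_zero
  | p + 1 => by
    rw [pow_succ, mul_neg_one]
    exact contraction_step (cohT_cobarStep p)

theorem isLRMap_cohT : ∀ p, IsLRMap (N.coh.cobarLact (p + 1)) (N.coh.cobarRco (p + 1))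
    (N.coh.cobarLact p) (N.coh.cobarRco p) (N.cohT p)
  | 0 => (isLRMap_counitT (coindLact k A N.lact) (coindRco N.rco)).lTensor
  | p + 1 => (isLRMap_cohT p).lTensor

theorem cohT_ract : ∀ p a,
    N.cohT p ∘ₗ N.coh.cobarRact (p + 1) a = N.coh.cobarRact p a ∘ₗ N.cohT p
  | 0 => lTensor_diag (counitT_ract (coindRact k A N.carrier))
  | p + 1 => lTensor_diag (cohT_ract p)

/-- The contracting homotopy in the direction of the coaction. -/
noncomputable def cohS (f : Tot M N.coh) : Tot M N.coh := fun x =>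
  (-1 : k) ^ (x.1 + x.2) • (N.cohT x.2 ∘ₗ f (x.1, x.2 + 1))

theorem cohS_mem_C {n : ℕ} {f : Tot M N.coh} (hf : f ∈ C M N.coh (n + 1)) :
    cohS f ∈ C M N.coh n := fun x => by
  refine ⟨mem_K_iff.2 (((isLRMap_cohT x.2).comp (mem_K_iff.1 (hf (x.1, x.2 + 1)).1)).smul _),
    fun h => ?_⟩
  have h1 := (hf (x.1, x.2 + 1)).2 (by simpa [← add_assoc] using h)
  refine LinearMap.ext fun v => ?_
  have h2 : cohS f x v = (-1 : k) ^ (x.1 + x.2) • N.cohT x.2 (f (x.1, x.2 + 1) v) := rfl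
  rw [h2, h1]
  exact (congrArg _ (map_zero (N.cohT x.2))).trans (smul_zero _)

/-- In the row p = 0 nothing arrives through d_c, so the homotopy relation is available only in the
rows p ≥ 1. Hence f + D(s f) is supported in p = 0 when f is a cocycle. -/
theorem D_cohS {f : Tot M N.coh} (hf : D M N.coh f = 0) (q p : ℕ) :
    D M N.coh (cohS f) (q, p + 1) = -f (q, p + 1) := by
  -- The component of D f = 0 that matters is at (q, p + 2), because the homotopy lowers p by one.
  refine add_eq_of_add_eq_zero (congrFun hf (q, p + 2)) (c := (-1 : k) ^ (q + (p + 1))) ?_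
    (homCobar_contraction q p (cohT_cobarStep p) _)
  cases q with
  | zero => exact add_smul_comp_zero _ _
  | succ q => exact homBar_contraction (cohT_ract (p + 1)) q (p + 1) _ _

theorem single_same (q p : ℕ) (α : M.bar q →ₗ[k] N.cobar p) : single q p α (q, p) = α :=
  Pi.single_eq_same (M := fun x : ℕ × ℕ => M.bar x.1 →ₗ[k] N.cobar x.2) (q, p) α

theorem single_ne (q p : ℕ) (α : M.bar q →ₗ[k] N.cobar p) {x : ℕ × ℕ} (h : x ≠ (q, p)) :
    single q p α x = 0 :=
  Pi.single_eq_of_ne (M := fun x : ℕ × ℕ => M.bar x.1 →ₗ[k] N.cobar x.2) h α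

theorem single_mem_C {q p n : ℕ} {α : M.bar q →ₗ[k] N.cobar p} (h : α ∈ K M N q p)
    (hn : q + p = n) : single q p α ∈ C M N n := fun x => by
  by_cases hx : x = (q, p)
  · subst hx
    exact ⟨by rwa [single_same], fun h => absurd hn h⟩
  · rw [single_ne q p α hx]
    exact ⟨zero_mem _, fun _ => rfl⟩

/-- A cocycle in the row p = 0 is closed for d_c, hence it is the comodule map given by some g with
values in Hom(A, N). Coinduction provides a primitive h of g for d_h, and the comodule map of h is
the primitive wanted. -/
theorem exists_D_eq_of_column {n : ℕ} {f : Tot M N.coh} (hf : f ∈ Z M N.coh (n + 1))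
    (h0 : ∀ q p, f (q, p + 1) = 0) : ∃ c ∈ C M N.coh n, D M N.coh c = f := by
  let W := A →ₗ[k] N.carrier
  obtain ⟨hC, hD⟩ := mem_Z_iff.1 hf
  let f₀ : M.bar n ⊗[k] A →ₗ[k] A ⊗[k] W := f (n + 1, 0)
  have hc : dc M N.coh (n + 1) 0 (f (n + 1, 0)) = 0 := by
    have h := congrFun hD (n + 1, 1)
    rw [D_apply, dhTot_succ, h0, map_zero, zero_add] at h
    exact h
  have hh : dh M N.coh (n + 1) 0 (f (n + 1, 0)) = 0 := by
    have h := congrFun hD (n + 2, 0)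
    rw [D_apply, dcTot_zero, add_zero] at h
    exact h
  let g : M.bar n ⊗[k] A →ₗ[k] W := counitT k A W ∘ₗ f₀
  have hfg : g.lTensor A ∘ₗ lcoStep (M.barLco n) = f₀ :=
    eq_lTensor_comp (pow_ne_zero (n + 1) (neg_ne_zero.2 one_ne_zero)) hc
  have hgLR : IsLRMap (LinearMap.rTensorHom A ∘ₗ M.barLact n) (rcoStep (M.barRco n))
      (coindLact k A N.lact) (coindRco N.rco) g :=
    (isLRMap_counitT _ _).comp (mem_K_iff.1 (hC (n + 1, 0)).1)
  have hgh : homBar (barStep (M.barD n) n) (coindRact k A N.carrier) ((-1) ^ (n + 2)) g = 0 := by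
    refine (homBar_comp_left _ (counitT_ract (coindRact k A N.carrier)) _ f₀).trans ?_
    exact (congrArg (counitT k A W ∘ₗ ·) hh).trans (LinearMap.comp_zero _)
  -- The primitive of `homBar_curry`. It is again left linear and right colinear, because evaluation
  -- at 1 is and currying preserves this.
  let h : M.bar n →ₗ[k] W :=
    (-1 : k) ^ (n + 1) • TensorProduct.curry (LinearMap.applyₗ (R := k) (1 : A) ∘ₗ g)
  have hhg := homBar_curry n hgh
  have hLR : IsLRMap (M.barLact n) (M.barRco n) (coindLact k A N.lact) (coindRco N.rco) h :=
    (isLRMap_curry ((isLRMap_eval_one _ _).comp hgLR)).smul _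
  let H : M.bar n →ₗ[k] N.coh.cobar 0 := h.lTensor A ∘ₗ M.barLco n
  have hHK : H ∈ K M N.coh n 0 := mem_K_iff.2 (hLR.lTensor.comp (M.isBi_bar n).isLRMap)
  have hH1 : dh M N.coh n 0 H = f (n + 1, 0) := by
    refine (homBar_lTensor_comp (M.isBarMap_barD n).lcolin (coindRact k A N.carrier) _ h).trans ?_
    rw [hhg]
    exact hfg
  -- `H` is a comodule map by construction, so its total differential has no component in the row p
  -- = 1.
  have hH2 : dc M N.coh n 0 H = 0 := homCobar_lTensor_comp (M.isBi_bar n).lcoassoc _ h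
  refine ⟨single n 0 H, single_mem_C hHK rfl, ?_⟩
  funext ⟨q, p⟩
  rw [D_apply]
  have hd : dhTot M N.coh q p (single n 0 H) = f (q, p) := by
    rcases q with _ | q
    · rw [dhTot_zero]
      rcases p with _ | p
      · exact ((hC (0, 0)).2 (by simp)).symm
      · exact (h0 _ _).symm
    · rw [dhTot_succ]
      rcases p with _ | p
      · by_cases hq : q = n
        · subst hq
          rw [single_same, hH1]
        · rw [single_ne n 0 H (by simpa using hq), map_zero]
          exact ((hC (q + 1, 0)).2 (by simpa using hq)).symm
      · rw [single_ne n 0 H (by simp), map_zero, h0]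
  have hd' : dcTot M N.coh q p (single n 0 H) = 0 := by
    rcases p with _ | p
    · rw [dcTot_zero]
    · rw [dcTot_succ]
      by_cases hq : (q, p) = (n, 0)
      · obtain ⟨rfl, rfl⟩ := Prod.mk.inj hq
        rw [single_same, hH2]
      · rw [single_ne n 0 H hq, map_zero]
  rw [hd, hd', add_zero]

/-- Adding the coboundary D(s f) moves `f` into the row p = 0, where `exists_D_eq_of_column`
applies. -/
theorem exists_D_eq_coh {n : ℕ} {f : Tot M N.coh} (hf : f ∈ Z M N.coh (n + 1)) :
    ∃ c ∈ C M N.coh n, D M N.coh c = f := by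
  obtain ⟨hC, hD⟩ := mem_Z_iff.1 hf
  have hs := cohS_mem_C hC
  obtain ⟨c, hc, hcD⟩ := exists_D_eq_of_column (f := f + D M N.coh (cohS f))
    (mem_Z_iff.2 ⟨add_mem hC (D_mem_C hs), by rw [map_add, hD, D_D, add_zero]⟩) fun q p => by
      change f (q, p + 1) + D M N.coh (cohS f) (q, p + 1) = 0
      rw [D_cohS hD, add_neg_cancel]
  exact ⟨c - cohS f, sub_mem hc hs, by rw [map_sub, hcD, add_sub_cancel_right]⟩

end HopfBimod
end HopfBimodCoh

/-! ### Injective coefficients and degree zero -/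

namespace HopfBimodCoh
variable {k A : Type u} [Field k] [Ring A] [HopfAlgebra k A] [FiniteDimensional k A]

/-- Replaces a diagram chase: P is the space of 0-cocycles at first, and the space `SES.pairs` in
the inductive step. Surjectivity of `a` makes the formula determine e. -/
theorem exists_linearEquiv_of_ker_eq {P H E : Type*} [AddCommGroup P] [Module k P] [AddCommGroup H]
    [Module k H] [AddCommGroup E] [Module k E] (a : P →ₗ[k] H) (b : P →ₗ[k] E)
    (ha : Function.Surjective a) (hb : Function.Surjective b)
    (h : ∀ x, a x = 0 ↔ b x = 0) : ∃ e : H ≃ₗ[k] E, ∀ x, e (a x) = b x := by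
  have hk : LinearMap.ker a = LinearMap.ker b := Submodule.ext h
  refine ⟨(a.quotKerEquivOfSurjective ha).symm ≪≫ₗ Submodule.quotEquivOfEq _ _ hk ≪≫ₗ
    b.quotKerEquivOfSurjective hb, fun x => ?_⟩
  have h1 : (a.quotKerEquivOfSurjective ha).symm (a x) = Submodule.Quotient.mk x := by
    rw [LinearEquiv.symm_apply_eq]
    rfl
  exact congrArg (fun y => b.quotKerEquivOfSurjective hb (Submodule.quotEquivOfEq _ _ hk y)) h1

/-- With its counterpart `homCobar_neg_eq`, it identifies the two halves of the cocycle condition in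
degree 0 with right linearity and left colinearity. -/
theorem homBar_lift_eq {V W : Type u} [AddCommGroup V] [Module k V] [AddCommGroup W] [Module k W]
    {σ : A →ₗ[k] Module.End k V} {σ' : A →ₗ[k] Module.End k W} {f : V →ₗ[k] W} :
    homBar (TensorProduct.lift σ.flip) σ' ((-1) ^ (0 + 1)) f = 0 ↔ ∀ a, f ∘ₗ σ a = σ' a ∘ₗ f := by
  constructor
  · intro h a
    refine LinearMap.ext fun v => ?_
    have h1 := LinearMap.congr_fun h (v ⊗ₜ a)
    simpa [homBar_eq, add_neg_eq_zero] using h1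
  · intro h
    ext v a
    have h1 := LinearMap.congr_fun (h a) v
    simpa [homBar_eq, add_neg_eq_zero] using h1

theorem homCobar_neg_eq {V W : Type u} [AddCommGroup V] [Module k V] [AddCommGroup W] [Module k W]
    {l : V →ₗ[k] A ⊗[k] V} {l' : W →ₗ[k] A ⊗[k] W} {f : V →ₗ[k] W} :
    ((-1 : k) ^ 0 • homCobar l (-l')) f = 0 ↔ l' ∘ₗ f = f.lTensor A ∘ₗ l := by
  constructor
  · intro h
    refine LinearMap.ext fun v => ?_
    have h1 := LinearMap.congr_fun h v
    simp only [pow_zero, one_smul, homCobar_eq, LinearMap.add_apply, LinearMap.comp_apply,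
      LinearMap.neg_apply, LinearMap.zero_apply, add_neg_eq_zero] at h1
    exact h1.symm
  · intro h
    refine LinearMap.ext fun v => ?_
    have h1 := LinearMap.congr_fun h v
    simp only [pow_zero, one_smul, homCobar_eq, LinearMap.add_apply, LinearMap.comp_apply,
      LinearMap.neg_apply, LinearMap.zero_apply, add_neg_eq_zero]
    exact h1.symm

namespace HopfBimod

open CategoryTheory

variable {M N N' I : HopfBimod k A}

theorem Hom.toX_injective {u v : Hom M N} (h : u.toX = v.toX) : u = v := by
  have h1 : u.toLin = v.toLin := LinearMap.ext fun m => congrArg (fun f => f.hom m) h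
  cases u
  cases v
  cases h1
  rfl

/-- The composition of morphisms of Hopf bimodules. -/
noncomputable def Hom.comp {L : HopfBimod k A} (v : Hom N L) (u : Hom M N) : Hom M L :=
  Hom.ofX (v.toXLin ∘ₗ u.toXLin)

theorem Hom.comp_toX {L : HopfBimod k A} (v : Hom N L) (u : Hom M N) :
    (v.comp u).toX = u.toX ≫ v.toX := rfl

theorem push_comp {L : HopfBimod k A} (v : Hom N L) (u : Hom M N) {P : HopfBimod k A}
    (f : Tot P M) : push P (v.comp u) f = push P v (push P u f) := by
  funext x
  have h := cobMap_comp (A := A) (V := ModuleCat.of k M.carrier) (W := ModuleCat.of k N.carrier)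
    (U := ModuleCat.of k L.carrier) v.toLin u.toLin x.2
  exact congrArg (· ∘ₗ f x) h

/-- The identity of a Hopf bimodule. -/
noncomputable def Hom.id (M : HopfBimod k A) : Hom M M := Hom.ofX LinearMap.id

theorem push_id {P : HopfBimod k A} (f : Tot P M) : push P (Hom.id M) f = f := by
  funext x
  have h := cobMap_id (A := A) (V := ModuleCat.of k M.carrier) x.2
  exact congrArg (· ∘ₗ f x) h

/-- An injective I is a retract of `I.coh`, into which it embeds. Push the cocycle there, take a
primitive, and retract it. -/
theorem exists_D_eq_of_injective [Injective (ModuleCat.of (XAlg k A) I.carrier)] {n : ℕ}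
    {f : Tot M I} (hf : f ∈ Z M I (n + 1)) : ∃ c ∈ C M I n, D M I c = f := by
  have : Mono I.toCoh.toX := (ModuleCat.mono_iff_injective _).2 I.toCoh_injective
  obtain ⟨r, hr⟩ := Hom.exists_toX_eq
    (Injective.factorThru (𝟙 (ModuleCat.of (XAlg k A) I.carrier)) I.toCoh.toX)
  have hri : r.comp I.toCoh = Hom.id I := Hom.toX_injective (by
    rw [Hom.comp_toX, hr, Injective.comp_factorThru]
    rfl)
  obtain ⟨c, hc, hcD⟩ := exists_D_eq_coh (push_mem_Z I.toCoh hf)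
  refine ⟨push M r c, push_mem_C r hc, ?_⟩
  rw [D_push, hcD, ← push_comp, hri, push_id]

/-- A morphism of Hopf bimodules, as a cochain. -/
noncomputable def Hom.cochain (u : Hom M N) : M.bar 0 →ₗ[k] N.cobar 0 := u.toLin

theorem single_mem_Z (u : Hom M N) : single 0 0 u.cochain ∈ Z M N 0 := by
  refine mem_Z_iff.2 ⟨single_mem_C (mem_K_iff.2 ⟨u.map_lact, u.map_rco⟩) rfl, ?_⟩
  funext ⟨q, p⟩
  rw [D_apply]
  have h1 : dhTot M N q p (single 0 0 u.cochain) = 0 := by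
    rcases q with _ | q
    · rw [dhTot_zero]
    · rw [dhTot_succ]
      by_cases h : (q, p) = (0, 0)
      · obtain ⟨rfl, rfl⟩ := Prod.mk.inj h
        rw [single_same]
        exact homBar_lift_eq.2 u.map_ract
      · rw [single_ne 0 0 u.cochain h, map_zero]
  have h2 : dcTot M N q p (single 0 0 u.cochain) = 0 := by
    rcases p with _ | p
    · rw [dcTot_zero]
    · rw [dcTot_succ]
      by_cases h : (q, p) = (0, 0)
      · obtain ⟨rfl, rfl⟩ := Prod.mk.inj h
        rw [single_same]
        exact homCobar_neg_eq.2 u.map_lco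
      · rw [single_ne 0 0 u.cochain h, map_zero]
  rw [h1, h2, add_zero]
  rfl

theorem exists_hom_of_mem_Z {f : Tot M N} (hf : f ∈ Z M N 0) :
    ∃ u : Hom M N, u.cochain = f (0, 0) ∧ f = single 0 0 u.cochain := by
  obtain ⟨hC, hD⟩ := mem_Z_iff.1 hf
  have hK := mem_K_iff.1 (hC (0, 0)).1
  have h1 : dh M N 0 0 (f (0, 0)) = 0 := by
    have h := congrFun hD (1, 0)
    rw [D_apply, dcTot_zero, add_zero] at h
    exact h
  have h2 : dc M N 0 0 (f (0, 0)) = 0 := by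
    have h := congrFun hD (0, 1)
    rw [D_apply, dhTot_zero, zero_add] at h
    exact h
  refine ⟨⟨f (0, 0), hK.lin, homBar_lift_eq.1 h1, homCobar_neg_eq.1 h2, hK.colin⟩, rfl, ?_⟩
  funext x
  by_cases hx : x = (0, 0)
  · subst hx
    exact (single_same 0 0 (f (0, 0))).symm
  · refine ((hC x).2 fun h => hx ?_).trans (single_ne 0 0 (f (0, 0)) hx).symm
    exact Prod.ext (Nat.eq_zero_of_add_eq_zero_right h) (Nat.eq_zero_of_add_eq_zero_left h)

/-- A scalar acts on X-linear maps through its image in X, which by `algebraMap_smul` is the given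
k-structure. The module structure is named so that the lemma fits `Abelian.Ext.mk₀_smul`. -/
theorem Hom.toX_smul {c : k} {u v : Hom M N} (h : v.toLin = c • u.toLin) :
    v.toX = (Linear.homModule (R := k) (ModuleCat.of (XAlg k A) M.carrier)
      (ModuleCat.of (XAlg k A) N.carrier)).toSMul.smul c u.toX := by
  refine ModuleCat.hom_ext (LinearMap.ext fun m => (LinearMap.congr_fun h m).trans ?_)
  have h1 := algebraMap_smul (XAlg k A) c (u.toLin m)
  exact h1.symm

theorem exists_linearMap_mk₀ : ∃ g : Z M N 0 →ₗ[k] ExtX M N 0,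
    ∀ (u : Hom M N) (f : Z M N 0), (f : Tot M N) = single 0 0 u.cochain →
      g f = Abelian.Ext.mk₀ u.toX := by
  choose h h1 h2 using fun f : Z M N 0 => exists_hom_of_mem_Z f.2
  have key : ∀ (u : Hom M N) (f : Z M N 0), (f : Tot M N) = single 0 0 u.cochain →
      h f = u := fun u f hf => by
    refine Hom.toX_injective ?_
    have h3 : (h f).cochain = u.cochain := by rw [h1, hf, single_same]
    ext m
    exact LinearMap.congr_fun h3 m
  refine ⟨{ toFun := fun f => Abelian.Ext.mk₀ (h f).toX
            map_add' := fun f f' => ?_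
            map_smul' := fun c f => ?_ }, fun u f hf => ?_⟩
  · rw [← Abelian.Ext.mk₀_add]
    congr 1
    ext m
    have h3 : (h (f + f')).cochain = (h f).cochain + (h f').cochain := by
      rw [h1, h1, h1]; rfl
    exact LinearMap.congr_fun h3 m
  · rw [RingHom.id_apply, ← Abelian.Ext.mk₀_smul]
    congr 1
    have h3 : (h (c • f)).cochain = c • (h f).cochain := by
      rw [h1, h1]; rfl
    exact Hom.toX_smul h3
  · change Abelian.Ext.mk₀ (h f).toX = _
    rw [key u f hf]

/-- There are no coboundaries in degree 0, so classes are cocycles, cocycles are morphisms of Hopf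
bimodules, and these are the elements of Ext⁰. -/
theorem exists_deltaMap_zero (M : HopfBimod k A) : ∃ φ : ∀ N : HopfBimod k A,
    HA4 M N 0 ≃ₗ[k] ExtX M N 0, ∀ {N : HopfBimod k A} (u : Hom M N) (f : Z M N 0),
    (f : Tot M N) = single 0 0 u.cochain → φ N (cls f) = Abelian.Ext.mk₀ u.toX := by
  have h : ∀ N : HopfBimod k A, ∃ e : HA4 M N 0 ≃ₗ[k] ExtX M N 0, ∀ (u : Hom M N) (f : Z M N 0),
      (f : Tot M N) = single 0 0 u.cochain → e (cls f) = Abelian.Ext.mk₀ u.toX := fun N => by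
    obtain ⟨g, hg⟩ := exists_linearMap_mk₀ (M := M) (N := N)
    obtain ⟨e, he⟩ := exists_linearEquiv_of_ker_eq
      (((B M N 0).comap (Z M N 0).subtype).mkQ) g (Submodule.mkQ_surjective _)
      (fun x => by
        obtain ⟨u, hu⟩ := Hom.exists_toX_eq (Abelian.Ext.addEquiv₀ x)
        refine ⟨⟨_, single_mem_Z u⟩, ?_⟩
        rw [hg u _ rfl, hu, Abelian.Ext.mk₀_addEquiv₀_apply])
      (fun f => by
        obtain ⟨u, hu, hf⟩ := exists_hom_of_mem_Z f.2
        rw [hg u f hf, Abelian.Ext.mk₀_eq_zero_iff]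
        refine (cls_eq_zero_iff f).trans ?_
        rw [show B M N 0 = ⊥ from rfl, Submodule.mem_bot]
        constructor
        · intro h
          rw [h] at hu
          ext m
          exact LinearMap.congr_fun hu m
        · intro h
          have h3 : u.cochain = 0 := LinearMap.ext fun m => congrArg (fun f => f.hom m) h
          rw [hf, h3, map_zero])
    exact ⟨e, fun u f hf => (he f).trans (hg u f hf)⟩
  choose φ hφ using h
  exact ⟨φ, fun u f hf => hφ _ u f hf⟩

end HopfBimod
end HopfBimodCoh

namespace HopfBimodCoh
variable {k A : Type u} [Field k] [Ring A] [HopfAlgebra k A] [FiniteDimensional k A]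

/-! ### Dimension shifting: existence and uniqueness of the comparison -/

namespace HopfBimod

open CategoryTheory

variable {M N N' I : HopfBimod k A}

/-- Every Hopf bimodule embeds into an injective one. -/
theorem exists_injective_ses (N : HopfBimod k A) : ∃ (I Q : HopfBimod k A) (_ : SES N I Q),
    Injective (ModuleCat.of (XAlg k A) I.carrier) := by
  obtain ⟨I, i, hi, hI⟩ := exists_injective N
  obtain ⟨Q, S, -⟩ := exists_cokernel i hi
  exact ⟨I, Q, S, hI⟩

/-- A morphism from the left end of a short exact sequence into the left end of a short exact
sequence with injective middle term extends to a morphism of short exact sequences. -/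
theorem SES.exists_extension {T' T T'' N I Q : HopfBimod k A} (E : SES T' T T'') (S : SES N I Q)
    (hI : Injective (ModuleCat.of (XAlg k A) I.carrier)) (u : Hom T' N) :
    ∃ (v : Hom T I) (w : Hom T'' Q), v.comp E.i = S.i.comp u ∧ w.comp E.p = S.p.comp v := by
  have : Mono E.i.toX := (ModuleCat.mono_iff_injective _).2 E.inj
  have : Epi E.complex.g := E.shortExact.epi_g
  obtain ⟨v, hv⟩ := Hom.exists_toX_eq (Injective.factorThru (S.i.comp u).toX E.i.toX)
  have hv' : E.i.toX ≫ v.toX = u.toX ≫ S.i.toX := by rw [hv, Injective.comp_factorThru]; rfl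
  have h0 : E.i.toX ≫ (v.toX ≫ S.p.toX) = 0 := by
    rw [← Category.assoc, hv', Category.assoc]
    exact (congrArg _ S.complex.zero).trans Limits.comp_zero
  obtain ⟨w, hw⟩ := Hom.exists_toX_eq (E.shortExact.exact.desc (v.toX ≫ S.p.toX) h0)
  refine ⟨v, w, Hom.toX_injective hv', Hom.toX_injective ?_⟩
  rw [Hom.comp_toX, hw]
  exact E.shortExact.exact.g_desc _ _

theorem SES.extClass_naturality {T' T T'' N I Q : HopfBimod k A} (E : SES T' T T'') (S : SES N I Q)
    {u : Hom T' N} {v : Hom T I} {w : Hom T'' Q} (h : v.comp E.i = S.i.comp u)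
    (h' : w.comp E.p = S.p.comp v) :
    E.extClass.comp (Abelian.Ext.mk₀ u.toX) (add_zero 1) =
      (Abelian.Ext.mk₀ w.toX).comp S.extClass (zero_add 1) :=
  ShortComplex.ShortExact.extClass_naturality E.shortExact S.shortExact
    { τ₁ := u.toX
      τ₂ := v.toX
      τ₃ := w.toX
      comm₁₂ := (congrArg Hom.toX h).symm
      comm₂₃ := (congrArg Hom.toX h').symm }

theorem SES.exact_ext_left {T' T T'' : HopfBimod k A} (S : SES T' T T'') {n : ℕ}
    (x : ExtX M T' (n + 1))
    (hx : x.comp (Abelian.Ext.mk₀ S.i.toX) (add_zero (n + 1)) = 0) :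
    ∃ z : ExtX M T'' n, z.comp S.extClass rfl = x :=
  Abelian.Ext.covariant_sequence_exact₁ _ S.shortExact x hx rfl

theorem SES.exact_ext_right {T' T T'' : HopfBimod k A} (S : SES T' T T'') {n : ℕ}
    (z : ExtX M T'' n) (hz : z.comp S.extClass rfl = 0) :
    ∃ y : ExtX M T n, y.comp (Abelian.Ext.mk₀ S.p.toX) (add_zero n) = z :=
  Abelian.Ext.covariant_sequence_exact₃ _ S.shortExact z rfl hz

variable (M) in
/-- Naturality of a family of maps in degree `n`. -/
def IsNatural (n : ℕ) (φ : ∀ N : HopfBimod k A, HA4 M N n →ₗ[k] ExtX M N n) : Prop :=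
  ∀ {N N' : HopfBimod k A} (u : Hom N N') (f : Z M N n) (f' : Z M N' n),
    (f' : Tot M N') = push M u f →
      φ N' (cls f') = (φ N (cls f)).comp (Abelian.Ext.mk₀ u.toX) (add_zero n)

variable (M) in
/-- Compatibility with the connecting homomorphisms from degree `n` to degree `n + 1`. -/
def IsConnecting (n : ℕ) (φ : ∀ N : HopfBimod k A, HA4 M N n →ₗ[k] ExtX M N n)
    (φ' : ∀ N : HopfBimod k A, HA4 M N (n + 1) →ₗ[k] ExtX M N (n + 1)) : Prop :=
  ∀ {N' N N'' : HopfBimod k A} (S : SES N' N N'') (f'' : Z M N'' n) (c : C M N n)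
    (f' : Z M N' (n + 1)), push M S.p c = f'' → D M N c = push M S.i f' →
      φ' N' (cls f') = (φ N'' (cls f'')).comp S.extClass rfl

theorem SES.push_mem_Z (S : SES N N' I) {n : ℕ} {c : Tot M N'} (hc : c ∈ C M N' n) {f : Tot M N}
    (h : D M N' c = push M S.i f) : push M S.p c ∈ Z M I n :=
  mem_Z_iff.2 ⟨push_mem_C _ hc, by rw [D_push, h, S.push_push]⟩

variable (M) in
/-- The pairs of a cochain `c` of the middle term and of a cocycle `f` of the left term for which
`D c` is the image of `f`. -/
noncomputable def SES.pairs {N I Q : HopfBimod k A} (S : SES N I Q) (n : ℕ) :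
    Submodule k (C M I n × Z M N (n + 1)) where
  carrier := {x | D M I x.1 = push M S.i x.2}
  zero_mem' := (map_zero (D M I)).trans (map_zero (push M S.i)).symm
  add_mem' {x y} hx hy := by
    change D M I (x.1 + y.1) = push M S.i (x.2 + y.2)
    rw [map_add, map_add, hx, hy]
  smul_mem' c x hx := by
    change D M I (c • (x.1 : Tot M I)) = push M S.i (c • (x.2 : Tot M N))
    rw [map_smul, map_smul, hx]

variable (M) in
/-- The map `(c, f) ↦ p(c)`. -/
noncomputable def SES.pairsToZ {N I Q : HopfBimod k A} (S : SES N I Q) (n : ℕ) :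
    S.pairs M n →ₗ[k] Z M Q n :=
  LinearMap.codRestrict _ (push M S.p ∘ₗ (C M I n).subtype ∘ₗ LinearMap.fst k _ _ ∘ₗ
    (S.pairs M n).subtype) fun x => S.push_mem_Z x.1.1.2 x.2

variable (M N) in
/-- The class of a cocycle, as a linear map. -/
noncomputable def clsL (n : ℕ) : Z M N n →ₗ[k] HA4 M N n := Submodule.mkQ _

/-- A pair (c, f) is sent to the class of f on one side, and to the connecting image of φ(p(c)) on
the other. Both maps are onto because I is acyclic for either functor. Both kill a pair exactly when
the class of p(c) comes from I, by the two long exact sequences and naturality of φ in degree n. -/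
theorem exists_step {n : ℕ} (φ : ∀ N : HopfBimod k A, HA4 M N n ≃ₗ[k] ExtX M N n)
    (hφ : IsNatural M n fun N => (φ N).toLinearMap) {N I Q : HopfBimod k A} (S : SES N I Q)
    (hI : Injective (ModuleCat.of (XAlg k A) I.carrier)) :
    ∃ e : HA4 M N (n + 1) ≃ₗ[k] ExtX M N (n + 1), ∀ x : S.pairs M n,
      e (cls x.1.2) = (φ Q (cls (S.pairsToZ M n x))).comp S.extClass rfl := by
  refine exists_linearEquiv_of_ker_eq (P := S.pairs M n)
    (clsL M N (n + 1) ∘ₗ LinearMap.snd k _ _ ∘ₗ (S.pairs M n).subtype)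
    (Abelian.Ext.postcompOfLinear S.extClass k _ rfl ∘ₗ (φ Q).toLinearMap ∘ₗ clsL M Q n ∘ₗ
      S.pairsToZ M n) (fun y => ?_) (fun y => ?_) fun x => ?_
  · obtain ⟨f, rfl⟩ := cls_surjective y
    obtain ⟨c, hc, hcD⟩ := exists_D_eq_of_injective (push_mem_Z S.i f.2)
    exact ⟨⟨⟨⟨c, hc⟩, f⟩, hcD⟩, rfl⟩
  · obtain ⟨z, hz⟩ := S.exact_ext_left y (Abelian.Ext.eq_zero_of_injective _)
    obtain ⟨f'', hf''⟩ := cls_surjective ((φ Q).symm z)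
    obtain ⟨c, hc, hcp⟩ := exists_push_eq S.surj f''.2.1
    obtain ⟨f, hf, hfc⟩ := S.exists_connecting hc (by rw [hcp]; exact (mem_Z_iff.1 f''.2).2)
    refine ⟨⟨⟨⟨c, hc⟩, ⟨f, hf⟩⟩, hfc⟩, ?_⟩
    have h1 : S.pairsToZ M n ⟨⟨⟨c, hc⟩, ⟨f, hf⟩⟩, hfc⟩ = f'' := Subtype.ext hcp
    change (φ Q (cls (S.pairsToZ M n _))).comp S.extClass rfl = y
    rw [h1, hf'', LinearEquiv.apply_symm_apply, hz]
  · change cls x.1.2 = 0 ↔ (φ Q (cls (S.pairsToZ M n x))).comp S.extClass rfl = 0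
    constructor
    · intro h
      obtain ⟨g, hg, hgc⟩ := S.exists_cocycle x.1.1.2 x.2 h
      have h1 := hφ S.p ⟨g, hg⟩ (S.pairsToZ M n x) hgc.symm
      simp only [LinearEquiv.coe_coe] at h1
      rw [h1, Abelian.Ext.comp_assoc_of_second_deg_zero]
      have h2 : (Abelian.Ext.mk₀ S.p.toX).comp S.extClass (zero_add 1) = 0 :=
        S.shortExact.comp_extClass
      rw [h2, Abelian.Ext.comp_zero]
    · intro h
      obtain ⟨y, hy⟩ := S.exact_ext_right _ h
      obtain ⟨g, hg⟩ := cls_surjective ((φ I).symm y)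
      have h1 := hφ S.p g ⟨_, HopfBimod.push_mem_Z S.p g.2⟩ rfl
      simp only [LinearEquiv.coe_coe] at h1
      rw [hg, LinearEquiv.apply_symm_apply] at h1
      have h2 := (φ Q).injective (h1.trans hy)
      rw [eq_comm, cls_eq_iff] at h2
      exact S.cls_eq_zero x.1.1.2 x.2 g.2 h2

/-- One embedding into an injective is fixed for each N and defines the map in degree n + 1;
independence of the choice is contained in `key`. -/
theorem exists_next {n : ℕ} (φ : ∀ N : HopfBimod k A, HA4 M N n ≃ₗ[k] ExtX M N n)
    (hφ : IsNatural M n fun N => (φ N).toLinearMap) :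
    ∃ φ' : ∀ N : HopfBimod k A, HA4 M N (n + 1) ≃ₗ[k] ExtX M N (n + 1),
      (IsNatural M (n + 1) fun N => (φ' N).toLinearMap) ∧
      IsConnecting M n (fun N => (φ N).toLinearMap) fun N => (φ' N).toLinearMap := by
  choose I Q S hI using exists_injective_ses (k := k) (A := A)
  choose e he using fun N => exists_step φ hφ (S N) (hI N)
  -- Any short exact sequence E with a morphism u from its left end to N maps to the fixed sequence
  -- of N. Taking E to be the fixed sequence of the source of u gives naturality; taking u to be the
  -- identity gives the connecting homomorphism of E.
  have key : ∀ {T' T T'' N : HopfBimod k A} (E : SES T' T T'') (u : Hom T' N) (f'' : Z M T'' n)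
      (c : C M T n) (f' : Z M T' (n + 1)) (f : Z M N (n + 1)), push M E.p c = f'' →
      D M T c = push M E.i f' → (f : Tot M N) = push M u f' →
      e N (cls f) = ((φ T'' (cls f'')).comp E.extClass rfl).comp
        (Abelian.Ext.mk₀ u.toX) (add_zero (n + 1)) := by
    intro T' T T'' N E u f'' c f' f h1 h2 h3
    obtain ⟨v, w, hv, hw⟩ := E.exists_extension (S N) (hI N) u
    have hD : D M (I N) (push M v c) = push M (S N).i f := by
      rw [D_push, h2, h3, ← push_comp, ← push_comp, hv]
    have h4 := he N ⟨⟨⟨push M v c, push_mem_C v c.2⟩, f⟩, hD⟩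
    have h5 : ((S N).pairsToZ M n ⟨⟨⟨push M v c, push_mem_C v c.2⟩, f⟩, hD⟩ : Tot M (Q N)) =
        push M w f'' := by
      change push M (S N).p (push M v c) = _
      rw [← push_comp, ← hw, push_comp, h1]
    have h6 := hφ w f'' _ h5
    simp only [LinearEquiv.coe_coe] at h6
    refine h4.trans ?_
    rw [h6, Abelian.Ext.comp_assoc_of_second_deg_zero, ← E.extClass_naturality (S N) hv hw,
      Abelian.Ext.comp_assoc_of_third_deg_zero]
  refine ⟨e, ?_, ?_⟩
  · intro N N' u f f' h
    obtain ⟨c, hc, hcD⟩ := @exists_D_eq_of_injective _ _ _ _ _ _ M _ (hI N) _ _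
      (push_mem_Z (S N).i f.2)
    have h1 := he N ⟨⟨⟨c, hc⟩, f⟩, hcD⟩
    have h2 := key (S N) u ((S N).pairsToZ M n ⟨⟨⟨c, hc⟩, f⟩, hcD⟩) ⟨c, hc⟩ f f' rfl hcD h
    rw [← h1] at h2
    exact h2
  · intro N' N N'' E f'' c f' h1 h2
    have h3 := key E (Hom.id N') f'' c f' f' h1 h2 (push_id _).symm
    refine h3.trans ?_
    exact Abelian.Ext.comp_mk₀_id _

variable (M) in
/-- The natural isomorphisms in degree `n`. -/
noncomputable def deltaSeq : ∀ n, {φ : ∀ N : HopfBimod k A, HA4 M N n ≃ₗ[k] ExtX M N n //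
    IsNatural M n fun N => (φ N).toLinearMap}
  | 0 => ⟨(exists_deltaMap_zero M).choose, fun {N N'} u f f' h => by
      obtain ⟨v, hv, hf⟩ := exists_hom_of_mem_Z f.2
      have hf' : (f' : Tot M N') = single 0 0 (u.comp v).cochain := by
        rw [h, hf]
        funext x
        rw [push_apply]
        by_cases hx : x = (0, 0)
        · subst hx
          exact (congrArg (u.toLin ∘ₗ ·) (single_same 0 0 v.cochain)).trans
            (single_same 0 0 (u.comp v).cochain).symm
        · exact (congrArg (cobarMap u x.2 ∘ₗ ·) (single_ne 0 0 v.cochain hx)).trans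
            ((LinearMap.comp_zero _).trans (single_ne 0 0 (u.comp v).cochain hx).symm)
      refine ((exists_deltaMap_zero M).choose_spec (u.comp v) f' hf').trans ?_
      change _ = ((exists_deltaMap_zero M).choose N (cls f)).comp _ _
      rw [(exists_deltaMap_zero M).choose_spec v f hf, Abelian.Ext.mk₀_comp_mk₀, Hom.comp_toX]⟩
  | n + 1 => ⟨(exists_next _ (deltaSeq n).2).choose, (exists_next _ (deltaSeq n).2).choose_spec.1⟩

theorem isDeltaMap_deltaSeq (M : HopfBimod k A) :
    M.IsDeltaMap fun N n => ((deltaSeq M n).1 N).toLinearMap where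
  natural u n f f' h := (deltaSeq M n).2 u f f' h
  connecting S n f'' c f' h1 h2 :=
    (exists_next _ (deltaSeq M n).2).choose_spec.2 S f'' c f' h1 h2
  zero u f h := (exists_deltaMap_zero M).choose_spec u f h

/-- Degree 0 is prescribed. In degree n + 1 every class is the connecting image of a class at the
cokernel of an injective embedding, so its value is forced by degree n. -/
theorem IsDeltaMap.eq {φ ψ : ∀ (N : HopfBimod k A) (n : ℕ), HA4 M N n →ₗ[k] ExtX M N n}
    (hφ : M.IsDeltaMap φ) (hψ : M.IsDeltaMap ψ) : φ = ψ := by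
  funext N n
  induction n generalizing N with
  | zero =>
    refine LinearMap.ext fun x => ?_
    obtain ⟨f, rfl⟩ := cls_surjective x
    obtain ⟨u, -, hf⟩ := exists_hom_of_mem_Z f.2
    rw [hφ.zero u f hf, hψ.zero u f hf]
  | succ n ih =>
    refine LinearMap.ext fun x => ?_
    obtain ⟨f, rfl⟩ := cls_surjective x
    obtain ⟨I, Q, S, hI⟩ := exists_injective_ses N
    obtain ⟨c, hc, hcD⟩ := exists_D_eq_of_injective (push_mem_Z S.i f.2)
    have hZ := S.push_mem_Z hc hcD
    rw [hφ.connecting S n ⟨_, hZ⟩ ⟨c, hc⟩ f rfl hcD, hψ.connecting S n ⟨_, hZ⟩ ⟨c, hc⟩ f rfl hcD,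
      ih]

end HopfBimod
end HopfBimodCoh

namespace HopfBimodCoh
variable {k A : Type u} [Field k] [Ring A] [HopfAlgebra k A] [FiniteDimensional k A]

/-! ### Codiagonal maps in the cup product -/

section Codiagonal

variable {V W U W' U' : Type u} [AddCommGroup V] [Module k V] [AddCommGroup W] [Module k W]
  [AddCommGroup U] [Module k U] [AddCommGroup W'] [Module k W'] [AddCommGroup U'] [Module k U']

/-- `(x ⊗ w) ⊗ a ↦ ∑ x a⁽¹⁾ ⊗ c(w ⊗ a⁽²⁾)` -/
noncomputable def codiagStep (c : W ⊗[k] A →ₗ[k] W') : (A ⊗[k] W) ⊗[k] A →ₗ[k] A ⊗[k] W' :=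
  TensorProduct.map (LinearMap.mul' k A) c ∘ₗ
    (TensorProduct.tensorTensorTensorComm k A W A A).toLinearMap ∘ₗ
    (comul (R := k) (A := A)).lTensor (A ⊗[k] W)

theorem codiagStep_tmul (c : W ⊗[k] A →ₗ[k] W') (t : A ⊗[k] W) (a : A) :
    codiagStep c (t ⊗ₜ a) = c.lTensor A (mixL k A W (t ⊗ₜ comul a)) := by
  change TensorProduct.map _ c (tensorTensorTensorComm k A W A A (t ⊗ₜ comul a)) = _
  have h : TensorProduct.map (LinearMap.mul' k A) c = c.lTensor A ∘ₗ
      (LinearMap.mul' k A).rTensor (W ⊗[k] A) := by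
    ext; simp
  rw [h]
  rfl

theorem codiagStep_id (t : A ⊗[k] W) (a : A) :
    codiagStep LinearMap.id (t ⊗ₜ a) = mixL k A W (t ⊗ₜ comul a) := by
  rw [codiagStep_tmul, LinearMap.lTensor_id, LinearMap.id_apply]

theorem codiagStep_comp (β : W' →ₗ[k] U) (c : W ⊗[k] A →ₗ[k] W') :
    codiagStep (β ∘ₗ c) = β.lTensor A ∘ₗ codiagStep c := by
  refine TensorProduct.ext' fun t a => ?_
  rw [LinearMap.comp_apply, codiagStep_tmul, codiagStep_tmul, LinearMap.lTensor_comp,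
    LinearMap.comp_apply]

theorem mixL_lTensor (F : V →ₗ[k] W) (t : A ⊗[k] V) (s : A ⊗[k] A) :
    mixL k A W (F.lTensor A t ⊗ₜ s) = (F.rTensor A).lTensor A (mixL k A V (t ⊗ₜ s)) := by
  have h1 : ∀ x, (mixL k A W ∘ₗ (F.lTensor A).rTensor (A ⊗[k] A)) x =
      ((F.rTensor A).lTensor A ∘ₗ mixL k A V) x :=
    apply_eq_of_fourfold _ _ fun x v y z => by simp
  exact h1 (t ⊗ₜ s)

theorem codiagStep_rTensor (F : V →ₗ[k] W) (c : W ⊗[k] A →ₗ[k] W') :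
    codiagStep (c ∘ₗ F.rTensor A) = codiagStep c ∘ₗ (F.lTensor A).rTensor A := by
  refine TensorProduct.ext' fun t a => ?_
  rw [LinearMap.comp_apply, LinearMap.rTensor_tmul, codiagStep_tmul, codiagStep_tmul,
    mixL_lTensor, LinearMap.lTensor_comp, LinearMap.comp_apply]

theorem codiagStep_coaction (F : V →ₗ[k] W) (l : V →ₗ[k] A ⊗[k] V) (c : W ⊗[k] A →ₗ[k] W') :
    codiagStep c ∘ₗ (F.lTensor A ∘ₗ l).rTensor A =
      (c ∘ₗ F.rTensor A).lTensor A ∘ₗ lcoStep l := by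
  refine TensorProduct.ext' fun t a => ?_
  rw [LinearMap.comp_apply, LinearMap.rTensor_tmul, codiagStep_tmul, LinearMap.comp_apply,
    LinearMap.comp_apply, mixL_lTensor, LinearMap.lTensor_comp, LinearMap.comp_apply, lcoStep_tmul]

/-- Both sides send (x ⊗ w) ⊗ a to ∑ x⁽¹⁾a⁽¹⁾ ⊗ x⁽²⁾a⁽²⁾ ⊗ c(w ⊗ a⁽³⁾), by multiplicativity of Δ and
coassociativity in a. -/
theorem comulT_codiagStep (c : W ⊗[k] A →ₗ[k] W') :
    comulT k A W' ∘ₗ codiagStep c =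
      codiagStep (codiagStep c) ∘ₗ (comulT k A W).rTensor A := by
  refine TensorProduct.ext_threefold fun x w a => ?_
  -- Linearity allows Δ(x) to be replaced by an arbitrary t.
  have key : ∀ t : A ⊗[k] A, ∑ i ∈ (ℛ k a).index, TensorProduct.assoc k A A W'
        ((t * comul ((ℛ k a).left i)) ⊗ₜ c (w ⊗ₜ (ℛ k a).right i)) =
      codiagStep (codiagStep c) (TensorProduct.assoc k A A W (t ⊗ₜ w) ⊗ₜ a) := by
    intro t
    induction t with
    | zero => simp
    | add x y hx hy =>
      simp only [add_mul, TensorProduct.add_tmul, map_add, Finset.sum_add_distrib, hx, hy]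
    | tmul y z =>
      let F : A ⊗[k] (A ⊗[k] A) →ₗ[k] A ⊗[k] (A ⊗[k] W') :=
        TensorProduct.map (LinearMap.mulLeft k y) (TensorProduct.map (LinearMap.mulLeft k z)
          (c ∘ₗ TensorProduct.mk k W A w))
      have h := tri_coassoc F a
      simp only [F, TensorProduct.map_tmul, LinearMap.mulLeft_apply, LinearMap.comp_apply,
        TensorProduct.mk_apply] at h
      refine Eq.trans (Eq.trans ?_ h) ?_
      · refine Finset.sum_congr rfl fun i _ => ?_
        conv_lhs => rw [← (ℛ k ((ℛ k a).left i)).eq]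
        simp [Finset.mul_sum, TensorProduct.sum_tmul]
      · rw [TensorProduct.assoc_tmul, codiagStep_tmul]
        conv_rhs => rw [← (ℛ k a).eq]
        simp only [TensorProduct.tmul_sum, map_sum, mixL_tmul, LinearMap.lTensor_tmul,
          codiagStep_tmul]
        refine Finset.sum_congr rfl fun i _ => ?_
        conv_rhs => rw [← (ℛ k ((ℛ k a).right i)).eq]
        simp [TensorProduct.tmul_sum]
  refine Eq.trans ?_ (key (comul x))
  rw [LinearMap.comp_apply, codiagStep_tmul]
  conv_lhs => rw [← (ℛ k a).eq]
  simp [TensorProduct.tmul_sum, comulT]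

theorem cobarStep_eq_smul (e : W →ₗ[k] A ⊗[k] W) :
    cobarStep e = (-1 : k) • (comulT k A W + e.lTensor A) := by
  rw [cobarStep_eq]
  refine LinearMap.ext fun x => ?_
  have h : ∀ {X : Type u} [AddCommGroup X] [Module k X] (u v : X),
      -u - v = (-1 : k) • (u + v) := fun u v => by
    rw [neg_one_smul, neg_add, sub_eq_add_neg]
  exact h _ _

theorem cobarStep_codiagStep {e : W →ₗ[k] A ⊗[k] W}
    {e' : W' →ₗ[k] A ⊗[k] W'} {c : W ⊗[k] A →ₗ[k] W'}
    (h : e' ∘ₗ c = codiagStep c ∘ₗ e.rTensor A) :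
    cobarStep e' ∘ₗ codiagStep c =
      codiagStep (codiagStep c) ∘ₗ (cobarStep e).rTensor A := by
  have h1 := comulT_codiagStep c
  have h2 := codiagStep_comp e' c
  rw [h, codiagStep_rTensor] at h2
  rw [cobarStep_eq_smul, cobarStep_eq_smul, LinearMap.smul_comp, LinearMap.rTensor_smul,
    LinearMap.comp_smul, LinearMap.add_comp, LinearMap.rTensor_add, LinearMap.comp_add, h1, h2]

/-- Distributing two letters one after the other and then multiplying their inner parts is the same
as distributing their product, since Δ is multiplicative. -/
theorem codiagStep_assoc {c : W ⊗[k] A →ₗ[k] W'} {c' : W' ⊗[k] A →ₗ[k] U} {m : U →ₗ[k] W'}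
    (h : m ∘ₗ c' ∘ₗ c.rTensor A = c ∘ₗ (LinearMap.mul' k A).lTensor W ∘ₗ
      (TensorProduct.assoc k W A A).toLinearMap) :
    m.lTensor A ∘ₗ codiagStep c' ∘ₗ (codiagStep c).rTensor A =
      codiagStep c ∘ₗ (LinearMap.mul' k A).lTensor (A ⊗[k] W) ∘ₗ
      (TensorProduct.assoc k (A ⊗[k] W) A A).toLinearMap := by
  refine TensorProduct.ext_threefold fun t a b => ?_
  induction t with
  | zero => simp
  | add x y hx hy => simp only [TensorProduct.add_tmul, map_add, hx, hy]
  | tmul x w =>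
    simp only [LinearMap.comp_apply, LinearMap.rTensor_tmul, LinearMap.lTensor_tmul,
      LinearEquiv.coe_coe, TensorProduct.assoc_tmul, LinearMap.mul'_apply, codiagStep_tmul,
      Bialgebra.comul_mul]
    generalize comul (R := k) a = s
    generalize comul (R := k) b = t
    induction s with
    | zero => simp
    | add x y hx hy =>
      simp only [add_mul, TensorProduct.add_tmul, TensorProduct.tmul_add, map_add, hx, hy]
    | tmul a a' =>
      induction t with
      | zero => simp
      | add x y hx hy => simp only [mul_add, TensorProduct.tmul_add, map_add, hx, hy]
      | tmul b b' =>
        have h1 := LinearMap.congr_fun h ((w ⊗ₜ a') ⊗ₜ b')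
        simp only [LinearMap.comp_apply, LinearMap.rTensor_tmul, LinearEquiv.coe_coe,
          TensorProduct.assoc_tmul, LinearMap.lTensor_tmul, LinearMap.mul'_apply] at h1
        simp [h1, mul_assoc]

theorem actR_codiagStep (σ : A →ₗ[k] Module.End k U) (β : W →ₗ[k] U) :
    actR (diag (LinearMap.mul k A).flip σ) (β.lTensor A) = codiagStep (actR σ β) := by
  refine TensorProduct.ext_threefold fun x w a => ?_
  change diag (LinearMap.mul k A).flip σ a (x ⊗ₜ β w) = _
  rw [codiagStep_tmul, diag_apply]
  conv_rhs => rw [← (ℛ k a).eq]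
  simp [TensorProduct.tmul_sum, actR]

theorem mixR_rTensor (F : V →ₗ[k] W) (t : V ⊗[k] A) (s : A ⊗[k] A) :
    mixR k A W (F.rTensor A t ⊗ₜ s) = (F.rTensor A).rTensor A (mixR k A V (t ⊗ₜ s)) := by
  have h1 : ∀ x, (mixR k A W ∘ₗ (F.rTensor A).rTensor (A ⊗[k] A)) x =
      ((F.rTensor A).rTensor A ∘ₗ mixR k A V) x :=
    apply_eq_of_fourfold _ _ fun x v y z => by simp
  exact h1 (t ⊗ₜ s)

theorem IsLRMap.rTensor {ρ : A →ₗ[k] Module.End k V} {r : V →ₗ[k] V ⊗[k] A}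
    {ρ' : A →ₗ[k] Module.End k W} {r' : W →ₗ[k] W ⊗[k] A} {F : V →ₗ[k] W}
    (h : IsLRMap ρ r ρ' r' F) :
    IsLRMap (LinearMap.rTensorHom A ∘ₗ ρ) (rcoStep r) (LinearMap.rTensorHom A ∘ₗ ρ') (rcoStep r')
      (F.rTensor A) where
  lin a := by
    refine TensorProduct.ext' fun v b => ?_
    have h1 := LinearMap.congr_fun (h.lin a) v
    simp only [LinearMap.comp_apply] at h1
    simp [h1]
  colin := by
    refine TensorProduct.ext' fun v b => ?_
    have h1 := LinearMap.congr_fun h.colin v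
    simp only [LinearMap.comp_apply] at h1
    simp only [LinearMap.comp_apply, LinearMap.rTensor_tmul, rcoStep_tmul, h1, mixR_rTensor]

/-- Left linearity follows from that of `c`, since the letter multiplies x from the right. For
colinearity both sides are ∑ xb⁽¹⁾ ⊗ c(w₍₀₎ ⊗ b⁽²⁾) ⊗ w₍₁₎b⁽³⁾, the coaction of A ⊗ W leaving x
alone. -/
theorem IsLRMap.codiagStep {ρ : A →ₗ[k] Module.End k W} {r : W →ₗ[k] W ⊗[k] A}
    {ρ' : A →ₗ[k] Module.End k W'} {r' : W' →ₗ[k] W' ⊗[k] A} {c : W ⊗[k] A →ₗ[k] W'}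
    (h : IsLRMap (LinearMap.rTensorHom A ∘ₗ ρ) (rcoStep r) ρ' r' c) :
    IsLRMap (LinearMap.rTensorHom A ∘ₗ diag (LinearMap.mul k A) ρ)
      (rcoStep ((TensorProduct.assoc k A W A).symm.toLinearMap ∘ₗ r.lTensor A))
      (diag (LinearMap.mul k A) ρ')
      ((TensorProduct.assoc k A W' A).symm.toLinearMap ∘ₗ r'.lTensor A)
      (HopfBimodCoh.codiagStep c) where
  lin a := by
    refine TensorProduct.ext_threefold fun x w b => ?_
    have h1 : ∀ a w b, c (ρ a w ⊗ₜ b) = ρ' a (c (w ⊗ₜ b)) := fun a w b =>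
      LinearMap.congr_fun (h.lin a) (w ⊗ₜ b)
    change HopfBimodCoh.codiagStep c (diag (LinearMap.mul k A) ρ a (x ⊗ₜ w) ⊗ₜ b) =
      diag (LinearMap.mul k A) ρ' a (HopfBimodCoh.codiagStep c ((x ⊗ₜ w) ⊗ₜ b))
    simp only [codiagStep_tmul, diag_apply, LinearMap.sum_apply, TensorProduct.map_tmul,
      TensorProduct.sum_tmul, map_sum]
    refine Finset.sum_congr rfl fun i _ => ?_
    generalize comul (R := k) b = t
    induction t with
    | zero => simp
    | add x y hx hy => simp only [TensorProduct.tmul_add, map_add, hx, hy]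
    | tmul b b' => simp [h1, mul_assoc]
  colin := by
    refine TensorProduct.ext_threefold fun x w b => ?_
    have h1 : ∀ b, r' (c (w ⊗ₜ b)) = c.rTensor A (mixR k A W (r w ⊗ₜ comul b)) := fun b =>
      LinearMap.congr_fun h.colin (w ⊗ₜ b)
    have key : ∀ t : W ⊗[k] A, (HopfBimodCoh.codiagStep c).rTensor A (mixR k A (A ⊗[k] W)
        ((TensorProduct.assoc k A W A).symm (x ⊗ₜ t) ⊗ₜ comul b)) =
        ∑ i ∈ (ℛ k b).index, (TensorProduct.assoc k A W' A).symm ((x * (ℛ k b).left i) ⊗ₜ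
          c.rTensor A (mixR k A W (t ⊗ₜ comul ((ℛ k b).right i)))) := by
      intro t
      induction t with
      | zero => simp
      | add x y hx hy =>
        simp only [TensorProduct.add_tmul, TensorProduct.tmul_add, map_add,
          Finset.sum_add_distrib, hx, hy]
      | tmul w y =>
        let F : A ⊗[k] (A ⊗[k] A) →ₗ[k] (A ⊗[k] W') ⊗[k] A :=
          (TensorProduct.assoc k A W' A).symm.toLinearMap ∘ₗ
            TensorProduct.map (LinearMap.mulLeft k x) (TensorProduct.map
              (c ∘ₗ TensorProduct.mk k W A w) (LinearMap.mulLeft k y))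
        have h := tri_coassoc F b
        simp only [F, TensorProduct.map_tmul, LinearMap.mulLeft_apply, LinearMap.comp_apply,
          TensorProduct.mk_apply, LinearEquiv.coe_coe, TensorProduct.assoc_symm_tmul] at h
        refine Eq.trans (Eq.trans ?_ h) ?_
        · conv_lhs => rw [← (ℛ k b).eq]
          simp only [TensorProduct.assoc_symm_tmul, TensorProduct.tmul_sum, map_sum, mixR_tmul,
            LinearMap.rTensor_tmul, codiagStep_tmul]
          refine Finset.sum_congr rfl fun i _ => ?_
          conv_lhs => rw [← (ℛ k ((ℛ k b).left i)).eq]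
          simp [TensorProduct.tmul_sum, TensorProduct.sum_tmul]
        · refine Finset.sum_congr rfl fun i _ => ?_
          conv_rhs => rw [← (ℛ k ((ℛ k b).right i)).eq]
          simp [TensorProduct.tmul_sum]
    refine Eq.trans ?_ (key (r w)).symm
    rw [LinearMap.comp_apply, codiagStep_tmul]
    conv_lhs => rw [← (ℛ k b).eq]
    simp only [TensorProduct.tmul_sum, map_sum, mixL_tmul, LinearMap.comp_apply,
      LinearEquiv.coe_coe, LinearMap.lTensor_tmul, h1]

end Codiagonal
end HopfBimodCoh

namespace HopfBimodCoh
variable {k A : Type u} [Field k] [Ring A] [HopfAlgebra k A] [FiniteDimensional k A]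

/-! ### Passing the differentials through the two halves of the cup product -/

section Steps

variable {V X Y Z Y' Y'' : Type u} [AddCommGroup V] [Module k V] [AddCommGroup X] [Module k X]
  [AddCommGroup Y] [Module k Y] [AddCommGroup Z] [Module k Z] [AddCommGroup Y'] [Module k Y']
  [AddCommGroup Y''] [Module k Y'']

theorem neg_lcoStep (l : V →ₗ[k] A ⊗[k] V) :
    -lcoStep l = codiagStep LinearMap.id ∘ₗ (-l).rTensor A := by
  refine TensorProduct.ext' fun v a => ?_
  let F : A ⊗[k] V →ₗ[k] A ⊗[k] (V ⊗[k] A) :=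
    codiagStep LinearMap.id ∘ₗ (TensorProduct.mk k (A ⊗[k] V) A).flip a
  refine Eq.trans (congrArg Neg.neg ?_) (map_neg F (l v)).symm
  exact (codiagStep_id (l v) a).symm

theorem cobarStep_lTensor_add {e : Y →ₗ[k] A ⊗[k] Y} {e' : X →ₗ[k] A ⊗[k] X} {F : X →ₗ[k] Y}
    {G : X →ₗ[k] Z} {τ : Z →ₗ[k] A ⊗[k] Y} {c : k}
    (h : e ∘ₗ F = F.lTensor A ∘ₗ e' + c • (τ ∘ₗ G)) :
    cobarStep e ∘ₗ F.lTensor A =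
      (F.lTensor A).lTensor A ∘ₗ cobarStep e' + (c * -1) • (τ.lTensor A ∘ₗ G.lTensor A) := by
  rw [cobarStep_eq_smul, cobarStep_eq_smul, LinearMap.smul_comp, LinearMap.add_comp, comulT_lTensor,
    ← LinearMap.lTensor_comp, h, LinearMap.lTensor_add, LinearMap.lTensor_smul,
    LinearMap.lTensor_comp, LinearMap.lTensor_comp, LinearMap.comp_smul, LinearMap.comp_add,
    ← add_assoc, smul_add, smul_smul, mul_comm c]

/-- Inductive step of `cupLeft_barD` with abstract spaces: `F` is the left half so far, `c` and `c'`
distribute one more letter, `P` is the bar differential on L ⊗ A^{⊗b}, and `κ` is a cast. The new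
sign (-1)^(a+b+1) is (-1)^a (-1)^(b+1), and `hm` carries the product of the last two letters across.
-/
theorem cupLeft_barStep {d : X ⊗[k] A →ₗ[k] X} {F : X →ₗ[k] Y} {c : Y ⊗[k] A →ₗ[k] Y'}
    {c' : Y' ⊗[k] A →ₗ[k] Y''} {G : Z →ₗ[k] Y} {κ : X ⊗[k] A →ₗ[k] Z} {P : Y' →ₗ[k] Y}
    {P' m : Y'' →ₗ[k] Y'} {a b : ℕ}
    (h : F ∘ₗ d = G ∘ₗ κ + (-1 : k) ^ a • (P ∘ₗ c ∘ₗ F.rTensor A))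
    (hP : P' ∘ₗ c' = c ∘ₗ P.rTensor A)
    (hm : m ∘ₗ c' ∘ₗ c.rTensor A = c ∘ₗ (LinearMap.mul' k A).lTensor Y ∘ₗ
      (TensorProduct.assoc k Y A A).toLinearMap) :
    (c ∘ₗ F.rTensor A) ∘ₗ barStep d (a + b) =
      (c ∘ₗ G.rTensor A) ∘ₗ κ.rTensor A + (-1 : k) ^ a •
        ((P' + (-1 : k) ^ (b + 1) • m) ∘ₗ c' ∘ₗ (c ∘ₗ F.rTensor A).rTensor A) := by
  refine TensorProduct.ext_threefold fun x a₁ a₂ => ?_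
  have h1 := LinearMap.congr_fun h (x ⊗ₜ a₁)
  have h2 := LinearMap.congr_fun hP (c (F x ⊗ₜ a₁) ⊗ₜ a₂)
  have h3 := LinearMap.congr_fun hm ((F x ⊗ₜ a₁) ⊗ₜ a₂)
  simp only [LinearMap.comp_apply, LinearMap.rTensor_tmul, LinearMap.add_apply,
    LinearMap.smul_apply, LinearEquiv.coe_coe, TensorProduct.assoc_tmul, LinearMap.lTensor_tmul,
    LinearMap.mul'_apply] at h1 h2 h3
  simp only [barStep, LinearMap.comp_apply, LinearMap.rTensor_tmul, LinearMap.add_apply,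
    LinearMap.smul_apply, LinearEquiv.coe_coe, TensorProduct.assoc_tmul, LinearMap.lTensor_tmul,
    LinearMap.mul'_apply, h1, h2, h3, map_add, map_smul, TensorProduct.add_tmul,
    ← TensorProduct.smul_tmul', smul_add, smul_smul, ← pow_add, add_assoc]

theorem actR_id_comp (σ : A →ₗ[k] Module.End k Y) (f : X →ₗ[k] Y) :
    actR σ LinearMap.id ∘ₗ f.rTensor A = actR σ f :=
  TensorProduct.ext' fun _ _ => rfl

/-- Base case of `cupLeft_barD`: the closing term of d_h f, with sign (-1)^(a+1), cancels the
opening term of the bar differential on the second factor, with sign (-1)^a. -/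
theorem eq_add_neg_one_pow_smul (x y : V) (a : ℕ) :
    x = x + (-1 : k) ^ (a + 1) • y + (-1 : k) ^ a • y := by
  rw [add_assoc, ← add_smul, pow_succ, mul_neg_one, neg_add_cancel, zero_smul, add_zero]

/-- Base case s = 0 of `cobarD_cupRight`: the term in which g follows the coaction is inserted with
both signs. -/
theorem comp_eq_add_homCobar (l : V →ₗ[k] A ⊗[k] V) (e : Y →ₗ[k] A ⊗[k] Y) (g : V →ₗ[k] Y) :
    e ∘ₗ g = g.lTensor A ∘ₗ (-l) + (-1 : k) ^ 0 • (LinearMap.id ∘ₗ homCobar l e g) := by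
  rw [pow_zero, one_smul, LinearMap.id_comp, homCobar_eq, ← add_assoc]
  refine LinearMap.ext fun v => ?_
  have h : g.lTensor A (-(l v)) + g.lTensor A (l v) = 0 := by
    rw [← map_add]
    exact (congrArg (g.lTensor A) (neg_add_cancel (l v))).trans (map_zero _)
  exact (zero_add _).symm.trans (congrArg (· + e (g v)) h.symm)

end Steps

section Codiag

variable {V W : ModuleCat.{u} k}

/-- The differential on `A^{⊗ s} ⊗ V` given by a map `V → A ⊗ V`. -/
noncomputable def cobE (e : V →ₗ[k] A ⊗[k] V) : ∀ s, cobV A V s →ₗ[k] A ⊗[k] cobV A V s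
  | 0 => e
  | s + 1 => cobarStep (cobE e s)

/-- The diagonal left action on `A^{⊗ s} ⊗ V`. -/
noncomputable def cobLact (ρ : A →ₗ[k] Module.End k V) : ∀ s, A →ₗ[k] Module.End k (cobV A V s)
  | 0 => ρ
  | s + 1 => diag (LinearMap.mul k A) (cobLact ρ s)

/-- The diagonal right action on `A^{⊗ s} ⊗ V`. -/
noncomputable def cobRact (σ : A →ₗ[k] Module.End k V) : ∀ s, A →ₗ[k] Module.End k (cobV A V s)
  | 0 => σ
  | s + 1 => diag (LinearMap.mul k A).flip (cobRact σ s)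

/-- The right coaction on `A^{⊗ s} ⊗ V`. -/
noncomputable def cobRco (r : V →ₗ[k] V ⊗[k] A) : ∀ s, cobV A V s →ₗ[k] cobV A V s ⊗[k] A
  | 0 => r
  | s + 1 => (TensorProduct.assoc k A (cobV A V s) A).symm.toLinearMap ∘ₗ (cobRco r s).lTensor A

/-- For the codiagonal coaction on V ⊗ A, which is the coaction of V with the letter distributed
over it, the letter may be distributed before or after the cobar differential. -/
theorem cobE_codiag {e : V →ₗ[k] A ⊗[k] V} {e' : barV A V 1 →ₗ[k] A ⊗[k] barV A V 1}
    (h : e' = codiagStep LinearMap.id ∘ₗ e.rTensor A) :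
    ∀ s, cobE e' s ∘ₗ codiag V s = codiag V (s + 1) ∘ₗ (cobE e s).rTensor A
  | 0 => h
  | s + 1 => cobarStep_codiagStep (cobE_codiag h s)

theorem codiag_assoc :
    ∀ s, cobMap (A := A) (V := barV A (barV A V 1) 1) (W := barV A V 1)
        ((LinearMap.mul' k A).lTensor V ∘ₗ (TensorProduct.assoc k V A A).toLinearMap) s ∘ₗ
        codiag (barV A V 1) s ∘ₗ (codiag V s).rTensor A =
      codiag V s ∘ₗ (LinearMap.mul' k A).lTensor (cobV A V s) ∘ₗ
        (TensorProduct.assoc k (cobV A V s) A A).toLinearMap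
  | 0 => by
    refine TensorProduct.ext_threefold fun x a b => ?_
    rfl
  | s + 1 => codiagStep_assoc (codiag_assoc s)

theorem codiag_natural (φ : V →ₗ[k] W) :
    ∀ s, cobMap (A := A) (V := barV A V 1) (W := barV A W 1) (φ.rTensor A) s ∘ₗ codiag V s =
      codiag W s ∘ₗ (cobMap φ s).rTensor A
  | 0 => rfl
  | s + 1 => (codiagStep_comp _ _).symm.trans
      ((congrArg codiagStep (codiag_natural φ s)).trans (codiagStep_rTensor _ _))

theorem cobMap_actR (σ : A →ₗ[k] Module.End k W) (β : V →ₗ[k] W) :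
    ∀ s, cobMap (A := A) (V := barV A V 1) (W := W) (actR σ β) s ∘ₗ codiag V s =
      actR (cobRact σ s) (cobMap β s)
  | 0 => rfl
  | s + 1 => (codiagStep_comp _ _).symm.trans
      ((congrArg codiagStep (cobMap_actR σ β s)).trans (actR_codiagStep _ _).symm)

theorem isLRMap_codiag (ρ : A →ₗ[k] Module.End k V) (r : V →ₗ[k] V ⊗[k] A) :
    ∀ s, IsLRMap (LinearMap.rTensorHom A ∘ₗ cobLact ρ s) (rcoStep (cobRco r s))
      (cobLact (V := barV A V 1) (LinearMap.rTensorHom A ∘ₗ ρ) s)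
      (cobRco (V := barV A V 1) (rcoStep r) s) (codiag V s)
  | 0 => ⟨fun _ => rfl,
      (LinearMap.comp_id _).trans (congrArg (· ∘ₗ rcoStep r) (LinearMap.rTensor_id _ _)).symm⟩
  | s + 1 => (isLRMap_codiag ρ r s).codiagStep

end Codiag

namespace HopfBimod

variable {M L N : HopfBimod k A}

/-- The identity `M ⊗ A^{⊗ n} = M ⊗ A^{⊗ n'}` for `n = n'`. -/
noncomputable def castBar {n n' : ℕ} (h : n = n') : M.bar n →ₗ[k] M.bar n' := h ▸ LinearMap.id

/-- The identity `A^{⊗ n} ⊗ N = A^{⊗ n'} ⊗ N` for `n = n'`. -/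
noncomputable def castCobar {n n' : ℕ} (h : n = n') : N.cobar n →ₗ[k] N.cobar n' := h ▸ LinearMap.id

/-- The indices a + 1 + b and a + b + 1 are not definitionally equal, so casts are unavoidable; this
moves them through the recursion on the number of letters. -/
theorem castBar_succ {n n' : ℕ} (h : n = n') (h' : n + 1 = n' + 1) :
    castBar (M := M) h' = (castBar (M := M) h).rTensor A := by
  subst h
  exact (LinearMap.rTensor_id _ _).symm

theorem castCobar_succ {n n' : ℕ} (h : n = n') (h' : n + 1 = n' + 1) :
    castCobar (N := N) h' = (castCobar (N := N) h).lTensor A := by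
  subst h
  exact (LinearMap.lTensor_id _ _).symm

theorem single_castBar {n n' : ℕ} (h : n = n') (p : ℕ) (α : M.bar n' →ₗ[k] N.cobar p) :
    single n' p α = single n p (α ∘ₗ castBar h) := by
  subst h
  rfl

theorem single_castCobar {n n' : ℕ} (h : n = n') (q : ℕ) (α : M.bar q →ₗ[k] N.cobar n) :
    single q n α = single q n' (castCobar h ∘ₗ α) := by
  subst h
  rfl

theorem cobE_lco : ∀ s, cobE (V := L.bar 0) (-L.barLco 0) s = L.cobarD s
  | 0 => rfl
  | s + 1 => congrArg cobarStep (cobE_lco s)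

theorem cobLact_lact : ∀ s, cobLact (V := L.bar 0) (L.barLact 0) s = L.cobarLact s
  | 0 => rfl
  | s + 1 => congrArg (diag (LinearMap.mul k A)) (cobLact_lact s)

theorem cobRact_ract : ∀ s, cobRact (V := L.bar 0) L.ract s = L.cobarRact s
  | 0 => rfl
  | s + 1 => congrArg (diag (LinearMap.mul k A).flip) (cobRact_ract s)

theorem cobRco_rco : ∀ s, cobRco (V := L.bar 0) (L.barRco 0) s = L.cobarRco s
  | 0 => rfl
  | s + 1 => congrArg (fun r : L.cobar s →ₗ[k] L.cobar s ⊗[k] A =>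
      (TensorProduct.assoc k A (L.cobar s) A).symm.toLinearMap ∘ₗ r.lTensor A) (cobRco_rco s)

section Left

variable {a s : ℕ} (f : M.bar a →ₗ[k] L.cobar s)

theorem cupLeft_succ (b : ℕ) :
    cupLeft f (b + 1) = codiag (L.bar b) s ∘ₗ (cupLeft f b).rTensor A := rfl

theorem isLRMap_cupLeft (hf : f ∈ K M L a s) :
    ∀ b, IsLRMap (M.barLact (a + b)) (M.barRco (a + b)) (cobLact (L.barLact b) s)
      (cobRco (L.barRco b) s) (cupLeft f b)
  | 0 => by
    rw [cobLact_lact, cobRco_rco]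
    exact mem_K_iff.1 hf
  | b + 1 => (isLRMap_codiag (L.barLact b) (L.barRco b) s).comp (isLRMap_cupLeft hf b).rTensor

/-- On the outermost factor A, distributing a letter is what the codiagonal coaction does. The
coaction of M ⊗ A^{⊗a} thus grows into that of M ⊗ A^{⊗(a+b)} one letter at a time. -/
theorem cupLeft_lTensor_comp :
    ∀ b, cupLeft (L := L) (s := s + 1) (f.lTensor A ∘ₗ M.barLco a) b =
      (cupLeft f b).lTensor A ∘ₗ M.barLco (a + b)
  | 0 => rfl
  | b + 1 => (congrArg (fun F : M.bar (a + b) →ₗ[k] cobV A (L.bar b) (s + 1) =>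
        codiag (L.bar b) (s + 1) ∘ₗ F.rTensor A) (cupLeft_lTensor_comp b)).trans
      (codiagStep_coaction (cupLeft f b) (M.barLco (a + b)) (codiag (L.bar b) s))

/-- Iteration of `cobE_codiag` over the b letters: the cobar differential formed with the codiagonal
coaction of L ⊗ A^{⊗b} becomes the one of A^{⊗s} ⊗ L applied directly to f. -/
theorem cobE_cupLeft :
    ∀ b, cobE (-L.barLco b) s ∘ₗ cupLeft f b =
      cupLeft (L := L) (s := s + 1) (L.cobarD s ∘ₗ f) b
  | 0 => by rw [cobE_lco]; rfl
  | b + 1 => by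
    have h := cobE_codiag (V := L.bar b) (e := -L.barLco b) (e' := -L.barLco (b + 1))
      (neg_lcoStep (L.barLco b)) s
    have h2 := congrArg (fun F : M.bar (a + b) →ₗ[k] cobV A (L.bar b) (s + 1) =>
        codiag (L.bar b) (s + 1) ∘ₗ F.rTensor A) (cobE_cupLeft b)
    refine Eq.trans ?_ h2
    rw [cupLeft_succ]
    refine (LinearMap.comp_assoc _ _ _).symm.trans ((congrArg (· ∘ₗ _) h).trans ?_)
    exact (LinearMap.comp_assoc _ _ _).trans
      (congrArg (codiag (L.bar b) (s + 1) ∘ₗ ·) (LinearMap.rTensor_comp _ _ _).symm)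

/-- The bar differential on a + b + 1 letters splits after letter a + 1. The first products belong
to d_h f, the later ones to the bar differential on L ⊗ A^{⊗b} with sign (-1)^a. The two terms in
which letter a + 1 acts on L are not in the original differential, and cancel each other. -/
theorem cupLeft_barD :
    ∀ (b : ℕ) (h : a + b + 1 = a + 1 + b), cupLeft f b ∘ₗ M.barD (a + b) =
      cupLeft (dh M L a s f) b ∘ₗ castBar h +
        (-1 : k) ^ a • (cobMap (V := L.bar (b + 1)) (W := L.bar b) (L.barD b) s ∘ₗ
          cupLeft f (b + 1))
  | 0, h => by
    have key : cobMap (V := L.bar 1) (W := L.bar 0) (L.barD 0) s ∘ₗ cupLeft f 1 =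
        actR (L.cobarRact s) f := by
      have h1 := cobMap_actR (V := L.bar 0) (W := L.bar 0) L.ract LinearMap.id s
      rw [cobMap_id, cobRact_ract] at h1
      exact (LinearMap.comp_assoc _ _ _).symm.trans ((congrArg (· ∘ₗ f.rTensor A) h1).trans
        (actR_id_comp _ _))
    rw [key]
    exact eq_add_neg_one_pow_smul _ _ a
  | b + 1, h => by
    have h1 := cupLeft_barStep (b := b) (cupLeft_barD b (Nat.succ.inj h))
      (codiag_natural (V := L.bar (b + 1)) (W := L.bar b) (L.barD b) s) (codiag_assoc s)
    rw [castBar_succ (Nat.succ.inj h) h]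
    refine h1.trans ?_
    have h2 := (cobMap_add (A := A) (V := L.bar (b + 2)) (W := L.bar (b + 1))
      ((L.barD b).rTensor A) _ s).trans
      (congrArg (cobMap (A := A) (V := L.bar (b + 2)) (W := L.bar (b + 1))
        ((L.barD b).rTensor A) s + ·) (cobMap_smul (A := A) (V := L.bar (b + 2))
          (W := L.bar (b + 1)) ((-1) ^ (b + 1)) ((LinearMap.mul' k A).lTensor (L.bar b) ∘ₗ
            (TensorProduct.assoc k (L.bar b) A A).toLinearMap) s))
    exact congrArg (fun F : cobV A (L.bar (b + 2)) s →ₗ[k] cobV A (L.bar (b + 1)) s =>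
      cupLeft (dh M L a s f) (b + 1) ∘ₗ (castBar (Nat.succ.inj h)).rTensor A +
        (-1 : k) ^ a • (F ∘ₗ codiag (L.bar (b + 1)) s ∘ₗ (cupLeft f (b + 1)).rTensor A)) h2.symm

end Left

section Right

variable {b r : ℕ} (g : L.bar b →ₗ[k] N.cobar r)

theorem cupRight_succ (s : ℕ) : cupRight g (s + 1) = (cupRight g s).lTensor A :=
  (LinearMap.lTensor_comp _ _ _).symm

theorem isLRMap_cupRight (hg : g ∈ K L N b r) :
    ∀ s, IsLRMap (cobLact (L.barLact b) s) (cobRco (L.barRco b) s) (N.cobarLact (r + s))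
      (N.cobarRco (r + s)) (cupRight g s)
  | 0 => mem_K_iff.1 hg
  | s + 1 => by
    rw [cupRight_succ]
    exact (isLRMap_cupRight hg s).lTensor

theorem cupRight_actR :
    ∀ s, cupRight (L := L) (b := b + 1) (actR (N.cobarRact r) g) s ∘ₗ codiag (L.bar b) s =
      actR (N.cobarRact (r + s)) (cupRight g s)
  | 0 => rfl
  | s + 1 => by
    rw [cupRight_succ g s]
    refine (congrArg (fun F => F ∘ₗ codiag (L.bar b) (s + 1))
      (cupRight_succ (b := b + 1) (actR (N.cobarRact r) g) s)).trans ?_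
    exact (codiagStep_comp _ _).symm.trans
      ((congrArg codiagStep (cupRight_actR s)).trans (actR_codiagStep _ _).symm)

/-- Dual of `cupLeft_barD`: the first s comultiplications belong to A^{⊗s} ⊗ (L ⊗ A^{⊗b}), the later
ones to d_c g. The coaction of L ⊗ A^{⊗b} between them occurs once in each part, with opposite
signs. -/
theorem cobarD_cupRight :
    ∀ (s : ℕ) (h : r + 1 + s = r + s + 1), N.cobarD (r + s) ∘ₗ cupRight g s =
      cupRight g (s + 1) ∘ₗ cobE (-L.barLco b) s + (-1 : k) ^ s • (castCobar h ∘ₗ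
        cupRight (L := L) (r := r + 1) (homCobar (L.barLco b) (N.cobarD r) g) s)
  | 0, _ => by
    rw [cupRight_succ]
    exact comp_eq_add_homCobar (V := L.bar b) (Y := N.cobar r) (L.barLco b) (N.cobarD r) g
  | s + 1, h => by
    have h0 := (cobarD_cupRight s (Nat.succ.inj h)).trans (congrArg (fun F => F ∘ₗ
      cobE (-L.barLco b) s + (-1 : k) ^ s • (castCobar (Nat.succ.inj h) ∘ₗ
        cupRight (L := L) (r := r + 1) (homCobar (L.barLco b) (N.cobarD r) g) s))
      (cupRight_succ g s))
    have h1 := cobarStep_lTensor_add (X := cobV A (L.bar b) s) (Y := N.cobar (r + s))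
      (Z := N.cobar (r + 1 + s)) (e := N.cobarD (r + s)) (F := cupRight g s)
      (τ := castCobar (Nat.succ.inj h)) h0
    rw [castCobar_succ (Nat.succ.inj h) h, cupRight_succ g (s + 1), cupRight_succ g s]
    refine h1.trans ?_
    rw [← pow_succ]
    let τ : N.cobar (r + 1 + s) →ₗ[k] A ⊗[k] N.cobar (r + s) := castCobar (Nat.succ.inj h)
    exact congrArg (fun F : A ⊗[k] cobV A (L.bar b) s →ₗ[k] A ⊗[k] N.cobar (r + 1 + s) =>
      ((cupRight g s).lTensor A).lTensor A ∘ₗ cobarStep (cobE (-L.barLco b) s) + (-1 : k) ^ (s + 1) •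
        (τ.lTensor A ∘ₗ F))
      (cupRight_succ (L := L) (r := r + 1) (homCobar (L.barLco b) (N.cobarD r) g) s).symm

end Right

end HopfBimod
end HopfBimodCoh

namespace HopfBimodCoh
variable {k A : Type u} [Field k] [Ring A] [HopfAlgebra k A] [FiniteDimensional k A]

/-- Abstract form of `dh_cupComp`. `h` rewrites the bar differential, and the action term, whose
sign is (-1)^a (-1)^(b+1), completes d_h of the second factor. -/
theorem comp_lift_add_smul {X Y Z Y' : Type u} [AddCommGroup X] [Module k X] [AddCommGroup Y]
    [Module k Y] [AddCommGroup Z] [Module k Z] [AddCommGroup Y'] [Module k Y']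
    {d : X ⊗[k] A →ₗ[k] X} {F : X →ₗ[k] Y} {G : Y →ₗ[k] Z} {H : X ⊗[k] A →ₗ[k] Y}
    {c : Y ⊗[k] A →ₗ[k] Y'} {P : Y' →ₗ[k] Y} {R : Y' →ₗ[k] Z} {σ : A →ₗ[k] Module.End k Z} {a b : ℕ}
    (h : F ∘ₗ d = H + (-1 : k) ^ a • (P ∘ₗ c ∘ₗ F.rTensor A)) (hR : R ∘ₗ c = actR σ G) :
    homBar d σ ((-1) ^ (a + b + 1)) (G ∘ₗ F) = G ∘ₗ H +
      (-1 : k) ^ a • ((G ∘ₗ P + (-1 : k) ^ (b + 1) • R) ∘ₗ c ∘ₗ F.rTensor A) := by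
  refine TensorProduct.ext' fun x y => ?_
  have h1 := LinearMap.congr_fun h (x ⊗ₜ y)
  have h2 := LinearMap.congr_fun hR (F x ⊗ₜ y)
  simp only [LinearMap.comp_apply, LinearMap.rTensor_tmul, LinearMap.add_apply,
    LinearMap.smul_apply, actR_tmul] at h1 h2
  simp only [homBar_eq, LinearMap.comp_apply, LinearMap.rTensor_tmul, LinearMap.add_apply,
    LinearMap.smul_apply, actR_tmul, h1, h2, map_add, map_smul, smul_add, smul_smul, ← pow_add,
    add_assoc]

/-- Abstract form of `dc_cupComp`. The terms `F₁` and `F₂` assemble to d_c of the first factor, and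
`H` is d_c of the second up to its sign. -/
theorem smul_homCobar_comp_add {X Y Z W : Type u} [AddCommGroup X] [Module k X] [AddCommGroup Y]
    [Module k Y] [AddCommGroup Z] [Module k Z] [AddCommGroup W] [Module k W]
    {l : X →ₗ[k] A ⊗[k] X} {F : X →ₗ[k] Y} {G : Y →ₗ[k] Z} {e : Z →ₗ[k] A ⊗[k] Z}
    {e' : Y →ₗ[k] A ⊗[k] Y} {H : Y →ₗ[k] W} {τ : W →ₗ[k] A ⊗[k] Z} {F₁ F₂ : X →ₗ[k] A ⊗[k] Y}
    {a b s : ℕ} (h : e ∘ₗ G = G.lTensor A ∘ₗ e' + (-1 : k) ^ s • (τ ∘ₗ H))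
    (h₁ : F₁ = F.lTensor A ∘ₗ l) (h₂ : e' ∘ₗ F = F₂) :
    ((-1 : k) ^ (a + b) • homCobar l e) (G ∘ₗ F) =
      (-1 : k) ^ b • (G.lTensor A ∘ₗ ((-1 : k) ^ a • (F₁ + F₂))) +
        (-1 : k) ^ (a + s) • (τ ∘ₗ ((-1 : k) ^ b • H) ∘ₗ F) := by
  subst h₁ h₂
  refine LinearMap.ext fun x => ?_
  have h1 := LinearMap.congr_fun h (F x)
  simp only [LinearMap.comp_apply, LinearMap.add_apply, LinearMap.smul_apply] at h1
  simp only [LinearMap.smul_apply, homCobar_eq, LinearMap.comp_apply, LinearMap.add_apply, h1,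
    LinearMap.lTensor_comp, map_add, map_smul, smul_add, smul_smul, ← pow_add]
  rw [show b + a = a + b by omega, show a + s + b = a + b + s by omega]
  exact (add_assoc _ _ _).symm

theorem bilin_sum_eq {X Y Z ι κ : Type*} [AddCommGroup X] [Module k X] [AddCommGroup Y] [Module k Y]
    [AddCommGroup Z] [Module k Z] (B B' : X →ₗ[k] Y →ₗ[k] Z) (s : Finset ι) (t : Finset κ)
    (f : ι → X) (g : κ → Y) (h : ∀ i ∈ s, ∀ j ∈ t, B (f i) (g j) = B' (f i) (g j)) :
    B (∑ i ∈ s, f i) (∑ j ∈ t, g j) = B' (∑ i ∈ s, f i) (∑ j ∈ t, g j) := by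
  simp only [map_sum, LinearMap.sum_apply]
  exact Finset.sum_congr rfl fun j hj => Finset.sum_congr rfl fun i hi => h i hi j hj

/-- The sign (-1)^{sb} of the cup product is made for this: d_c f has s + 1 factors A and d_h g
takes b + 1 letters, so the sign changes by (-1)^b and (-1)^s respectively. Here x and y come from
d_h, z and w from d_c. -/
theorem leibniz_signs {V : Type u} [AddCommGroup V] [Module k V] (x y z w : V) (a b s : ℕ) :
    (-1 : k) ^ (s * b) • ((x + (-1 : k) ^ a • y) + ((-1 : k) ^ b • z + (-1 : k) ^ (a + s) • w)) =
      ((-1 : k) ^ (s * b) • x + (-1 : k) ^ ((s + 1) * b) • z) +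
        (-1 : k) ^ (a + s) • ((-1 : k) ^ (s * (b + 1)) • y + (-1 : k) ^ (s * b) • w) := by
  have h : (-1 : k) ^ (a + s) * (-1) ^ (s * (b + 1)) = (-1) ^ (s * b) * (-1) ^ a := by
    have h1 : (-1 : k) ^ s * (-1) ^ s = 1 := by rw [← mul_pow]; simp
    rw [mul_add, mul_one, pow_add, pow_add]
    linear_combination ((-1 : k) ^ (s * b) * (-1) ^ a) * h1
  simp only [smul_add, smul_smul, h, ← pow_add]
  rw [show (s + 1) * b = s * b + b by ring, show a + s + s * b = s * b + (a + s) by ring]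
  abel

/-! ### The Leibniz rule -/

namespace HopfBimod

variable {M L N : HopfBimod k A}

section Linear

variable {a s b r : ℕ}

theorem cupLeft_add (f f' : M.bar a →ₗ[k] L.cobar s) :
    ∀ b, cupLeft (f + f') b = cupLeft f b + cupLeft f' b
  | 0 => rfl
  | b + 1 => by
    rw [cupLeft_succ, cupLeft_add f f' b, LinearMap.rTensor_add, LinearMap.comp_add]
    rfl

theorem cupLeft_smul (c : k) (f : M.bar a →ₗ[k] L.cobar s) :
    ∀ b, cupLeft (c • f) b = c • cupLeft f b
  | 0 => rfl
  | b + 1 => by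
    rw [cupLeft_succ, cupLeft_smul c f b, LinearMap.rTensor_smul, LinearMap.comp_smul]
    rfl

theorem cupRight_add (g g' : L.bar b →ₗ[k] N.cobar r) (s : ℕ) :
    cupRight (g + g') s = cupRight g s + cupRight g' s :=
  (congrArg (cobAdd (ModuleCat.of k N.carrier) r s ∘ₗ ·) (cobMap_add (A := A) g g' s)).trans
    (LinearMap.comp_add _ _ _)

theorem cupRight_smul (c : k) (g : L.bar b →ₗ[k] N.cobar r) (s : ℕ) :
    cupRight (c • g) s = c • cupRight g s :=
  (congrArg (cobAdd (ModuleCat.of k N.carrier) r s ∘ₗ ·) (cobMap_smul (A := A) c g s)).trans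
    (LinearMap.comp_smul _ _ _)

theorem cupRight_comp {b' : ℕ} (g : L.bar b →ₗ[k] N.cobar r) (d : L.bar b' →ₗ[k] L.bar b) (s : ℕ) :
    cupRight (g ∘ₗ d) s = cupRight g s ∘ₗ cobMap d s :=
  congrArg (cobAdd (ModuleCat.of k N.carrier) r s ∘ₗ ·) (cobMap_comp (A := A) g d s)

end Linear

/-- The cup product of two members of families, without the sign. -/
noncomputable def cupComp {a s b r : ℕ} (f : M.bar a →ₗ[k] L.cobar s) (g : L.bar b →ₗ[k] N.cobar r) :
    M.bar (a + b) →ₗ[k] N.cobar (r + s) :=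
  cupRight g s ∘ₗ cupLeft f b

section Components

variable {a s b r : ℕ} (f f' : M.bar a →ₗ[k] L.cobar s) (g g' : L.bar b →ₗ[k] N.cobar r)

theorem cupComp_add_left : cupComp (f + f') g = cupComp f g + cupComp f' g := by
  rw [cupComp, cupLeft_add, LinearMap.comp_add]
  rfl

theorem cupComp_smul_left (c : k) : cupComp (c • f) g = c • cupComp f g := by
  rw [cupComp, cupLeft_smul, LinearMap.comp_smul]
  rfl

theorem cupComp_add_right : cupComp f (g + g') = cupComp f g + cupComp f g' := by
  rw [cupComp, cupRight_add, LinearMap.add_comp]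
  rfl

theorem cupComp_smul_right (c : k) : cupComp f (c • g) = c • cupComp f g := by
  rw [cupComp, cupRight_smul, LinearMap.smul_comp]
  rfl

theorem cupComp_mem_K (hf : f ∈ K M L a s) (hg : g ∈ K L N b r) :
    cupComp f g ∈ K M N (a + b) (r + s) :=
  mem_K_iff.2 ((isLRMap_cupRight g hg s).comp (isLRMap_cupLeft f hf b))

theorem dh_cupComp (h : a + b + 1 = a + 1 + b) :
    dh M N (a + b) (r + s) (cupComp f g) =
      cupComp (dh M L a s f) g ∘ₗ castBar h + (-1 : k) ^ a • cupComp f (dh L N b r g) := by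
  have h1 := comp_lift_add_smul (b := b) (cupLeft_barD f b h) (cupRight_actR g s)
  refine h1.trans ?_
  have h2 : cupRight (dh L N b r g) s = cupRight g s ∘ₗ cobMap (L.barD b) s +
      (-1 : k) ^ (b + 1) • cupRight (L := L) (b := b + 1) (actR (N.cobarRact r) g) s :=
    (cupRight_add (L := L) (b := b + 1) _ _ s).trans
      (congrArg₂ (· + ·) (cupRight_comp (b' := b + 1) g (L.barD b) s)
        (cupRight_smul (L := L) (b := b + 1) _ _ s))
  let H : M.bar (a + b) ⊗[k] A →ₗ[k] N.cobar (r + s) := cupComp (dh M L a s f) g ∘ₗ castBar h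
  exact congrArg (fun F : cobV A (L.bar (b + 1)) s →ₗ[k] N.cobar (r + s) => H +
      (-1 : k) ^ a • (F ∘ₗ codiag (L.bar b) s ∘ₗ (cupLeft f b).rTensor A)) h2.symm

theorem dc_cupComp (h : r + 1 + s = r + s + 1) :
    dc M N (a + b) (r + s) (cupComp f g) =
      (-1 : k) ^ b • cupComp (dc M L a s f) g +
        (-1 : k) ^ (a + s) • (castCobar h ∘ₗ cupComp f (dc L N b r g)) := by
  have h0 := cobarD_cupRight g s h
  rw [cupRight_succ] at h0
  have h1 := smul_homCobar_comp_add (a := a) (b := b) h0 (cupLeft_lTensor_comp f b)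
    (cobE_cupLeft f b)
  refine h1.trans ?_
  let F : M.bar (a + b) →ₗ[k] A ⊗[k] cobV A (L.bar b) s := cupLeft (L := L) (s := s + 1) (dc M L a s f) b
  have i1 : (-1 : k) ^ a • (cupLeft (L := L) (s := s + 1) (f.lTensor A ∘ₗ M.barLco a) b +
      cupLeft (L := L) (s := s + 1) (L.cobarD s ∘ₗ f) b) = F :=
    ((congrArg ((-1 : k) ^ a • ·) (cupLeft_add (L := L) (s := s + 1) _ _ b)).symm.trans
      (cupLeft_smul (L := L) (s := s + 1) _ _ b).symm)
  have i2 := (cupRight_smul (L := L) (r := r + 1) ((-1 : k) ^ b)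
    (homCobar (L.barLco b) (N.cobarD r) g) s).symm
  have i3 := congrArg (fun G : A ⊗[k] cobV A (L.bar b) s →ₗ[k] A ⊗[k] N.cobar (r + s) =>
    (-1 : k) ^ b • (G ∘ₗ F)) (cupRight_succ g s).symm
  let τ : N.cobar (r + 1 + s) →ₗ[k] A ⊗[k] N.cobar (r + s) := castCobar h
  refine congrArg₂ (fun x y : M.bar (a + b) →ₗ[k] A ⊗[k] N.cobar (r + s) => x + y) ?_ ?_
  · refine Eq.trans ?_ i3
    exact congrArg (fun F : M.bar (a + b) →ₗ[k] A ⊗[k] cobV A (L.bar b) s =>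
      (-1 : k) ^ b • ((cupRight g s).lTensor A ∘ₗ F)) i1
  · exact congrArg (fun G : cobV A (L.bar b) s →ₗ[k] N.cobar (r + 1 + s) =>
      (-1 : k) ^ (a + s) • (τ ∘ₗ G ∘ₗ cupLeft f b)) i2

end Components

theorem D_single (q p : ℕ) (α : M.bar q →ₗ[k] N.cobar p) :
    D M N (single q p α) = single (q + 1) p (dh M N q p α) + single q (p + 1) (dc M N q p α) := by
  funext ⟨q', p'⟩
  refine congrArg₂ (fun x y : M.bar q' →ₗ[k] N.cobar p' => x + y) ?_ ?_
  · rcases q' with _ | q'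
    · exact (single_ne (x := (0, p')) (q + 1) p _ (by simp)).symm
    · by_cases h : (q', p') = (q, p)
      · obtain ⟨rfl, rfl⟩ := Prod.mk.inj h
        rw [dhTot_succ, single_same, single_same]
      · rw [dhTot_succ, single_ne q p α h, map_zero]
        exact (single_ne (x := (q' + 1, p')) (q + 1) p _ (by simpa using h)).symm
  · rcases p' with _ | p'
    · rw [dcTot_zero]
      exact (single_ne (x := (q', 0)) q (p + 1) _ (by simp)).symm
    · by_cases h : (q', p') = (q, p)
      · obtain ⟨rfl, rfl⟩ := Prod.mk.inj h
        rw [dcTot_succ, single_same, single_same]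
      · rw [dcTot_succ, single_ne q p α h, map_zero]
        exact (single_ne (x := (q', p' + 1)) q (p + 1) _ (by simpa using h)).symm

theorem cup_eq (p q : ℕ) (f : Tot M L) (g : Tot L N) :
    cup p q f g = ∑ x ∈ Finset.HasAntidiagonal.antidiagonal p, ∑ y ∈ Finset.HasAntidiagonal.antidiagonal q,
      (-1 : k) ^ (x.2 * y.1) • single (x.1 + y.1) (y.2 + x.2) (cupComp (f x) (g y)) := rfl

/-- The cup product, as a bilinear map. -/
noncomputable def cupBilin (M L N : HopfBimod k A) (p q : ℕ) : Tot M L →ₗ[k] Tot L N →ₗ[k] Tot M N :=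
  LinearMap.mk₂ k (cup p q)
    (fun f f' g => by
      simp only [cup_eq, ← Finset.sum_add_distrib]
      refine Finset.sum_congr rfl fun x _ => Finset.sum_congr rfl fun y _ => ?_
      rw [← smul_add, ← map_add, ← cupComp_add_left]
      rfl)
    (fun c f g => by
      simp only [cup_eq, Finset.smul_sum]
      refine Finset.sum_congr rfl fun x _ => Finset.sum_congr rfl fun y _ => ?_
      rw [smul_comm c]
      exact congrArg ((-1 : k) ^ (x.2 * y.1) • ·) ((congrArg (single (x.1 + y.1) (y.2 + x.2))
        (cupComp_smul_left (f x) (g y) c)).trans (map_smul _ _ _)))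
    (fun f g g' => by
      simp only [cup_eq, ← Finset.sum_add_distrib]
      refine Finset.sum_congr rfl fun x _ => Finset.sum_congr rfl fun y _ => ?_
      rw [← smul_add, ← map_add, ← cupComp_add_right]
      rfl)
    (fun c f g => by
      simp only [cup_eq, Finset.smul_sum]
      refine Finset.sum_congr rfl fun x _ => Finset.sum_congr rfl fun y _ => ?_
      rw [smul_comm c]
      exact congrArg ((-1 : k) ^ (x.2 * y.1) • ·) ((congrArg (single (x.1 + y.1) (y.2 + x.2))
        (cupComp_smul_right (f x) (g y) c)).trans (map_smul _ _ _)))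

theorem cupBilin_apply (p q : ℕ) (f : Tot M L) (g : Tot L N) :
    cupBilin M L N p q f g = cup p q f g := rfl

theorem cupComp_zero_left {a s b r : ℕ} (g : L.bar b →ₗ[k] N.cobar r) :
    cupComp (0 : M.bar a →ₗ[k] L.cobar s) g = 0 := by
  have h := cupComp_smul_left (0 : M.bar a →ₗ[k] L.cobar s) g (0 : k)
  rwa [smul_zero, zero_smul] at h

theorem cupComp_zero_right {a s b r : ℕ} (f : M.bar a →ₗ[k] L.cobar s) :
    cupComp f (0 : L.bar b →ₗ[k] N.cobar r) = 0 := by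
  have h := cupComp_smul_right f (0 : L.bar b →ₗ[k] N.cobar r) (0 : k)
  rwa [smul_zero, zero_smul] at h

theorem cupBilin_single {a s b r p q : ℕ} (hp : a + s = p) (hq : b + r = q)
    (f : M.bar a →ₗ[k] L.cobar s) (g : L.bar b →ₗ[k] N.cobar r) :
    cupBilin M L N p q (single a s f) (single b r g) =
      (-1 : k) ^ (s * b) • single (a + b) (r + s) (cupComp f g) := by
  rw [cupBilin_apply, cup_eq, Finset.sum_eq_single (a, s), Finset.sum_eq_single (b, r)]
  · rw [single_same, single_same]
  · intro y _ hy
    rw [single_ne b r g hy, cupComp_zero_right, map_zero, smul_zero]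
  · intro h
    exact absurd (Finset.HasAntidiagonal.mem_antidiagonal.2 hq) h
  · intro x _ hx
    refine Finset.sum_eq_zero fun y _ => ?_
    rw [single_ne a s f hx, cupComp_zero_left, map_zero, smul_zero]
  · intro h
    exact absurd (Finset.HasAntidiagonal.mem_antidiagonal.2 hp) h

theorem D_cup_single {a s b r p q : ℕ} (hp : a + s = p) (hq : b + r = q)
    (f : M.bar a →ₗ[k] L.cobar s) (g : L.bar b →ₗ[k] N.cobar r) :
    D M N (cupBilin M L N p q (single a s f) (single b r g)) =
      cupBilin M L N (p + 1) q (D M L (single a s f)) (single b r g) +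
        (-1 : k) ^ p • cupBilin M L N p (q + 1) (single a s f) (D L N (single b r g)) := by
  have h1 : a + b + 1 = a + 1 + b := by omega
  have h2 : r + 1 + s = r + s + 1 := by omega
  have e1 := cupBilin_single (p := p + 1) (by omega) hq (dh M L a s f) g
  have e2 := cupBilin_single (p := p + 1) (s := s + 1) (by omega) hq (dc M L a s f) g
  have e3 := cupBilin_single (q := q + 1) (b := b + 1) hp (by omega) f (dh L N b r g)
  have e4 := cupBilin_single (q := q + 1) (r := r + 1) hp (by omega) f (dc L N b r g)
  -- The components at a + 1 + b and r + 1 + s are moved to a + b + 1 and r + s + 1, where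
  -- `D_single` places the differential of the product.
  rw [single_castBar h1] at e1
  rw [single_castCobar h2] at e4
  have d1 := (congrArg (single (M := M) (N := N) (a + b + 1) (r + s)) (dh_cupComp f g h1)).trans
    ((map_add _ _ _).trans (congrArg (single (M := M) (N := N) (a + b + 1) (r + s)
      (cupComp (dh M L a s f) g ∘ₗ castBar h1) + ·) (map_smul _ _ _)))
  have d2 := (congrArg (single (M := M) (N := N) (a + b) (r + s + 1)) (dc_cupComp f g h2)).trans
    ((map_add _ _ _).trans (congrArg₂ (· + ·) (map_smul _ _ _) (map_smul _ _ _)))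
  rw [cupBilin_single hp hq, map_smul, D_single, D_single, D_single, LinearMap.map_add₂, map_add,
    e1, e2, e3, e4, d1, d2, ← hp]
  exact leibniz_signs _ _ _ _ a b s

theorem eq_sum_single {n : ℕ} {f : Tot M N} (hf : f ∈ C M N n) :
    f = ∑ x ∈ Finset.HasAntidiagonal.antidiagonal n, single x.1 x.2 (f x) := by
  funext x
  rw [Finset.sum_apply]
  by_cases hx : x.1 + x.2 = n
  · rw [Finset.sum_eq_single x]
    · exact (single_same x.1 x.2 (f x)).symm
    · intro y _ hy
      exact single_ne y.1 y.2 (f y) (Ne.symm hy)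
    · intro h
      exact absurd (Finset.HasAntidiagonal.mem_antidiagonal.2 hx) h
  · rw [(hf x).2 hx, Finset.sum_eq_zero]
    intro y hy
    refine single_ne y.1 y.2 (f y) ?_
    rintro rfl
    exact hx (Finset.HasAntidiagonal.mem_antidiagonal.1 hy)

theorem cup_mem_C {p q : ℕ} {f : Tot M L} {g : Tot L N} (hf : f ∈ C M L p) (hg : g ∈ C L N q) :
    cup p q f g ∈ C M N (p + q) := by
  rw [cup_eq]
  refine sum_mem fun x hx => sum_mem fun y hy => Submodule.smul_mem _ _ (single_mem_C ?_ ?_)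
  · exact cupComp_mem_K _ _ (hf x).1 (hg y).1
  · have h1 := Finset.HasAntidiagonal.mem_antidiagonal.1 hx
    have h2 := Finset.HasAntidiagonal.mem_antidiagonal.1 hy
    omega

/-- Both sides are bilinear and a cochain is a finite sum of single components, so `D_cup_single`
suffices. -/
theorem D_cup {p q : ℕ} {f : Tot M L} {g : Tot L N} (hf : f ∈ C M L p) (hg : g ∈ C L N q) :
    D M N (cup p q f g) = cup (p + 1) q (D M L f) g + (-1 : k) ^ p • cup p (q + 1) f (D L N g) := by
  have h := bilin_sum_eq ((cupBilin M L N p q).compr₂ (D M N))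
    (cupBilin M L N (p + 1) q ∘ₗ D M L + (-1 : k) ^ p • (cupBilin M L N p (q + 1)).compl₂ (D L N))
    (Finset.HasAntidiagonal.antidiagonal p) (Finset.HasAntidiagonal.antidiagonal q)
    (fun x => single x.1 x.2 (f x)) (fun y => single y.1 y.2 (g y)) fun x hx y hy =>
      D_cup_single (Finset.HasAntidiagonal.mem_antidiagonal.1 hx)
        (Finset.HasAntidiagonal.mem_antidiagonal.1 hy) _ _
  rw [← eq_sum_single hf, ← eq_sum_single hg] at h
  exact h

end HopfBimod
end HopfBimodCoh

namespace HopfBimodCoh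
variable {k A : Type u} [Field k] [Ring A] [HopfAlgebra k A] [FiniteDimensional k A]

/-! ### Cup product and Yoneda product -/

namespace HopfBimod

variable {M L N N' : HopfBimod k A}

theorem push_single (u : Hom N N') (q p : ℕ) (α : M.bar q →ₗ[k] N.cobar p) :
    push M u (single q p α) = single q p (cobarMap u p ∘ₗ α) := by
  funext x
  rw [push_apply]
  by_cases hx : x = (q, p)
  · subst hx
    rw [single_same, single_same]
  · rw [single_ne q p α hx, single_ne q p _ hx, LinearMap.comp_zero]

theorem cupRight_push (u : Hom N N') {b r : ℕ} (g : L.bar b →ₗ[k] N.cobar r) :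
    ∀ s, cupRight (cobarMap u r ∘ₗ g) s = cobarMap u (r + s) ∘ₗ cupRight g s
  | 0 => rfl
  | s + 1 => by
    rw [cupRight_succ, cupRight_push u g s, cupRight_succ]
    exact LinearMap.lTensor_comp _ _ _

theorem cup_push (u : Hom N N') (p q : ℕ) (f : Tot M L) (g : Tot L N) :
    cup p q f (push L u g) = push M u (cup p q f g) := by
  rw [cup_eq, cup_eq, map_sum]
  refine Finset.sum_congr rfl fun x _ => ?_
  rw [map_sum]
  refine Finset.sum_congr rfl fun y _ => ?_
  rw [map_smul, push_single]
  refine congrArg (fun F => (-1 : k) ^ (x.2 * y.1) • single (x.1 + y.1) (y.2 + x.2) F) ?_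
  exact congrArg (· ∘ₗ cupLeft (f x) y.1) (cupRight_push u (g y) x.2)

theorem cupRight_cochain (u : Hom L N) :
    ∀ (s : ℕ) (h : 0 + s = s), castCobar h ∘ₗ cupRight u.cochain s = cobarMap u s
  | 0, _ => rfl
  | s + 1, h => by
    rw [castCobar_succ (Nat.succ.inj h) h, cupRight_succ]
    exact (LinearMap.lTensor_comp _ _ _).symm.trans
      (congrArg (LinearMap.lTensor A) (cupRight_cochain u s (Nat.succ.inj h)))

/-- With b = r = 0 the sign is trivial and no letter is distributed, so that only 1^{⊗s} ⊗ u is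
left. It is the case q = 0 of the comparison of products. -/
theorem cup_cochain (u : Hom L N) {p : ℕ} {f : Tot M L} (hf : f ∈ C M L p) :
    cup p 0 f (single 0 0 u.cochain) = push M u f := by
  rw [← cupBilin_apply]
  conv_lhs => rw [eq_sum_single hf]
  conv_rhs => rw [eq_sum_single hf]
  rw [map_sum, map_sum, LinearMap.sum_apply]
  refine Finset.sum_congr rfl fun x hx => ?_
  rw [cupBilin_single (b := 0) (r := 0) (q := 0) (Finset.HasAntidiagonal.mem_antidiagonal.1 hx) rfl, mul_zero, pow_zero,
    one_smul, push_single, single_castCobar (zero_add x.2)]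
  exact congrArg (fun F => single x.1 x.2 (F ∘ₗ f x)) (cupRight_cochain u x.2 (zero_add x.2))

theorem cup_mem_Z {p q : ℕ} {f : Tot M L} {g : Tot L N} (hf : f ∈ Z M L p) (hg : g ∈ Z L N q) :
    cup p q f g ∈ Z M N (p + q) := by
  obtain ⟨hf, hf'⟩ := mem_Z_iff.1 hf
  obtain ⟨hg, hg'⟩ := mem_Z_iff.1 hg
  refine mem_Z_iff.2 ⟨cup_mem_C hf hg, ?_⟩
  rw [D_cup hf hg, hf', hg', ← cupBilin_apply, ← cupBilin_apply, map_zero, map_zero,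
    LinearMap.zero_apply, smul_zero, add_zero]

open CategoryTheory

/-- A family of maps of `δ`-functors takes cup products to Yoneda products. -/
theorem IsDeltaMap.map_cup {φ : ∀ (M N : HopfBimod k A) (n : ℕ), HA4 M N n →ₗ[k] ExtX M N n}
    (hφ : ∀ M : HopfBimod k A, M.IsDeltaMap (φ M)) {p : ℕ} {f : Tot M L} (hf : f ∈ Z M L p) (q : ℕ) :
    ∀ {N : HopfBimod k A} {g : Tot L N} (hg : g ∈ Z L N q),
      φ M N (p + q) (cls ⟨cup p q f g, cup_mem_Z hf hg⟩) =
        (-1 : k) ^ (p * q) • (φ M L p (cls ⟨f, hf⟩)).comp (φ L N q (cls ⟨g, hg⟩)) rfl := by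
  obtain ⟨hfC, hfD⟩ := mem_Z_iff.1 hf
  induction q with
  | zero =>
    intro N g hg
    obtain ⟨u, -, hu⟩ := exists_hom_of_mem_Z hg
    rw [(hφ L).zero u ⟨g, hg⟩ hu, mul_zero, pow_zero, one_smul]
    refine (hφ M).natural u p ⟨f, hf⟩ _ ?_
    change cup p 0 f g = push M u f
    rw [hu, cup_cochain u hfC]
  | succ q ih =>
    intro N g hg
    obtain ⟨I, Q, S, hI⟩ := exists_injective_ses N
    -- This presents the class of g as the connecting image of the class of p(c), which has degree q
    -- at Q.
    obtain ⟨c, hc, hD⟩ := exists_D_eq_of_injective (push_mem_Z S.i hg)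
    have hc' : push L S.p c ∈ Z L Q q := S.push_mem_Z hc hD
    have hL := (hφ L).connecting S q ⟨push L S.p c, hc'⟩ ⟨c, hc⟩ ⟨g, hg⟩ rfl hD
    -- As D f = 0, the Leibniz rule gives D(f ⌣ c) = (-1)^p f ⌣ i(g). The connecting homomorphism
    -- therefore sends f ⌣ p(c) to (-1)^p f ⌣ g, and each step of the induction contributes one
    -- factor (-1)^p.
    have hD' : D M I (cup p q f c) = push M S.i ((-1 : k) ^ p • cup p (q + 1) f g) := by
      rw [D_cup hfC hc, hfD, ← cupBilin_apply, map_zero, LinearMap.zero_apply, zero_add, hD,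
        cup_push, map_smul]
    have he : cup p q f (push L S.p c) ∈ Z M Q (p + q) :=
      cup_mem_Z (g := push L S.p c) hf hc'
    have he' : cup p q f c ∈ C M I (p + q) := cup_mem_C hfC hc
    let z : Z M N (p + (q + 1)) := ⟨cup p (q + 1) f g, cup_mem_Z hf hg⟩
    have hM := (hφ M).connecting S (p + q) ⟨cup p q f (push L S.p c), he⟩ ⟨cup p q f c, he'⟩
      ((-1 : k) ^ p • z)
      (cup_push S.p p q f c).symm hD'
    rw [ih hc'] at hM
    have hcls : cls ((-1 : k) ^ p • z) = (-1 : k) ^ p • cls z := rfl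
    have h1 : (-1 : k) ^ p * (-1) ^ p = 1 := by rw [← mul_pow]; simp
    -- Multiplying by (-1)^p, whose square is 1, isolates the class of f ⌣ g; the exponents add up
    -- to p(q + 1).
    have hM' := congrArg ((-1 : k) ^ p • ·) ((map_smul _ _ _).symm.trans
      ((congrArg (φ M N (p + (q + 1))) hcls).symm.trans hM))
    simp only [smul_smul, h1, one_smul] at hM'
    refine hM'.trans ?_
    rw [hL, Abelian.Ext.smul_comp, smul_smul, ← pow_add, mul_add, mul_one, add_comm (p * q)]
    congr 1
    -- Composing with the class of the sequence may be done before or after composing with the class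
    -- of f.
    exact Abelian.Ext.comp_assoc _ _ _ rfl rfl rfl

end HopfBimod
end HopfBimodCoh

theorem mainTheorem3 {k A : Type u} [Field k] [Ring A] [HopfAlgebra k A] [FiniteDimensional k A] :
    ∃ φ : ∀ (M N : HopfBimod k A) (n : ℕ), M.HA4 N n ≃ₗ[k] M.ExtX N n,
      (∀ M : HopfBimod k A, M.IsDeltaMap fun N n => (φ M N n).toLinearMap) ∧
      (∀ (M : HopfBimod k A) (ψ : ∀ (N : HopfBimod k A) (n : ℕ), M.HA4 N n →ₗ[k] M.ExtX N n),
        M.IsDeltaMap ψ → ψ = fun N n => (φ M N n).toLinearMap) ∧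
      ∀ (M L N : HopfBimod k A) (p q : ℕ) (f : M.Z L p) (g : L.Z N q),
        ∃ c : M.Z N (p + q), (c : M.Tot N) = HopfBimod.cup p q (f : M.Tot L) (g : L.Tot N) ∧
          φ M N (p + q) (HopfBimod.cls c) =
            (-1 : k) ^ (p * q) • (φ M L p (HopfBimod.cls f)).comp (φ L N q (HopfBimod.cls g)) rfl := by
  have hφ : ∀ M : HopfBimod k A,
      M.IsDeltaMap fun N n => ((HopfBimod.deltaSeq M n).1 N).toLinearMap :=
    HopfBimod.isDeltaMap_deltaSeq
  refine ⟨fun M N n => (HopfBimod.deltaSeq M n).1 N, hφ, fun M ψ h => h.eq (hφ M), ?_⟩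
  intro M L N p q f g
  exact ⟨⟨_, HopfBimod.cup_mem_Z f.2 g.2⟩, rfl, HopfBimod.IsDeltaMap.map_cup hφ f.2 q g.2⟩
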